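/- Let $k$ be a field of characteristic $0$. Let $\mathcal H$ be Khovanov's Heisenberg category: the idempotent completion of the additive envelope of the $k$-linear monoidal category generated by objects $P$ (an upward strand) and $Q$ (a downward strand), whose morphisms are linear combinations of oriented planar string diagrams (generated by crossings and oriented cups and caps) up to planar isotopy and the local relations: two equally oriented strands that cross twice may be straightened; the braid relation holds for equally oriented strands; $PQ\to QP\to PQ$ (two sideways crossings) is the identity; $QP\to PQ\to QP$ is the identity minus the composite of the cap $QP\to 1$ with the cup $1\to QP$; a counterclockwise circle equals $1$; a left curl equals $0$. The symmetric group $S_n$ acts on $P^{\otimes n}$ and $Q^{\otimes n}$ by crossings, and for a partition $\lambda\vdash n$ the objects $P^\lambda$ and $Q^\lambda$ of $\mathcal H$ are the images of the Young symmetrizer $e_\lambda=\gamma_\lambda^{-1}a_\lambda b_\lambda$ ($a_\lambda$ the row symmetrizer, $b_\lambda$ the signed column sum of the tableau of shape $\lambda$ filled row by row) on $P^{\otimes n}$ and $Q^{\otimes n}$. Complexes are homologically graded (differentials lower the degree) and defined over all of $\mathbb Z$. Let $\Sigma^-$ have the object $\bigoplus_{\lambda\vdash n}P^\lambda Q^{\lambda^t}$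 in degree $n$, and let $\Sigma^+$ have the same object in degree $-n$ (for $n\ge 0$; all other degrees are $0$). The differential of $\Sigma^-$ has, for $\lambda=\mu+\square$, the components $$P^{\lambda}Q^{\lambda^t}\xrightarrow{\;c_{\lambda\mu}\,\iota\otimes\kappa\;}P^{\mu}PQQ^{\mu^t}\xrightarrow{\;1\otimes \mathrm{cap}\otimes 1\;}P^{\mu}Q^{\mu^t},$$ and that of $\Sigma^+$ has the components $$P^{\mu}Q^{\mu^t}\xrightarrow{\;1\otimes \mathrm{cup}\otimes 1\;}P^{\mu}PQQ^{\mu^t}\xrightarrow{\;c_{\lambda\mu}\,\iota'\otimes\kappa'\;}P^{\lambda}Q^{\lambda^t}.$$ Here $\iota=e_\mu\sigma e_\lambda$ and $\iota'=e_\lambda\sigma^{-1}e_\mu$, where $\sigma\in S_{|\lambda|}$ matches the labels of the boxes of $\lambda$ that lie in $\mu$ with their labels in $\mu$ and sends the label of the new box to the last strand; $\kappa=e_{\mu^t}\tau e_{\lambda^t}$ and $\kappa'=e_{\lambda^t}\tau^{-1}e_{\mu^t}$ are defined in the same way for the transposes, the new box going to the first strand; and $c_{\lambda\mu}=\operatorname{sgn}(\sigma)/n_{\lambda\mu}$,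 where $\iota'\iota=n_{\lambda\mu}e_\lambda$. For complexes $A,B$ let $A\otimes B$ and $A\,\tilde\otimes\,B$ be the direct sum and the direct product total complex of the bicomplex $A_i\otimes B_j$, with differential $d_A\otimes 1+(-1)^{i}\,1\otimes d_B$. These are complexes in the categories of formal direct sums, respectively formal products, of objects of $\mathcal H$ (both contain $\mathcal H$ as a full subcategory), and the homotopy equivalences below are taken there. Then the differentials of $\Sigma^-$ and $\Sigma^+$ square to zero, and the following holds. (a) Let $C^-$ be a complex in $\mathcal H$ that is homotopy equivalent to a complex $\cdots\to C_2\to C_1\to \mathbf 1$ with $\mathbf 1$ in degree $0$, such that every $C_r$, $r>0$, is isomorphic to a finite direct sum of objects $P^{\lambda^i}X_iQ^{\mu^i}$ with $X_i\in\mathcal H$ and $\lambda^i,\mu^i$ nonempty partitions. Then $$\Sigma^-\otimes C^-\simeq\Sigma^-\simeq C^-\otimes\Sigma^-,\qquad \Sigma^+\otimes C^-\simeq\Sigma^+\simeq C^-\otimes\Sigma^+ .$$ (b) Let $C^+$ be a complex in $\mathcal H$ that is homotopy equivalent to a complex $\mathbf 1\to C_{-1}\to C_{-2}\to\cdots$ with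 $\mathbf 1$ in degree $0$, such that every $C_r$, $r<0$, is of the same form. Then $$\Sigma^+\,\tilde\otimes\, C^+\simeq\Sigma^+\simeq C^+\,\tilde\otimes\,\Sigma^+,\qquad \Sigma^-\,\tilde\otimes\, C^+\simeq\Sigma^-\simeq C^+\,\tilde\otimes\,\Sigma^- .$$ (c) In particular $\Sigma^-\otimes\Sigma^-\simeq\Sigma^-$ and $\Sigma^+\,\tilde\otimes\,\Sigma^+\simeq\Sigma^+$; that is, $\Sigma^-$ and $\Sigma^+$ are idempotent. -/

import Mathlib

open CategoryTheory MonoidalCategory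

universe u

noncomputable section

/-! ## Khovanov's diagrammatic category -/

/-- Objects of the generating category: bracketed words in `P` (an upward strand) and `Q`
(a downward strand). -/
inductive Heis (k : Type u) : Type
  | unit : Heis k
  | P : Heis k
  | Q : Heis k
  | tensor : Heis k → Heis k → Heis k

namespace Heis

/-- Formal `k`-linear combinations of string diagrams: generated by the upward crossing, the four
oriented cups and caps, and the structure maps of a monoidal category under composition, tensor
product and `k`-linear combination. Composition `f.comp g` puts `g` on top of `f`. -/
inductive Diag (k : Type u) : Heis k → Heis k → Type u
  | one (X : Heis k) : Diag k X X
  | comp {X Y Z : Heis k} (f : Diag k X Y) (g : Diag k Y Z) : Diag k X Z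
  | ten {W X Y Z : Heis k} (f : Diag k W Y) (g : Diag k X Z) :
      Diag k (W.tensor X) (Y.tensor Z)
  | ahom (X Y Z : Heis k) : Diag k ((X.tensor Y).tensor Z) (X.tensor (Y.tensor Z))
  | ainv (X Y Z : Heis k) : Diag k (X.tensor (Y.tensor Z)) ((X.tensor Y).tensor Z)
  | lhom (X : Heis k) : Diag k (unit.tensor X) X
  | linv (X : Heis k) : Diag k X (unit.tensor X)
  | rhom (X : Heis k) : Diag k (X.tensor unit) X
  | rinv (X : Heis k) : Diag k X (X.tensor unit)
  | zero (X Y : Heis k) : Diag k X Y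
  | add {X Y : Heis k} (f g : Diag k X Y) : Diag k X Y
  | smul {X Y : Heis k} (a : k) (f : Diag k X Y) : Diag k X Y
  | cross : Diag k (P.tensor P) (P.tensor P)
  | cupQP : Diag k unit (Q.tensor P)
  | cupPQ : Diag k unit (P.tensor Q)
  | capQP : Diag k (Q.tensor P) unit
  | capPQ : Diag k (P.tensor Q) unit

namespace Diag

variable {k : Type u}

/-- The reassociation `(WX)(YZ) → W((XY)Z)`. -/
def mid (W X Y Z : Heis k) :
    Diag k ((W.tensor X).tensor (Y.tensor Z)) (W.tensor ((X.tensor Y).tensor Z)) :=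
  (ahom W X (Y.tensor Z)).comp ((one W).ten (ainv X Y Z))

/-- The reassociation `W((XY)Z) → (WX)(YZ)`. -/
def midInv (W X Y Z : Heis k) :
    Diag k (W.tensor ((X.tensor Y).tensor Z)) ((W.tensor X).tensor (Y.tensor Z)) :=
  ((one W).ten (ahom X Y Z)).comp (ainv W X (Y.tensor Z))

/-- Given `f : XY → ZW`, the diagram `1_{V} f 1_{V'}` from `(VX)(YV')` to `(VZ)(WV')`. -/
def inner (V V' : Heis k) {X Y Z W : Heis k} (f : Diag k (X.tensor Y) (Z.tensor W)) :
    Diag k ((V.tensor X).tensor (Y.tensor V')) ((V.tensor Z).tensor (W.tensor V')) :=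
  (mid V X Y V').comp (((one V).ten (f.ten (one V'))).comp (midInv V Z W V'))

/-- Rotation of a diagram `f : XY → ZW`: a `QP`-cup is placed at the bottom left (`X = P`), a
`PQ`-cap at the top right (`W = P`). -/
def rotCW {Y Z : Heis k} (f : Diag k (P.tensor Y) (Z.tensor P)) :
    Diag k (Y.tensor Q) (Q.tensor Z) :=
  (linv _).comp ((cupQP.ten (one _)).comp ((inner Q Q f).comp (((one _).ten capPQ).comp (rhom _))))

/-- Rotation of a diagram `f : XY → ZW` in the other direction: a `PQ`-cup is placed at the bottom
right (`Y = P`), a `QP`-cap at the top left (`Z = P`). -/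
def rotCCW {X W : Heis k} (f : Diag k (X.tensor P) (P.tensor W)) :
    Diag k (Q.tensor X) (W.tensor Q) :=
  (rinv _).comp ((((one _).ten cupPQ)).comp ((inner Q Q f).comp ((capQP.ten (one _)).comp (lhom _))))

/-- The sideways crossing `PQ → QP`. -/
def crossPQ : Diag k (P.tensor Q) (Q.tensor P) := rotCW cross

/-- The sideways crossing `QP → PQ`. -/
def crossQP : Diag k (Q.tensor P) (P.tensor Q) := rotCCW cross

/-- The downward crossing `QQ → QQ`. -/
def crossDown : Diag k (Q.tensor Q) (Q.tensor Q) := rotCW crossPQ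

/-- An upward strand with a curl to its left. -/
def leftCurl : Diag k P P :=
  (linv P).comp ((cupQP.ten (one P)).comp ((ahom Q P P).comp (((one Q).ten cross).comp
    ((ainv Q P P).comp ((capQP.ten (one P)).comp (lhom P))))))

/-- For `f : XX → XX`, the endomorphism `f 1_X` of `X(XX)`. -/
def fst {X : Heis k} (f : Diag k (X.tensor X) (X.tensor X)) :
    Diag k (X.tensor (X.tensor X)) (X.tensor (X.tensor X)) :=
  (ainv X X X).comp ((f.ten (one X)).comp (ahom X X X))

/-- For `f : XX → XX`, the endomorphism `1_X f` of `X(XX)`. -/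
def snd {X : Heis k} (f : Diag k (X.tensor X) (X.tensor X)) :
    Diag k (X.tensor (X.tensor X)) (X.tensor (X.tensor X)) :=
  (one X).ten f

end Diag

open Diag in
/-- Equality of diagrams: the congruence generated by the axioms of a `k`-linear monoidal category,
planar isotopy and the local relations. -/
inductive Rel (k : Type u) [CommRing k] : ∀ {X Y : Heis k}, Diag k X Y → Diag k X Y → Prop
  -- equivalence relation and congruence
  | refl {X Y} (f : Diag k X Y) : Rel k f f
  | symm {X Y} {f g : Diag k X Y} : Rel k f g → Rel k g f
  | trans {X Y} {f g h : Diag k X Y} : Rel k f g → Rel k g h → Rel k f h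
  | comp_congr {X Y Z} {f f' : Diag k X Y} {g g' : Diag k Y Z} :
      Rel k f f' → Rel k g g' → Rel k (f.comp g) (f'.comp g')
  | ten_congr {W X Y Z} {f f' : Diag k W Y} {g g' : Diag k X Z} :
      Rel k f f' → Rel k g g' → Rel k (f.ten g) (f'.ten g')
  | add_congr {X Y} {f f' g g' : Diag k X Y} :
      Rel k f f' → Rel k g g' → Rel k (f.add g) (f'.add g')
  | smul_congr {X Y} (a : k) {f f' : Diag k X Y} : Rel k f f' → Rel k (f.smul a) (f'.smul a)
  -- category
  | id_comp {X Y} (f : Diag k X Y) : Rel k ((one X).comp f) f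
  | comp_id {X Y} (f : Diag k X Y) : Rel k (f.comp (one Y)) f
  | assoc {W X Y Z} (f : Diag k W X) (g : Diag k X Y) (h : Diag k Y Z) :
      Rel k ((f.comp g).comp h) (f.comp (g.comp h))
  -- `k`-modules
  | add_assoc {X Y} (f g h : Diag k X Y) : Rel k ((f.add g).add h) (f.add (g.add h))
  | add_comm {X Y} (f g : Diag k X Y) : Rel k (f.add g) (g.add f)
  | zero_add {X Y} (f : Diag k X Y) : Rel k ((zero X Y).add f) f
  | one_smul {X Y} (f : Diag k X Y) : Rel k (f.smul 1) f
  | zero_smul {X Y} (f : Diag k X Y) : Rel k (f.smul 0) (zero X Y)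
  | smul_zero {X Y} (a : k) : Rel k ((zero X Y).smul a) (zero X Y)
  | mul_smul {X Y} (a b : k) (f : Diag k X Y) : Rel k (f.smul (a * b)) ((f.smul b).smul a)
  | add_smul {X Y} (a b : k) (f : Diag k X Y) :
      Rel k (f.smul (a + b)) ((f.smul a).add (f.smul b))
  | smul_add {X Y} (a : k) (f g : Diag k X Y) :
      Rel k ((f.add g).smul a) ((f.smul a).add (g.smul a))
  -- bilinearity of composition and tensor product
  | add_comp {X Y Z} (f f' : Diag k X Y) (g : Diag k Y Z) :
      Rel k ((f.add f').comp g) ((f.comp g).add (f'.comp g))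
  | comp_add {X Y Z} (f : Diag k X Y) (g g' : Diag k Y Z) :
      Rel k (f.comp (g.add g')) ((f.comp g).add (f.comp g'))
  | smul_comp {X Y Z} (a : k) (f : Diag k X Y) (g : Diag k Y Z) :
      Rel k ((f.smul a).comp g) ((f.comp g).smul a)
  | comp_smul {X Y Z} (a : k) (f : Diag k X Y) (g : Diag k Y Z) :
      Rel k (f.comp (g.smul a)) ((f.comp g).smul a)
  | add_ten {W X Y Z} (f f' : Diag k W Y) (g : Diag k X Z) :
      Rel k ((f.add f').ten g) ((f.ten g).add (f'.ten g))
  | ten_add {W X Y Z} (f : Diag k W Y) (g g' : Diag k X Z) :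
      Rel k (f.ten (g.add g')) ((f.ten g).add (f.ten g'))
  | smul_ten {W X Y Z} (a : k) (f : Diag k W Y) (g : Diag k X Z) :
      Rel k ((f.smul a).ten g) ((f.ten g).smul a)
  | ten_smul {W X Y Z} (a : k) (f : Diag k W Y) (g : Diag k X Z) :
      Rel k (f.ten (g.smul a)) ((f.ten g).smul a)
  -- monoidal category
  | id_ten_id (X Y) : Rel k ((one X).ten (one Y)) (one (X.tensor Y))
  | ten_comp_ten {X₁ Y₁ Z₁ X₂ Y₂ Z₂} (f₁ : Diag k X₁ Y₁) (f₂ : Diag k X₂ Y₂)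
      (g₁ : Diag k Y₁ Z₁) (g₂ : Diag k Y₂ Z₂) :
      Rel k ((f₁.ten f₂).comp (g₁.ten g₂)) ((f₁.comp g₁).ten (f₂.comp g₂))
  | ahom_ainv (X Y Z) : Rel k ((ahom X Y Z).comp (ainv X Y Z)) (one _)
  | ainv_ahom (X Y Z) : Rel k ((ainv X Y Z).comp (ahom X Y Z)) (one _)
  | lhom_linv (X) : Rel k ((lhom X).comp (linv X)) (one _)
  | linv_lhom (X) : Rel k ((linv X).comp (lhom X)) (one _)
  | rhom_rinv (X) : Rel k ((rhom X).comp (rinv X)) (one _)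
  | rinv_rhom (X) : Rel k ((rinv X).comp (rhom X)) (one _)
  | ahom_nat {X₁ X₂ X₃ Y₁ Y₂ Y₃} (f₁ : Diag k X₁ Y₁) (f₂ : Diag k X₂ Y₂) (f₃ : Diag k X₃ Y₃) :
      Rel k (((f₁.ten f₂).ten f₃).comp (ahom Y₁ Y₂ Y₃))
        ((ahom X₁ X₂ X₃).comp (f₁.ten (f₂.ten f₃)))
  | lhom_nat {X Y} (f : Diag k X Y) :
      Rel k (((one unit).ten f).comp (lhom Y)) ((lhom X).comp f)
  | rhom_nat {X Y} (f : Diag k X Y) :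
      Rel k ((f.ten (one unit)).comp (rhom Y)) ((rhom X).comp f)
  | pentagon (W X Y Z) :
      Rel k (((ahom W X Y).ten (one Z)).comp
          ((ahom W (X.tensor Y) Z).comp ((one W).ten (ahom X Y Z))))
        ((ahom (W.tensor X) Y Z).comp (ahom W X (Y.tensor Z)))
  | triangle (X Y) :
      Rel k ((ahom X unit Y).comp ((one X).ten (lhom Y))) ((rhom X).ten (one Y))
  -- planar isotopy: straightening of strands, and rotation invariance of the crossing
  | zigzag₁ : Rel k ((rinv P).comp (((one P).ten cupQP).comp ((ainv P Q P).comp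
      ((capPQ.ten (one P)).comp (lhom P))))) (one P)
  | zigzag₂ : Rel k ((linv P).comp ((cupPQ.ten (one P)).comp ((ahom P Q P).comp
      (((one P).ten capQP).comp (rhom P))))) (one P)
  | zigzag₃ : Rel k ((rinv Q).comp (((one Q).ten cupPQ).comp ((ainv Q P Q).comp
      ((capQP.ten (one Q)).comp (lhom Q))))) (one Q)
  | zigzag₄ : Rel k ((linv Q).comp ((cupQP.ten (one Q)).comp ((ahom Q P Q).comp
      (((one Q).ten capPQ).comp (rhom Q))))) (one Q)
  | rotate : Rel k (rotCW crossPQ) (rotCCW crossQP)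
  -- local relations; the first two hold for both orientations
  | up_double : Rel k (cross.comp cross) (one _)
  | down_double : Rel k (crossDown.comp crossDown) (one _)
  | up_triple : Rel k ((fst cross).comp ((snd cross).comp (fst cross)))
      ((snd cross).comp ((fst cross).comp (snd cross)))
  | down_triple : Rel k ((fst crossDown).comp ((snd crossDown).comp (fst crossDown)))
      ((snd crossDown).comp ((fst crossDown).comp (snd crossDown)))
  | up_down : Rel k (crossPQ.comp crossQP) (one _)
  | down_up : Rel k (crossQP.comp crossPQ) ((one _).add ((capQP.comp cupQP).smul (-1)))
  | bubble : Rel k (cupQP.comp capQP) (one unit)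
  | curl : Rel k leftCurl (zero P P)

variable {k : Type u} [CommRing k]

instance setoid (X Y : Heis k) : Setoid (Diag k X Y) :=
  ⟨Rel k, ⟨Rel.refl, Rel.symm, Rel.trans⟩⟩

instance : Category.{u} (Heis k) where
  Hom X Y := Quotient (setoid X Y)
  id X := ⟦Diag.one X⟧
  comp := Quotient.map₂ Diag.comp (fun _ _ hf _ _ hg => Rel.comp_congr hf hg)
  id_comp := by rintro X Y ⟨f⟩; exact Quotient.sound (Rel.id_comp f)
  comp_id := by rintro X Y ⟨f⟩; exact Quotient.sound (Rel.comp_id f)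
  assoc := by rintro W X Y Z ⟨f⟩ ⟨g⟩ ⟨h⟩; exact Quotient.sound (Rel.assoc f g h)

/-- The morphism given by a diagram. -/
def mk {X Y : Heis k} (f : Diag k X Y) : X ⟶ Y := Quotient.mk (setoid X Y) f

instance (X Y : Heis k) : Zero (X ⟶ Y) := ⟨mk (Diag.zero X Y)⟩

instance (X Y : Heis k) : Add (X ⟶ Y) :=
  ⟨Quotient.map₂ Diag.add (fun _ _ hf _ _ hg => Rel.add_congr hf hg)⟩

instance (X Y : Heis k) : Neg (X ⟶ Y) :=
  ⟨Quotient.map (Diag.smul (-1)) (fun _ _ hf => Rel.smul_congr _ hf)⟩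

instance (X Y : Heis k) : AddCommGroup (X ⟶ Y) where
  add_assoc := by rintro ⟨f⟩ ⟨g⟩ ⟨h⟩; exact Quotient.sound (Rel.add_assoc f g h)
  add_comm := by rintro ⟨f⟩ ⟨g⟩; exact Quotient.sound (Rel.add_comm f g)
  zero_add := by rintro ⟨f⟩; exact Quotient.sound (Rel.zero_add f)
  add_zero := by
    rintro ⟨f⟩
    exact Quotient.sound ((Rel.add_comm _ _).trans (Rel.zero_add f))
  neg_add_cancel := by
    rintro ⟨f⟩
    refine Quotient.sound ((Rel.add_congr (Rel.refl _) (Rel.one_smul f).symm).trans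
      ((Rel.add_smul (-1) 1 f).symm.trans ?_))
    rw [neg_add_cancel]
    exact Rel.zero_smul f
  nsmul := nsmulRec
  zsmul := zsmulRec

instance (X Y : Heis k) : Module k (X ⟶ Y) where
  smul a := Quotient.map (Diag.smul a) (fun _ _ hf => Rel.smul_congr a hf)
  one_smul := by rintro ⟨f⟩; exact Quotient.sound (Rel.one_smul f)
  mul_smul := by rintro a b ⟨f⟩; exact Quotient.sound (Rel.mul_smul a b f)
  smul_zero a := Quotient.sound (Rel.smul_zero a)
  smul_add := by rintro a ⟨f⟩ ⟨g⟩; exact Quotient.sound (Rel.smul_add a f g)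
  add_smul := by rintro a b ⟨f⟩; exact Quotient.sound (Rel.add_smul a b f)
  zero_smul := by rintro ⟨f⟩; exact Quotient.sound (Rel.zero_smul f)

instance : Preadditive (Heis k) where
  add_comp := by rintro _ _ _ ⟨f⟩ ⟨g⟩ ⟨h⟩; exact Quotient.sound (Rel.add_comp f g h)
  comp_add := by rintro _ _ _ ⟨f⟩ ⟨g⟩ ⟨h⟩; exact Quotient.sound (Rel.comp_add f g h)

instance : Linear k (Heis k) where
  smul_comp := by rintro _ _ _ a ⟨f⟩ ⟨g⟩; exact Quotient.sound (Rel.smul_comp a f g)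
  comp_smul := by rintro _ _ _ ⟨f⟩ a ⟨g⟩; exact Quotient.sound (Rel.comp_smul a f g)

/-- The tensor product of morphisms: diagrams side by side. -/
def ten {W X Y Z : Heis k} : (W ⟶ Y) → (X ⟶ Z) → (W.tensor X ⟶ Y.tensor Z) :=
  Quotient.map₂ Diag.ten (fun _ _ hf _ _ hg => Rel.ten_congr hf hg)

instance : MonoidalCategoryStruct (Heis k) where
  tensorObj := tensor
  tensorUnit := unit
  tensorHom f g := ten f g
  whiskerLeft X _ _ f := ten (𝟙 X) f
  whiskerRight f Y := ten f (𝟙 Y)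
  associator X Y Z := ⟨mk (Diag.ahom X Y Z), mk (Diag.ainv X Y Z),
    Quotient.sound (Rel.ahom_ainv X Y Z), Quotient.sound (Rel.ainv_ahom X Y Z)⟩
  leftUnitor X := ⟨mk (Diag.lhom X), mk (Diag.linv X),
    Quotient.sound (Rel.lhom_linv X), Quotient.sound (Rel.linv_lhom X)⟩
  rightUnitor X := ⟨mk (Diag.rhom X), mk (Diag.rinv X),
    Quotient.sound (Rel.rhom_rinv X), Quotient.sound (Rel.rinv_rhom X)⟩

instance : MonoidalCategory (Heis k) := MonoidalCategory.ofTensorHom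
  (id_tensorHom_id := fun X Y => Quotient.sound (Rel.id_ten_id X Y))
  (id_tensorHom := fun _ _ _ _ => rfl)
  (tensorHom_id := fun _ _ => rfl)
  (tensorHom_comp_tensorHom := by
    rintro _ _ _ _ _ _ ⟨f₁⟩ ⟨f₂⟩ ⟨g₁⟩ ⟨g₂⟩
    exact Quotient.sound (Rel.ten_comp_ten f₁ f₂ g₁ g₂))
  (associator_naturality := by
    rintro _ _ _ _ _ _ ⟨f₁⟩ ⟨f₂⟩ ⟨f₃⟩
    exact Quotient.sound (Rel.ahom_nat f₁ f₂ f₃))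
  (leftUnitor_naturality := by rintro _ _ ⟨f⟩; exact Quotient.sound (Rel.lhom_nat f))
  (rightUnitor_naturality := by rintro _ _ ⟨f⟩; exact Quotient.sound (Rel.rhom_nat f))
  (pentagon := fun W X Y Z => Quotient.sound (Rel.pentagon W X Y Z))
  (triangle := fun X Y => Quotient.sound (Rel.triangle X Y))

theorem add_ten {W X Y Z : Heis k} (f f' : W ⟶ Y) (g : X ⟶ Z) :
    (f + f') ⊗ₘ g = f ⊗ₘ g + f' ⊗ₘ g := by
  obtain ⟨f⟩ := f; obtain ⟨f'⟩ := f'; obtain ⟨g⟩ := g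
  exact Quotient.sound (Rel.add_ten f f' g)

theorem ten_add {W X Y Z : Heis k} (f : W ⟶ Y) (g g' : X ⟶ Z) :
    f ⊗ₘ (g + g') = f ⊗ₘ g + f ⊗ₘ g' := by
  obtain ⟨f⟩ := f; obtain ⟨g⟩ := g; obtain ⟨g'⟩ := g'
  exact Quotient.sound (Rel.ten_add f g g')

instance : MonoidalPreadditive (Heis k) where
  whiskerLeft_add {X Y Z} f g := ten_add (𝟙 X) f g
  add_whiskerRight {X Y Z} f g := add_ten f g (𝟙 X)
  whiskerLeft_zero {X Y Z} := by
    have h := ten_add (𝟙 X) (0 : Y ⟶ Z) 0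
    rw [add_zero] at h
    exact left_eq_add.mp h
  zero_whiskerRight {X Y Z} := by
    have h := add_ten (0 : Y ⟶ Z) 0 (𝟙 X)
    rw [add_zero] at h
    exact left_eq_add.mp h

end Heis


/-! ## Actions of symmetric groups -/

/-- `s 0, …, s (n - 2)` satisfy the Coxeter relations of the symmetric group on `n` letters. -/
structure CoxeterRel {M : Type*} [Monoid M] (n : ℕ) (s : ℕ → M) : Prop where
  sq : ∀ i, i + 1 < n → s i * s i = 1
  braid : ∀ i, i + 2 < n → s i * s (i + 1) * s i = s (i + 1) * s i * s (i + 1)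
  comm : ∀ i j, i + 1 < j → j + 1 < n → s i * s j = s j * s i

namespace CoxeterRel

variable {M : Type*} [Monoid M]

/-- The product `s (n - j) ⋯ s (n - 1)`. -/
def cyc (s : ℕ → M) (n : ℕ) : ℕ → M
  | 0 => 1
  | j + 1 => s (n - (j + 1)) * cyc s n j

theorem comm_cyc {s : ℕ → M} {n : ℕ} (h : CoxeterRel (n + 1) s) (i j : ℕ) (hi : i + j + 1 < n) :
    s i * cyc s n j = cyc s n j * s i := by
  induction j with
  | zero => simp [cyc]
  | succ j ih =>
    rw [cyc, ← mul_assoc, h.comm i (n - (j + 1)) (by omega) (by omega), mul_assoc,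
      ih (by omega), mul_assoc]

theorem shift_cyc {s : ℕ → M} {n : ℕ} (h : CoxeterRel (n + 1) s) (i j : ℕ)
    (hi : n < i + 1 + j) (hj : j ≤ n) (hin : i + 1 < n) :
    s (i + 1) * cyc s n j = cyc s n j * s i := by
  induction j with
  | zero => omega
  | succ j ih =>
    obtain hlt | heq := Nat.lt_or_ge n (i + 1 + j)
    · rw [cyc, ← mul_assoc, ← h.comm (n - (j + 1)) (i + 1) (by omega) (by omega), mul_assoc,
        ih hlt (by omega), mul_assoc]
    · obtain ⟨j, rfl⟩ : ∃ j', j = j' + 1 := ⟨j - 1, by omega⟩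
      have e1 : n - (j + 1 + 1) = i := by omega
      have e2 : n - (j + 1) = i + 1 := by omega
      rw [cyc, cyc, e1, e2, ← mul_assoc, ← mul_assoc, ← h.braid i (by omega), mul_assoc,
        mul_assoc, mul_assoc, mul_assoc, h.comm_cyc i j (by omega)]

/-- The adjacent transposition of `i` and `i + 1`. -/
def adj (n : ℕ) (i : ℕ) : Equiv.Perm (Fin n) :=
  if h : i + 1 < n then Equiv.swap ⟨i, by omega⟩ ⟨i + 1, h⟩ else 1

theorem closure_adj (n : ℕ) : Submonoid.closure (adj n '' {i | i + 1 < n}) = ⊤ := by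
  match n with
  | 0 => exact Subsingleton.elim _ _
  | n + 1 =>
    rw [← Equiv.Perm.mclosure_swap_castSucc_succ n]
    congr 1
    ext σ
    constructor
    · rintro ⟨i, hi, rfl⟩
      exact ⟨⟨i, by simpa using hi⟩, by simp [adj, show i + 1 < n + 1 from hi]⟩
    · rintro ⟨i, rfl⟩
      exact ⟨i, by simp, by simp [adj]; rfl⟩

theorem adj_rel (n : ℕ) : CoxeterRel n (adj n) where
  sq i hi := by simp [adj, hi]
  braid i hi := by
    have h1 : i + 1 < n := by omega
    have h2 : i + 1 + 1 < n := by omega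
    ext x
    simp only [adj, h1, h2, dite_true, Equiv.Perm.mul_apply, Equiv.swap_apply_def, Fin.ext_iff]
    grind
  comm i j hij hj := by
    have h1 : i + 1 < n := by omega
    ext x
    simp only [adj, h1, hj, dite_true, Equiv.Perm.mul_apply, Equiv.swap_apply_def, Fin.ext_iff]
    grind

theorem cyc_adj_last (n j : ℕ) (hj : j ≤ n) :
    (cyc (adj (n + 1)) n j (Fin.last n) : ℕ) = n - j := by
  induction j with
  | zero => simp [cyc]
  | succ j ih =>
    have h : n - (j + 1) + 1 < n + 1 := by omega
    have e : cyc (adj (n + 1)) n j (Fin.last n) = ⟨n - (j + 1) + 1, h⟩ :=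
      Fin.ext (by rw [ih (by omega)]; simp only; omega)
    simp [cyc, e, adj, h]

/-- The Coxeter presentation of the symmetric group. -/
theorem exists_hom (n : ℕ) : ∀ {M : Type*} [Monoid M] {s : ℕ → M}, CoxeterRel n s →
    ∃ φ : Equiv.Perm (Fin n) →* M, ∀ i, i + 1 < n → φ (adj n i) = s i := by
  induction n with
  | zero => exact fun _ => ⟨1, fun i hi => absurd hi (by omega)⟩
  | succ n ih =>
    intro M _ s h
    let t : ℕ → M × Equiv.Perm (Fin (n + 1)) := fun i => (s i, adj (n + 1) i)
    have ha := adj_rel (n + 1)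
    have ht : CoxeterRel (n + 1) t :=
      ⟨fun i hi => Prod.ext (h.sq i hi) (ha.sq i hi),
        fun i hi => Prod.ext (h.braid i hi) (ha.braid i hi),
        fun i j hi hj => Prod.ext (h.comm i j hi hj) (ha.comm i j hi hj)⟩
    obtain ⟨φ, hφ⟩ := ih (s := t) ⟨fun i hi => ht.sq i (by omega),
      fun i hi => ht.braid i (by omega), fun i j hi hj => ht.comm i j hi (by omega)⟩
    have hφ2 : ∀ w, (φ w).2 (Fin.last n) = Fin.last n ∧
        ∀ x, (φ w).2 (Fin.castSucc x) = Fin.castSucc (w x) := by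
      intro w
      have hw : w ∈ Submonoid.closure (adj n '' {i | i + 1 < n}) := by
        rw [closure_adj]; exact Submonoid.mem_top w
      induction hw using Submonoid.closure_induction with
      | mem w hw =>
        obtain ⟨i, hi, rfl⟩ := hw
        have hi' : i + 1 < n := hi
        have hi'' : i + 1 < n + 1 := by omega
        rw [hφ i hi]
        simp only [t, adj, hi', hi'', dite_true]
        refine ⟨Equiv.swap_apply_of_ne_of_ne ?_ ?_, fun x => ?_⟩
        · simp only [ne_eq, Fin.ext_iff, Fin.val_last]; omega
        · simp only [ne_eq, Fin.ext_iff, Fin.val_last]; omega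
        · simp only [Equiv.swap_apply_def, Fin.ext_iff, Fin.val_castSucc]
          split_ifs <;> simp_all
      | one => simp
      | mul a b _ _ iha ihb => simp [iha, ihb]
    have hmem : ∀ x ∈ Submonoid.closure (t '' {i | i + 1 < n + 1}),
        ∃ j ≤ n, ∃ w, x = cyc t n j * φ w := by
      intro x hx
      induction hx using Submonoid.closure_induction_left with
      | one => exact ⟨0, Nat.zero_le _, 1, by simp [cyc]⟩
      | mul_left y hy x _ ihx =>
        obtain ⟨i, hi, rfl⟩ := hy
        have hi' : i < n := Nat.lt_of_succ_lt_succ hi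
        obtain ⟨j, hj, w, rfl⟩ := ihx
        obtain h1 | h1 | h1 | h1 : i + j + 1 < n ∨ i + j + 1 = n ∨ i + j = n ∨ n < i + j := by
          omega
        · exact ⟨j, hj, adj n i * w, by
            rw [map_mul, hφ i (by omega), ← mul_assoc, ht.comm_cyc i j h1, mul_assoc]⟩
        · exact ⟨j + 1, by omega, w, by
            rw [cyc, show n - (j + 1) = i by omega, mul_assoc]⟩
        · obtain ⟨j, rfl⟩ : ∃ j', j = j' + 1 := ⟨j - 1, by omega⟩
          exact ⟨j, by omega, w, by
            rw [cyc, show n - (j + 1) = i by omega, ← mul_assoc, ← mul_assoc, ht.sq i hi,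
              one_mul]⟩
        · obtain ⟨i, rfl⟩ : ∃ i', i = i' + 1 := ⟨i - 1, by omega⟩
          exact ⟨j, hj, adj n i * w, by
            rw [map_mul, hφ i hi', ← mul_assoc, ht.shift_cyc i j (by omega) hj hi', mul_assoc]⟩
    have hcyc : ∀ j, (cyc t n j).2 = cyc (adj (n + 1)) n j := by
      intro j
      induction j with
      | zero => rfl
      | succ j ihj => simp [cyc, ihj, t]
    have hinj : ∀ x ∈ Submonoid.closure (t '' {i | i + 1 < n + 1}),
        ∀ y ∈ Submonoid.closure (t '' {i | i + 1 < n + 1}), x.2 = y.2 → x = y := by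
      intro x hx y hy hxy
      obtain ⟨j, hj, w, rfl⟩ := hmem x hx
      obtain ⟨j', hj', w', rfl⟩ := hmem y hy
      rw [Prod.snd_mul, Prod.snd_mul, hcyc, hcyc] at hxy
      have e := congrArg (fun σ => (σ (Fin.last n) : ℕ)) hxy
      simp only [Equiv.Perm.mul_apply, (hφ2 _).1, cyc_adj_last n _ hj, cyc_adj_last n _ hj'] at e
      obtain rfl : j = j' := by omega
      have e' := mul_left_cancel hxy
      suffices w = w' by rw [this]
      ext x
      have := congrArg (fun σ => (σ (Fin.castSucc x) : ℕ)) e'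
      simpa [(hφ2 _).2] using this
    have hsurj : ∀ σ, ∃ x ∈ Submonoid.closure (t '' {i | i + 1 < n + 1}), x.2 = σ := by
      intro σ
      have hσ : σ ∈ Submonoid.closure (adj (n + 1) '' {i | i + 1 < n + 1}) := by
        rw [closure_adj]; exact Submonoid.mem_top σ
      induction hσ using Submonoid.closure_induction with
      | mem w hw =>
        obtain ⟨i, hi, rfl⟩ := hw
        exact ⟨t i, Submonoid.subset_closure ⟨i, hi, rfl⟩, rfl⟩
      | one => exact ⟨1, one_mem _, rfl⟩
      | mul a b _ _ iha ihb =>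
        obtain ⟨x, hx, rfl⟩ := iha
        obtain ⟨y, hy, rfl⟩ := ihb
        exact ⟨x * y, mul_mem hx hy, rfl⟩
    choose f hf hf2 using hsurj
    refine ⟨⟨⟨fun σ => (f σ).1, ?_⟩, ?_⟩, ?_⟩
    · exact congrArg Prod.fst (hinj _ (hf 1) 1 (one_mem _) (hf2 1))
    · intro σ τ
      exact congrArg Prod.fst
        (hinj _ (hf _) _ (mul_mem (hf σ) (hf τ)) (by rw [hf2, Prod.snd_mul, hf2, hf2]))
    · intro i hi
      exact congrArg Prod.fst
        (hinj _ (hf _) (t i) (Submonoid.subset_closure ⟨i, hi, rfl⟩) (hf2 _))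

/-- The homomorphism from the symmetric group that sends the transposition of `i` and `i + 1` to
`s i`. -/
def hom {M : Type*} [Monoid M] {n : ℕ} {s : ℕ → M} (h : CoxeterRel n s) :
    Equiv.Perm (Fin n) →* M :=
  (exists_hom n h).choose

theorem hom_adj {M : Type*} [Monoid M] {n : ℕ} {s : ℕ → M} (h : CoxeterRel n s) (i : ℕ)
    (hi : i + 1 < n) : h.hom (adj n i) = s i :=
  (exists_hom n h).choose_spec i hi

end CoxeterRel

section Powers

variable {C : Type*} [Category C] [MonoidalCategory C]

/-- `V ⊗ ⋯ ⊗ V` bracketed from the left: `powR V (n + 1) = powR V n ⊗ V`. -/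
def powR (V : C) : ℕ → C
  | 0 => 𝟙_ C
  | n + 1 => powR V n ⊗ V

/-- `V ⊗ ⋯ ⊗ V` bracketed from the right: `powL V (n + 1) = V ⊗ powL V n`. -/
def powL (V : C) : ℕ → C
  | 0 => 𝟙_ C
  | n + 1 => V ⊗ powL V n

/-- Adding an identity strand on the right. -/
def addR (V : C) (n : ℕ) : End (powR V n) →* End (powR V (n + 1)) where
  toFun f := f ▷ V
  map_one' := id_whiskerRight _ _
  map_mul' f g := comp_whiskerRight g f V

/-- Adding an identity strand on the left. -/
def addL (V : C) (n : ℕ) : End (powL V n) →* End (powL V (n + 1)) where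
  toFun f := V ◁ f
  map_one' := whiskerLeft_id _ _
  map_mul' f g := whiskerLeft_comp V g f

variable {V : C} (c : V ⊗ V ⟶ V ⊗ V)

/-- `c` applied to the last two factors of `(W ⊗ V) ⊗ V`. -/
def lastTwo (W : C) : (W ⊗ V) ⊗ V ⟶ (W ⊗ V) ⊗ V :=
  (α_ W V V).hom ≫ (W ◁ c) ≫ (α_ W V V).inv

/-- `c` applied to the first two factors of `V ⊗ (V ⊗ W)`. -/
def firstTwo (W : C) : V ⊗ (V ⊗ W) ⟶ V ⊗ (V ⊗ W) :=
  (α_ V V W).inv ≫ (c ▷ W) ≫ (α_ V V W).hom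

/-- `c` applied to the strands `i` and `i + 1` (counted from the left, starting with `0`) of
`powR V n`. -/
def strandR : (n : ℕ) → ℕ → End (powR V n)
  | 0, _ => 𝟙 _
  | 1, _ => 𝟙 _
  | n + 2, i => if i = n then lastTwo c (powR V n) else addR V (n + 1) (strandR (n + 1) i)

/-- `c` applied to the strands `i` and `i + 1` (counted from the left, starting with `0`) of
`powL V n`. -/
def strandL : (n : ℕ) → ℕ → End (powL V n)
  | 0, _ => 𝟙 _
  | 1, _ => 𝟙 _
  | n + 2, 0 => firstTwo c (powL V n)
  | n + 2, i + 1 => addL V (n + 1) (strandL (n + 1) i)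

/-- `c` is an involution satisfying the braid relation. -/
structure IsSymmetry : Prop where
  sq : c ≫ c = 𝟙 _
  braid : firstTwo c V ≫ V ◁ c ≫ firstTwo c V = V ◁ c ≫ firstTwo c V ≫ V ◁ c

variable {c}

theorem lastTwo_sq (h : IsSymmetry c) (W : C) : lastTwo c W ≫ lastTwo c W = 𝟙 _ := by
  simp only [lastTwo, Category.assoc, Iso.inv_hom_id_assoc]
  rw [← whiskerLeft_comp_assoc, h.sq]
  simp

theorem firstTwo_sq (h : IsSymmetry c) (W : C) : firstTwo c W ≫ firstTwo c W = 𝟙 _ := by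
  simp only [firstTwo, Category.assoc, Iso.hom_inv_id_assoc]
  rw [← comp_whiskerRight_assoc, h.sq]
  simp

theorem lastTwo_comm {W : C} (f : W ⟶ W) :
    lastTwo c W ≫ f ▷ V ▷ V = f ▷ V ▷ V ≫ lastTwo c W := by
  have e : f ▷ V ▷ V = (α_ W V V).hom ≫ f ▷ (V ⊗ V) ≫ (α_ W V V).inv := by simp
  rw [e, lastTwo]
  simp only [Category.assoc, Iso.inv_hom_id_assoc, whisker_exchange_assoc]

theorem firstTwo_comm {W : C} (f : W ⟶ W) :
    firstTwo c W ≫ V ◁ V ◁ f = V ◁ V ◁ f ≫ firstTwo c W := by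
  have e : V ◁ V ◁ f = (α_ V V W).inv ≫ (V ⊗ V) ◁ f ≫ (α_ V V W).hom := by simp
  rw [e, firstTwo]
  simp only [Category.assoc, Iso.hom_inv_id_assoc, whisker_exchange_assoc]

theorem lastTwo_braid (h : IsSymmetry c) (W : C) :
    lastTwo c (W ⊗ V) ≫ lastTwo c W ▷ V ≫ lastTwo c (W ⊗ V) =
      lastTwo c W ▷ V ≫ lastTwo c (W ⊗ V) ≫ lastTwo c W ▷ V := by
  let e : ((W ⊗ V) ⊗ V) ⊗ V ≅ W ⊗ (V ⊗ (V ⊗ V)) := α_ _ _ _ ≪≫ α_ _ _ _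
  have h1 : lastTwo c (W ⊗ V) = e.hom ≫ (W ◁ V ◁ c) ≫ e.inv := by
    simp [lastTwo, e]
  have h2 : lastTwo c W ▷ V = e.hom ≫ (W ◁ firstTwo c V) ≫ e.inv := by
    simp [lastTwo, firstTwo, e]
  rw [h1, h2]
  simp only [Category.assoc, Iso.inv_hom_id_assoc]
  simp only [← whiskerLeft_comp_assoc, h.braid]

theorem firstTwo_braid (h : IsSymmetry c) (W : C) :
    firstTwo c (V ⊗ W) ≫ V ◁ firstTwo c W ≫ firstTwo c (V ⊗ W) =
      V ◁ firstTwo c W ≫ firstTwo c (V ⊗ W) ≫ V ◁ firstTwo c W := by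
  let e : (V ⊗ (V ⊗ V)) ⊗ W ≅ V ⊗ (V ⊗ (V ⊗ W)) := α_ _ _ _ ≪≫ whiskerLeftIso V (α_ _ _ _)
  have h1 : firstTwo c (V ⊗ W) = e.inv ≫ (firstTwo c V ▷ W) ≫ e.hom := by
    simp [firstTwo, e]
  have h2 : V ◁ firstTwo c W = e.inv ≫ ((V ◁ c) ▷ W) ≫ e.hom := by
    simp [firstTwo, e]
  rw [h1, h2]
  simp only [Category.assoc, Iso.hom_inv_id_assoc]
  simp only [← comp_whiskerRight_assoc, h.braid]

theorem strandR_last (n : ℕ) : strandR c (n + 2) n = lastTwo c (powR V n) := if_pos rfl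

theorem strandR_of_ne {n i : ℕ} (h : i ≠ n) : 
    strandR c (n + 2) i = addR V (n + 1) (strandR c (n + 1) i) :=
  if_neg h

theorem strandR_rel (h : IsSymmetry c) : ∀ n, CoxeterRel n (strandR c n)
  | 0 => ⟨fun i hi => by omega, fun i hi => by omega, fun i j hi hj => by omega⟩
  | 1 => ⟨fun i hi => by omega, fun i hi => by omega, fun i j hi hj => by omega⟩
  | n + 2 => by
    have ih := strandR_rel h (n + 1)
    refine ⟨fun i hi => ?_, fun i hi => ?_, fun i j hi hj => ?_⟩
    · obtain rfl | hn := eq_or_ne i n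
      · rw [strandR_last]; exact lastTwo_sq h _
      · rw [strandR_of_ne hn, ← map_mul, ih.sq i (by omega), map_one]
    · obtain ⟨n, rfl⟩ : ∃ m, n = m + 1 := ⟨n - 1, by omega⟩
      obtain rfl | hn := eq_or_ne i n
      · rw [strandR_of_ne (Nat.succ_ne_self i).symm, strandR_last, strandR_last]
        exact (lastTwo_braid h (powR V i)).symm
      · rw [strandR_of_ne (show i ≠ n + 1 by omega), strandR_of_ne (show i + 1 ≠ n + 1 by omega),
          ← map_mul, ← map_mul, ← map_mul, ← map_mul, ih.braid i (by omega)]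
    · obtain rfl | hn := eq_or_ne j n
      · obtain ⟨m, rfl⟩ : ∃ m, j = m + 1 := ⟨j - 1, by omega⟩
        rw [strandR_of_ne (show i ≠ m + 1 by omega), strandR_last,
          strandR_of_ne (show i ≠ m by omega)]
        exact lastTwo_comm (strandR c (m + 1) i)
      · rw [strandR_of_ne (show i ≠ n by omega), strandR_of_ne hn, ← map_mul, ← map_mul,
          ih.comm i j hi (by omega)]

theorem strandL_rel (h : IsSymmetry c) : ∀ n, CoxeterRel n (strandL c n)
  | 0 => ⟨fun i hi => by omega, fun i hi => by omega, fun i j hi hj => by omega⟩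
  | 1 => ⟨fun i hi => by omega, fun i hi => by omega, fun i j hi hj => by omega⟩
  | n + 2 => by
    have ih := strandL_rel h (n + 1)
    refine ⟨fun i hi => ?_, fun i hi => ?_, fun i j hi hj => ?_⟩
    · cases i with
      | zero => exact firstTwo_sq h _
      | succ i =>
        rw [strandL, ← map_mul, ih.sq i (by omega), map_one]
    · cases i with
      | zero =>
        obtain ⟨n, rfl⟩ : ∃ m, n = m + 1 := ⟨n - 1, by omega⟩
        exact firstTwo_braid h (powL V n)
      | succ i =>
        rw [strandL, strandL, ← map_mul, ← map_mul, ← map_mul, ← map_mul, ih.braid i (by omega)]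
    · obtain ⟨j, rfl⟩ : ∃ m, j = m + 1 := ⟨j - 1, by omega⟩
      cases i with
      | zero =>
        obtain ⟨j, rfl⟩ : ∃ m, j = m + 1 := ⟨j - 1, by omega⟩
        obtain ⟨n, rfl⟩ : ∃ m, n = m + 1 := ⟨n - 1, by omega⟩
        exact (firstTwo_comm (strandL c (n + 1) j)).symm
      | succ i =>
        rw [strandL, strandL, ← map_mul, ← map_mul, ih.comm i j (by omega) (by omega)]

end Powers

namespace Heis

variable (k : Type u) [CommRing k]

/-- The crossing of two upward strands. -/
def crossP : (P : Heis k) ⊗ P ⟶ P ⊗ P := mk Diag.cross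

/-- The crossing of two downward strands. -/
def crossQ : (Q : Heis k) ⊗ Q ⟶ Q ⊗ Q := mk Diag.crossDown

/-- The cap `PQ → 1`. -/
def capPQ : (P : Heis k) ⊗ Q ⟶ 𝟙_ (Heis k) := mk Diag.capPQ

/-- The cup `1 → PQ`. -/
def cupPQ : 𝟙_ (Heis k) ⟶ (P : Heis k) ⊗ Q := mk Diag.cupPQ

theorem crossP_symmetry : IsSymmetry (crossP k) where
  sq := Quotient.sound Rel.up_double
  braid := Quotient.sound Rel.up_triple

theorem crossQ_symmetry : IsSymmetry (crossQ k) where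
  sq := Quotient.sound Rel.down_double
  braid := Quotient.sound Rel.down_triple

/-- The action of the symmetric group on `P^{⊗ n}`: a permutation `w` acts by the string diagram
that joins the strand `i` at the bottom to the strand `w i` at the top. -/
def permP (n : ℕ) : Equiv.Perm (Fin n) →* End (powR (P : Heis k) n) :=
  (strandR_rel (crossP_symmetry k) n).hom

/-- The action of the symmetric group on `Q^{⊗ n}`: a permutation `w` acts by the string diagram
that joins the strand `i` at the bottom to the strand `w i` at the top. -/
def permQ (n : ℕ) : Equiv.Perm (Fin n) →* End (powL (Q : Heis k) n) :=
  (strandL_rel (crossQ_symmetry k) n).hom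

end Heis

/-! ## Young symmetrizers -/

namespace YoungDiagram

open Equiv MonoidAlgebra

/-- The boxes of a Young diagram. -/
abbrev Box (l : YoungDiagram) : Type := ↥l.cells

variable (l : YoungDiagram)

/-- The permutations of the boxes that preserve every row. -/
def rowGroup : Subgroup (Perm l.Box) where
  carrier := {w | ∀ x, (w x).1.1 = x.1.1}
  one_mem' _ := rfl
  mul_mem' hv hw x := (hv _).trans (hw x)
  inv_mem' {w} hw x := by simpa using (hw (w⁻¹ x)).symm

/-- The permutations of the boxes that preserve every column. -/
def colGroup : Subgroup (Perm l.Box) where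
  carrier := {w | ∀ x, (w x).1.2 = x.1.2}
  one_mem' _ := rfl
  mul_mem' hv hw x := (hv _).trans (hw x)
  inv_mem' {w} hw x := by simpa using (hw (w⁻¹ x)).symm

theorem row_lt_colLen {w : Perm l.Box}
    (h : ∀ x y : l.Box, x ≠ y → x.1.2 = y.1.2 → (w x).1.1 ≠ (w y).1.1) (z : l.Box) :
    ((w z).1.1, z.1.2) ∈ l := by
  classical
  rw [YoungDiagram.mem_iff_lt_colLen]
  set m := l.colLen z.1.2 with hm
  let A : Finset l.Box := Finset.univ.filter fun x => (w x).1.1 < m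
  let B : Finset l.Box := Finset.univ.filter fun x => x.1.1 < m
  have hAB : A.card = B.card :=
    Finset.card_bij (fun x _ => w x) (by simp [A, B]) (by simp)
      (fun y hy => ⟨w⁻¹ y, by simpa [A, B] using hy, by simp⟩)
  let J : Finset ℕ := Finset.univ.image fun x : l.Box => x.1.2
  have hA : A.card = ∑ j ∈ J, (A.filter fun x => x.1.2 = j).card :=
    Finset.card_eq_sum_card_fiberwise (fun x _ => Finset.mem_image_of_mem _ (Finset.mem_univ x))
  have hB : B.card = ∑ j ∈ J, (B.filter fun x => x.1.2 = j).card :=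
    Finset.card_eq_sum_card_fiberwise (fun x _ => Finset.mem_image_of_mem _ (Finset.mem_univ x))
  have hle : ∀ j ∈ J, (A.filter fun x => x.1.2 = j).card ≤ (B.filter fun x => x.1.2 = j).card := by
    intro j _
    obtain hj | hj := le_or_gt m (l.colLen j)
    · refine Finset.card_le_card_of_injOn
        (fun x => if hx : ((w x).1.1, j) ∈ l then ⟨((w x).1.1, j), hx⟩ else x) ?_ ?_
      · intro x hx
        simp only [A, B, Finset.coe_filter, Finset.mem_filter, Finset.mem_univ, true_and,
          Set.mem_ofPred_eq] at hx ⊢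
        have hx' : ((w x).1.1, j) ∈ l := by
          rw [YoungDiagram.mem_iff_lt_colLen]; omega
        simp [hx', hx.1]
      · intro x hx y hy hxy
        simp only [A, Finset.coe_filter, Finset.mem_filter, Finset.mem_univ, true_and,
          Set.mem_ofPred_eq] at hx hy
        have hx' : ((w x).1.1, j) ∈ l := by
          rw [YoungDiagram.mem_iff_lt_colLen]; omega
        have hy' : ((w y).1.1, j) ∈ l := by
          rw [YoungDiagram.mem_iff_lt_colLen]; omega
        by_contra hne
        refine h x y hne (hx.2.trans hy.2.symm) ?_
        simpa [hx', hy'] using hxy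
    · refine Finset.card_le_card fun x hx => ?_
      simp only [A, B, Finset.mem_filter, Finset.mem_univ, true_and] at hx ⊢
      have : x.1.1 < l.colLen x.1.2 := by
        rw [← YoungDiagram.mem_iff_lt_colLen]; exact x.2
      rw [hx.2] at this
      exact ⟨by omega, hx.2⟩
  rw [hA, hB] at hAB
  have hz := (Finset.sum_eq_sum_iff_of_le hle).1 hAB z.1.2
    (Finset.mem_image_of_mem _ (Finset.mem_univ z))
  have hsub : (A.filter fun x => x.1.2 = z.1.2) ⊆ (B.filter fun x => x.1.2 = z.1.2) := by
    intro x hx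
    simp only [A, B, Finset.mem_filter, Finset.mem_univ, true_and] at hx ⊢
    refine ⟨?_, hx.2⟩
    rw [hm, ← hx.2, ← YoungDiagram.mem_iff_lt_colLen]
    exact x.2
  have hzB : z ∈ B.filter fun x => x.1.2 = z.1.2 := by
    simp only [B, Finset.mem_filter, Finset.mem_univ, true_and, and_true]
    rw [hm, ← YoungDiagram.mem_iff_lt_colLen]
    exact z.2
  rw [← Finset.eq_of_subset_of_card_le hsub hz.ge] at hzB
  simp only [A, Finset.mem_filter, Finset.mem_univ, true_and, and_true] at hzB
  exact hzB

theorem exists_swap_or_eq_mul (w : Perm l.Box) :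
    (∃ x y : l.Box, x ≠ y ∧ x.1.2 = y.1.2 ∧ (w x).1.1 = (w y).1.1) ∨
      ∃ r ∈ l.rowGroup, ∃ c ∈ l.colGroup, w = r * c := by
  by_cases h : ∃ x y : l.Box, x ≠ y ∧ x.1.2 = y.1.2 ∧ (w x).1.1 = (w y).1.1
  · exact Or.inl h
  · push Not at h
    let f : l.Box → l.Box := fun z => ⟨((w z).1.1, z.1.2), l.row_lt_colLen h z⟩
    have hf : Function.Injective f := by
      intro x y hxy
      by_contra hne
      have e : ((w x).1.1, x.1.2) = ((w y).1.1, y.1.2) := congrArg Subtype.val hxy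
      exact h x y hne (Prod.ext_iff.1 e).2 (Prod.ext_iff.1 e).1
    let c : Perm l.Box := Equiv.ofBijective f (Finite.injective_iff_bijective.1 hf)
    have hc : ∀ x, c x = f x := fun x => rfl
    refine Or.inr ⟨w * c⁻¹, fun y => ?_, c, fun x => rfl, by simp⟩
    obtain ⟨x, rfl⟩ := c.surjective y
    change ((w * c⁻¹) (c x)).1.1 = (c x).1.1
    have e : c⁻¹ (c x) = x := c.symm_apply_apply x
    rw [Perm.mul_apply, e, hc]

variable (k : Type*) [Field k]

open Classical in
/-- The sum of the permutations that preserve every row. -/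
def rowSym : MonoidAlgebra k (Perm l.Box) := ∑ w : l.rowGroup, single w.1 1

open Classical in
/-- The signed sum of the permutations that preserve every column. -/
def colAntisym : MonoidAlgebra k (Perm l.Box) :=
  ∑ w : l.colGroup, single w.1 ((Perm.sign w.1 : ℤ) : k)

variable {l k}

theorem rowSym_mul {w : Perm l.Box} (hw : w ∈ l.rowGroup) :
    l.rowSym k * single w 1 = l.rowSym k := by
  classical
  rw [rowSym, Finset.sum_mul]
  refine Fintype.sum_equiv (Equiv.mulRight (⟨w, hw⟩ : l.rowGroup)) _ _ fun v => ?_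
  simp [single_mul_single]

theorem mul_colAntisym {w : Perm l.Box} (hw : w ∈ l.colGroup) :
    single w 1 * l.colAntisym k = ((Perm.sign w : ℤ) : k) • l.colAntisym k := by
  classical
  rw [colAntisym, Finset.mul_sum, Finset.smul_sum]
  refine Fintype.sum_equiv (Equiv.mulLeft (⟨w, hw⟩ : l.colGroup)) _ _ fun v => ?_
  rw [single_mul_single, smul_single]
  have : ((Perm.sign w : ℤ) : k) * ((Perm.sign w : ℤ) : k) = 1 := by
    rw [← Int.cast_mul, ← Units.val_mul, Int.units_mul_self]; simp
  simp [← mul_assoc, this]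

theorem trace_lmul (x : MonoidAlgebra k (Perm l.Box)) :
    LinearMap.trace k _ (LinearMap.mulLeft k x) = Fintype.card (Perm l.Box) * x.coeff 1 := by
  classical
  rw [LinearMap.trace_eq_matrix_trace k (MonoidAlgebra.basis (Perm l.Box) k), Matrix.trace]
  have : ∀ w, (LinearMap.toMatrix (MonoidAlgebra.basis (Perm l.Box) k)
      (MonoidAlgebra.basis (Perm l.Box) k) (LinearMap.mulLeft k x)).diag w = x.coeff 1 := by
    intro w
    rw [Matrix.diag_apply, LinearMap.toMatrix_apply, basis_apply, LinearMap.mulLeft_apply]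
    change (x * single w 1).coeff w = _
    rw [coeff_mul_single_eq_coeff_mul 1 (by intro v _; simp), mul_one]
  rw [Finset.sum_congr rfl fun w _ => this w]
  simp

variable [CharZero k]

theorem rowSym_mul_mul_colAntisym (x : MonoidAlgebra k (Perm l.Box)) :
    ∃ c : k, l.rowSym k * x * l.colAntisym k = c • (l.rowSym k * l.colAntisym k) := by
  induction x using MonoidAlgebra.induction_linear with
  | zero => exact ⟨0, by simp⟩
  | add x y hx hy =>
    obtain ⟨c, hc⟩ := hx
    obtain ⟨d, hd⟩ := hy
    exact ⟨c + d, by rw [mul_add, add_mul, hc, hd, add_smul]⟩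
  | single w t =>
    obtain ⟨x, y, hne, hcol, hrow⟩ | ⟨r, hr, c, hc, rfl⟩ := l.exists_swap_or_eq_mul w
    · refine ⟨0, ?_⟩
      classical
      have hc : swap x y ∈ l.colGroup := by
        intro z
        obtain rfl | hx := eq_or_ne z x
        · rw [swap_apply_left, hcol]
        obtain rfl | hy := eq_or_ne z y
        · rw [swap_apply_right, hcol]
        rw [swap_apply_of_ne_of_ne hx hy]
      have hr : swap (w x) (w y) ∈ l.rowGroup := by
        intro z
        obtain rfl | hx := eq_or_ne z (w x)
        · rw [swap_apply_left, hrow]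
        obtain rfl | hy := eq_or_ne z (w y)
        · rw [swap_apply_right, hrow]
        rw [swap_apply_of_ne_of_ne hx hy]
      have e : single (swap (w x) (w y)) (1 : k) * single w t =
          single w t * single (swap x y) 1 := by
        rw [single_mul_single, single_mul_single, one_mul, mul_one]
        congr 1
        rw [← Equiv.mul_swap_eq_swap_mul]
      have h1 : l.rowSym k * single w t * l.colAntisym k =
          -(l.rowSym k * single w t * l.colAntisym k) := by
        conv_lhs => rw [← rowSym_mul hr, mul_assoc (l.rowSym k), e, ← mul_assoc, mul_assoc,
          mul_colAntisym hc, Perm.sign_swap hne]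
        simp
      rw [zero_smul]
      ext v
      have h2 := congrArg (fun z => z.coeff v) h1
      simp only [coeff_neg, Finsupp.neg_apply] at h2
      simpa using self_eq_neg.1 h2
    · refine ⟨t * ((Perm.sign c : ℤ) : k), ?_⟩
      have e : (single (r * c) t : MonoidAlgebra k (Perm l.Box)) = single r 1 * (t • single c 1) := by
        rw [smul_single, single_mul_single]; simp
      rw [e, ← mul_assoc, rowSym_mul hr, mul_smul_comm, smul_mul_assoc, mul_assoc,
        mul_colAntisym hc, mul_smul_comm, smul_smul]

variable (l k)

/-- The product of the row symmetrizer and the column antisymmetrizer. -/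
def preYoung : MonoidAlgebra k (Perm l.Box) := l.rowSym k * l.colAntisym k

theorem coeff_preYoung_one : (l.preYoung k).coeff 1 = 1 := by
  classical
  rw [preYoung, rowSym, colAntisym, Finset.sum_mul_sum, coeff_sum, Finset.sum_apply']
  rw [Finset.sum_eq_single 1]
  · rw [coeff_sum, Finset.sum_apply', Finset.sum_eq_single 1]
    · simp [single_mul_single]
    · intro c _ hc
      have hc' : c.1 ≠ 1 := fun h => hc (Subtype.ext h)
      simp [single_mul_single, hc']
    · simp
  · intro r _ hr
    rw [coeff_sum, Finset.sum_apply']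
    refine Finset.sum_eq_zero fun c _ => ?_
    rw [single_mul_single, coeff_single, Finsupp.single_eq_of_ne]
    intro h
    have h' : (1 : Perm l.Box) = r.1 * c.1 := h
    apply hr
    have hrc : r.1 = c.1⁻¹ := eq_inv_of_mul_eq_one_left h'.symm
    refine Subtype.ext (Equiv.ext fun x => Subtype.ext (Prod.ext (r.2 x) ?_))
    rw [hrc]
    exact l.colGroup.inv_mem c.2 x
  · simp

/-- The scalar `γ` with `(a b)² = γ a b`. -/
def hook : k := (l.preYoung k * l.preYoung k).coeff 1

theorem preYoung_mul_self : l.preYoung k * l.preYoung k = l.hook k • l.preYoung k := by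
  obtain ⟨c, hc⟩ := rowSym_mul_mul_colAntisym (l.colAntisym k * l.rowSym k)
  have h : l.preYoung k * l.preYoung k = c • l.preYoung k := by
    rw [preYoung, ← hc]; simp only [mul_assoc]
  rw [hook, h, coeff_smul, Finsupp.smul_apply, coeff_preYoung_one, smul_eq_mul, mul_one]

theorem hook_ne_zero : l.hook k ≠ 0 := by
  intro h
  have h0 := l.preYoung_mul_self k
  rw [h, zero_smul] at h0
  have hn : IsNilpotent (LinearMap.mulLeft k (l.preYoung k)) := ⟨2, by
    rw [sq]
    refine LinearMap.ext fun x => ?_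
    rw [Module.End.mul_apply, LinearMap.mulLeft_apply, LinearMap.mulLeft_apply, ← mul_assoc, h0]
    simp⟩
  have ht := (LinearMap.isNilpotent_trace_of_isNilpotent hn).eq_zero
  rw [trace_lmul, coeff_preYoung_one, mul_one] at ht
  exact Fintype.card_ne_zero (Nat.cast_eq_zero.1 ht)

/-- The Young symmetrizer of the standard tableau on `l`: the idempotent multiple of the product of
the row symmetrizer and the column antisymmetrizer. -/
def young : MonoidAlgebra k (Perm l.Box) := (l.hook k)⁻¹ • l.preYoung k

theorem young_mul_self : l.young k * l.young k = l.young k := by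
  rw [young, smul_mul_smul_comm, preYoung_mul_self, smul_smul, mul_assoc,
    inv_mul_cancel₀ (l.hook_ne_zero k), mul_one]

end YoungDiagram

/-! ## The additive and idempotent completion -/

section Completion

open Idempotents

/-- The morphism between direct summands that is induced by a morphism of the ambient objects. -/
def cutDown {D : Type*} [Category D] (A B : Karoubi D) (g : A.X ⟶ B.X) : A ⟶ B :=
  ⟨A.p ≫ g ≫ B.p, by simp⟩

variable {C : Type*} [Category C] [Preadditive C] [MonoidalCategory C] [MonoidalPreadditive C]

/-- The tensor product of formal finite direct sums. -/
def matObj (X Y : Mat_ C) : Mat_ C := ⟨X.ι × Y.ι, fun p => X.X p.1 ⊗ Y.X p.2⟩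

/-- The tensor product of matrices. -/
def matHom {X X' Y Y' : Mat_ C} (f : X ⟶ X') (g : Y ⟶ Y') : matObj X Y ⟶ matObj X' Y' :=
  fun p q => f p.1 q.1 ⊗ₘ g p.2 q.2

theorem matHom_id (X Y : Mat_ C) : matHom (𝟙 X) (𝟙 Y) = 𝟙 (matObj X Y) := by
  ext p q
  obtain ⟨i, j⟩ := p
  obtain ⟨i', j'⟩ := q
  by_cases hi : i = i'
  · subst hi
    by_cases hj : j = j'
    · subst hj
      erw [Mat_.id_apply_self]
      simp only [matHom, Mat_.id_apply_self]
      exact id_tensorHom_id _ _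
    · erw [Mat_.id_apply_of_ne (matObj X Y) _ _ (fun h => hj (Prod.ext_iff.1 h).2)]
      simp only [matHom, Mat_.id_apply_of_ne _ _ _ hj]
      exact MonoidalPreadditive.tensor_zero _
  · erw [Mat_.id_apply_of_ne (matObj X Y) _ _ (fun h => hi (Prod.ext_iff.1 h).1)]
    simp only [matHom, Mat_.id_apply_of_ne _ _ _ hi]
    exact MonoidalPreadditive.zero_tensor _

theorem matHom_comp {X X' X'' Y Y' Y'' : Mat_ C} (f : X ⟶ X') (f' : X' ⟶ X'') (g : Y ⟶ Y')
    (g' : Y' ⟶ Y'') : matHom (f ≫ f') (g ≫ g') = matHom f g ≫ matHom f' g' := by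
  ext p q
  simp only [matHom, Mat_.comp_apply, sum_tensor, tensor_sum]
  change _ = ∑ r : X'.ι × Y'.ι, _
  rw [Fintype.sum_prod_type, Finset.sum_comm]
  refine Finset.sum_congr rfl fun i _ => Finset.sum_congr rfl fun j _ => ?_
  exact (tensorHom_comp_tensorHom _ _ _ _).symm

theorem matHom_add_left {X X' Y Y' : Mat_ C} (f f' : X ⟶ X') (g : Y ⟶ Y') :
    matHom (f + f') g = matHom f g + matHom f' g := by
  ext p q
  exact MonoidalPreadditive.add_tensor _ _ _

theorem matHom_add_right {X X' Y Y' : Mat_ C} (f : X ⟶ X') (g g' : Y ⟶ Y') :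
    matHom f (g + g') = matHom f g + matHom f g' := by
  ext p q
  exact MonoidalPreadditive.tensor_add _ _ _

/-- The tensor product of objects of the idempotent completion. -/
def tenObj (X Y : Karoubi (Mat_ C)) : Karoubi (Mat_ C) :=
  ⟨matObj X.X Y.X, matHom X.p Y.p, by
    rw [← matHom_comp, X.idem, Y.idem]⟩

/-- The tensor product of morphisms of the idempotent completion. -/
def tenHom {X X' Y Y' : Karoubi (Mat_ C)} (f : X ⟶ X') (g : Y ⟶ Y') : tenObj X Y ⟶ tenObj X' Y' :=
  ⟨matHom f.f g.f, by
    change matHom X.p Y.p ≫ matHom f.f g.f ≫ matHom X'.p Y'.p = _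
    rw [← matHom_comp, ← matHom_comp, f.comm, g.comm]⟩

theorem tenHom_id (X Y : Karoubi (Mat_ C)) : tenHom (𝟙 X) (𝟙 Y) = 𝟙 (tenObj X Y) := rfl

theorem tenHom_comp {X X' X'' Y Y' Y'' : Karoubi (Mat_ C)} (f : X ⟶ X') (f' : X' ⟶ X'')
    (g : Y ⟶ Y') (g' : Y' ⟶ Y'') : tenHom (f ≫ f') (g ≫ g') = tenHom f g ≫ tenHom f' g' :=
  Karoubi.hom_ext _ _ (matHom_comp f.f f'.f g.f g'.f)

theorem tenHom_add_left {X X' Y Y' : Karoubi (Mat_ C)} (f f' : X ⟶ X') (g : Y ⟶ Y') :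
    tenHom (f + f') g = tenHom f g + tenHom f' g :=
  Karoubi.hom_ext _ _ (matHom_add_left f.f f'.f g.f)

theorem tenHom_add_right {X X' Y Y' : Karoubi (Mat_ C)} (f : X ⟶ X') (g g' : Y ⟶ Y') :
    tenHom f (g + g') = tenHom f g + tenHom f g' :=
  Karoubi.hom_ext _ _ (matHom_add_right f.f g.f g'.f)

/-- `tenHom` as a biadditive map. -/
def tenAdd (X X' Y Y' : Karoubi (Mat_ C)) :
    (X ⟶ X') →+ (Y ⟶ Y') →+ (tenObj X Y ⟶ tenObj X' Y') :=
  AddMonoidHom.mk' (fun f => AddMonoidHom.mk' (tenHom f) (tenHom_add_right f))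
    (fun f f' => AddMonoidHom.ext fun g => tenHom_add_left f f' g)

theorem tenHom_zero_left {X X' Y Y' : Karoubi (Mat_ C)} (g : Y ⟶ Y') :
    tenHom (0 : X ⟶ X') g = 0 :=
  DFunLike.congr_fun (map_zero (tenAdd X X' Y Y')) g

theorem tenHom_zero_right {X X' Y Y' : Karoubi (Mat_ C)} (f : X ⟶ X') :
    tenHom f (0 : Y ⟶ Y') = 0 :=
  map_zero (tenAdd X X' Y Y' f)

end Completion

/-- The Heisenberg category: the idempotent completion of the additive envelope of Khovanov's
diagrammatic category. -/
abbrev Heisenberg (k : Type u) [CommRing k] := Idempotents.Karoubi (Mat_ (Heis k))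

namespace Heisenberg

variable (k : Type u) [CommRing k]

/-- The monoidal unit. -/
def unit : Heisenberg k := ⟨(Mat_.embedding _).obj (𝟙_ (Heis k)), 𝟙 _, Category.id_comp _⟩

variable {k}

/-- The direct summand of an object cut out by an idempotent. -/
def image {X : Heis k} (e : End X) (he : e * e = e) : Heisenberg k :=
  ⟨(Mat_.embedding _).obj X, (Mat_.embedding _).map e, by
    rw [← Functor.map_comp]; exact congrArg _ he⟩

/-- The morphism between direct summands of `X ⊗ Y` and `X' ⊗ Y'` that is induced by a morphism
`X ⊗ Y ⟶ X' ⊗ Y'`. -/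
def induced {X Y X' Y' : Heis k} {e : End X} {f : End Y} {e' : End X'} {f' : End Y'}
    (he : e * e = e) (hf : f * f = f) (he' : e' * e' = e') (hf' : f' * f' = f')
    (g : X ⊗ Y ⟶ X' ⊗ Y') :
    tenObj (image e he) (image f hf) ⟶ tenObj (image e' he') (image f' hf') :=
  cutDown (tenObj (image e he) (image f hf)) (tenObj (image e' he') (image f' hf'))
    (show matObj ((Mat_.embedding _).obj X) ((Mat_.embedding _).obj Y) ⟶
      matObj ((Mat_.embedding _).obj X') ((Mat_.embedding _).obj Y') from fun _ _ => g)

end Heisenberg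

/-! ## Removing a box from a Young diagram -/

namespace YoungDiagram

open Equiv MonoidAlgebra

/-- The boxes of a Young diagram, ordered lexicographically (row by row). -/
def lexCells (l : YoungDiagram) : Finset (ℕ ×ₗ ℕ) := l.cells.map toLex.toEmbedding

/-- The standard tableau whose rows, read one after another from left to right, are filled with
`0, 1, 2, …`. -/
def rowTab (l : YoungDiagram) : l.Box ≃ Fin l.card :=
  (toLex.subtypeEquiv fun x => by simp [lexCells]).trans
    (l.lexCells.orderIsoOfFin (Finset.card_map _)).symm.toEquiv

/-- `l` arises from `m` by adding one box. -/
def AddBox (m l : YoungDiagram) : Prop := m ≤ l ∧ l.card = m.card + 1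

theorem card_transpose (l : YoungDiagram) : l.transpose.card = l.card :=
  Finset.card_bij (fun x _ => x.swap) (fun x hx => by simpa using hx)
    (fun x _ y _ h => Prod.swap_injective h)
    (fun x hx => ⟨x.swap, by simpa using hx, by simp⟩)

theorem AddBox.transpose {m l : YoungDiagram} (h : AddBox m l) :
    AddBox m.transpose l.transpose :=
  ⟨YoungDiagram.transpose_mono h.1, by rw [card_transpose, card_transpose, h.2]⟩

theorem AddBox.bijective {m l : YoungDiagram} (h : AddBox m l) :
    Function.Bijective (fun x : l.Box => if hx : x.1 ∈ m.cells then some (⟨x.1, hx⟩ : m.Box)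
      else none) := by
  rw [Fintype.bijective_iff_surjective_and_card]
  constructor
  · rintro (_ | ⟨x, hx⟩)
    · have : m.cells ⊂ l.cells := by
        refine Finset.ssubset_iff_subset_ne.2 ⟨YoungDiagram.cells_subset_iff.2 h.1, fun e => ?_⟩
        have := h.2
        rw [YoungDiagram.card, YoungDiagram.card, e] at this
        omega
      obtain ⟨x, hx, hx'⟩ := Finset.exists_of_ssubset this
      exact ⟨⟨x, hx⟩, dif_neg hx'⟩
    · exact ⟨⟨x, h.1 hx⟩, dif_pos hx⟩
  · rw [Fintype.card_option, Fintype.card_coe, Fintype.card_coe]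
    exact h.2

/-- The boxes of `l` are the boxes of `m` and the new box `none`. -/
def AddBox.strip {m l : YoungDiagram} (h : AddBox m l) : l.Box ≃ Option m.Box :=
  Equiv.ofBijective _ h.bijective

/-- The permutation that carries the labels of the row tableau of `l` to the labels of the row
tableau of `m`, followed by a last label for the new box. -/
def AddBox.newLast {m l : YoungDiagram} (h : AddBox m l) : Perm (Fin l.card) :=
  l.rowTab.symm.trans (h.strip.trans ((Equiv.optionCongr m.rowTab).trans
    (finSuccEquivLast.symm.trans (finCongr h.2.symm))))

/-- The permutation that carries the labels of the row tableau of `l` to a first label for the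
new box, followed by the labels of the row tableau of `m`. -/
def AddBox.newFirst {m l : YoungDiagram} (h : AddBox m l) : Perm (Fin l.card) :=
  l.rowTab.symm.trans (h.strip.trans ((Equiv.optionCongr m.rowTab).trans
    ((finSuccEquiv m.card).symm.trans (finCongr h.2.symm))))

variable (k : Type*) [Field k]

/-- The Young symmetrizer of `m`, acting on the boxes of `l`. -/
def AddBox.youngExt {m l : YoungDiagram} (h : AddBox m l) : MonoidAlgebra k (Perm l.Box) :=
  MonoidAlgebra.mapDomain (fun w : Perm m.Box => h.strip.symm.permCongr (Equiv.optionCongr w))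
    (m.young k)

/-- The scalar `n` with `e_l e_m e_l = n e_l`. -/
def AddBox.scalar {m l : YoungDiagram} (h : AddBox m l) : k :=
  (l.young k * h.youngExt k * l.young k).coeff 1 / (l.young k).coeff 1

/-- The scalar that normalizes the differentials. -/
def AddBox.coef {m l : YoungDiagram} (h : AddBox m l) : k :=
  ((Perm.sign h.newLast : ℤ) : k) * (h.scalar k)⁻¹

instance finite_card (n : ℤ) : Finite {l : YoungDiagram // (l.card : ℤ) = n} := by
  let f : {l : YoungDiagram // (l.card : ℤ) = n} →
      (Finset.range (n.toNat + 1) ×ˢ Finset.range (n.toNat + 1)).powerset := fun l =>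
    ⟨l.1.cells, by
      rw [Finset.mem_powerset]
      rintro ⟨i, j⟩ hx
      have hn : n.toNat = l.1.cells.card := by
        have h : (l.1.cells.card : ℤ) = n := l.2
        omega
      have h1 : (Finset.range (i + 1) ×ˢ {j}).card ≤ l.1.cells.card := by
        refine Finset.card_le_card ?_
        rintro ⟨i', j'⟩ h
        simp only [Finset.mem_product, Finset.mem_range, Finset.mem_singleton] at h
        exact l.1.up_left_mem (by omega) h.2.le hx
      have h2 : ({i} ×ˢ Finset.range (j + 1)).card ≤ l.1.cells.card := by
        refine Finset.card_le_card ?_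
        rintro ⟨i', j'⟩ h
        simp only [Finset.mem_product, Finset.mem_range, Finset.mem_singleton] at h
        exact l.1.up_left_mem h.1.le (by omega) hx
      simp only [Finset.card_product, Finset.card_range, Finset.card_singleton] at h1 h2
      simp only [Finset.mem_product, Finset.mem_range]
      omega⟩
  refine Finite.of_injective f fun l m h => Subtype.ext (YoungDiagram.ext ?_)
  exact congrArg (fun z => z.1) h

end YoungDiagram

/-! ## The complexes -/

namespace Heisenberg

open YoungDiagram

variable (k : Type u) [Field k]

/-- The action of the group algebra of the permutations of the boxes of `l` on `P^{⊗ n}`. -/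
def actP (l : YoungDiagram) :
    MonoidAlgebra k (Equiv.Perm l.Box) →ₐ[k] End (powR (Heis.P : Heis k) l.card) :=
  MonoidAlgebra.lift k _ _ ((Heis.permP k l.card).comp l.rowTab.permCongrHom.toMonoidHom)

/-- The action of the group algebra of the permutations of the boxes of `l` on `Q^{⊗ n}`. -/
def actQ (l : YoungDiagram) :
    MonoidAlgebra k (Equiv.Perm l.Box) →ₐ[k] End (powL (Heis.Q : Heis k) l.card) :=
  MonoidAlgebra.lift k _ _ ((Heis.permQ k l.card).comp l.rowTab.permCongrHom.toMonoidHom)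

theorem powR_succ {m l : YoungDiagram} (h : AddBox m l) :
    powR (Heis.P : Heis k) l.card = powR Heis.P m.card ⊗ Heis.P := by
  rw [h.2]; rfl

theorem powL_succ {m l : YoungDiagram} (h : AddBox m l) :
    powL (Heis.Q : Heis k) l.transpose.card = Heis.Q ⊗ powL Heis.Q m.transpose.card := by
  rw [h.transpose.2]; rfl

variable [CharZero k]

theorem actP_young (l : YoungDiagram) :
    actP k l (l.young k) * actP k l (l.young k) = actP k l (l.young k) := by
  rw [← map_mul, young_mul_self]

theorem actQ_young (l : YoungDiagram) :
    actQ k l (l.young k) * actQ k l (l.young k) = actQ k l (l.young k) := by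
  rw [← map_mul, young_mul_self]

/-- The object `P^l`. -/
def symP (l : YoungDiagram) : Heisenberg k := image _ (actP_young k l)

/-- The object `Q^l`. -/
def symQ (l : YoungDiagram) : Heisenberg k := image _ (actQ_young k l)

/-- The object `P^l Q^{l^t}`. -/
def symPQ (l : YoungDiagram) : Heisenberg k := tenObj (symP k l) (symQ k l.transpose)

variable {k}

/-- The cap `PQ → 1` between the two halves of `(A P)(Q B)`. -/
def midCap (A B : Heis k) : (A ⊗ Heis.P) ⊗ (Heis.Q ⊗ B) ⟶ A ⊗ B :=
  (α_ A Heis.P (Heis.Q ⊗ B)).hom ≫ A ◁ ((α_ Heis.P Heis.Q B).inv ≫ Heis.capPQ k ▷ B ≫ (λ_ B).hom)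

/-- The cup `1 → PQ` between `A` and `B`. -/
def midCup (A B : Heis k) : A ⊗ B ⟶ (A ⊗ Heis.P) ⊗ (Heis.Q ⊗ B) :=
  A ◁ ((λ_ B).inv ≫ Heis.cupPQ k ▷ B ≫ (α_ Heis.P Heis.Q B).hom) ≫
    (α_ A Heis.P (Heis.Q ⊗ B)).inv

variable (k) {m l : YoungDiagram} (h : AddBox m l)

/-- The permutation of strands that makes the strand of the new box the last one. -/
def splitP : powR (Heis.P : Heis k) l.card ⟶ powR Heis.P m.card ⊗ Heis.P :=
  Heis.permP k l.card h.newLast ≫ eqToHom (powR_succ k h)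

/-- The inverse of `splitP`. -/
def mergeP : powR Heis.P m.card ⊗ Heis.P ⟶ powR (Heis.P : Heis k) l.card :=
  eqToHom (powR_succ k h).symm ≫ Heis.permP k l.card h.newLast⁻¹

/-- The permutation of strands that makes the strand of the new box the first one. -/
def splitQ : powL (Heis.Q : Heis k) l.transpose.card ⟶
    Heis.Q ⊗ powL Heis.Q m.transpose.card :=
  Heis.permQ k l.transpose.card h.transpose.newFirst ≫ eqToHom (powL_succ k h)

/-- The inverse of `splitQ`. -/
def mergeQ : Heis.Q ⊗ powL Heis.Q m.transpose.card ⟶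
    powL (Heis.Q : Heis k) l.transpose.card :=
  eqToHom (powL_succ k h).symm ≫ Heis.permQ k l.transpose.card h.transpose.newFirst⁻¹

/-- The component `P^l Q^{l^t} → P^m P Q Q^{m^t} → P^m Q^{m^t}` of the differential. -/
def capComponent : symPQ k l ⟶ symPQ k m :=
  induced (actP_young k l) (actQ_young k l.transpose) (actP_young k m) (actQ_young k m.transpose)
    (h.coef k • (splitP k h ⊗ₘ splitQ k h) ≫ midCap _ _)

/-- The component `P^m Q^{m^t} → P^m P Q Q^{m^t} → P^l Q^{l^t}` of the differential. -/
def cupComponent : symPQ k m ⟶ symPQ k l :=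
  induced (actP_young k m) (actQ_young k m.transpose) (actP_young k l) (actQ_young k l.transpose)
    (h.coef k • midCup _ _ ≫ (mergeP k h ⊗ₘ mergeQ k h))

open Limits

/-- The direct sum of the objects `P^l Q^{l^t}` over the partitions `l` of `n`. -/
def sigmaObj (n : ℤ) : Heisenberg k :=
  ⨁ fun l : {l : YoungDiagram // (l.card : ℤ) = n} => symPQ k l.1

open Classical in
/-- The map from `sigmaObj a` to `sigmaObj b` that removes a box in all possible ways. -/
def dMinus (a b : ℤ) : sigmaObj k a ⟶ sigmaObj k b :=
  biproduct.matrix fun l m => if h : AddBox m.1 l.1 then capComponent k h else 0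

open Classical in
/-- The map from `sigmaObj a` to `sigmaObj b` that adds a box in all possible ways. -/
def dPlus (a b : ℤ) : sigmaObj k a ⟶ sigmaObj k b :=
  biproduct.matrix fun m l => if h : AddBox m.1 l.1 then cupComponent k h else 0

theorem matrix_eq_zero {a b : ℤ}
    (f : ∀ (l : {l : YoungDiagram // (l.card : ℤ) = a}) (m : {l : YoungDiagram // (l.card : ℤ) = b}),
      symPQ k l.1 ⟶ symPQ k m.1) (hf : ∀ l m, f l m = 0) :
    (biproduct.matrix f : sigmaObj k a ⟶ sigmaObj k b) = 0 := by
  refine biproduct.hom_ext' _ _ fun l => biproduct.hom_ext _ _ fun m => ?_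
  have e := biproduct.matrix_components f l m
  rw [biproduct.components, hf] at e
  refine (Category.assoc _ _ _).trans (e.trans ?_)
  rw [comp_zero, zero_comp]

theorem dMinus_shape {a b : ℤ} (hab : b + 1 ≠ a) : dMinus k a b = 0 :=
  matrix_eq_zero k _ fun l m => dif_neg fun h => hab (by
    have := h.2
    have := l.2
    have := m.2
    omega)

theorem dPlus_shape {a b : ℤ} (hab : a + 1 ≠ b) : dPlus k a b = 0 :=
  matrix_eq_zero k _ fun l m => dif_neg fun h => hab (by
    have := h.2
    have := l.2
    have := m.2
    omega)

variable {k}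

/-- The complex `Σ⁻`, given that its differential squares to zero. -/
def sigmaMinus (hd : ∀ a b c, dMinus k a b ≫ dMinus k b c = 0) : ChainComplex (Heisenberg k) ℤ where
  X := sigmaObj k
  d := dMinus k
  shape _ _ hab := dMinus_shape k hab
  d_comp_d' _ _ _ _ _ := hd _ _ _

/-- The complex `Σ⁺`, given that its differential squares to zero. The summands `P^l Q^{l^t}` with
`l` a partition of `n` are placed in degree `-n`. -/
def sigmaPlus (hd : ∀ a b c, dPlus k a b ≫ dPlus k b c = 0) : ChainComplex (Heisenberg k) ℤ where
  X n := sigmaObj k (-n)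
  d a b := dPlus k (-a) (-b)
  shape a b hab := dPlus_shape k (fun h => hab (by change b + 1 = a; omega))
  d_comp_d' _ _ _ _ _ := hd _ _ _

end Heisenberg

/-! ## Formal direct sums and products -/

section Formal

/-- Formal direct sums `⊕ i, X i` of arbitrary families of objects. -/
structure SumCompl (C : Type*) where
  /-- The index type. -/
  ι : Type
  /-- The summands. -/
  X : ι → C

variable {C : Type*} [Category C] [Preadditive C]

namespace SumCompl

/-- A morphism of formal direct sums: a matrix in which every summand of the source meets only
finitely many nonzero entries. -/
@[ext]
structure Hom (A B : SumCompl C) where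
  /-- The entries. -/
  e : ∀ i j, A.X i ⟶ B.X j
  /-- Row finiteness. -/
  finite : ∀ i, {j | e i j ≠ 0}.Finite

theorem comp_finite {A B D : SumCompl C} (f : Hom A B) (g : Hom B D) (i : A.ι) :
    {l | ∑ᶠ j, f.e i j ≫ g.e j l ≠ 0}.Finite := by
  refine ((f.finite i).biUnion fun j _ => g.finite j).subset fun l hl => ?_
  by_contra hc
  refine hl (finsum_eq_zero_of_forall_eq_zero fun j => ?_)
  by_cases hj : f.e i j = 0
  · rw [hj, Limits.zero_comp]
  · by_cases hg : g.e j l = 0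
    · rw [hg, Limits.comp_zero]
    · exact absurd (Set.mem_biUnion (show j ∈ {j | f.e i j ≠ 0} from hj) hg) hc

open Classical in
instance : Category (SumCompl C) where
  Hom := Hom
  id A := ⟨fun i j => if h : i = j then eqToHom (congrArg A.X h) else 0, fun i =>
    (Set.finite_singleton i).subset fun j hj => by
      by_contra hne
      exact hj (dif_neg fun h : i = j => hne (by rw [h]; rfl))⟩
  comp f g := ⟨fun i l => ∑ᶠ j, f.e i j ≫ g.e j l, comp_finite f g⟩
  id_comp {A B} f := by
    ext i l
    refine (finsum_eq_single _ i fun j hj => ?_).trans ?_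
    · exact (congrArg (· ≫ f.e j l) (dif_neg hj.symm)).trans Limits.zero_comp
    · exact (congrArg (· ≫ f.e i l) (dif_pos rfl)).trans (Category.id_comp _)
  comp_id {A B} f := by
    ext i l
    refine (finsum_eq_single _ l fun j hj => ?_).trans ?_
    · exact (congrArg (f.e i j ≫ ·) (dif_neg hj)).trans Limits.comp_zero
    · exact (congrArg (f.e i l ≫ ·) (dif_pos rfl)).trans (Category.comp_id _)
  assoc {A B D E} f g h := by
    ext i m
    have hL : (⋃ j ∈ {j | f.e i j ≠ 0}, {l | g.e j l ≠ 0}).Finite :=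
      (f.finite i).biUnion fun j _ => g.finite j
    have h1 : ∀ l, ∑ᶠ j, f.e i j ≫ g.e j l = ∑ j ∈ (f.finite i).toFinset, f.e i j ≫ g.e j l := by
      intro l
      refine finsum_eq_sum_of_support_subset _ fun j hj => ?_
      rw [Set.Finite.coe_toFinset]
      intro h0
      exact hj ((congrArg (· ≫ _) h0).trans Limits.zero_comp)
    have h2 : ∀ j ∈ (f.finite i).toFinset,
        ∑ᶠ l, g.e j l ≫ h.e l m = ∑ l ∈ hL.toFinset, g.e j l ≫ h.e l m := by
      intro j hj
      refine finsum_eq_sum_of_support_subset _ fun l hl => ?_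
      rw [Set.Finite.coe_toFinset]
      refine Set.mem_biUnion (by simpa using hj) ?_
      intro h0
      exact hl ((congrArg (· ≫ _) h0).trans Limits.zero_comp)
    have h3 : ∑ᶠ l, (∑ᶠ j, f.e i j ≫ g.e j l) ≫ h.e l m =
        ∑ l ∈ hL.toFinset, (∑ᶠ j, f.e i j ≫ g.e j l) ≫ h.e l m := by
      refine finsum_eq_sum_of_support_subset _ fun l hl => ?_
      by_contra hc
      refine hl ?_
      have : ∑ᶠ j, f.e i j ≫ g.e j l = 0 := by
        refine finsum_eq_zero_of_forall_eq_zero fun j => ?_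
        by_cases hj : f.e i j = 0
        · rw [hj, Limits.zero_comp]
        · by_cases hg : g.e j l = 0
          · rw [hg, Limits.comp_zero]
          · refine absurd ?_ hc
            rw [Set.Finite.coe_toFinset]
            exact Set.mem_biUnion (show j ∈ {j | f.e i j ≠ 0} from hj) hg
      change (∑ᶠ j, f.e i j ≫ g.e j l) ≫ h.e l m = 0
      rw [this, Limits.zero_comp]
    have h4 : ∑ᶠ j, f.e i j ≫ (∑ᶠ l, g.e j l ≫ h.e l m) =
        ∑ j ∈ (f.finite i).toFinset, f.e i j ≫ (∑ᶠ l, g.e j l ≫ h.e l m) := by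
      refine finsum_eq_sum_of_support_subset _ fun j hj => ?_
      rw [Set.Finite.coe_toFinset]
      intro h0
      exact hj ((congrArg (· ≫ _) h0).trans Limits.zero_comp)
    change ∑ᶠ l, (∑ᶠ j, f.e i j ≫ g.e j l) ≫ h.e l m =
      ∑ᶠ j, f.e i j ≫ (∑ᶠ l, g.e j l ≫ h.e l m)
    rw [h3, h4, Finset.sum_congr rfl fun l _ => by rw [h1 l, Preadditive.sum_comp],
      Finset.sum_comm]
    refine Finset.sum_congr rfl fun j hj => ?_
    rw [h2 j hj, Preadditive.comp_sum]
    exact Finset.sum_congr rfl fun l _ => Category.assoc _ _ _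

theorem id_e (A : SumCompl C) (i : A.ι) : (𝟙 A : A ⟶ A).e i i = 𝟙 (A.X i) := dif_pos rfl

theorem comp_e {A B D : SumCompl C} (f : A ⟶ B) (g : B ⟶ D) (i : A.ι) (l : D.ι) :
    (f ≫ g).e i l = ∑ᶠ j, f.e i j ≫ g.e j l := rfl

instance (A B : SumCompl C) : Zero (A ⟶ B) := ⟨⟨fun _ _ => 0, fun i => by simp⟩⟩

instance (A B : SumCompl C) : Add (A ⟶ B) :=
  ⟨fun f g => ⟨fun i j => f.e i j + g.e i j, fun i =>
    ((f.finite i).union (g.finite i)).subset fun j hj => by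
      by_contra hc
      simp only [Set.mem_union, Set.mem_ofPred_eq, not_or, not_not] at hc
      exact hj (by rw [hc.1, hc.2, add_zero])⟩⟩

instance (A B : SumCompl C) : Neg (A ⟶ B) :=
  ⟨fun f => ⟨fun i j => -f.e i j, fun i => (f.finite i).subset fun j hj h0 =>
    hj (by rw [h0, neg_zero])⟩⟩

instance (A B : SumCompl C) : AddCommGroup (A ⟶ B) where
  add_assoc f g h := Hom.ext (funext fun i => funext fun j => add_assoc _ _ _)
  zero_add f := Hom.ext (funext fun i => funext fun j => zero_add _)
  add_zero f := Hom.ext (funext fun i => funext fun j => add_zero _)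
  add_comm f g := Hom.ext (funext fun i => funext fun j => add_comm _ _)
  neg_add_cancel f := Hom.ext (funext fun i => funext fun j => neg_add_cancel _)
  nsmul := nsmulRec
  zsmul := zsmulRec

theorem finite_support_comp {A B D : SumCompl C} (f : A ⟶ B) (g : B ⟶ D) (i : A.ι) (l : D.ι) :
    (Function.support fun j => f.e i j ≫ g.e j l).Finite :=
  (f.finite i).subset fun _ hj h0 => hj ((congrArg (· ≫ _) h0).trans Limits.zero_comp)

instance : Preadditive (SumCompl C) where
  add_comp A B D f f' g := Hom.ext (funext fun i => funext fun l => by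
    change ∑ᶠ j, (f.e i j + f'.e i j) ≫ g.e j l = _
    simp only [Preadditive.add_comp]
    exact finsum_add_distrib (finite_support_comp f g i l) (finite_support_comp f' g i l))
  comp_add A B D f g g' := Hom.ext (funext fun i => funext fun l => by
    change ∑ᶠ j, f.e i j ≫ (g.e j l + g'.e j l) = _
    simp only [Preadditive.comp_add]
    exact finsum_add_distrib (finite_support_comp f g i l) (finite_support_comp f g' i l))

variable (C)

/-- An object regarded as a direct sum with one summand. -/
def incl : C ⥤ SumCompl C where
  obj X := ⟨PUnit, fun _ => X⟩
  map f := ⟨fun _ _ => f, fun _ => Set.toFinite _⟩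
  map_id X := Hom.ext (funext fun i => funext fun _ => (id_e ⟨PUnit, fun _ => X⟩ i).symm)
  map_comp f g := Hom.ext (funext fun _ => funext fun _ =>
    (finsum_unique (fun _ : PUnit => f ≫ g)).symm)

instance : (incl C).Additive where
  map_add {X Y f g} := by
    refine Hom.ext (funext fun i => funext fun j => ?_)
    rfl

end SumCompl

/-- Formal products of arbitrary families of objects. -/
abbrev ProdCompl (C : Type*) [Category C] := (SumCompl Cᵒᵖ)ᵒᵖ

variable (C) in
/-- An object regarded as a product with one factor. -/
abbrev ProdCompl.incl : C ⥤ ProdCompl C := (SumCompl.incl Cᵒᵖ).rightOp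

end Formal

/-! ## Total complexes -/

section Total

open Idempotents

variable {C : Type*} [Category C] [Preadditive C]

variable (A B : ChainComplex (Karoubi (Mat_ C)) ℤ)

/-- The identity of the object in degree `i = j`, and zero for `i ≠ j`. -/
def degDiag (i j : ℤ) : A.X i ⟶ A.X j := if h : i = j then eqToHom (congrArg A.X h) else 0

theorem degDiag_self (i : ℤ) : degDiag A i i = 𝟙 _ := dif_pos rfl

theorem degDiag_of_ne {i j : ℤ} (h : i ≠ j) : degDiag A i j = 0 := dif_neg h

theorem d_degDiag (i r : ℤ) : A.d i (i - 1) ≫ degDiag A (i - 1) r = A.d i r := by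
  obtain rfl | h := eq_or_ne r (i - 1)
  · rw [degDiag_self, Category.comp_id]
  · rw [degDiag_of_ne A h.symm, Limits.comp_zero, A.shape]
    intro h'
    have h'' : r + 1 = i := h'
    omega

variable [MonoidalCategory C] [MonoidalPreadditive C]

/-- The components of the differential `d ⊗ 1 + (-1)^{deg} 1 ⊗ d` of the total complex of the
bicomplex with entries `A_{p.1} ⊗ B_{p.2}`. -/
def totEntry (p q : ℤ × ℤ) : tenObj (A.X p.1) (B.X p.2) ⟶ tenObj (A.X q.1) (B.X q.2) :=
  tenHom (A.d p.1 q.1) (degDiag B p.2 q.2) + p.1.negOnePow • tenHom (degDiag A p.1 q.1) (B.d p.2 q.2)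

theorem totEntry_eq_zero {p q : ℤ × ℤ} (h1 : q ≠ (p.1 - 1, p.2)) (h2 : q ≠ (p.1, p.2 - 1)) :
    totEntry A B p q = 0 := by
  have e1 : tenHom (A.d p.1 q.1) (degDiag B p.2 q.2) = 0 := by
    by_cases h : p.2 = q.2
    · rw [A.shape, tenHom_zero_left]
      intro h'
      have h'' : q.1 + 1 = p.1 := h'
      exact h1 (Prod.ext (by simp only; omega) h.symm)
    · rw [degDiag_of_ne B h, tenHom_zero_right]
  have e2 : tenHom (degDiag A p.1 q.1) (B.d p.2 q.2) = 0 := by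
    by_cases h : p.1 = q.1
    · rw [B.shape, tenHom_zero_right]
      intro h'
      have h'' : q.2 + 1 = p.2 := h'
      exact h2 (Prod.ext h.symm (by simp only; omega))
    · rw [degDiag_of_ne A h, tenHom_zero_left]
  rw [totEntry, e1, e2, smul_zero, add_zero]

theorem totEntry_left (p : ℤ × ℤ) :
    totEntry A B p (p.1 - 1, p.2) = tenHom (A.d p.1 (p.1 - 1)) (𝟙 _) := by
  rw [totEntry, degDiag_self, degDiag_of_ne A (show p.1 ≠ p.1 - 1 by omega), tenHom_zero_left, smul_zero,
    add_zero]

theorem totEntry_right (p : ℤ × ℤ) :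
    totEntry A B p (p.1, p.2 - 1) = p.1.negOnePow • tenHom (𝟙 _) (B.d p.2 (p.2 - 1)) := by
  rw [totEntry, degDiag_self, degDiag_of_ne B (show p.2 ≠ p.2 - 1 by omega), tenHom_zero_right, zero_add]

theorem totEntry_comp (p r : ℤ × ℤ) :
    totEntry A B p (p.1 - 1, p.2) ≫ totEntry A B (p.1 - 1, p.2) r +
      totEntry A B p (p.1, p.2 - 1) ≫ totEntry A B (p.1, p.2 - 1) r = 0 := by
  rw [totEntry_left, totEntry_right, totEntry, totEntry]
  simp only [Preadditive.comp_add, Preadditive.comp_zsmul, Preadditive.zsmul_comp, Units.smul_def,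
    ← tenHom_comp, Category.id_comp, A.d_comp_d, B.d_comp_d, tenHom_zero_left, tenHom_zero_right,
    d_degDiag, smul_zero, zero_add, add_zero, Int.negOnePow_sub, Int.negOnePow_one]
  simp

/-- The pairs of degrees that contribute to degree `n`. -/
abbrev TotIdx (n : ℤ) : Type := {p : ℤ × ℤ // p.1 + p.2 = n}

theorem totEntry_finite_right {m n : ℤ} (p : TotIdx m) :
    {q : TotIdx n | totEntry A B p.1 q.1 ≠ 0}.Finite := by
  refine Set.Finite.of_finite_image (f := Subtype.val) ?_ Subtype.val_injective.injOn
  refine (Set.toFinite {(p.1.1 - 1, p.1.2), (p.1.1, p.1.2 - 1)}).subset ?_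
  rintro _ ⟨q, hq, rfl⟩
  by_contra hc
  simp only [Set.mem_insert_iff, Set.mem_singleton_iff, not_or] at hc
  exact hq (totEntry_eq_zero A B hc.1 hc.2)

theorem totEntry_finite_left {m n : ℤ} (q : TotIdx n) :
    {p : TotIdx m | totEntry A B p.1 q.1 ≠ 0}.Finite := by
  refine Set.Finite.of_finite_image (f := Subtype.val) ?_ Subtype.val_injective.injOn
  refine (Set.toFinite {(q.1.1 + 1, q.1.2), (q.1.1, q.1.2 + 1)}).subset ?_
  rintro _ ⟨p, hp, rfl⟩
  by_contra hc
  simp only [Set.mem_insert_iff, Set.mem_singleton_iff, not_or] at hc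
  refine hp (totEntry_eq_zero A B (fun h => hc.1 ?_) (fun h => hc.2 ?_)) <;>
    rw [h] <;> ext <;> simp

theorem totEntry_shape {m n : ℤ} (h : n + 1 ≠ m) (p : TotIdx m) (q : TotIdx n) :
    totEntry A B p.1 q.1 = 0 := by
  refine totEntry_eq_zero A B (fun e => h ?_) (fun e => h ?_) <;>
  · have hp := p.2
    have hq := q.2
    rw [e] at hq
    simp only at hq
    omega

theorem totEntry_finsum {m n l : ℤ} (hmn : n + 1 = m) (p : TotIdx m) (r : TotIdx l) :
    ∑ᶠ q : TotIdx n, totEntry A B p.1 q.1 ≫ totEntry A B q.1 r.1 = 0 := by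
  classical
  have hp := p.2
  let q₁ : TotIdx n := ⟨(p.1.1 - 1, p.1.2), by simp only; omega⟩
  let q₂ : TotIdx n := ⟨(p.1.1, p.1.2 - 1), by simp only; omega⟩
  have hne : q₁ ≠ q₂ := fun h => by
    have : p.1.1 - 1 = p.1.1 := congrArg (fun q : TotIdx n => q.1.1) h
    omega
  rw [finsum_eq_sum_of_support_subset (s := {q₁, q₂}), Finset.sum_pair hne]
  · exact totEntry_comp A B p.1 r.1
  · intro q hq
    by_contra hc
    simp only [Finset.coe_insert, Finset.coe_singleton, Set.mem_insert_iff, Set.mem_singleton_iff,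
      not_or] at hc
    refine hq ?_
    change totEntry A B p.1 q.1 ≫ _ = 0
    rw [totEntry_eq_zero A B (fun h => hc.1 (Subtype.ext h)) (fun h => hc.2 (Subtype.ext h)),
      Limits.zero_comp]

/-- The tensor product `A ⊗ B`: in degree `n` it is the direct sum of all `A_i ⊗ B_j` with
`i + j = n`. -/
def tensorSum : ChainComplex (SumCompl (Karoubi (Mat_ C))) ℤ where
  X n := ⟨TotIdx n, fun p => tenObj (A.X p.1.1) (B.X p.1.2)⟩
  d _ _ := ⟨fun p q => totEntry A B p.1 q.1, totEntry_finite_right A B⟩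
  shape _ _ h := SumCompl.Hom.ext (funext fun p => funext fun q => totEntry_shape A B h p q)
  d_comp_d' _ _ _ h _ := SumCompl.Hom.ext (funext fun p => funext fun r =>
    totEntry_finsum A B h p r)

/-- The completed tensor product `A ⊗̃ B`: in degree `n` it is the product of all `A_i ⊗ B_j`
with `i + j = n`. -/
def tensorProd : ChainComplex (ProdCompl (Karoubi (Mat_ C))) ℤ where
  X n := Opposite.op ⟨TotIdx n, fun p => Opposite.op (tenObj (A.X p.1.1) (B.X p.1.2))⟩
  d _ _ := Quiver.Hom.op ⟨fun q p => (totEntry A B p.1 q.1).op, fun q =>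
    (totEntry_finite_left A B q).subset fun p hp h0 => hp (by rw [h0]; rfl)⟩
  shape _ _ h := congrArg Quiver.Hom.op (SumCompl.Hom.ext (funext fun q => funext fun p =>
    congrArg Quiver.Hom.op (totEntry_shape A B h p q)))
  d_comp_d' _ n _ h _ := congrArg Quiver.Hom.op (SumCompl.Hom.ext (funext fun r => funext fun p => by
    change ∑ᶠ q : TotIdx n, (totEntry A B q.1 r.1).op ≫ (totEntry A B p.1 q.1).op = 0
    have hfin : (Function.support fun q : TotIdx n =>
        totEntry A B p.1 q.1 ≫ totEntry A B q.1 r.1).Finite :=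
      (totEntry_finite_right A B p).subset fun q hq h0 =>
        hq ((congrArg (· ≫ _) h0).trans Limits.zero_comp)
    have h1 := (opHom _ _).map_finsum hfin
    rw [totEntry_finsum A B h p r, map_zero] at h1
    exact h1.symm))

end Total

namespace Heisenberg

open Limits

variable (k : Type u) [Field k]

/-- Chain complexes in the Heisenberg category; the differential lowers the degree by one. -/
abbrev Cpx := ChainComplex (Heisenberg k) ℤ

variable {k}

/-- A complex, regarded as a complex of formal direct sums. -/
def Cpx.toSum (A : Cpx k) : ChainComplex (SumCompl (Heisenberg k)) ℤ :=
  ((SumCompl.incl (Heisenberg k)).mapHomologicalComplex _).obj A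

/-- A complex, regarded as a complex of formal products. -/
def Cpx.toProd (A : Cpx k) : ChainComplex (ProdCompl (Heisenberg k)) ℤ :=
  ((ProdCompl.incl (Heisenberg k)).mapHomologicalComplex _).obj A

variable [CharZero k]

/-- `Y` is a finite direct sum of objects `P^λ X Q^μ` with nontrivial partitions `λ` and `μ`. -/
def IsReducible (Y : Heisenberg k) : Prop :=
  ∃ (N : ℕ) (l m : Fin N → YoungDiagram) (X : Fin N → Heisenberg k),
    (∀ i, l i ≠ ⊥ ∧ m i ≠ ⊥) ∧
      Nonempty (Y ≅ ⨁ fun i => tenObj (tenObj (symP k (l i)) (X i)) (symQ k (m i)))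

/-- `A` is homotopy equivalent to a complex `⋯ → C₂ → C₁ → 1` in which every `C_r`, `r > 0`, is a
finite direct sum of objects `P^λ X Q^μ` with nontrivial partitions `λ` and `μ`. -/
def IsCMinus (A : Cpx k) : Prop :=
  ∃ D : Cpx k, Nonempty (HomotopyEquiv A D) ∧ Nonempty (D.X 0 ≅ unit k) ∧
    (∀ n < 0, IsZero (D.X n)) ∧ ∀ n > 0, IsReducible (D.X n)

/-- `A` is homotopy equivalent to a complex `1 → C₋₁ → C₋₂ → ⋯` in which every `C_r`, `r < 0`, is a
finite direct sum of objects `P^λ X Q^μ` with nontrivial partitions `λ` and `μ`. -/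
def IsCPlus (A : Cpx k) : Prop :=
  ∃ D : Cpx k, Nonempty (HomotopyEquiv A D) ∧ Nonempty (D.X 0 ≅ unit k) ∧
    (∀ n > 0, IsZero (D.X n)) ∧ ∀ n < 0, IsReducible (D.X n)

end Heisenberg

end

set_option linter.unusedSectionVars false

universe v w

open CategoryTheory.Category (assoc comp_id id_comp)
open CategoryTheory.Limits (comp_zero zero_comp IsZero)
open CategoryTheory.Preadditive (add_comp comp_add sub_comp comp_sub)

noncomputable section

section GroupAlgebra

open MonoidAlgebra

variable {k G H : Type*} [Field k] [Group G] [Group H]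

/-- The anti-involution of a group algebra that inverts the group elements. -/
def bar : MonoidAlgebra k G →ₐ[k] (MonoidAlgebra k G)ᵐᵒᵖ :=
  MonoidAlgebra.lift k _ _
    { toFun := fun w => MulOpposite.op (single w⁻¹ 1)
      map_one' := by simp [one_def]
      map_mul' := fun v w => by rw [← MulOpposite.op_mul, single_mul_single, mul_inv_rev, one_mul] }

/-- The value of the anti-involution. -/
def inv' (x : MonoidAlgebra k G) : MonoidAlgebra k G := (bar x).unop

theorem inv'_single (w : G) (t : k) : inv' (single w t) = single w⁻¹ t := by
  simp [inv', bar, lift_single]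

theorem inv'_mul (x y : MonoidAlgebra k G) : inv' (x * y) = inv' y * inv' x := by
  simp [inv']

theorem inv'_add (x y : MonoidAlgebra k G) : inv' (x + y) = inv' x + inv' y := by
  simp [inv']

theorem inv'_smul (t : k) (x : MonoidAlgebra k G) : inv' (t • x) = t • inv' x := by
  simp [inv']

theorem inv'_zero : inv' (0 : MonoidAlgebra k G) = 0 := by simp [inv']

theorem inv'_sum {ι : Type*} (s : Finset ι) (f : ι → MonoidAlgebra k G) :
    inv' (∑ i ∈ s, f i) = ∑ i ∈ s, inv' (f i) := by
  simp [inv']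

theorem inv'_inv' (x : MonoidAlgebra k G) : inv' (inv' x) = x := by
  induction x using MonoidAlgebra.induction_linear with
  | zero => simp [inv'_zero]
  | add x y hx hy => rw [inv'_add, inv'_add, hx, hy]
  | single w t => rw [inv'_single, inv'_single, inv_inv]

theorem inv'_domCongr (e : G ≃* H) (x : MonoidAlgebra k G) :
    inv' (domCongr k k e x) = domCongr k k e (inv' x) := by
  induction x using MonoidAlgebra.induction_linear with
  | zero => simp [inv'_zero]
  | add x y hx hy => simp only [inv'_add, map_add, hx, hy]
  | single w t => simp [inv'_single]

theorem coeff_one_mul_comm (x y : MonoidAlgebra k G) : (x * y).coeff 1 = (y * x).coeff 1 := by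
  classical
  induction x using MonoidAlgebra.induction_linear with
  | zero => simp
  | add x x' hx hx' => simp [add_mul, mul_add, hx, hx']
  | single v s =>
    induction y using MonoidAlgebra.induction_linear with
    | zero => simp
    | add y y' hy hy' => simp only [add_mul, mul_add, coeff_add, Finsupp.add_apply, hy, hy']
    | single w t =>
      rw [single_mul_single, single_mul_single, coeff_single, coeff_single, Finsupp.single_apply,
        Finsupp.single_apply, mul_comm s t]
      simp only [mul_eq_one_iff_eq_inv, eq_comm (a := v), inv_eq_iff_eq_inv]

variable [Fintype G]

/-- The sum of all conjugates. -/
def conjSum (x : MonoidAlgebra k G) : MonoidAlgebra k G :=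
  ∑ g : G, single g 1 * x * single g⁻¹ 1

theorem conjSum_comm (x y : MonoidAlgebra k G) : conjSum x * y = y * conjSum x := by
  induction y using MonoidAlgebra.induction_linear with
  | zero => simp
  | add y y' hy hy' => rw [mul_add, add_mul, hy, hy']
  | single w t =>
    have e : (single w t : MonoidAlgebra k G) = t • single w 1 := by simp
    rw [e, mul_smul_comm, smul_mul_assoc, conjSum, Finset.mul_sum, Finset.sum_mul]
    congr 1
    symm
    refine Fintype.sum_equiv (Equiv.mulLeft w) _ _ fun g => ?_
    have e1 : (single w 1 : MonoidAlgebra k G) * single g 1 = single (w * g) 1 := by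
      rw [single_mul_single, one_mul]
    have e2 : (single (w * g)⁻¹ 1 : MonoidAlgebra k G) * single w 1 = single g⁻¹ 1 := by
      rw [single_mul_single, one_mul]; congr 1; group
    rw [Equiv.coe_mulLeft, mul_assoc _ _ (single w 1), e2, ← mul_assoc, ← mul_assoc, e1]

theorem coeff_one_conjSum (x : MonoidAlgebra k G) :
    (conjSum x).coeff 1 = Fintype.card G * x.coeff 1 := by
  rw [conjSum, coeff_sum, Finset.sum_apply']
  have : ∀ g ∈ Finset.univ, (single g 1 * x * single g⁻¹ 1 : MonoidAlgebra k G).coeff 1 = x.coeff 1 := by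
    intro g _
    rw [coeff_one_mul_comm, ← mul_assoc, single_mul_single]
    simp [← one_def]
  rw [Finset.sum_congr rfl this]
  simp

theorem coeff_one_eq_zero_of_isNilpotent [CharZero k] (x : MonoidAlgebra k G) (h : IsNilpotent x) :
    x.coeff 1 = 0 := by
  classical
  have hn : IsNilpotent (LinearMap.mulLeft k x) := by
    obtain ⟨n, hn⟩ := h
    exact ⟨n, by rw [LinearMap.pow_mulLeft, hn, LinearMap.mulLeft_zero_eq_zero]⟩
  have ht := (LinearMap.isNilpotent_trace_of_isNilpotent hn).eq_zero
  rw [LinearMap.trace_eq_matrix_trace k (MonoidAlgebra.basis G k), Matrix.trace] at ht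
  have : ∀ w, (LinearMap.toMatrix (MonoidAlgebra.basis G k)
      (MonoidAlgebra.basis G k) (LinearMap.mulLeft k x)).diag w = x.coeff 1 := by
    intro w
    rw [Matrix.diag_apply, LinearMap.toMatrix_apply, basis_apply, LinearMap.mulLeft_apply]
    change (x * single w 1).coeff w = _
    rw [coeff_mul_single_eq_coeff_mul 1 (by intro v _; simp), mul_one]
  rw [Finset.sum_congr rfl fun w _ => this w] at ht
  simpa using ht

end GroupAlgebra

namespace YoungDiagram

open Equiv MonoidAlgebra

variable {k : Type*} [Field k] {l m : YoungDiagram}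

theorem inv'_rowSym : inv' (l.rowSym k) = l.rowSym k := by
  classical
  rw [rowSym, inv'_sum]
  refine Fintype.sum_equiv (Equiv.inv _) _ _ fun w => ?_
  rw [inv'_single]; rfl

theorem inv'_colAntisym : inv' (l.colAntisym k) = l.colAntisym k := by
  classical
  rw [colAntisym, inv'_sum]
  refine Fintype.sum_equiv (Equiv.inv _) _ _ fun w => ?_
  rw [inv'_single]; simp

theorem mul_rowSym {w : Perm l.Box} (hw : w ∈ l.rowGroup) :
    single w 1 * l.rowSym k = l.rowSym k := by
  have h := congrArg inv' (rowSym_mul (k := k) (l.rowGroup.inv_mem hw))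
  rwa [inv'_mul, inv'_single, inv'_rowSym, inv_inv] at h

theorem colAntisym_mul {w : Perm l.Box} (hw : w ∈ l.colGroup) :
    l.colAntisym k * single w 1 = ((Perm.sign w : ℤ) : k) • l.colAntisym k := by
  have h := congrArg inv' (mul_colAntisym (k := k) (l.colGroup.inv_mem hw))
  rwa [inv'_mul, inv'_single, inv'_smul, inv'_colAntisym, inv_inv, Perm.sign_inv] at h

theorem coeff_young_one [CharZero k] : (l.young k).coeff 1 = (l.hook k)⁻¹ := by
  rw [young, coeff_smul, Finsupp.smul_apply, coeff_preYoung_one, smul_eq_mul, mul_one]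

section

variable [CharZero k]

theorem young_sandwich (x : MonoidAlgebra k (Perm l.Box)) :
    ∃ c : k, l.young k * x * l.young k = c • l.young k := by
  obtain ⟨c, hc⟩ := rowSym_mul_mul_colAntisym (l.colAntisym k * x * l.rowSym k)
  refine ⟨(l.hook k)⁻¹ * c, ?_⟩
  have : l.preYoung k * x * l.preYoung k = c • l.preYoung k := by
    rw [preYoung, ← hc]; simp only [mul_assoc]
  rw [young, smul_mul_assoc, smul_mul_smul_comm, this, smul_smul, smul_smul]
  congr 1; ring

end

variable {α : Type*}

/-- Transport of the group algebra along a tableau, i.e. a labelling of the boxes. -/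
abbrev tab (k : Type*) [Field k] (T : l.Box ≃ α) :
    MonoidAlgebra k (Perm l.Box) ≃ₐ[k] MonoidAlgebra k (Perm α) :=
  MonoidAlgebra.domCongr k k T.permCongrHom

/-- The Young symmetrizer of a tableau. -/
def tabYoung (k : Type*) [Field k] (T : l.Box ≃ α) : MonoidAlgebra k (Perm α) := tab k T (l.young k)

theorem tab_single (T : l.Box ≃ α) (w : Perm l.Box) (t : k) :
    tab k T (single w t) = single (T.permCongr w) t := by
  simp [tab, domCongr]

theorem coeff_one_tab (T : l.Box ≃ α) (x : MonoidAlgebra k (Perm l.Box)) :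
    (tab k T x).coeff 1 = x.coeff 1 := by
  rw [coeff_domCongr, map_one]

theorem coeff_one_tabYoung [CharZero k] (T : l.Box ≃ α) : (tabYoung k T).coeff 1 = (l.hook k)⁻¹ := by
  rw [tabYoung, coeff_one_tab, coeff_young_one]

theorem tabYoung_trans {β : Type*} (T : l.Box ≃ α) (e : α ≃ β) :
    tabYoung k (T.trans e) = domCongr k k e.permCongrHom (tabYoung k T) := by
  rw [tabYoung, tabYoung]
  ext w
  simp only [coeff_domCongr]
  rfl

theorem tabYoung_conj (T : l.Box ≃ α) (g : Perm α) :
    tabYoung k (T.trans g) = single g 1 * tabYoung k T * single g⁻¹ 1 := by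
  rw [tabYoung_trans]
  induction tabYoung k T using MonoidAlgebra.induction_linear with
  | zero => simp
  | add x y hx hy => simp only [map_add, mul_add, add_mul, hx, hy]
  | single w t =>
    rw [single_mul_single, single_mul_single, one_mul, mul_one]
    simp [domCongr]

/-- The scalar by which `y x y` differs from the Young symmetrizer `y`. -/
def chi (T : l.Box ≃ α) : MonoidAlgebra k (Perm α) →ₗ[k] k :=
  l.hook k • ((Finsupp.lapply 1 ∘ₗ (MonoidAlgebra.coeffLinearEquiv k (S := k) (M := Perm α)).toLinearMap)
    ∘ₗ LinearMap.mulLeft k (tabYoung k T) ∘ₗ LinearMap.mulRight k (tabYoung k T))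

theorem chi_apply (T : l.Box ≃ α) (x : MonoidAlgebra k (Perm α)) :
    chi T x = l.hook k * (tabYoung k T * x * tabYoung k T).coeff 1 := by
  simp [chi, mul_assoc]

variable [CharZero k]

theorem tabYoung_mul_self (T : l.Box ≃ α) : tabYoung k T * tabYoung k T = tabYoung k T := by
  rw [tabYoung, ← map_mul, young_mul_self]

theorem tabYoung_ne_zero (T : l.Box ≃ α) : tabYoung k T ≠ 0 := by
  intro h
  have h1 := coeff_one_tabYoung (k := k) T
  rw [h] at h1
  exact inv_ne_zero (l.hook_ne_zero k) h1.symm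

theorem tabYoung_sandwich (T : l.Box ≃ α) (x : MonoidAlgebra k (Perm α)) :
    tabYoung k T * x * tabYoung k T = chi T x • tabYoung k T := by
  obtain ⟨c, hc⟩ := young_sandwich ((tab k T).symm x)
  have h := congrArg (tab k T) hc
  rw [map_mul, map_mul, AlgEquiv.apply_symm_apply, map_smul] at h
  change tabYoung k T * x * tabYoung k T = c • tabYoung k T at h
  rw [chi_apply, h, coeff_smul, Finsupp.smul_apply, coeff_one_tabYoung, smul_eq_mul,
    mul_left_comm, mul_inv_cancel₀ (l.hook_ne_zero k), mul_one]

theorem chi_eq_of_sandwich (T : l.Box ≃ α) {x : MonoidAlgebra k (Perm α)} {c : k}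
    (h : tabYoung k T * x * tabYoung k T = c • tabYoung k T) : chi T x = c := by
  rw [tabYoung_sandwich] at h
  exact smul_left_injective k (tabYoung_ne_zero T) h

end YoungDiagram
end

noncomputable section
namespace YoungDiagram

open Equiv MonoidAlgebra

section Dominance

/-- The number of boxes in the first `t` rows. -/
def rowCount (l : YoungDiagram) (t : ℕ) : ℕ := (Finset.univ.filter fun x : l.Box => x.1.1 < t).card

theorem rowCount_succ (l : YoungDiagram) (t : ℕ) : l.rowCount (t + 1) = l.rowCount t + l.rowLen t := by
  classical
  have h : (Finset.univ.filter fun x : l.Box => x.1.1 = t).card = l.rowLen t := by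
    rw [rowLen_eq_card]
    refine Finset.card_bij (fun x _ => x.1) ?_ ?_ ?_
    · intro x hx
      simp only [Finset.mem_filter, Finset.mem_univ, true_and] at hx
      exact mem_row_iff.2 ⟨x.2, hx⟩
    · intro x _ y _ h
      exact Subtype.ext h
    · intro y hy
      rw [mem_row_iff] at hy
      exact ⟨⟨y, hy.1⟩, by simp [hy.2], rfl⟩
  rw [← h, rowCount, rowCount, ← Finset.card_union_of_disjoint]
  · congr 1
    ext x
    simp only [Finset.mem_filter, Finset.mem_univ, true_and, Finset.mem_union]
    omega
  · rw [Finset.disjoint_filter]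
    intro x _ h1 h2
    omega

theorem eq_of_rowCount_eq {l m : YoungDiagram} (h : ∀ t, l.rowCount t = m.rowCount t) : l = m := by
  ext ⟨i, j⟩
  have h1 := h (i + 1)
  rw [rowCount_succ, rowCount_succ, h i] at h1
  rw [mem_cells, mem_cells, mem_iff_lt_rowLen, mem_iff_lt_rowLen]
  omega

theorem rowCount_le {l m : YoungDiagram} (f : l.Box ≃ m.Box)
    (hf : ∀ x y : l.Box, x ≠ y → x.1.2 = y.1.2 → (f x).1.1 ≠ (f y).1.1) (t : ℕ) :
    m.rowCount t ≤ l.rowCount t := by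
  classical
  let A : Finset l.Box := Finset.univ.filter fun x => (f x).1.1 < t
  let B : Finset l.Box := Finset.univ.filter fun x => x.1.1 < t
  have hA' : m.rowCount t = A.card :=
    Finset.card_bij (fun y _ => f.symm y) (by simp [A]) (by simp)
      (fun x hx => ⟨f x, by simpa [A] using hx, by simp⟩)
  let J : Finset ℕ := Finset.univ.image fun x : l.Box => x.1.2
  have hA : A.card = ∑ j ∈ J, (A.filter fun x => x.1.2 = j).card :=
    Finset.card_eq_sum_card_fiberwise (fun x _ => Finset.mem_image_of_mem _ (Finset.mem_univ x))
  have hB : B.card = ∑ j ∈ J, (B.filter fun x => x.1.2 = j).card :=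
    Finset.card_eq_sum_card_fiberwise (fun x _ => Finset.mem_image_of_mem _ (Finset.mem_univ x))
  rw [hA', hA]
  change _ ≤ B.card
  rw [hB]
  refine Finset.sum_le_sum fun j _ => ?_
  obtain hj | hj := le_or_gt t (l.colLen j)
  · refine Finset.card_le_card_of_injOn
      (fun x => if hx : ((f x).1.1, j) ∈ l then ⟨((f x).1.1, j), hx⟩ else x) ?_ ?_
    · intro x hx
      simp only [A, B, Finset.coe_filter, Finset.mem_filter, Finset.mem_univ, true_and,
        Set.mem_ofPred_eq] at hx ⊢
      have hx' : ((f x).1.1, j) ∈ l := by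
        rw [YoungDiagram.mem_iff_lt_colLen]; omega
      simp [hx', hx.1]
    · intro x hx y hy hxy
      simp only [A, Finset.coe_filter, Finset.mem_filter, Finset.mem_univ, true_and,
        Set.mem_ofPred_eq] at hx hy
      have hx' : ((f x).1.1, j) ∈ l := by
        rw [YoungDiagram.mem_iff_lt_colLen]; omega
      have hy' : ((f y).1.1, j) ∈ l := by
        rw [YoungDiagram.mem_iff_lt_colLen]; omega
      by_contra hne
      refine hf x y hne (hx.2.trans hy.2.symm) ?_
      simpa [hx', hy'] using hxy
  · refine Finset.card_le_card fun x hx => ?_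
    simp only [A, B, Finset.mem_filter, Finset.mem_univ, true_and] at hx ⊢
    have : x.1.1 < l.colLen x.1.2 := by
      rw [← YoungDiagram.mem_iff_lt_colLen]; exact x.2
    rw [hx.2] at this
    exact ⟨by omega, hx.2⟩

end Dominance

section Orthogonality

variable {k : Type*} [Field k] {l m : YoungDiagram} {α : Type*}

theorem tabYoung_eq (T : l.Box ≃ α) :
    tabYoung k T = (l.hook k)⁻¹ • (tab k T (l.rowSym k) * tab k T (l.colAntisym k)) := by
  rw [tabYoung, young, map_smul, preYoung, map_mul]

theorem swap_mem_colGroup [DecidableEq l.Box] {x y : l.Box} (h : x.1.2 = y.1.2) :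
    swap x y ∈ l.colGroup := by
  intro z
  obtain rfl | hx := eq_or_ne z x
  · rw [swap_apply_left, h]
  obtain rfl | hy := eq_or_ne z y
  · rw [swap_apply_right, h]
  rw [swap_apply_of_ne_of_ne hx hy]

theorem swap_mem_rowGroup [DecidableEq l.Box] {x y : l.Box} (h : x.1.1 = y.1.1) :
    swap x y ∈ l.rowGroup := by
  intro z
  obtain rfl | hx := eq_or_ne z x
  · rw [swap_apply_left, h]
  obtain rfl | hy := eq_or_ne z y
  · rw [swap_apply_right, h]
  rw [swap_apply_of_ne_of_ne hx hy]

theorem rowCount_le_of_colAntisym_mul_ne_zero [CharZero k] {T : l.Box ≃ α} {S : m.Box ≃ α}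
    {w : Perm α} (h : tab k T (l.colAntisym k) * single w 1 * tab k S (m.rowSym k) ≠ 0) (t : ℕ) :
    m.rowCount t ≤ l.rowCount t := by
  classical
  refine rowCount_le (T.trans ((w⁻¹ : Perm α).trans S.symm)) (fun x y hne hcol hrow => h ?_) t
  have h1 : tab k T (l.colAntisym k) * single (swap (T x) (T y)) 1 = -tab k T (l.colAntisym k) := by
    have := congrArg (tab k T) (colAntisym_mul (k := k) (swap_mem_colGroup hcol))
    rw [map_mul, tab_single, Perm.sign_swap hne, map_smul] at this
    have e : T.permCongr (swap x y) = swap (T x) (T y) := by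
      rw [permCongr_def]; exact Equiv.symm_trans_swap_trans x y T
    rw [e] at this
    simpa using this
  have h2 : single (swap (w⁻¹ (T x)) (w⁻¹ (T y))) 1 * tab k S (m.rowSym k) =
      tab k S (m.rowSym k) := by
    have := congrArg (tab k S) (mul_rowSym (k := k) (swap_mem_rowGroup hrow))
    rw [map_mul, tab_single] at this
    have e : S.permCongr (swap ((T.trans ((w⁻¹ : Perm α).trans S.symm)) x)
        ((T.trans ((w⁻¹ : Perm α).trans S.symm)) y)) = swap (w⁻¹ (T x)) (w⁻¹ (T y)) := by
      rw [permCongr_def, Equiv.symm_trans_swap_trans]; simp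
    rwa [e] at this
  have e : single (swap (T x) (T y)) (1 : k) * single w 1 =
      single w 1 * single (swap (w⁻¹ (T x)) (w⁻¹ (T y))) 1 := by
    rw [single_mul_single, single_mul_single, Equiv.mul_swap_eq_swap_mul]; simp
  have h3 : tab k T (l.colAntisym k) * single w 1 * tab k S (m.rowSym k) =
      -(tab k T (l.colAntisym k) * single w 1 * tab k S (m.rowSym k)) := by
    conv_lhs => rw [← h2, ← mul_assoc, mul_assoc (tab k T _), ← e, ← mul_assoc, h1]
    simp only [neg_mul]
  ext v
  have h2 := congrArg (fun z => z.coeff v) h3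
  simp only [coeff_neg, Finsupp.neg_apply] at h2
  simpa using self_eq_neg.1 h2

theorem rowCount_le_of_tabYoung_mul_ne_zero [CharZero k] {T : l.Box ≃ α} {S : m.Box ≃ α}
    {x : MonoidAlgebra k (Perm α)} (h : tabYoung k T * x * tabYoung k S ≠ 0) (t : ℕ) :
    m.rowCount t ≤ l.rowCount t := by
  by_contra hc
  have key : ∀ w, tab k T (l.colAntisym k) * single w 1 * tab k S (m.rowSym k) = 0 := fun w => by
    by_contra h0
    exact hc (rowCount_le_of_colAntisym_mul_ne_zero h0 t)
  have key' : ∀ x, tab k T (l.colAntisym k) * x * tab k S (m.rowSym k) = 0 := by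
    intro x
    induction x using MonoidAlgebra.induction_linear with
    | zero => simp
    | add x y hx hy => rw [mul_add, add_mul, hx, hy, add_zero]
    | single w r =>
      have e : (single w r : MonoidAlgebra k (Perm α)) = r • single w 1 := by simp
      rw [e, mul_smul_comm, smul_mul_assoc, key, smul_zero]
  refine h ?_
  have e := key' x
  rw [tabYoung_eq, tabYoung_eq]
  simp only [smul_mul_assoc, mul_smul_comm]
  rw [mul_assoc (tab k T (l.rowSym k)), ← mul_assoc _ (tab k S (m.rowSym k)),
    mul_assoc (tab k T (l.rowSym k)), e, mul_zero, zero_mul, smul_zero, smul_zero]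

variable [Fintype α] [DecidableEq α]

theorem mul_conjSum_of_sandwich {x y : MonoidAlgebra k (Perm α)} (h : ∀ z, x * z * y = 0) :
    x * conjSum y = 0 := by
  rw [conjSum, Finset.mul_sum]
  refine Finset.sum_eq_zero fun g _ => ?_
  rw [← mul_assoc, ← mul_assoc, h, zero_mul]

theorem conjSum_mul_of_mul {x y : MonoidAlgebra k (Perm α)} {c : k} (h : x * conjSum y = c • x) :
    conjSum x * conjSum y = c • conjSum x := by
  conv_lhs => enter [1]; rw [conjSum]
  conv_rhs => rw [conjSum]
  rw [Finset.sum_mul, Finset.smul_sum]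
  refine Finset.sum_congr rfl fun g _ => ?_
  rw [mul_assoc, ← conjSum_comm, ← mul_assoc, mul_assoc _ x, h, mul_smul_comm, smul_mul_assoc]

theorem conjSum_tabYoung_trans (T : l.Box ≃ α) (g : Perm α) :
    conjSum (tabYoung k (T.trans g)) = conjSum (tabYoung k T) := by
  rw [tabYoung_conj, conjSum, conjSum]
  refine Fintype.sum_equiv (Equiv.mulRight g) _ _ fun w => ?_
  rw [Equiv.coe_mulRight, mul_inv_rev]
  have e1 : ∀ v w : Perm α, (single (v * w) 1 : MonoidAlgebra k (Perm α)) = single v 1 * single w 1 := by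
    intro v w; rw [single_mul_single, one_mul]
  rw [e1, e1]
  simp only [mul_assoc]

variable [CharZero k]

theorem conjSum_mul_conjSum_of_ne (hlm : l ≠ m) (T : l.Box ≃ α) (S : m.Box ≃ α) :
    conjSum (tabYoung k T) * conjSum (tabYoung k S) = 0 := by
  by_cases h : ∀ x, tabYoung k T * x * tabYoung k S = 0
  · rw [conjSum_mul_of_mul (c := 0) (by rw [zero_smul, mul_conjSum_of_sandwich h]), zero_smul]
  · by_cases h' : ∀ x, tabYoung k S * x * tabYoung k T = 0
    · rw [conjSum_comm,
        conjSum_mul_of_mul (c := 0) (by rw [zero_smul, mul_conjSum_of_sandwich h']), zero_smul]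
    · push Not at h h'
      obtain ⟨x, hx⟩ := h
      obtain ⟨y, hy⟩ := h'
      exact absurd (eq_of_rowCount_eq fun t => le_antisymm
        (rowCount_le_of_tabYoung_mul_ne_zero hy t) (rowCount_le_of_tabYoung_mul_ne_zero hx t)) hlm

/-- The scalar by which the sum of the conjugates of a Young symmetrizer acts on its block. -/
def kappa (k : Type*) [Field k] (T : l.Box ≃ α) : k := chi T (conjSum (tabYoung k T))

theorem tabYoung_mul_conjSum (T : l.Box ≃ α) :
    tabYoung k T * conjSum (tabYoung k T) = kappa k T • tabYoung k T := by
  rw [kappa, ← tabYoung_sandwich, mul_assoc, conjSum_comm, ← mul_assoc, tabYoung_mul_self]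

theorem coeff_one_conjSum_tabYoung_ne_zero (T : l.Box ≃ α) :
    (conjSum (tabYoung k T)).coeff 1 ≠ 0 := by
  rw [coeff_one_conjSum, coeff_one_tabYoung]
  exact mul_ne_zero (Nat.cast_ne_zero.2 Fintype.card_ne_zero) (inv_ne_zero (l.hook_ne_zero k))

theorem kappa_ne_zero (T : l.Box ≃ α) : kappa k T ≠ 0 := by
  intro h
  have h2 := conjSum_mul_of_mul (tabYoung_mul_conjSum (k := k) T)
  rw [h, zero_smul] at h2
  exact coeff_one_conjSum_tabYoung_ne_zero (k := k) T
    (coeff_one_eq_zero_of_isNilpotent _ ⟨2, by rw [sq, h2]⟩)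

end Orthogonality

section Completeness

theorem card_cellsOfRowLens : ∀ w : List ℕ, (YoungDiagram.cellsOfRowLens w).card = w.sum
  | [] => rfl
  | w :: ws => by
    rw [YoungDiagram.cellsOfRowLens, Finset.card_union_of_disjoint, Finset.card_map,
      card_cellsOfRowLens ws]
    · simp
    · rw [Finset.disjoint_left]
      rintro ⟨i, j⟩ h1 h2
      simp only [Finset.mem_product, Finset.mem_singleton, Finset.mem_map] at h1 h2
      obtain ⟨a, _, ha⟩ := h2
      have : a.1 + 1 = i := congrArg Prod.fst ha
      omega

/-- The Young diagram of a partition of a number. -/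
def ofPartition {n : ℕ} (p : n.Partition) : YoungDiagram :=
  ofRowLens (p.parts.sort (· ≥ ·)) (Multiset.pairwise_sort _ _).sortedGE

theorem card_ofPartition {n : ℕ} (p : n.Partition) : (ofPartition p).card = n := by
  refine (card_cellsOfRowLens _).trans ?_
  rw [← Multiset.sum_coe, Multiset.sort_eq, p.parts_sum]

theorem ofPartition_injective {n : ℕ} : Function.Injective (ofPartition (n := n)) := by
  intro p q h
  have h1 := congrArg rowLens h
  rw [ofPartition, ofPartition, rowLens_ofRowLens_eq_self, rowLens_ofRowLens_eq_self] at h1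
  · ext1
    rw [← Multiset.sort_eq p.parts (· ≥ ·), h1, Multiset.sort_eq]
  · intro x hx
    exact q.parts_pos (by simpa using hx)
  · intro x hx
    exact p.parts_pos (by simpa using hx)

/-- The class functions. -/
def classFunctions (k α : Type*) [Field k] : Submodule k (MonoidAlgebra k (Perm α)) where
  carrier := {x | ∀ g, single g 1 * x = x * single g 1}
  add_mem' hx hy g := by rw [mul_add, add_mul, hx, hy]
  zero_mem' g := by simp
  smul_mem' c x hx g := by rw [mul_smul_comm, smul_mul_assoc, hx]

theorem finrank_classFunctions_le (k α : Type*) [Field k] [Fintype α] :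
    Module.finrank k (classFunctions k α) ≤ Nat.card (ConjClasses (Perm α)) := by
  classical
  have := Fintype.ofFinite (ConjClasses (Perm α))
  choose rep hrep using ConjClasses.exists_rep (α := Perm α)
  let f : classFunctions k α →ₗ[k] (ConjClasses (Perm α) → k) :=
    { toFun := fun x c => x.1.coeff (rep c)
      map_add' := fun x y => by ext c; simp
      map_smul' := fun t x => by ext c; simp }
  have hf : Function.Injective f := by
    intro x y h
    refine Subtype.ext (MonoidAlgebra.ext (Finsupp.ext fun w => ?_))
    have key : ∀ z : classFunctions k α, z.1.coeff w = z.1.coeff (rep (ConjClasses.mk w)) := by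
      intro z
      obtain ⟨g, hg⟩ := isConj_iff.1 (ConjClasses.mk_eq_mk_iff_isConj.1
        (hrep (ConjClasses.mk w)))
      have hw : w * g = g * rep (ConjClasses.mk w) := mul_inv_eq_iff_eq_mul.1 hg |>.symm
      have h1 := congrArg (fun y => y.coeff (w * g)) (z.2 g)
      rw [coeff_mul_single_eq_coeff_mul w (by intro v _; simp),
        coeff_single_mul_eq_mul_coeff (rep (ConjClasses.mk w)) (by intro v _; rw [hw]; simp)] at h1
      simpa using h1.symm
    rw [key x, key y]
    exact congrFun h _
  have h1 := LinearMap.finrank_le_finrank_of_injective hf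
  rwa [Module.finrank_fintype_fun_eq_card, ← Nat.card_eq_fintype_card] at h1

variable (α : Type*) [Fintype α] [DecidableEq α]

/-- The Young diagrams with as many boxes as `α` has elements. -/
abbrev Shape (α : Type*) [Fintype α] : Type := {l : YoungDiagram // l.card = Fintype.card α}

instance : Finite (Shape α) :=
  Finite.of_injective (β := {l : YoungDiagram // (l.card : ℤ) = (Fintype.card α : ℤ)})
    (fun l => ⟨l.1, by rw [l.2]⟩) fun l m h => Subtype.ext (congrArg (fun z => z.1) h)

instance : Fintype (Shape α) := Fintype.ofFinite _

variable {α}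

/-- Some tableau of a given shape. -/
def Shape.tableau (l : Shape α) : l.1.Box ≃ α :=
  Fintype.equivOfCardEq (by rw [Fintype.card_coe]; exact l.2)

variable (k : Type*) [Field k]

/-- The sum of the conjugates of a Young symmetrizer of given shape. -/
def Shape.block (l : Shape α) : MonoidAlgebra k (Perm α) := conjSum (tabYoung k l.tableau)

theorem card_conjClasses_le : Nat.card (ConjClasses (Perm α)) ≤ Nat.card (Shape α) := by
  let f : ConjClasses (Perm α) → Shape α := Quotient.lift
    (fun σ => (⟨ofPartition σ.partition, card_ofPartition _⟩ : Shape α))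
    (fun σ τ h => Subtype.ext (congrArg ofPartition (Perm.partition_eq_of_isConj.1 h)))
  refine Nat.card_le_card_of_injective f ?_
  rintro ⟨σ⟩ ⟨τ⟩ h
  refine Quotient.sound (Perm.partition_eq_of_isConj.2 (ofPartition_injective ?_))
  exact congrArg Subtype.val h

theorem Shape.block_eq {l : Shape α} (T : l.1.Box ≃ α) : l.block k = conjSum (tabYoung k T) := by
  rw [Shape.block, ← conjSum_tabYoung_trans l.tableau (l.tableau.symm.trans T)]
  congr 2
  ext x
  simp

variable [CharZero k]

theorem Shape.linearIndependent_block :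
    LinearIndependent k (Shape.block k : Shape α → MonoidAlgebra k (Perm α)) := by
  rw [Fintype.linearIndependent_iff]
  intro g hg l
  have h1 := congrArg (· * Shape.block k l) hg
  simp only [Finset.sum_mul, zero_mul, smul_mul_assoc] at h1
  rw [Finset.sum_eq_single l] at h1
  · have h2 := conjSum_mul_of_mul (tabYoung_mul_conjSum (k := k) l.tableau)
    change Shape.block k l * Shape.block k l = _ • Shape.block k l at h2
    rw [h2, smul_smul] at h1
    have h3 : Shape.block k l ≠ 0 := fun h0 =>
      coeff_one_conjSum_tabYoung_ne_zero (k := k) l.tableau (by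
        change (Shape.block k l).coeff 1 = 0
        rw [h0]; rfl)
    exact (mul_eq_zero.1 ((smul_eq_zero.1 h1).resolve_right h3)).resolve_right (kappa_ne_zero _)
  · intro m _ hm
    rw [Shape.block, Shape.block, conjSum_mul_conjSum_of_ne (fun h => hm (Subtype.ext h)), smul_zero]
  · simp

theorem exists_sum_block :
    ∃ c : Shape α → k, (1 : MonoidAlgebra k (Perm α)) = ∑ l, c l • Shape.block k l := by
  classical
  let b : Shape α → classFunctions k α := fun l => ⟨Shape.block k l, fun g => (conjSum_comm _ _).symm⟩
  have hb : LinearIndependent k b := by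
    refine LinearIndependent.of_comp (classFunctions k α).subtype ?_
    exact Shape.linearIndependent_block k
  have h1 : Fintype.card (Shape α) = Module.finrank k (classFunctions k α) := by
    refine le_antisymm hb.fintype_card_le_finrank ?_
    rw [← Nat.card_eq_fintype_card]
    exact (finrank_classFunctions_le k α).trans card_conjClasses_le
  have h2 := hb.span_eq_top_of_card_eq_finrank' h1
  have h3 : (⟨1, fun g => by simp⟩ : classFunctions k α) ∈ Submodule.span k (Set.range b) := by
    rw [h2]; trivial
  obtain ⟨c, hc⟩ := (Submodule.mem_span_range_iff_exists_fun k).1 h3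
  refine ⟨c, ?_⟩
  have := congrArg Subtype.val hc
  simpa using this.symm

theorem Shape.mul_block {l : Shape α} (T : l.1.Box ≃ α) :
    tabYoung k T * l.block k = kappa k T • tabYoung k T := by
  rw [Shape.block_eq k T, tabYoung_mul_conjSum]

theorem Shape.mul_block_of_ne {l : Shape α} {m : YoungDiagram} (h : m ≠ l.1) (S : m.Box ≃ α) :
    tabYoung k S * l.block k = 0 := by
  have h1 := tabYoung_mul_conjSum (k := k) S
  rw [← inv_smul_eq_iff₀ (kappa_ne_zero S)] at h1
  rw [← h1, smul_mul_assoc, mul_assoc, Shape.block, conjSum_mul_conjSum_of_ne h, mul_zero, smul_zero]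

theorem tabYoung_mul_mul_of_ne {l m : YoungDiagram} (h : l ≠ m) (T : l.Box ≃ α) (S : m.Box ≃ α)
    (x : MonoidAlgebra k (Perm α)) : tabYoung k T * x * tabYoung k S = 0 := by
  have h1 := tabYoung_mul_conjSum (k := k) T
  have h2 := tabYoung_mul_conjSum (k := k) S
  rw [← inv_smul_eq_iff₀ (kappa_ne_zero _)] at h1 h2
  rw [← h1, ← h2, ← conjSum_comm (tabYoung k S)]
  simp only [smul_mul_assoc, mul_smul_comm]
  rw [← conjSum_comm (tabYoung k T)]
  have e : conjSum (tabYoung k T) * tabYoung k T * x * (conjSum (tabYoung k S) * tabYoung k S) =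
      conjSum (tabYoung k T) * conjSum (tabYoung k S) * (tabYoung k T * x * tabYoung k S) := by
    simp only [mul_assoc]
    rw [← mul_assoc x, ← conjSum_comm _ x, mul_assoc, ← mul_assoc (tabYoung k T) (conjSum _),
      ← conjSum_comm _ (tabYoung k T), mul_assoc]
  rw [e, conjSum_mul_conjSum_of_ne h, zero_mul, smul_zero, smul_zero]

theorem kappa_eq {l : YoungDiagram} (T S : l.Box ≃ α) : kappa k T = kappa k S := by
  have hl : l.card = Fintype.card α := by rw [← Fintype.card_congr T, Fintype.card_coe]
  have h1 := Shape.mul_block k (l := ⟨l, hl⟩) T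
  have h2 := conjSum_mul_of_mul (tabYoung_mul_conjSum (k := k) T)
  have h3 := conjSum_mul_of_mul (tabYoung_mul_conjSum (k := k) S)
  have e : conjSum (tabYoung k T) = conjSum (tabYoung k S) := by
    rw [← Shape.block_eq k (l := ⟨l, hl⟩) T, Shape.block_eq k (l := ⟨l, hl⟩) S]
  rw [e, h3] at h2
  exact (smul_left_injective k (fun h0 => coeff_one_conjSum_tabYoung_ne_zero (k := k) S
    (by rw [h0]; rfl)) h2).symm

theorem sum_inv_kappa_smul_block :
    ∑ l : Shape α, (kappa k l.tableau)⁻¹ • l.block k = (1 : MonoidAlgebra k (Perm α)) := by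
  obtain ⟨c, hc⟩ := exists_sum_block k (α := α)
  rw [hc]
  refine Finset.sum_congr rfl fun l _ => ?_
  have h1 : tabYoung k l.tableau = (c l * kappa k l.tableau) • tabYoung k l.tableau := by
    conv_lhs => rw [← mul_one (tabYoung k l.tableau), hc, Finset.mul_sum]
    rw [Finset.sum_eq_single l]
    · rw [mul_smul_comm, Shape.mul_block, smul_smul]
    · intro m _ hm
      rw [mul_smul_comm, Shape.mul_block_of_ne _ (fun h => hm (Subtype.ext h.symm)), smul_zero]
    · simp
  have h2 : c l * kappa k l.tableau = 1 := by
    conv_lhs at h1 => rw [← one_smul k (tabYoung k l.tableau)]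
    exact (smul_left_injective k (tabYoung_ne_zero l.tableau) h1).symm
  rw [eq_inv_of_mul_eq_one_left h2]

end Completeness
end YoungDiagram
end

noncomputable section

section Extension

open Equiv MonoidAlgebra

variable {k : Type*} [Field k] {α : Type*}

/-- The permutations of `α` as permutations of `Option α` that fix `none`. -/
def optionPerm (α : Type*) : Perm α →* Perm (Option α) where
  toFun := Equiv.optionCongr
  map_one' := Equiv.optionCongr_one
  map_mul' v w := by ext x : 1; cases x <;> rfl

theorem optionPerm_injective : Function.Injective (optionPerm α) := Equiv.optionCongr_injective

theorem optionPerm_none (w : Perm α) : optionPerm α w none = none := rfl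

theorem optionPerm_some (w : Perm α) (x : α) : optionPerm α w (some x) = some (w x) := rfl

theorem exists_optionPerm {w : Perm (Option α)} (h : w none = none) : ∃ v, w = optionPerm α v := by
  classical
  refine ⟨Equiv.removeNone w, ?_⟩
  change w = optionCongr (removeNone w)
  rw [map_equiv_removeNone, h, swap_self]
  rfl

/-- The inclusion of group algebras induced by `optionPerm`. -/
def extAlg (k α : Type*) [Field k] : MonoidAlgebra k (Perm α) →ₐ[k] MonoidAlgebra k (Perm (Option α)) :=
  mapDomainAlgHom k k (optionPerm α)

theorem extAlg_single (w : Perm α) (t : k) :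
    extAlg k α (single w t) = single (optionPerm α w) t := by
  simp [extAlg]

theorem extAlg_injective : Function.Injective (extAlg k α) :=
  mapDomain_injective optionPerm_injective

theorem inv'_extAlg (x : MonoidAlgebra k (Perm α)) : inv' (extAlg k α x) = extAlg k α (inv' x) := by
  induction x using MonoidAlgebra.induction_linear with
  | zero => simp [inv'_zero]
  | add x y hx hy => simp only [inv'_add, map_add, hx, hy]
  | single w t => rw [inv'_single, extAlg_single, extAlg_single, inv'_single, map_inv]

theorem extAlg_domCongr {β : Type*} (e : α ≃ β) (x : MonoidAlgebra k (Perm α)) :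
    extAlg k β (domCongr k k e.permCongrHom x) =
      domCongr k k (optionCongr e).permCongrHom (extAlg k α x) := by
  induction x using MonoidAlgebra.induction_linear with
  | zero => simp
  | add x y hx hy => simp only [map_add, hx, hy]
  | single w t =>
    rw [extAlg_single, domCongr_single, domCongr_single, extAlg_single]
    congr 1
    ext x : 1
    cases x <;> rfl

open Classical in
/-- The sum of the terms of `x` indexed by permutations `w` for which `w⁻¹ none` lies in `s`. -/
def restrictNone (s : Set (Option α)) : MonoidAlgebra k (Perm (Option α)) →ₗ[k]
    MonoidAlgebra k (Perm (Option α)) where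
  toFun x := ofCoeff (x.coeff.filter fun w => w⁻¹ none ∈ s)
  map_add' x y := by rw [coeff_add, Finsupp.filter_add]; rfl
  map_smul' t x := by rw [coeff_smul, Finsupp.filter_smul]; rfl

theorem restrictNone_single_of_mem {s : Set (Option α)} {w : Perm (Option α)} (h : w⁻¹ none ∈ s)
    (t : k) : restrictNone s (single w t) = single w t := by
  change ofCoeff _ = _
  rw [coeff_single, Finsupp.filter_single_of_pos]
  · rfl
  · exact h

theorem restrictNone_single_of_notMem {s : Set (Option α)} {w : Perm (Option α)}
    (h : w⁻¹ none ∉ s) (t : k) : restrictNone s (single w t) = 0 := by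
  change ofCoeff _ = _
  rw [coeff_single, Finsupp.filter_single_of_neg]
  · rfl
  · exact h

theorem restrictNone_extAlg_mul (s : Set (Option α)) (x : MonoidAlgebra k (Perm α))
    (y : MonoidAlgebra k (Perm (Option α))) :
    restrictNone s (extAlg k α x * y) = extAlg k α x * restrictNone s y := by
  induction x using MonoidAlgebra.induction_linear with
  | zero => simp
  | add x x' hx hx' => rw [map_add, add_mul, map_add, hx, hx', add_mul]
  | single v t =>
    induction y using MonoidAlgebra.induction_linear with
    | zero => simp
    | add y y' hy hy' => rw [mul_add, map_add, hy, hy', map_add, mul_add]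
    | single w t' =>
      rw [extAlg_single, single_mul_single]
      have e : (optionPerm α v * w)⁻¹ none = w⁻¹ none := by
        rw [mul_inv_rev, ← map_inv]; rfl
      by_cases h : w⁻¹ none ∈ s
      · rw [restrictNone_single_of_mem h, restrictNone_single_of_mem (by rwa [e]),
          single_mul_single]
      · rw [restrictNone_single_of_notMem h, restrictNone_single_of_notMem (by rwa [e]), mul_zero]

open Classical in
/-- The weighted sum of the elements of a subgroup. -/
def weightedSum {G : Type*} [Group G] [Fintype G] (H : Subgroup G) (σ : G → k) : MonoidAlgebra k G :=
  ∑ w ∈ Finset.univ.filter (· ∈ H), single w (σ w)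

variable [Fintype α] [DecidableEq α]

theorem weightedSum_comap (H : Subgroup (Perm (Option α))) (σ : Perm (Option α) → k) :
    restrictNone {none} (weightedSum H σ) =
      extAlg k α (weightedSum (H.comap (optionPerm α)) (σ ∘ optionPerm α)) := by
  classical
  rw [weightedSum, weightedSum, map_sum, map_sum]
  symm
  refine Finset.sum_of_injOn (optionPerm α) optionPerm_injective.injOn ?_ ?_ ?_
  · intro v hv
    simpa using hv
  · intro w _ hw'
    refine restrictNone_single_of_notMem (fun h => hw' ?_) _
    have h' : w none = none := by
      have : w⁻¹ none = none := h
      rw [Perm.inv_eq_iff_eq] at this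
      exact this.symm
    obtain ⟨v, rfl⟩ := exists_optionPerm h'
    exact ⟨v, by simp_all, rfl⟩
  · intro v _
    rw [extAlg_single, restrictNone_single_of_mem]
    · rfl
    · rw [← map_inv]; rfl

theorem restrictNone_weightedSum_mul (s : Set (Option α)) (H K : Subgroup (Perm (Option α)))
    (σ τ : Perm (Option α) → k) (hK : ∀ w ∈ K, ∀ x, w x ∈ s ↔ x ∈ s)
    (hH : ∀ w ∈ H, w none ∈ s ↔ w none = none) :
    restrictNone s (weightedSum H σ * weightedSum K τ) =
      extAlg k α (weightedSum (H.comap (optionPerm α)) (σ ∘ optionPerm α)) * weightedSum K τ := by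
  classical
  rw [← weightedSum_comap, weightedSum, Finset.sum_mul, map_sum, map_sum, Finset.sum_mul]
  refine Finset.sum_congr rfl fun w hw => ?_
  have hw' : w⁻¹ ∈ H := H.inv_mem (by simpa using hw)
  by_cases h : w⁻¹ none = none
  · rw [restrictNone_single_of_mem (by simpa using h), weightedSum, Finset.mul_sum, map_sum]
    refine Finset.sum_congr rfl fun v hv => ?_
    have hv' : v⁻¹ ∈ K := K.inv_mem (by simpa using hv)
    rw [single_mul_single, restrictNone_single_of_mem]
    rw [mul_inv_rev, Perm.mul_apply, hK _ hv', hH _ hw', h]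
  · rw [restrictNone_single_of_notMem (by simpa using h), zero_mul, weightedSum, Finset.mul_sum,
      map_sum]
    refine Finset.sum_eq_zero fun v hv => ?_
    have hv' : v⁻¹ ∈ K := K.inv_mem (by simpa using hv)
    rw [single_mul_single, restrictNone_single_of_notMem]
    rwa [mul_inv_rev, Perm.mul_apply, hK _ hv', hH _ hw']

/-- If `x` does not annihilate the product of two weighted sums over subgroups of `Perm α`, then
its extension does not annihilate the product of the weighted sums over suitable subgroups of
`Perm (Option α)`. -/
theorem extAlg_mul_weightedSum_ne_zero (s : Set (Option α)) (H K : Subgroup (Perm (Option α)))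
    (σ τ : Perm (Option α) → k) (hK : ∀ w ∈ K, ∀ x, w x ∈ s ↔ x ∈ s)
    (hH : ∀ w ∈ H, w none ∈ s ↔ w none = none) {x : MonoidAlgebra k (Perm α)}
    (hx : x * (weightedSum (H.comap (optionPerm α)) (σ ∘ optionPerm α) *
      weightedSum (K.comap (optionPerm α)) (τ ∘ optionPerm α)) ≠ 0) :
    extAlg k α x * (weightedSum H σ * weightedSum K τ) ≠ 0 := by
  intro h
  have h1 := congrArg (restrictNone s) h
  rw [restrictNone_extAlg_mul, restrictNone_weightedSum_mul s H K σ τ hK hH, map_zero,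
    ← mul_assoc, ← map_mul] at h1
  have h2 := congrArg (restrictNone {none}) h1
  rw [restrictNone_extAlg_mul, weightedSum_comap, map_zero, ← map_mul, mul_assoc,
    map_eq_zero_iff _ extAlg_injective] at h2
  exact hx h2

end Extension

namespace YoungDiagram

open Equiv MonoidAlgebra

variable {k : Type*} [Field k] {l m : YoungDiagram}

theorem tab_sum_subgroup {α : Type*} [Fintype α] [DecidableEq α] (T : l.Box ≃ α)
    (G : Subgroup (Perm l.Box)) {_ : Fintype G} (f : Perm l.Box → k) :
    tab k T (∑ w : G, single w.1 (f w.1)) =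
      weightedSum (G.comap T.symm.permCongrHom.toMonoidHom) (f ∘ T.symm.permCongr) := by
  classical
  rw [map_sum, weightedSum]
  refine Finset.sum_bij (fun w _ => T.permCongr w.1) ?_ ?_ ?_ ?_
  · intro w _
    rw [Finset.mem_filter, Subgroup.mem_comap]
    refine ⟨Finset.mem_univ _, ?_⟩
    change T.permCongr.symm (T.permCongr w.1) ∈ G
    rw [Equiv.symm_apply_apply]
    exact w.2
  · intro v _ w _ h
    exact Subtype.ext (T.permCongr.injective h)
  · intro w hw
    rw [Finset.mem_filter, Subgroup.mem_comap] at hw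
    exact ⟨⟨T.permCongr.symm w, hw.2⟩, Finset.mem_univ _, T.permCongr.apply_symm_apply w⟩
  · intro w _
    rw [tab_single]
    congr 1
    exact congrArg f (T.permCongr.symm_apply_apply w.1).symm

theorem tab_rowSym {α : Type*} [Fintype α] [DecidableEq α] (T : l.Box ≃ α) :
    tab k T (l.rowSym k) = weightedSum (l.rowGroup.comap T.symm.permCongrHom.toMonoidHom)
      (fun _ => 1) :=
  tab_sum_subgroup T l.rowGroup fun _ => 1

theorem tab_colAntisym {α : Type*} [Fintype α] [DecidableEq α] (T : l.Box ≃ α) :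
    tab k T (l.colAntisym k) = weightedSum (l.colGroup.comap T.symm.permCongrHom.toMonoidHom)
      (fun w => ((Perm.sign w : ℤ) : k)) := by
  refine (tab_sum_subgroup T _ fun w => ((Perm.sign w : ℤ) : k)).trans ?_
  congr 1
  ext w
  simp [Perm.sign_permCongr]

/-- The box of `l` that is not a box of `m`. -/
def AddBox.newBox (h : AddBox m l) : l.Box := h.strip.symm none

theorem AddBox.strip_of_mem (h : AddBox m l) {x : l.Box} (hx : x.1 ∈ m.cells) :
    h.strip x = some ⟨x.1, hx⟩ := dif_pos hx

theorem AddBox.strip_of_notMem (h : AddBox m l) {x : l.Box} (hx : x.1 ∉ m.cells) :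
    h.strip x = none := dif_neg hx

theorem AddBox.newBox_notMem (h : AddBox m l) : h.newBox.1 ∉ m.cells := by
  intro hx
  have := h.strip_of_mem hx
  rw [show h.strip h.newBox = none from h.strip.apply_symm_apply none] at this
  exact absurd this (by simp)

theorem AddBox.eq_newBox (h : AddBox m l) {x : l.Box} (hx : x.1 ∉ m.cells) : x = h.newBox := by
  exact (h.strip.eq_symm_apply.2 (h.strip_of_notMem hx))

theorem AddBox.strip_symm_some (h : AddBox m l) (x : m.Box) : (h.strip.symm (some x)).1 = x.1 := by
  have hx : h.strip ⟨x.1, h.1 x.2⟩ = some x := h.strip_of_mem (x := ⟨x.1, h.1 x.2⟩) x.2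
  rw [← hx, Equiv.symm_apply_apply]

theorem AddBox.comap_rowGroup (h : AddBox m l) :
    (l.rowGroup.comap h.strip.symm.permCongrHom.toMonoidHom).comap (optionPerm m.Box) =
      m.rowGroup := by
  ext w
  constructor
  · intro hw x
    have h1 : (h.strip.symm (optionPerm m.Box w (h.strip (h.strip.symm (some x))))).1.1 =
      (h.strip.symm (some x)).1.1 := hw (h.strip.symm (some x))
    rwa [Equiv.apply_symm_apply, optionPerm_some, strip_symm_some, strip_symm_some] at h1
  · intro hw x
    change (h.strip.symm (optionPerm m.Box w (h.strip x))).1.1 = x.1.1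
    obtain ⟨y, rfl⟩ := h.strip.symm.surjective x
    rw [Equiv.apply_symm_apply]
    cases y with
    | none => rfl
    | some y => rw [optionPerm_some, strip_symm_some, strip_symm_some]; exact hw y

theorem AddBox.comap_colGroup (h : AddBox m l) :
    (l.colGroup.comap h.strip.symm.permCongrHom.toMonoidHom).comap (optionPerm m.Box) =
      m.colGroup := by
  ext w
  constructor
  · intro hw x
    have h1 : (h.strip.symm (optionPerm m.Box w (h.strip (h.strip.symm (some x))))).1.2 =
      (h.strip.symm (some x)).1.2 := hw (h.strip.symm (some x))
    rwa [Equiv.apply_symm_apply, optionPerm_some, strip_symm_some, strip_symm_some] at h1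
  · intro hw x
    change (h.strip.symm (optionPerm m.Box w (h.strip x))).1.2 = x.1.2
    obtain ⟨y, rfl⟩ := h.strip.symm.surjective x
    rw [Equiv.apply_symm_apply]
    cases y with
    | none => rfl
    | some y => rw [optionPerm_some, strip_symm_some, strip_symm_some]; exact hw y

theorem weightedSum_rowGroup : weightedSum m.rowGroup (fun _ => 1) = m.rowSym k := by
  classical
  rw [weightedSum, rowSym]
  exact Finset.sum_subtype _ (by simp) _

theorem weightedSum_colGroup :
    weightedSum m.colGroup (fun w => ((Perm.sign w : ℤ) : k)) = m.colAntisym k := by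
  classical
  rw [weightedSum, colAntisym]
  exact Finset.sum_subtype _ (by simp) _

theorem sign_comp_optionPerm {α : Type*} [Fintype α] [DecidableEq α] :
    (fun w => ((Perm.sign w : ℤ) : k)) ∘ optionPerm α = fun w => ((Perm.sign w : ℤ) : k) := by
  ext w
  have : Perm.sign (optionPerm α w) = Perm.sign w := optionCongr_sign w
  simp [this]

variable [CharZero k]

theorem AddBox.extAlg_young_mul_ne_zero (h : AddBox m l) :
    extAlg k m.Box (m.young k) * tabYoung k h.strip ≠ 0 := by
  rw [tabYoung_eq, mul_smul_comm, tab_rowSym, tab_colAntisym]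
  refine smul_ne_zero (inv_ne_zero (l.hook_ne_zero k))
    (extAlg_mul_weightedSum_ne_zero {o | (h.strip.symm o).1.2 = h.newBox.1.2} _ _ _ _ ?_ ?_ ?_)
  · intro w hw x
    have := hw (h.strip.symm x)
    change (h.strip.symm (w (h.strip (h.strip.symm x)))).1.2 = _ at this
    rw [Equiv.apply_symm_apply] at this
    simp only [Set.mem_ofPred_eq, this]
  · intro w hw
    have h1 := hw h.newBox
    change (h.strip.symm (w (h.strip h.newBox))).1.1 = _ at h1
    rw [show h.strip h.newBox = none from h.strip.apply_symm_apply none] at h1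
    refine ⟨fun h2 => h.strip.symm.injective (Subtype.ext (Prod.ext h1 h2)), fun h2 => ?_⟩
    rw [h2]; rfl
  · rw [sign_comp_optionPerm, h.comap_rowGroup, h.comap_colGroup, weightedSum_colGroup,
      show (fun _ => (1 : k)) ∘ optionPerm m.Box = fun _ => 1 from rfl, weightedSum_rowGroup,
      ← preYoung]
    have e : m.preYoung k = m.hook k • m.young k := by
      rw [young, smul_smul, mul_inv_cancel₀ (m.hook_ne_zero k), one_smul]
    rw [e, mul_smul_comm, young_mul_self]
    refine smul_ne_zero (m.hook_ne_zero k) fun h0 => ?_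
    have := coeff_young_one (k := k) (l := m)
    rw [h0] at this
    exact inv_ne_zero (m.hook_ne_zero k) this.symm

theorem AddBox.tabYoung_mul_extAlg_ne_zero (h : AddBox m l) :
    tabYoung k h.strip * extAlg k m.Box (m.young k) ≠ 0 := by
  intro h0
  have h1 := congrArg inv' h0
  rw [inv'_mul, inv'_extAlg, inv'_zero, tabYoung_eq, inv'_smul, inv'_mul, inv'_domCongr,
    inv'_domCongr, inv'_rowSym, inv'_colAntisym, mul_smul_comm, tab_rowSym, tab_colAntisym] at h1
  refine (smul_ne_zero (inv_ne_zero (l.hook_ne_zero k))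
    (extAlg_mul_weightedSum_ne_zero {o | (h.strip.symm o).1.1 = h.newBox.1.1} _ _ _ _ ?_ ?_ ?_)) h1
  · intro w hw x
    have := hw (h.strip.symm x)
    change (h.strip.symm (w (h.strip (h.strip.symm x)))).1.1 = _ at this
    rw [Equiv.apply_symm_apply] at this
    simp only [Set.mem_ofPred_eq, this]
  · intro w hw
    have h1 := hw h.newBox
    change (h.strip.symm (w (h.strip h.newBox))).1.2 = _ at h1
    rw [show h.strip h.newBox = none from h.strip.apply_symm_apply none] at h1
    refine ⟨fun h2 => h.strip.symm.injective (Subtype.ext (Prod.ext h2 h1)), fun h2 => ?_⟩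
    rw [h2]; rfl
  · rw [sign_comp_optionPerm, h.comap_rowGroup, h.comap_colGroup, weightedSum_colGroup,
      show (fun _ => (1 : k)) ∘ optionPerm m.Box = fun _ => 1 from rfl, weightedSum_rowGroup]
    have e : m.colAntisym k * m.rowSym k = m.hook k • inv' (m.young k) := by
      rw [young, inv'_smul, smul_smul, mul_inv_cancel₀ (m.hook_ne_zero k), one_smul, preYoung,
        inv'_mul, inv'_rowSym, inv'_colAntisym]
    rw [e, mul_smul_comm, ← inv'_mul, young_mul_self]
    refine smul_ne_zero (m.hook_ne_zero k) fun h0 => ?_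
    have := coeff_young_one (k := k) (l := m)
    rw [← inv'_inv' (m.young k), h0, inv'_zero] at this
    exact inv_ne_zero (m.hook_ne_zero k) this.symm

/-- The tableau on the larger diagram that gives the label `none` to the new box. -/
def AddBox.extTab (h : AddBox m l) {α : Type*} (S : m.Box ≃ α) : l.Box ≃ Option α :=
  h.strip.trans (optionCongr S)

theorem AddBox.extAlg_tabYoung_mul_ne_zero (h : AddBox m l) {α : Type*} (S : m.Box ≃ α) :
    extAlg k α (tabYoung k S) * tabYoung k (h.extTab S) ≠ 0 := by
  rw [extTab, tabYoung_trans]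
  change extAlg k α (domCongr k k S.permCongrHom (m.young k)) * _ ≠ 0
  rw [extAlg_domCongr, ← map_mul]
  exact (map_ne_zero_iff _ (domCongr k k (optionCongr S).permCongrHom).injective).2
    h.extAlg_young_mul_ne_zero

theorem AddBox.tabYoung_mul_extAlg_tabYoung_ne_zero (h : AddBox m l) {α : Type*} (S : m.Box ≃ α) :
    tabYoung k (h.extTab S) * extAlg k α (tabYoung k S) ≠ 0 := by
  rw [extTab, tabYoung_trans]
  change _ * extAlg k α (domCongr k k S.permCongrHom (m.young k)) ≠ 0
  rw [extAlg_domCongr, ← map_mul]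
  exact (map_ne_zero_iff _ (domCongr k k (optionCongr S).permCongrHom).injective).2
    h.tabYoung_mul_extAlg_ne_zero

end YoungDiagram
end

noncomputable section

namespace YoungDiagram

section Corners

variable {m l : YoungDiagram}

theorem AddBox.mem_or_eq (h : AddBox m l) {x : ℕ × ℕ} (hx : x ∈ l) : x ∈ m ∨ x = h.newBox.1 := by
  by_cases hm : x ∈ m
  · exact Or.inl hm
  · exact Or.inr (congrArg Subtype.val (h.eq_newBox (x := ⟨x, hx⟩) hm))

theorem AddBox.newBox_corner (h : AddBox m l) {x : ℕ × ℕ} (hx : x ∈ l) (hle : h.newBox.1 ≤ x) :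
    x = h.newBox.1 := by
  refine (h.mem_or_eq hx).resolve_left fun hm => h.newBox_notMem ?_
  exact m.up_left_mem hle.1 hle.2 hm

theorem AddBox.rowLen_newBox (h : AddBox m l) : l.rowLen h.newBox.1.1 = h.newBox.1.2 + 1 := by
  refine le_antisymm ?_ (mem_iff_lt_rowLen.1 h.newBox.2)
  by_contra hc
  have := h.newBox_corner (x := (h.newBox.1.1, h.newBox.1.2 + 1))
    (mem_iff_lt_rowLen.2 (not_le.1 hc)) ⟨le_rfl, Nat.le_succ _⟩
  exact absurd (congrArg Prod.snd this) (Nat.succ_ne_self _)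

theorem AddBox.rowLen_succ_lt (h : AddBox m l) :
    l.rowLen (h.newBox.1.1 + 1) < l.rowLen h.newBox.1.1 := by
  rw [h.rowLen_newBox]
  by_contra hc
  have := h.newBox_corner (x := (h.newBox.1.1 + 1, h.newBox.1.2))
    (mem_iff_lt_rowLen.2 (by omega)) ⟨Nat.le_succ _, le_rfl⟩
  exact absurd (congrArg Prod.fst this) (Nat.succ_ne_self _)

theorem AddBox.eq_of_newBox_row_eq {m' : YoungDiagram} (h : AddBox m l) (h' : AddBox m' l)
    (e : h.newBox.1.1 = h'.newBox.1.1) : m = m' := by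
  have e2 : h.newBox.1 = h'.newBox.1 := by
    refine Prod.ext e ?_
    have h1 := h.rowLen_newBox
    rw [e, h'.rowLen_newBox] at h1
    exact (Nat.succ_injective h1).symm
  ext x
  constructor
  · intro hx
    refine (h'.mem_or_eq (h.1 hx)).resolve_right fun hn => h.newBox_notMem ?_
    rw [e2, ← hn]; exact hx
  · intro hx
    refine (h.mem_or_eq (h'.1 hx)).resolve_right fun hn => h'.newBox_notMem ?_
    rw [← e2, ← hn]; exact hx

/-- Adding a box at the end of the row `i`. -/
def addRow (m : YoungDiagram) (i : ℕ) (h : ∀ j < i, m.rowLen i < m.rowLen j) : YoungDiagram where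
  cells := insert (i, m.rowLen i) m.cells
  isLowerSet := by
    rintro ⟨a, b⟩ ⟨a', b'⟩ hle hx
    rw [Finset.mem_coe, Finset.mem_insert] at hx ⊢
    obtain hx | hx := hx
    · cases hx
      have h1 : a' ≤ i := hle.1
      have h2 : b' ≤ m.rowLen i := hle.2
      obtain h1 | rfl := h1.lt_or_eq
      · exact Or.inr (mem_iff_lt_rowLen.2 (h2.trans_lt (h _ h1)))
      · obtain h2 | rfl := h2.lt_or_eq
        · exact Or.inr (mem_iff_lt_rowLen.2 h2)
        · exact Or.inl rfl
    · exact Or.inr (m.isLowerSet hle hx)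

theorem addBox_addRow (i : ℕ) (h : ∀ j < i, m.rowLen i < m.rowLen j) : AddBox m (m.addRow i h) := by
  refine ⟨cells_subset_iff.1 (Finset.subset_insert _ _), Finset.card_insert_of_notMem fun hx => ?_⟩
  exact lt_irrefl _ (mem_iff_lt_rowLen.1 (show (i, m.rowLen i) ∈ m from hx))

theorem addRow_injective {i j : ℕ} (hi : ∀ j < i, m.rowLen i < m.rowLen j)
    (hj : ∀ i < j, m.rowLen j < m.rowLen i) (e : m.addRow i hi = m.addRow j hj) : i = j := by
  have h1 : (i, m.rowLen i) ∈ (m.addRow j hj).cells := by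
    rw [← e]; exact Finset.mem_insert_self _ _
  obtain h1 | h1 := Finset.mem_insert.1 h1
  · exact congrArg Prod.fst h1
  · exact absurd (mem_iff_lt_rowLen.1 (show (i, m.rowLen i) ∈ m from h1)) (lt_irrefl _)

instance finite_addBox (m : YoungDiagram) : Finite {l // AddBox m l} :=
  Finite.of_injective (β := {l : YoungDiagram // (l.card : ℤ) = ((m.card + 1 : ℕ) : ℤ)})
    (fun l => ⟨l.1, by rw [l.2.2]⟩) fun l l' h => Subtype.ext (congrArg (fun z => z.1) h)

instance finite_removeBox (m : YoungDiagram) : Finite {l // AddBox l m} :=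
  Finite.of_injective (β := {l : YoungDiagram // (l.card : ℤ) = (m.card : ℤ) - 1})
    (fun l => ⟨l.1, by have := l.2.2; omega⟩) fun l l' h => Subtype.ext (congrArg (fun z => z.1) h)

/-- The diagrams with one box more outnumber the diagrams with one box less. -/
theorem card_removeBox_lt (m : YoungDiagram) :
    Nat.card (Option {l // AddBox l m}) ≤ Nat.card {l // AddBox m l} := by
  have key : ∀ o : Option {l // AddBox l m}, ∀ j < o.elim 0 fun l => l.2.newBox.1.1 + 1,
      m.rowLen (o.elim 0 fun l => l.2.newBox.1.1 + 1) < m.rowLen j := by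
    rintro (_ | l) j hj
    · exact absurd hj (Nat.not_lt_zero _)
    · exact l.2.rowLen_succ_lt.trans_le (m.rowLen_anti j _ (Nat.lt_succ_iff.1 hj))
  refine Nat.card_le_card_of_injective
    (fun o => (⟨m.addRow _ (key o), addBox_addRow _ _⟩ : {l // AddBox m l})) fun o o' h => ?_
  have e := addRow_injective (key o) (key o') (congrArg Subtype.val h)
  cases o with
  | none => cases o' with
    | none => rfl
    | some l' => exact absurd e (Nat.succ_ne_zero _).symm
  | some l => cases o' with
    | none => exact absurd e (Nat.succ_ne_zero _)
    | some l' => exact congrArg some (Subtype.ext (l.2.eq_of_newBox_row_eq l'.2 (Nat.succ_injective e)))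

end Corners

section Branching

theorem mul_mul_mul_assoc' {M : Type*} [Semigroup M] (a b c d : M) :
    a * b * c * d = a * (b * c * d) := by simp only [mul_assoc]

open Equiv MonoidAlgebra

variable {k : Type*} [Field k] [CharZero k] {l m : YoungDiagram} {α : Type} [Fintype α] [DecidableEq α]

theorem eq_zero_of_mul_mul_tabYoung (T : l.Box ≃ α) {v : MonoidAlgebra k (Perm α)}
    (hv : tabYoung k T * v = v) (h : ∀ x, v * x * tabYoung k T = 0) : v = 0 := by
  have h1 : v * conjSum (tabYoung k T) = 0 := by
    rw [conjSum, Finset.mul_sum]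
    refine Finset.sum_eq_zero fun g _ => ?_
    rw [← mul_assoc, ← mul_assoc, h, zero_mul]
  rw [← conjSum_comm, ← hv, ← mul_assoc, conjSum_comm, tabYoung_mul_conjSum, smul_mul_assoc, hv] at h1
  exact (smul_eq_zero.1 h1).resolve_left (kappa_ne_zero T)

theorem exists_rankOne_symm (T : l.Box ≃ α) (e : MonoidAlgebra k (Perm α))
    (h : ∃ u, ∀ x, ∃ c : k, e * x * tabYoung k T = c • u) :
    ∃ v, ∀ x, ∃ c : k, tabYoung k T * x * e = c • v := by
  obtain ⟨u, hu⟩ := h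
  by_cases h0 : ∀ x, tabYoung k T * x * e = 0
  · exact ⟨0, fun x => ⟨0, by rw [h0, smul_zero]⟩⟩
  push Not at h0
  obtain ⟨x₁, hx₁⟩ := h0
  have h1 : ∃ y, tabYoung k T * x₁ * e * y * tabYoung k T ≠ 0 := by
    by_contra hc
    push Not at hc
    exact hx₁ (eq_zero_of_mul_mul_tabYoung T (by simp only [← mul_assoc, tabYoung_mul_self]) hc)
  obtain ⟨y, hy⟩ := h1
  obtain ⟨c, hc⟩ := hu y
  have hc0 : c ≠ 0 := by
    rintro rfl
    rw [mul_mul_mul_assoc', hc, zero_smul, mul_zero] at hy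
    exact hy rfl
  have hs : ∀ x, tabYoung k T * x * (e * y * tabYoung k T) = chi T (x * e * y) • tabYoung k T := by
    intro x
    rw [← tabYoung_sandwich]
    simp only [mul_assoc]
  have hc1 : chi T (x₁ * e * y) ≠ 0 := by
    intro h
    have h2 := hs x₁
    rw [h, zero_smul] at h2
    exact hy (by rw [← h2]; simp only [mul_assoc])
  refine ⟨tabYoung k T * x₁ * e, fun x => ⟨chi T (x * e * y) / chi T (x₁ * e * y), sub_eq_zero.1 ?_⟩⟩
  rw [← smul_mul_assoc, ← sub_mul, ← mul_smul_comm, ← mul_sub]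
  refine eq_zero_of_mul_mul_tabYoung T (by simp only [← mul_assoc, tabYoung_mul_self]) fun z => ?_
  obtain ⟨d, hd⟩ := hu z
  have e1 : e * z * tabYoung k T = (d / c) • (e * y * tabYoung k T) := by
    rw [hd, hc, smul_smul, div_mul_cancel₀ _ hc0]
  rw [mul_mul_mul_assoc', e1, mul_smul_comm, mul_sub, sub_mul, hs, mul_smul_comm,
    smul_mul_assoc, hs, smul_smul, div_mul_cancel₀ _ hc1, sub_self, smul_zero]

theorem mul_eq_zero_symm (T : l.Box ≃ α) {e : MonoidAlgebra k (Perm α)}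
    (h : ∀ x, e * x * tabYoung k T = 0) (x : MonoidAlgebra k (Perm α)) : tabYoung k T * x * e = 0 :=
  eq_zero_of_mul_mul_tabYoung T (by simp only [← mul_assoc, tabYoung_mul_self]) fun y => by
    rw [mul_mul_mul_assoc', h, mul_zero]

variable (k) in
/-- Restricted to `Perm α`, the irreducible representation of shape `l` contains the one of shape
`m` at most once, and only if `l` arises from `m` by adding a box. -/
def Branching (α : Type) [Fintype α] [DecidableEq α] : Prop :=
  ∀ (m l : YoungDiagram) (S : m.Box ≃ α) (T : l.Box ≃ Option α),
    ∃ u, (¬AddBox m l → u = 0) ∧ ∀ x, ∃ c : k,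
      extAlg k α (tabYoung k S) * x * tabYoung k T = c • u

theorem Branching.symm (h : Branching k α) (S : m.Box ≃ α) (T : l.Box ≃ Option α) :
    ∃ v, ∀ x, ∃ c : k, tabYoung k T * x * extAlg k α (tabYoung k S) = c • v := by
  obtain ⟨u, -, hu⟩ := h m l S T
  exact exists_rankOne_symm T _ ⟨u, hu⟩

theorem extAlg_sandwich (S : m.Box ≃ α) (v : Perm α) :
    extAlg k α (tabYoung k S) * single (optionPerm α v) (1 : k) * extAlg k α (tabYoung k S) =
      chi S (single v (1 : k)) • extAlg k α (tabYoung k S) := by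
  rw [← extAlg_single, ← map_mul, ← map_mul, tabYoung_sandwich, map_smul]

theorem domCongr_extAlg_swap (a : α) (x : MonoidAlgebra k (Perm {x // x ≠ a})) :
    extAlg k α (domCongr k k (optionSubtypeNe a).permCongrHom (extAlg k _ x)) *
        single (swap none (some a)) 1 =
      single (swap none (some a)) 1 *
        extAlg k α (domCongr k k (optionSubtypeNe a).permCongrHom (extAlg k _ x)) := by
  induction x using MonoidAlgebra.induction_linear with
  | zero => simp
  | add x y hx hy => simp only [map_add, add_mul, mul_add, hx, hy]
  | single w t =>
    rw [extAlg_single, domCongr_single, extAlg_single, single_mul_single, single_mul_single, one_mul,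
      mul_one]
    congr 1
    set v := (optionSubtypeNe a).permCongrHom (optionPerm _ w)
    have hv : v a = a := by
      change (optionSubtypeNe a) (optionPerm _ w ((optionSubtypeNe a).symm a)) = a
      rw [optionSubtypeNe_symm_self, optionPerm_none, optionSubtypeNe_none]
    have h2 := Equiv.mul_swap_eq_swap_mul (optionPerm α v) none (some a)
    rwa [optionPerm_none, optionPerm_some, hv] at h2

theorem exists_eq_optionPerm_mul_swap_mul (a : α) {w : Perm (Option α)} (hw : w none ≠ none) :
    ∃ v v', w = optionPerm α v * swap none (some a) * optionPerm α v' := by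
  obtain ⟨b, hb⟩ := Option.ne_none_iff_exists'.1 hw
  obtain ⟨v', hv'⟩ := exists_optionPerm (w := swap none (some a) * (optionPerm α (swap a b) * w)) (by
    rw [Perm.mul_apply, Perm.mul_apply, hb, optionPerm_some, swap_apply_right, swap_apply_right])
  refine ⟨swap a b, v', ?_⟩
  rw [← hv', mul_assoc, ← mul_assoc (swap none (some a)), swap_mul_self, one_mul, ← mul_assoc,
    ← map_mul, swap_mul_self, map_one, one_mul]

/-- The algebra `e k[Perm (Option α)] e`, with `e` a Young symmetrizer of shape `m`, is spanned by
`e` and one element for every box of `m` that can be removed. -/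
theorem Branching.exists_spanning (a : α) (h : Branching k {x // x ≠ a}) (S : m.Box ≃ α) :
    ∃ z : {n // AddBox n m} → MonoidAlgebra k (Perm (Option α)), ∀ x,
      extAlg k α (tabYoung k S) * x * extAlg k α (tabYoung k S) ∈ Submodule.span k
        (Set.range fun o : Option {n // AddBox n m} => o.elim (extAlg k α (tabYoung k S)) z) := by
  classical
  set ε := domCongr k k (optionSubtypeNe a).permCongrHom with hε
  let T : m.Box ≃ Option {x // x ≠ a} := S.trans (optionSubtypeNe a).symm
  have hT : tabYoung k S = ε (tabYoung k T) := by
    rw [hε, ← tabYoung_trans]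
    refine congrArg _ (Equiv.ext fun x => ?_)
    exact ((optionSubtypeNe a).apply_symm_apply (S x)).symm
  let V : ∀ n : {n // AddBox n m}, n.1.Box ≃ {x // x ≠ a} := fun n => Fintype.equivOfCardEq (by
    have h1 := Fintype.card_congr T
    rw [Fintype.card_option, Fintype.card_coe] at h1
    have h2 : m.cells.card = n.1.cells.card + 1 := n.2.2
    rw [Fintype.card_coe]; omega)
  choose u hu using fun n => (h n.1 m (V n) T).imp fun _ hh => hh.2
  choose v hv using fun n => h.symm (V n) T
  have hu' : ∀ n x, ∃ c : k, ε (extAlg k _ (tabYoung k (V n))) * x * tabYoung k S = c • ε (u n) := by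
    intro n x
    obtain ⟨c, hc⟩ := hu n (ε.symm x)
    exact ⟨c, by rw [← map_smul, ← hc, map_mul, map_mul, AlgEquiv.apply_symm_apply, hT]⟩
  have hv' : ∀ n x, ∃ c : k, tabYoung k S * x * ε (extAlg k _ (tabYoung k (V n))) = c • ε (v n) := by
    intro n x
    obtain ⟨c, hc⟩ := hv n (ε.symm x)
    exact ⟨c, by rw [← map_smul, ← hc, map_mul, map_mul, AlgEquiv.apply_symm_apply, hT]⟩
  have hsw : ∀ x y, single (swap none (some a)) 1 * (extAlg k α (ε (extAlg k _ x)) * y) =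
      extAlg k α (ε (extAlg k _ x)) * (single (swap none (some a)) 1 * y) := by
    intro x y
    rw [← mul_assoc, ← domCongr_extAlg_swap, mul_assoc]
  refine ⟨fun n => extAlg k α (ε (v n)) * single (swap none (some a)) 1 * extAlg k α (ε (u n)),
    fun x => ?_⟩
  generalize hW : Submodule.span k (M := MonoidAlgebra k (Perm (Option α))) (Set.range _) = W
  induction x using MonoidAlgebra.induction_linear with
  | zero => rw [mul_zero, zero_mul]; exact W.zero_mem
  | add x y hx hy => rw [mul_add, add_mul]; exact W.add_mem hx hy
  | single w t =>
    rw [show (single w t : MonoidAlgebra k (Perm (Option α))) = t • single w 1 by simp, mul_smul_comm, smul_mul_assoc]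
    refine W.smul_mem _ ?_
    by_cases hw : w none = none
    · obtain ⟨w, rfl⟩ := exists_optionPerm hw
      rw [extAlg_sandwich]
      exact W.smul_mem _ (hW ▸ Submodule.subset_span ⟨none, rfl⟩)
    · obtain ⟨w, w', rfl⟩ := exists_eq_optionPerm_mul_swap_mul a hw
      have e1 : extAlg k α (tabYoung k S) *
          single (optionPerm α w * swap none (some a) * optionPerm α w') 1 *
            extAlg k α (tabYoung k S) =
          extAlg k α (tabYoung k S * single w 1) *
            extAlg k α (ε (extAlg k _ (∑ l : Shape {x // x ≠ a}, (kappa k l.tableau)⁻¹ • l.block k))) *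
            single (swap none (some a)) 1 * extAlg k α (single w' 1 * tabYoung k S) := by
        rw [sum_inv_kappa_smul_block, map_one, map_one, map_one, mul_one, map_mul, map_mul,
          extAlg_single, extAlg_single, ← one_mul (1 : k), ← single_mul_single, ← one_mul (1 : k),
          ← single_mul_single]
        simp only [mul_assoc, mul_one]
      rw [e1]
      simp only [map_sum, map_smul, Finset.mul_sum, Finset.sum_mul, mul_smul_comm, smul_mul_assoc]
      refine W.sum_mem fun n _ => W.smul_mem _ ?_
      by_cases hn : AddBox n.1 m
      · rw [Shape.block_eq k (V ⟨n.1, hn⟩), conjSum]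
        simp only [map_sum, Finset.mul_sum, Finset.sum_mul]
        refine W.sum_mem fun g _ => ?_
        obtain ⟨c, hc⟩ := hv' ⟨n.1, hn⟩ (single w 1 * ε (extAlg k _ (single g 1)))
        obtain ⟨d, hd⟩ := hu' ⟨n.1, hn⟩ (ε (extAlg k _ (single g⁻¹ 1)) * single w' 1)
        have e2 : extAlg k α (tabYoung k S * single w 1) * extAlg k α (ε (extAlg k _
            (single g 1 * tabYoung k (V ⟨n.1, hn⟩) * single g⁻¹ 1))) *
              single (swap none (some a)) 1 * extAlg k α (single w' 1 * tabYoung k S) =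
            extAlg k α (tabYoung k S * (single w 1 * ε (extAlg k _ (single g 1))) *
              ε (extAlg k _ (tabYoung k (V ⟨n.1, hn⟩)))) * single (swap none (some a)) 1 *
              extAlg k α (ε (extAlg k _ (tabYoung k (V ⟨n.1, hn⟩))) *
              (ε (extAlg k _ (single g⁻¹ 1)) * single w' 1) * tabYoung k S) := by
          conv_lhs => rw [← tabYoung_mul_self (V _)]
          simp only [map_mul, mul_assoc, hsw]
        rw [e2, hc, hd]
        simp only [map_smul, smul_mul_assoc, mul_smul_comm]
        exact W.smul_mem _ (W.smul_mem _ (hW ▸ Submodule.subset_span ⟨some ⟨n.1, hn⟩, rfl⟩))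
      · convert W.zero_mem
        rw [Shape.block, conjSum]
        simp only [map_sum, Finset.mul_sum, Finset.sum_mul]
        refine Finset.sum_eq_zero fun g _ => ?_
        obtain ⟨u, hu, hu1⟩ := h n.1 m n.tableau T
        obtain ⟨c, hc⟩ := hu1 (extAlg k _ (single g⁻¹ 1) * ε.symm (single w' 1))
        rw [hu hn, smul_zero] at hc
        have h0 := congrArg ε hc
        rw [map_mul, map_mul, ← hT, map_mul, AlgEquiv.apply_symm_apply, map_zero] at h0
        have e2 : extAlg k α (tabYoung k S * single w 1) * extAlg k α (ε (extAlg k _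
            (single g 1 * tabYoung k n.tableau * single g⁻¹ 1))) *
              single (swap none (some a)) 1 * extAlg k α (single w' 1 * tabYoung k S) =
            extAlg k α (tabYoung k S * single w 1 * ε (extAlg k _ (single g 1))) *
              single (swap none (some a)) 1 *
              extAlg k α (ε (extAlg k _ (tabYoung k n.tableau)) *
              (ε (extAlg k _ (single g⁻¹ 1)) * single w' 1) * tabYoung k S) := by
          simp only [map_mul, mul_assoc, hsw]
        rw [e2, h0, map_zero, mul_zero]

/-- The spanning property of `Branching.exists_spanning` implies `Branching`. -/
theorem branching_of_spanning
    (h : ∀ (m : YoungDiagram) (S : m.Box ≃ α),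
      ∃ z : {n // AddBox n m} → MonoidAlgebra k (Perm (Option α)), ∀ x,
        extAlg k α (tabYoung k S) * x * extAlg k α (tabYoung k S) ∈ Submodule.span k
        (Set.range fun o : Option {n // AddBox n m} => o.elim (extAlg k α (tabYoung k S)) z)) :
    Branching k α := by
  classical
  intro m l S T
  obtain ⟨z, hz⟩ := h m S
  set e := extAlg k α (tabYoung k S) with he
  have hee : e * e = e := by rw [he, ← map_mul, tabYoung_mul_self]
  have huv : ∀ n : {n // AddBox m n}, ∃ u v : MonoidAlgebra k (Perm (Option α)),
      e * u = u ∧ u * tabYoung k (n.2.extTab S) = u ∧ tabYoung k (n.2.extTab S) * v = v ∧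
        v * e = v ∧ v * u = tabYoung k (n.2.extTab S) := by
    intro n
    set f := tabYoung k (n.2.extTab S) with hf
    have hff : f * f = f := tabYoung_mul_self _
    have h1 : ∃ y, f * e * y * f ≠ 0 := by
      by_contra hc
      push Not at hc
      exact n.2.tabYoung_mul_extAlg_tabYoung_ne_zero S
        (eq_zero_of_mul_mul_tabYoung (n.2.extTab S) (by rw [← mul_assoc, ← hf, hff]) hc)
    obtain ⟨y, hy⟩ := h1
    have hc : f * (e * y) * f = chi (n.2.extTab S) (e * y) • f := tabYoung_sandwich _ _
    have hc0 : chi (n.2.extTab S) (e * y) ≠ 0 := by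
      intro h0
      rw [h0, zero_smul, ← mul_assoc] at hc
      exact hy hc
    refine ⟨(chi (n.2.extTab S) (e * y))⁻¹ • (e * y * f), f * e, ?_, ?_, ?_, ?_, ?_⟩
    · rw [mul_smul_comm, ← mul_assoc, ← mul_assoc, hee]
    · rw [smul_mul_assoc, mul_assoc, hff]
    · rw [← mul_assoc, hff]
    · rw [mul_assoc, hee]
    · rw [mul_smul_comm, inv_smul_eq_iff₀ hc0, ← hc, mul_assoc f e, ← mul_assoc e, ← mul_assoc e,
        hee, ← mul_assoc]
  choose u v hu1 hu2 hv1 hv2 hvu using huv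
  have hvu0 : ∀ i j, i ≠ j → v i * u j = 0 := by
    intro i j hij
    rw [← hv1, ← hu2 j, ← mul_assoc, mul_assoc (tabYoung k _)]
    exact tabYoung_mul_mul_of_ne k (fun h => hij (Subtype.ext h)) _ _ _
  have := Fintype.ofFinite {n // AddBox m n}
  have := Fintype.ofFinite {n // AddBox n m}
  have hcoef : ∀ (c : {n // AddBox m n} → k) j,
      v j * (∑ i, c i • (u i * v i)) * u j = c j • tabYoung k (j.2.extTab S) := by
    intro c j
    rw [Finset.mul_sum, Finset.sum_mul, Finset.sum_eq_single j]
    · rw [mul_smul_comm, smul_mul_assoc, ← mul_assoc, hvu, mul_assoc, hvu, tabYoung_mul_self]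
    · intro i _ hi
      rw [mul_smul_comm, ← mul_assoc, hvu0 _ _ hi.symm, zero_mul, smul_zero, zero_mul]
    · simp
  have hli : LinearIndependent k fun i => u i * v i := by
    rw [Fintype.linearIndependent_iff]
    intro c hc j
    have := hcoef c j
    rw [hc, mul_zero, zero_mul] at this
    exact (smul_eq_zero.1 this.symm).resolve_right (tabYoung_ne_zero _)
  have hle : Submodule.span k (Set.range fun i => u i * v i) ≤ Submodule.span k
      (Set.range fun o : Option {n // AddBox n m} => o.elim e z) := by
    rw [Submodule.span_le]
    rintro _ ⟨i, rfl⟩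
    have := hz (u i * v i)
    rwa [← mul_assoc, hu1, mul_assoc, hv2] at this
  have heq := Submodule.eq_of_le_of_finrank_le hle (by
    rw [finrank_span_eq_card hli]
    refine (finrank_range_le_card _).trans ?_
    rw [← Nat.card_eq_fintype_card, ← Nat.card_eq_fintype_card]
    exact card_removeBox_lt m)
  have hmem : e ∈ Submodule.span k (Set.range fun i => u i * v i) := by
    rw [heq]
    exact Submodule.subset_span ⟨none, rfl⟩
  obtain ⟨c, hc⟩ := (Submodule.mem_span_range_iff_exists_fun k).1 hmem
  have h0 : ∀ i : {n // AddBox m n}, i.1 ≠ l → ∀ x, u i * v i * x * tabYoung k T = 0 := by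
    intro i hi x
    have e1 : u i * v i * x * tabYoung k T =
        u i * (tabYoung k (i.2.extTab S) * (v i * x) * tabYoung k T) := by
      conv_lhs => rw [← hv1]
      simp only [mul_assoc]
    rw [e1, tabYoung_mul_mul_of_ne k hi, mul_zero]
  by_cases hl : AddBox m l
  · obtain ⟨g, hg⟩ : ∃ g : Perm (Option α), T = (hl.extTab S).trans g :=
      ⟨(hl.extTab S).symm.trans T, Equiv.ext fun x => congrArg T ((hl.extTab S).symm_apply_apply x).symm⟩
    refine ⟨u ⟨l, hl⟩ * (tabYoung k (hl.extTab S) * single g⁻¹ 1), fun h => absurd hl h, fun x => ?_⟩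
    refine ⟨c ⟨l, hl⟩ * chi (hl.extTab S) (v ⟨l, hl⟩ * x * single g 1), ?_⟩
    rw [← hc, Finset.sum_mul, Finset.sum_mul, Finset.sum_eq_single ⟨l, hl⟩]
    · have e1 : u ⟨l, hl⟩ * v ⟨l, hl⟩ * x * tabYoung k T = u ⟨l, hl⟩ * (tabYoung k (hl.extTab S) *
          (v ⟨l, hl⟩ * x * single g 1) * tabYoung k (hl.extTab S)) * single g⁻¹ 1 := by
        rw [hg, tabYoung_conj]
        conv_lhs => rw [← hv1]
        simp only [mul_assoc]
      rw [smul_mul_assoc, smul_mul_assoc, e1, tabYoung_sandwich, mul_smul_comm, smul_mul_assoc,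
        smul_smul, mul_assoc (u _)]
    · intro i _ hi
      rw [smul_mul_assoc, smul_mul_assoc, h0 i (fun h => hi (Subtype.ext h)), smul_zero]
    · simp
  · refine ⟨0, fun _ => rfl, fun x => ⟨0, ?_⟩⟩
    rw [smul_zero, ← hc, Finset.sum_mul, Finset.sum_mul]
    refine Finset.sum_eq_zero fun i _ => ?_
    rw [smul_mul_assoc, smul_mul_assoc, h0 i (fun h => hl (h ▸ i.2)), smul_zero]

variable (k) in
theorem branching (α : Type) [Fintype α] [DecidableEq α] : Branching k α := by
  induction hn : Fintype.card α using Nat.strong_induction_on generalizing α with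
  | _ n ih =>
    refine branching_of_spanning fun m S => ?_
    obtain hα | ⟨⟨a⟩⟩ := isEmpty_or_nonempty α
    · refine ⟨0, fun x => ?_⟩
      generalize hW : Submodule.span k (M := MonoidAlgebra k (Perm (Option α))) (Set.range _) = W
      induction x using MonoidAlgebra.induction_linear with
      | zero => rw [mul_zero, zero_mul]; exact W.zero_mem
      | add x y hx hy => rw [mul_add, add_mul]; exact W.add_mem hx hy
      | single w t =>
        obtain ⟨w, rfl⟩ := exists_optionPerm (w := w) (Subsingleton.elim _ _)
        rw [show (single (optionPerm α w) t : MonoidAlgebra k (Perm (Option α))) =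
          t • single (optionPerm α w) 1 by simp, mul_smul_comm, smul_mul_assoc, extAlg_sandwich]
        exact W.smul_mem _ (W.smul_mem _ (hW ▸ Submodule.subset_span ⟨none, rfl⟩))
    · refine Branching.exists_spanning a (ih _ ?_ _ rfl) S
      rw [← hn]
      exact Fintype.card_subtype_lt (x := a) (by simp)

/-- Young symmetrizers of shapes that do not differ by a box annihilate each other. -/
theorem extAlg_tabYoung_mul_of_not_addBox (h : ¬AddBox m l) (S : m.Box ≃ α) (T : l.Box ≃ Option α)
    (x : MonoidAlgebra k (Perm (Option α))) :
    extAlg k α (tabYoung k S) * x * tabYoung k T = 0 := by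
  obtain ⟨u, hu, hu'⟩ := branching k α m l S T
  obtain ⟨c, hc⟩ := hu' x
  rw [hc, hu h, smul_zero]

end Branching

end YoungDiagram
end

noncomputable section

namespace YoungDiagram

open Equiv MonoidAlgebra

section

variable {k : Type*} [Field k] {l m : YoungDiagram} {α : Type} [Fintype α] [DecidableEq α]
  [CharZero k]

theorem AddBox.youngExt_eq (h : AddBox m l) :
    h.youngExt k = (tab k h.strip).symm (extAlg k m.Box (m.young k)) := by
  rw [AlgEquiv.eq_symm_apply, youngExt]
  generalize m.young k = x
  induction x using MonoidAlgebra.induction_linear with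
  | zero => simp
  | add x y hx hy => simp only [mapDomain_add, map_add, hx, hy]
  | single w t =>
    rw [mapDomain_single, tab_single, extAlg_single]
    congr 1
    exact h.strip.permCongr.apply_symm_apply _

theorem AddBox.tabYoung_mul_extAlg_mul (h : AddBox m l) (S : m.Box ≃ α) :
    tabYoung k (h.extTab S) * extAlg k α (tabYoung k S) * tabYoung k (h.extTab S) =
      h.scalar k • tabYoung k (h.extTab S) := by
  obtain ⟨c, hc⟩ := young_sandwich (h.youngExt k)
  have hn : h.scalar k = c := by
    rw [scalar, hc, coeff_smul, Finsupp.smul_apply, smul_eq_mul, mul_div_assoc, div_self, mul_one]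
    rw [coeff_young_one]
    exact inv_ne_zero (l.hook_ne_zero k)
  have h1 := congrArg (tab k (h.extTab S)) hc
  rw [map_mul, map_mul, map_smul] at h1
  rw [hn, tabYoung, tabYoung, ← h1]
  congr 2
  rw [h.youngExt_eq]
  have e : ∀ x, tab k (h.extTab S) x = domCongr k k (optionCongr S).permCongrHom (tab k h.strip x) := by
    intro x
    induction x using MonoidAlgebra.induction_linear with
    | zero => simp
    | add x y hx hy => simp only [map_add, hx, hy]
    | single w t =>
      rw [tab_single, tab_single, domCongr_single]
      rfl
  rw [e, AlgEquiv.apply_symm_apply, ← extAlg_domCongr]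

theorem AddBox.chi_extAlg (h : AddBox m l) (S : m.Box ≃ α) :
    chi (h.extTab S) (extAlg k α (tabYoung k S)) = h.scalar k :=
  chi_eq_of_sandwich _ (h.tabYoung_mul_extAlg_mul S)

theorem AddBox.exists_extAlg_mul_mul (h : AddBox m l) (S : m.Box ≃ α)
    (x : MonoidAlgebra k (Perm (Option α))) :
    ∃ c : k, extAlg k α (tabYoung k S) * x * tabYoung k (h.extTab S) =
      c • (extAlg k α (tabYoung k S) * tabYoung k (h.extTab S)) := by
  obtain ⟨u, -, hu⟩ := branching k α m l S (h.extTab S)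
  obtain ⟨c, hc⟩ := hu x
  obtain ⟨d, hd⟩ := hu 1
  rw [mul_one] at hd
  have hd0 : d ≠ 0 := by
    rintro rfl
    rw [zero_smul] at hd
    exact h.extAlg_tabYoung_mul_ne_zero S hd
  exact ⟨c / d, by rw [hc, hd, smul_smul, div_mul_cancel₀ _ hd0]⟩

theorem AddBox.exists_mul_mul_extAlg (h : AddBox m l) (S : m.Box ≃ α)
    (x : MonoidAlgebra k (Perm (Option α))) :
    ∃ c : k, tabYoung k (h.extTab S) * x * extAlg k α (tabYoung k S) =
      c • (tabYoung k (h.extTab S) * extAlg k α (tabYoung k S)) := by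
  obtain ⟨u, hu⟩ := (branching k α).symm S (h.extTab S)
  obtain ⟨c, hc⟩ := hu x
  obtain ⟨d, hd⟩ := hu 1
  rw [mul_one] at hd
  have hd0 : d ≠ 0 := by
    rintro rfl
    rw [zero_smul] at hd
    exact h.tabYoung_mul_extAlg_tabYoung_ne_zero S hd
  exact ⟨c / d, by rw [hc, hd, smul_smul, div_mul_cancel₀ _ hd0]⟩

theorem AddBox.scalar_ne_zero (h : AddBox m l) : h.scalar k ≠ 0 := by
  intro h0
  have h1 := h.tabYoung_mul_extAlg_mul (k := k) (Equiv.refl m.Box)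
  rw [h0, zero_smul] at h1
  refine h.tabYoung_mul_extAlg_tabYoung_ne_zero (k := k) (Equiv.refl m.Box)
    (eq_zero_of_mul_mul_tabYoung (h.extTab (Equiv.refl m.Box)) ?_ fun x => ?_)
  · rw [← mul_assoc, tabYoung_mul_self]
  · obtain ⟨c, hc⟩ := h.exists_extAlg_mul_mul (k := k) (Equiv.refl m.Box) x
    rw [mul_assoc, mul_assoc, ← mul_assoc (extAlg _ _ _), hc, mul_smul_comm, ← mul_assoc, h1,
      smul_zero]

theorem AddBox.extAlg_mul_mul (h : AddBox m l) (S : m.Box ≃ α)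
    (x : MonoidAlgebra k (Perm (Option α))) :
    extAlg k α (tabYoung k S) * x * tabYoung k (h.extTab S) =
      (chi (h.extTab S) (extAlg k α (tabYoung k S) * x) / h.scalar k) •
        (extAlg k α (tabYoung k S) * tabYoung k (h.extTab S)) := by
  obtain ⟨c, hc⟩ := h.exists_extAlg_mul_mul (k := k) S x
  rw [hc]
  congr 1
  rw [eq_div_iff h.scalar_ne_zero]
  symm
  refine chi_eq_of_sandwich _ ?_
  rw [mul_assoc, hc, mul_smul_comm, ← mul_assoc, h.tabYoung_mul_extAlg_mul, smul_smul]

theorem AddBox.mul_mul_extAlg (h : AddBox m l) (S : m.Box ≃ α)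
    (x : MonoidAlgebra k (Perm (Option α))) :
    tabYoung k (h.extTab S) * x * extAlg k α (tabYoung k S) =
      (chi (h.extTab S) (x * extAlg k α (tabYoung k S)) / h.scalar k) •
        (tabYoung k (h.extTab S) * extAlg k α (tabYoung k S)) := by
  obtain ⟨c, hc⟩ := h.exists_mul_mul_extAlg (k := k) S x
  rw [hc]
  congr 1
  rw [eq_div_iff h.scalar_ne_zero]
  symm
  refine chi_eq_of_sandwich _ ?_
  rw [← mul_assoc, hc, smul_mul_assoc, h.tabYoung_mul_extAlg_mul, smul_smul]

theorem sum_chi_mul_chi (T : l.Box ≃ α) (x y : MonoidAlgebra k (Perm α)) :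
    ∑ w : Perm α, chi T (x * single w 1) * chi T (single w⁻¹ 1 * y) = kappa k T * chi T (x * y) := by
  symm
  have key : tabYoung k T * (x * conjSum (tabYoung k T) * y) * tabYoung k T =
      (kappa k T * chi T (x * y)) • tabYoung k T := by
    rw [← conjSum_comm, mul_smul, ← tabYoung_sandwich, mul_assoc (conjSum _), ← mul_assoc,
      tabYoung_mul_conjSum, smul_mul_assoc, smul_mul_assoc]
  rw [← chi_eq_of_sandwich _ key, conjSum, Finset.mul_sum, Finset.sum_mul, map_sum]
  refine Finset.sum_congr rfl fun w _ => chi_eq_of_sandwich _ ?_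
  have e : tabYoung k T * (x * (single w 1 * tabYoung k T * single w⁻¹ 1) * y) * tabYoung k T =
      (tabYoung k T * (x * single w 1) * tabYoung k T) * (single w⁻¹ 1 * y) * tabYoung k T := by
    simp only [mul_assoc]
  rw [e, tabYoung_sandwich, smul_mul_assoc, smul_mul_assoc, tabYoung_sandwich, smul_smul]

end

section Transpose

variable {k : Type*} [Field k] {l : YoungDiagram}

/-- Reflection of boxes. -/
def boxTranspose (l : YoungDiagram) : l.Box ≃ l.transpose.Box where
  toFun x := ⟨x.1.swap, by
    have := x.2
    rw [mem_cells] at this ⊢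
    rwa [mem_transpose, Prod.swap_swap]⟩
  invFun x := ⟨x.1.swap, by
    have := x.2
    rw [mem_cells] at this ⊢
    rwa [mem_transpose] at this⟩
  left_inv x := Subtype.ext (Prod.swap_swap _)
  right_inv x := Subtype.ext (Prod.swap_swap _)

/-- The automorphism of the group algebra of a symmetric group that multiplies permutations by their
signs. -/
def signTwist (k : Type*) [Field k] (α : Type*) [Fintype α] [DecidableEq α] :
    MonoidAlgebra k (Perm α) →ₐ[k] MonoidAlgebra k (Perm α) :=
  MonoidAlgebra.lift k _ _
    { toFun := fun w => single w ((Perm.sign w : ℤ) : k)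
      map_one' := by simp only [Perm.sign_one, Units.val_one, Int.cast_one]; rfl
      map_mul' := fun v w => by simp [single_mul_single] }

theorem signTwist_single {α : Type*} [Fintype α] [DecidableEq α] (w : Perm α) (t : k) :
    signTwist k α (single w t) = single w (t * ((Perm.sign w : ℤ) : k)) := by
  rw [signTwist, lift_single]
  simp [smul_single]

theorem signTwist_domCongr {α β : Type*} [Fintype α] [DecidableEq α] [Fintype β] [DecidableEq β]
    (e : α ≃ β) (x : MonoidAlgebra k (Perm α)) :
    signTwist k β (domCongr k k e.permCongrHom x) = domCongr k k e.permCongrHom (signTwist k α x) := by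
  induction x using MonoidAlgebra.induction_linear with
  | zero => simp
  | add x y hx hy => simp only [map_add, hx, hy]
  | single w t =>
    rw [domCongr_single, signTwist_single, signTwist_single, domCongr_single]
    congr 3
    exact congrArg Units.val (Perm.sign_permCongr e w)

theorem tab_boxTranspose_signTwist_rowSym :
    tab k l.boxTranspose (l.rowSym k) = signTwist k _ (l.transpose.colAntisym k) := by
  classical
  rw [rowSym, colAntisym, map_sum, map_sum]
  refine Finset.sum_bij' (fun w _ => ⟨l.boxTranspose.permCongr w.1, fun x => w.2 _⟩)
    (fun w _ => ⟨l.boxTranspose.permCongr.symm w.1, fun x => w.2 _⟩) ?_ ?_ ?_ ?_ ?_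
  · intros; exact Finset.mem_univ _
  · intros; exact Finset.mem_univ _
  · intro w _; exact Subtype.ext (l.boxTranspose.permCongr.symm_apply_apply _)
  · intro w _; exact Subtype.ext (l.boxTranspose.permCongr.apply_symm_apply _)
  · intro w _
    rw [tab_single, signTwist_single, ← Int.cast_mul, ← Units.val_mul, Int.units_mul_self]
    simp

theorem tab_boxTranspose_signTwist_colAntisym :
    tab k l.boxTranspose (l.colAntisym k) = signTwist k _ (l.transpose.rowSym k) := by
  classical
  rw [rowSym, colAntisym, map_sum, map_sum]
  refine Finset.sum_bij' (fun w _ => ⟨l.boxTranspose.permCongr w.1, fun x => w.2 _⟩)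
    (fun w _ => ⟨l.boxTranspose.permCongr.symm w.1, fun x => w.2 _⟩) ?_ ?_ ?_ ?_ ?_
  · intros; exact Finset.mem_univ _
  · intros; exact Finset.mem_univ _
  · intro w _; exact Subtype.ext (l.boxTranspose.permCongr.symm_apply_apply _)
  · intro w _; exact Subtype.ext (l.boxTranspose.permCongr.apply_symm_apply _)
  · intro w _
    rw [tab_single, signTwist_single, one_mul]
    congr 3
    exact (Perm.sign_permCongr l.boxTranspose w.1).symm

theorem coeff_one_signTwist {α : Type*} [Fintype α] [DecidableEq α] (x : MonoidAlgebra k (Perm α)) :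
    (signTwist k α x).coeff 1 = x.coeff 1 := by
  induction x using MonoidAlgebra.induction_linear with
  | zero => simp
  | add x y hx hy => simp only [map_add, coeff_add, Finsupp.add_apply, hx, hy]
  | single w t =>
    rw [signTwist_single, coeff_single, coeff_single, Finsupp.single_apply, Finsupp.single_apply]
    split_ifs with h
    · simp [h]
    · rfl

theorem signTwist_preYoung_transpose :
    signTwist k _ (l.transpose.preYoung k) = tab k l.boxTranspose (l.colAntisym k * l.rowSym k) := by
  rw [preYoung, map_mul, map_mul, tab_boxTranspose_signTwist_rowSym,
    tab_boxTranspose_signTwist_colAntisym]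

theorem hook_transpose : l.transpose.hook k = l.hook k := by
  rw [hook, ← coeff_one_signTwist, map_mul, signTwist_preYoung_transpose, ← map_mul, coeff_one_tab,
    hook, mul_assoc, coeff_one_mul_comm, preYoung]
  simp only [mul_assoc]

theorem signTwist_young_transpose :
    signTwist k _ (l.transpose.young k) = tab k l.boxTranspose (inv' (l.young k)) := by
  rw [young, map_smul, signTwist_preYoung_transpose, hook_transpose, young, inv'_smul, map_smul,
    preYoung, inv'_mul, inv'_rowSym, inv'_colAntisym]

/-- The Young symmetrizer of the transposed tableau. -/
theorem signTwist_tabYoung_transpose {α : Type*} [Fintype α] [DecidableEq α]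
    (T : l.transpose.Box ≃ α) :
    signTwist k α (tabYoung k T) = inv' (tabYoung k (l.boxTranspose.trans T)) := by
  rw [tabYoung_trans, inv'_domCongr]
  change signTwist k α (domCongr k k T.permCongrHom _) = domCongr k k T.permCongrHom _
  rw [signTwist_domCongr, signTwist_young_transpose]
  congr 1
  exact (inv'_domCongr _ _).symm

end Transpose

end YoungDiagram
end

noncomputable section

section OppositeLinear

variable {k : Type*} [CommRing k] {C : Type*} [Category C] [Preadditive C] [Linear k C]

instance linearOpposite : Linear k Cᵒᵖ where
  homModule _ _ :=
    { smul := fun a f => (a • f.unop).op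
      one_smul := fun f => congrArg Quiver.Hom.op (one_smul k f.unop)
      mul_smul := fun a b f => congrArg Quiver.Hom.op (mul_smul a b f.unop)
      smul_zero := fun a => congrArg Quiver.Hom.op (smul_zero a)
      smul_add := fun a f g => congrArg Quiver.Hom.op (smul_add a f.unop g.unop)
      add_smul := fun a b f => congrArg Quiver.Hom.op (add_smul a b f.unop)
      zero_smul := fun f => congrArg Quiver.Hom.op (zero_smul k f.unop) }
  smul_comp _ _ _ a f g := congrArg Quiver.Hom.op (Linear.comp_smul _ _ _ g.unop a f.unop)
  comp_smul _ _ _ f a g := congrArg Quiver.Hom.op (Linear.smul_comp _ _ _ a g.unop f.unop)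

instance linear_functor_op {D : Type*} [Category D] [Preadditive D] [Linear k D] (F : C ⥤ D)
    [F.Linear k] : F.op.Linear k where
  map_smul f a := congrArg Quiver.Hom.op (Functor.Linear.map_smul (F := F) f.unop a)

end OppositeLinear

theorem inv_comp_eq_of_comp_hom_eq {C : Type*} [Category C] {A B A' B' : C} (i : A ≅ B)
    (j : A' ≅ B') {g : A ⟶ A'} {h : B ⟶ B'} (w : g ≫ j.hom = i.hom ≫ h) :
    i.inv ≫ g = h ≫ j.inv := by
  rw [Iso.inv_comp_eq, ← assoc, ← w, assoc, Iso.hom_inv_id, comp_id]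

theorem CoxeterRel.adj_inv (n i : ℕ) (h : i + 1 < n) : (adj n i)⁻¹ = adj n i :=
  inv_eq_of_mul_eq_one_left ((adj_rel n).sq i h)

/-- A permutation of `Fin n`, extended by fixing the last element. -/
def extLast (n : ℕ) : Equiv.Perm (Fin n) →* Equiv.Perm (Fin (n + 1)) :=
  (finSuccEquivLast.symm.permCongrHom.toMonoidHom).comp (optionPerm (Fin n))

/-- A permutation of `Fin n`, shifted by one and extended by fixing the first element. -/
def extFirst (n : ℕ) : Equiv.Perm (Fin n) →* Equiv.Perm (Fin (n + 1)) :=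
  ((finSuccEquiv n).symm.permCongrHom.toMonoidHom).comp (optionPerm (Fin n))

/-- Conjugation with the order reversal. -/
def flipPerm (n : ℕ) : Equiv.Perm (Fin n) →* Equiv.Perm (Fin n) :=
  (Fin.revPerm.permCongrHom).toMonoidHom

open CoxeterRel in
/-- Functors and natural transformations satisfying the relations of the generators of Khovanov's
category, with models of the powers of the generators. -/
structure HeisAct (k : Type*) [Field k] (C : Type*) [Category C] [Preadditive C] [Linear k C] where
  /-- Action of the upward strand. -/
  p : C ⥤ C
  /-- Action of the downward strand. -/
  q : C ⥤ C
  /-- Crossing of upward strands. -/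
  s (Z : C) : p.obj (p.obj Z) ⟶ p.obj (p.obj Z)
  /-- Crossing of downward strands. -/
  t (Z : C) : q.obj (q.obj Z) ⟶ q.obj (q.obj Z)
  /-- Sideways crossing. -/
  x (Z : C) : q.obj (p.obj Z) ⟶ p.obj (q.obj Z)
  /-- Sideways crossing. -/
  y (Z : C) : p.obj (q.obj Z) ⟶ q.obj (p.obj Z)
  /-- Cap. -/
  c (Z : C) : p.obj (q.obj Z) ⟶ Z
  /-- Cup. -/
  d (Z : C) : Z ⟶ p.obj (q.obj Z)
  /-- Cap. -/
  e (Z : C) : q.obj (p.obj Z) ⟶ Z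
  /-- Cup. -/
  f (Z : C) : Z ⟶ q.obj (p.obj Z)
  s_nat {Z Z' : C} (g : Z ⟶ Z') : p.map (p.map g) ≫ s Z' = s Z ≫ p.map (p.map g)
  x_nat {Z Z' : C} (g : Z ⟶ Z') : q.map (p.map g) ≫ x Z' = x Z ≫ p.map (q.map g)
  y_nat {Z Z' : C} (g : Z ⟶ Z') : p.map (q.map g) ≫ y Z' = y Z ≫ q.map (p.map g)
  c_nat {Z Z' : C} (g : Z ⟶ Z') : p.map (q.map g) ≫ c Z' = c Z ≫ g
  d_nat {Z Z' : C} (g : Z ⟶ Z') : g ≫ d Z' = d Z ≫ p.map (q.map g)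
  e_nat {Z Z' : C} (g : Z ⟶ Z') : q.map (p.map g) ≫ e Z' = e Z ≫ g
  f_nat {Z Z' : C} (g : Z ⟶ Z') : g ≫ f Z' = f Z ≫ q.map (p.map g)
  pf_c (Z : C) : p.map (f Z) ≫ c (p.obj Z) = 𝟙 _
  f_qc (Z : C) : f (q.obj Z) ≫ q.map (c Z) = 𝟙 _
  d_pe (Z : C) : d (p.obj Z) ≫ p.map (e Z) = 𝟙 _
  qd_e (Z : C) : q.map (d Z) ≫ e (q.obj Z) = 𝟙 _
  y_eq (Z : C) : y Z = f (p.obj (q.obj Z)) ≫ q.map (s (q.obj Z)) ≫ q.map (p.map (c Z))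
  x_eq (Z : C) : x Z = q.map (p.map (d Z)) ≫ q.map (s (q.obj Z)) ≫ e (p.obj (q.obj Z))
  t_eq (Z : C) : t Z = f (q.obj (q.obj Z)) ≫ q.map (y (q.obj Z)) ≫ q.map (q.map (c Z))
  t_eq' (Z : C) : t Z = q.map (q.map (d Z)) ≫ q.map (x (q.obj Z)) ≫ e (q.obj (q.obj Z))
  s_sq (Z : C) : s Z ≫ s Z = 𝟙 _
  s_braid (Z : C) : s (p.obj Z) ≫ p.map (s Z) ≫ s (p.obj Z) =
    p.map (s Z) ≫ s (p.obj Z) ≫ p.map (s Z)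
  y_x (Z : C) : y Z ≫ x Z = 𝟙 _
  x_y (Z : C) : x Z ≫ y Z + e Z ≫ f Z = 𝟙 _
  f_e (Z : C) : f Z ≫ e Z = 𝟙 _
  /-- The powers of `p`. -/
  pw : ℕ → C ⥤ C
  /-- The power zero. -/
  a₀ (Z : C) : (pw 0).obj Z ≅ Z
  /-- The recursion for powers. -/
  a (n : ℕ) (Z : C) : (pw (n + 1)).obj Z ≅ (pw n).obj (p.obj Z)
  a₀_nat {Z Z' : C} (g : Z ⟶ Z') : (pw 0).map g ≫ (a₀ Z').hom = (a₀ Z).hom ≫ g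
  a_nat (n : ℕ) {Z Z' : C} (g : Z ⟶ Z') :
    (pw (n + 1)).map g ≫ (a n Z').hom = (a n Z).hom ≫ (pw n).map (p.map g)
  /-- The powers of `q`. -/
  W : ℕ → C
  /-- The recursion for powers. -/
  b (n : ℕ) : W (n + 1) ≅ q.obj (W n)
  /-- The permutations of upward strands. -/
  ρ (n : ℕ) : Equiv.Perm (Fin n) →* End (pw n)
  /-- The permutations of downward strands. -/
  τ (n : ℕ) : Equiv.Perm (Fin n) →* End (W n)
  ρ_ext (n : ℕ) (w : Equiv.Perm (Fin n)) (Z : C) :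
    (ρ (n + 1) (extLast n w)).app Z ≫ (a n Z).hom = (a n Z).hom ≫ (ρ n w).app (p.obj Z)
  ρ_adj (n : ℕ) (Z : C) : (ρ (n + 2) (adj (n + 2) n)).app Z ≫ (a (n + 1) Z).hom ≫ (a n _).hom =
    (a (n + 1) Z).hom ≫ (a n _).hom ≫ (pw n).map (s Z)
  τ_ext (n : ℕ) (w : Equiv.Perm (Fin n)) :
    τ (n + 1) (extFirst n w) ≫ (b n).hom = (b n).hom ≫ q.map (τ n w)
  τ_adj (n : ℕ) : τ (n + 2) (adj (n + 2) 0) ≫ (b (n + 1)).hom ≫ q.map (b n).hom =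
    (b (n + 1)).hom ≫ q.map (b n).hom ≫ t (W n)
  q_additive : q.Additive
  q_linear : q.Linear k
  pw_additive (n : ℕ) : (pw n).Additive

namespace HeisAct

attribute [instance] q_additive q_linear pw_additive

variable {k : Type*} [Field k] {C : Type*} [Category C] [Preadditive C] [Linear k C] (M : HeisAct k C)

theorem f_x (Z : C) : M.f Z ≫ M.x Z = 0 := by
  have h1 : M.f Z ≫ M.x Z ≫ M.y Z = 0 := by
    have h := congrArg (M.f Z ≫ ·) (M.x_y Z)
    simp only [comp_add, comp_id] at h
    rw [← assoc (M.f Z) (M.e Z), M.f_e, id_comp] at h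
    simpa using h
  have h2 := congrArg (· ≫ M.x Z) h1
  simpa only [assoc, M.y_x, comp_id, zero_comp] using h2

theorem pf_y (Z : C) : M.p.map (M.f Z) ≫ M.y (M.p.obj Z) = M.f (M.p.obj Z) ≫ M.q.map (M.s Z) := by
  rw [M.y_eq, ← assoc, M.f_nat, assoc, ← M.q.map_comp_assoc, M.s_nat,
    ← M.q.map_comp, assoc, ← M.p.map_comp, M.pf_c]
  simp

theorem s_py_y (Z : C) : M.s (M.q.obj Z) ≫ M.p.map (M.y Z) ≫ M.y (M.p.obj Z) =
    M.p.map (M.y Z) ≫ M.y (M.p.obj Z) ≫ M.q.map (M.s Z) := by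
  have h : M.p.map (M.y Z) ≫ M.y (M.p.obj Z) = M.f _ ≫ M.q.map (M.s (M.p.obj (M.q.obj Z)) ≫
      M.p.map (M.s (M.q.obj Z)) ≫ M.p.map (M.p.map (M.c Z))) := by
    conv_lhs => rw [M.y_eq Z]
    simp only [M.p.map_comp, M.q.map_comp, assoc]
    rw [M.y_nat, reassoc_of% (M.y_nat (M.s (M.q.obj Z))), reassoc_of% (M.pf_y (M.p.obj (M.q.obj Z)))]
  rw [← assoc (M.p.map (M.y Z)) (M.y _) (M.q.map (M.s Z)), h,
    ← assoc (M.s _), M.f_nat]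
  simp only [assoc, ← M.q.map_comp]
  rw [M.s_nat, reassoc_of% (M.s_braid (M.q.obj Z))]

theorem pt_c (Z : C) : M.p.map (M.t Z) ≫ M.c (M.q.obj Z) = M.y (M.q.obj Z) ≫ M.q.map (M.c Z) := by
  rw [M.t_eq, M.p.map_comp, M.p.map_comp, assoc, assoc, M.c_nat,
    reassoc_of% (M.c_nat (M.y (M.q.obj Z))), reassoc_of% (M.pf_c (M.q.obj (M.q.obj Z)))]

theorem py_c (Z : C) : M.p.map (M.y Z) ≫ M.c (M.p.obj Z) = M.s (M.q.obj Z) ≫ M.p.map (M.c Z) := by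
  rw [M.y_eq, M.p.map_comp, M.p.map_comp, assoc, assoc, M.c_nat,
    reassoc_of% (M.c_nat (M.s (M.q.obj Z))), reassoc_of% (M.pf_c (M.p.obj (M.q.obj Z)))]

theorem nested_cap (Z : C) : M.s (M.q.obj (M.q.obj Z)) ≫ M.p.map (M.c (M.q.obj Z)) ≫ M.c Z =
    M.p.map (M.p.map (M.t Z)) ≫ M.p.map (M.c (M.q.obj Z)) ≫ M.c Z := by
  rw [← M.p.map_comp_assoc, M.pt_c, M.p.map_comp_assoc, M.c_nat, reassoc_of% (M.py_c (M.q.obj Z))]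

/-- The opposite action, with cups and caps interchanged. -/
def op : HeisAct k Cᵒᵖ where
  p := M.p.op
  q := M.q.op
  s Z := (M.s Z.unop).op
  t Z := (M.t Z.unop).op
  x Z := (M.y Z.unop).op
  y Z := (M.x Z.unop).op
  c Z := (M.d Z.unop).op
  d Z := (M.c Z.unop).op
  e Z := (M.f Z.unop).op
  f Z := (M.e Z.unop).op
  s_nat g := congrArg Quiver.Hom.op (M.s_nat g.unop).symm
  x_nat g := congrArg Quiver.Hom.op (M.y_nat g.unop).symm
  y_nat g := congrArg Quiver.Hom.op (M.x_nat g.unop).symm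
  c_nat g := congrArg Quiver.Hom.op (M.d_nat g.unop).symm
  d_nat g := congrArg Quiver.Hom.op (M.c_nat g.unop).symm
  e_nat g := congrArg Quiver.Hom.op (M.f_nat g.unop).symm
  f_nat g := congrArg Quiver.Hom.op (M.e_nat g.unop).symm
  pf_c Z := congrArg Quiver.Hom.op (M.d_pe Z.unop)
  f_qc Z := congrArg Quiver.Hom.op (M.qd_e Z.unop)
  d_pe Z := congrArg Quiver.Hom.op (M.pf_c Z.unop)
  qd_e Z := congrArg Quiver.Hom.op (M.f_qc Z.unop)
  y_eq Z := congrArg Quiver.Hom.op ((M.x_eq Z.unop).trans (assoc _ _ _).symm)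
  x_eq Z := congrArg Quiver.Hom.op ((M.y_eq Z.unop).trans (assoc _ _ _).symm)
  t_eq Z := congrArg Quiver.Hom.op ((M.t_eq' Z.unop).trans (assoc _ _ _).symm)
  t_eq' Z := congrArg Quiver.Hom.op ((M.t_eq Z.unop).trans (assoc _ _ _).symm)
  s_sq Z := congrArg Quiver.Hom.op (M.s_sq Z.unop)
  s_braid Z := congrArg Quiver.Hom.op ((assoc _ _ _).trans
    ((M.s_braid Z.unop).trans (assoc _ _ _).symm))
  y_x Z := congrArg Quiver.Hom.op (M.y_x Z.unop)
  x_y Z := congrArg Quiver.Hom.op (M.x_y Z.unop)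
  f_e Z := congrArg Quiver.Hom.op (M.f_e Z.unop)
  pw n := (M.pw n).op
  a₀ Z := (M.a₀ Z.unop).symm.op
  a n Z := (M.a n Z.unop).symm.op
  a₀_nat g := congrArg Quiver.Hom.op (inv_comp_eq_of_comp_hom_eq _ _ (M.a₀_nat g.unop))
  a_nat n _ _ g := congrArg Quiver.Hom.op (inv_comp_eq_of_comp_hom_eq _ _ (M.a_nat n g.unop))
  W n := Opposite.op (M.W n)
  b n := (M.b n).symm.op
  ρ n :=
    { toFun := fun w => NatTrans.op (M.ρ n w⁻¹)
      map_one' := congrArg NatTrans.op ((congrArg _ inv_one).trans (map_one (M.ρ n)))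
      map_mul' := fun v w => congrArg NatTrans.op
        ((congrArg _ (mul_inv_rev v w)).trans (map_mul (M.ρ n) w⁻¹ v⁻¹)) }
  τ n :=
    { toFun := fun w => Quiver.Hom.op (M.τ n w⁻¹)
      map_one' := congrArg Quiver.Hom.op ((congrArg _ inv_one).trans (map_one (M.τ n)))
      map_mul' := fun v w => congrArg Quiver.Hom.op
        ((congrArg _ (mul_inv_rev v w)).trans (map_mul (M.τ n) w⁻¹ v⁻¹)) }
  ρ_ext n w Z := congrArg Quiver.Hom.op (inv_comp_eq_of_comp_hom_eq (M.a n Z.unop) (M.a n Z.unop)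
    (by
      have h := M.ρ_ext n w⁻¹ Z.unop
      rw [show extLast n w⁻¹ = (extLast n w)⁻¹ from map_inv _ _] at h
      exact h))
  ρ_adj n Z := congrArg Quiver.Hom.op ((inv_comp_eq_of_comp_hom_eq
    (M.a (n + 1) Z.unop ≪≫ M.a n (M.p.obj Z.unop)) (M.a (n + 1) Z.unop ≪≫ M.a n (M.p.obj Z.unop))
    (by
      have h := M.ρ_adj n Z.unop
      rw [← CoxeterRel.adj_inv (n + 2) n (by omega)] at h
      exact h.trans (assoc _ _ _).symm)).trans (assoc _ _ _).symm)
  τ_ext n w := congrArg Quiver.Hom.op (inv_comp_eq_of_comp_hom_eq (M.b n) (M.b n)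
    (by
      have h := M.τ_ext n w⁻¹
      rw [show extFirst n w⁻¹ = (extFirst n w)⁻¹ from map_inv _ _] at h
      exact h))
  τ_adj n := congrArg Quiver.Hom.op ((inv_comp_eq_of_comp_hom_eq
    (M.b (n + 1) ≪≫ M.q.mapIso (M.b n)) (M.b (n + 1) ≪≫ M.q.mapIso (M.b n))
    (by
      have h := M.τ_adj n
      rw [← CoxeterRel.adj_inv (n + 2) 0 (by omega)] at h
      exact h.trans (assoc _ _ _).symm)).trans (assoc _ _ _).symm)
  q_additive := inferInstance
  q_linear := inferInstance
  pw_additive _ := inferInstance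

end HeisAct
end

noncomputable section

section ExtendPerm

open Equiv

theorem extLast_last (n : ℕ) (w : Perm (Fin n)) : extLast n w (Fin.last n) = Fin.last n := by
  change finSuccEquivLast.symm (optionPerm _ w (finSuccEquivLast (Fin.last n))) = _
  rw [finSuccEquivLast_last, optionPerm_none, finSuccEquivLast_symm_none]

theorem extLast_castSucc (n : ℕ) (w : Perm (Fin n)) (i : Fin n) :
    extLast n w i.castSucc = (w i).castSucc := by
  change finSuccEquivLast.symm (optionPerm _ w (finSuccEquivLast i.castSucc)) = _
  rw [finSuccEquivLast_castSucc, optionPerm_some, finSuccEquivLast_symm_some]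

theorem extFirst_zero (n : ℕ) (w : Perm (Fin n)) : extFirst n w 0 = 0 := by
  change (finSuccEquiv n).symm (optionPerm _ w (finSuccEquiv n 0)) = _
  rw [finSuccEquiv_zero, optionPerm_none, finSuccEquiv_symm_none]

theorem extFirst_succ (n : ℕ) (w : Perm (Fin n)) (i : Fin n) : extFirst n w i.succ = (w i).succ := by
  change (finSuccEquiv n).symm (optionPerm _ w (finSuccEquiv n i.succ)) = _
  rw [finSuccEquiv_succ, optionPerm_some, finSuccEquiv_symm_some]

theorem extLast_injective (n : ℕ) : Function.Injective (extLast n) :=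
  (finSuccEquivLast.symm.permCongr.injective).comp optionPerm_injective

theorem sign_extLast (n : ℕ) (w : Perm (Fin n)) : Perm.sign (extLast n w) = Perm.sign w :=
  (Perm.sign_permCongr _ _).trans (optionCongr_sign w)

theorem flipPerm_apply (n : ℕ) (w : Perm (Fin n)) (i : Fin n) : flipPerm n w i = (w i.rev).rev := rfl

theorem flipPerm_flipPerm (n : ℕ) (w : Perm (Fin n)) : flipPerm n (flipPerm n w) = w := by
  ext i
  rw [flipPerm_apply, flipPerm_apply, Fin.rev_rev, Fin.rev_rev]

theorem flipPerm_extLast (n : ℕ) (w : Perm (Fin n)) :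
    flipPerm (n + 1) (extLast n w) = extFirst n (flipPerm n w) := by
  refine Equiv.ext fun i => ?_
  rw [flipPerm_apply]
  induction i using Fin.cases with
  | zero => rw [Fin.rev_zero, extLast_last, extFirst_zero, Fin.rev_last]
  | succ i => rw [Fin.rev_succ, extLast_castSucc, extFirst_succ, Fin.rev_castSucc, flipPerm_apply]

theorem extLast_adj (n i : ℕ) (h : i + 1 < n) :
    extLast n (CoxeterRel.adj n i) = CoxeterRel.adj (n + 1) i := by
  refine Equiv.ext fun j => ?_
  have h' : i + 1 < n + 1 := by omega
  induction j using Fin.lastCases with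
  | last =>
    rw [extLast_last, CoxeterRel.adj, dif_pos h', swap_apply_of_ne_of_ne]
    · simp only [ne_eq, Fin.ext_iff, Fin.val_last]; omega
    · simp only [ne_eq, Fin.ext_iff, Fin.val_last]; omega
  | cast j =>
    rw [extLast_castSucc, CoxeterRel.adj, CoxeterRel.adj, dif_pos h, dif_pos h']
    simp only [Equiv.swap_apply_def, Fin.ext_iff, Fin.val_castSucc]
    split_ifs <;> simp_all

theorem extFirst_adj (n i : ℕ) (h : i + 1 < n) :
    extFirst n (CoxeterRel.adj n i) = CoxeterRel.adj (n + 1) (i + 1) := by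
  refine Equiv.ext fun j => ?_
  have h' : i + 1 + 1 < n + 1 := by omega
  induction j using Fin.cases with
  | zero =>
    rw [extFirst_zero, CoxeterRel.adj, dif_pos h', swap_apply_of_ne_of_ne]
    · simp [Fin.ext_iff]
    · simp [Fin.ext_iff]
  | succ j =>
    rw [extFirst_succ, CoxeterRel.adj, CoxeterRel.adj, dif_pos h, dif_pos h']
    simp only [Equiv.swap_apply_def, Fin.ext_iff, Fin.val_succ]
    split_ifs <;> simp_all

theorem flipPerm_adj (n i : ℕ) (h : i + 1 < n) :
    flipPerm n (CoxeterRel.adj n i) = CoxeterRel.adj n (n - 2 - i) := by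
  refine Equiv.ext fun j => ?_
  have h' : n - 2 - i + 1 < n := by omega
  rw [flipPerm_apply, CoxeterRel.adj, CoxeterRel.adj, dif_pos h, dif_pos h']
  simp only [Equiv.swap_apply_def, Fin.ext_iff, Fin.val_rev]
  split_ifs <;> simp only [Fin.val_rev] <;> omega

theorem exists_extLast {n : ℕ} {w : Perm (Fin (n + 1))} (h : w (Fin.last n) = Fin.last n) :
    ∃ v, w = extLast n v := by
  obtain ⟨v, hv⟩ := exists_optionPerm (w := finSuccEquivLast.permCongr w) (by
    change finSuccEquivLast (w (finSuccEquivLast.symm none)) = none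
    rw [finSuccEquivLast_symm_none, h, finSuccEquivLast_last])
  exact ⟨v, (finSuccEquivLast.permCongr.symm_apply_apply w).symm.trans
    (congrArg finSuccEquivLast.symm.permCongr hv)⟩

theorem exists_extLast_mul_adj_mul {n : ℕ} {w : Perm (Fin (n + 2))}
    (h : w (Fin.last (n + 1)) ≠ Fin.last (n + 1)) :
    ∃ v v', w = extLast (n + 1) v * CoxeterRel.adj (n + 2) n * extLast (n + 1) v' := by
  obtain ⟨v, v', hv⟩ := YoungDiagram.exists_eq_optionPerm_mul_swap_mul (Fin.last n)
    (w := finSuccEquivLast.permCongr w) (by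
      change finSuccEquivLast (w (finSuccEquivLast.symm none)) ≠ none
      rw [finSuccEquivLast_symm_none, ← finSuccEquivLast_last]
      exact fun h' => h (finSuccEquivLast.injective h'))
  have h1 : finSuccEquivLast.symm.permCongrHom (swap none (some (Fin.last n))) =
      CoxeterRel.adj (n + 2) n := by
    have e := Equiv.symm_trans_swap_trans (none : Option (Fin (n + 1))) (some (Fin.last n))
      finSuccEquivLast.symm
    refine (show finSuccEquivLast.symm.permCongrHom (swap none (some (Fin.last n))) = _ from e).trans ?_
    rw [finSuccEquivLast_symm_none, finSuccEquivLast_symm_some, CoxeterRel.adj, dif_pos (by omega),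
      swap_comm]
    congr 1
  refine ⟨v, v', (finSuccEquivLast.permCongr.symm_apply_apply w).symm.trans ?_⟩
  rw [← h1]
  change finSuccEquivLast.symm.permCongrHom _ = finSuccEquivLast.symm.permCongrHom _ * _ *
    finSuccEquivLast.symm.permCongrHom _
  rw [← map_mul, ← map_mul, hv]

end ExtendPerm

/-- A contraction of a complex whose objects split into two parts in a suitable way. -/
theorem contraction_of_splitting {C : Type*} [Category C] [Preadditive C] {X B : ℕ → C}
    {e : ∀ n, X n ⟶ X n} {b : ∀ n, B n ⟶ B n} {D : ∀ n, X (n + 1) ⟶ X n} {α : ∀ n, X n ⟶ B n}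
    {α' : ∀ n, B n ⟶ X n} {β : ∀ n, B n ⟶ X (n + 1)} {β' : ∀ n, X (n + 1) ⟶ B n}
    (he : ∀ n, e n ≫ e n = e n) (heα : ∀ n, e n ≫ α n = α n) (hαb : ∀ n, α n ≫ b n = α n)
    (hbβ : ∀ n, b n ≫ β n = β n) (hβe : ∀ n, β n ≫ e (n + 1) = β n)
    (heD : ∀ n, e (n + 1) ≫ D n = D n) (hDe : ∀ n, D n ≫ e n = D n)
    (hD : ∀ n, D (n + 1) ≫ D n = 0) (h0 : α 0 ≫ α' 0 = e 0)
    (hS : ∀ n, α (n + 1) ≫ α' (n + 1) + β' n ≫ β n = e (n + 1))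
    (hβα : ∀ n, β n ≫ α (n + 1) = 0) (hβDα : ∀ n, β n ≫ D n ≫ α n = b n) :
    (α 0 ≫ β 0) ≫ D 0 = e 0 ∧
      ∀ n, (α (n + 1) ≫ β (n + 1)) ≫ D (n + 1) + D n ≫ α n ≫ β n = e (n + 1) := by
  constructor
  · set T := (α 0 ≫ β 0) ≫ D 0 with hT
    have h1 : T ≫ α 0 = α 0 := by
      simp only [hT, assoc, hβDα, hαb]
    have h2 : T ≫ e 0 = T := by
      simp only [hT, assoc, hDe]
    rw [← h2, ← h0, ← assoc, h1]
  · intro n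
    set T := (α (n + 1) ≫ β (n + 1)) ≫ D (n + 1) + D n ≫ α n ≫ β n with hT
    have h1 : T ≫ α (n + 1) = α (n + 1) := by
      simp only [hT, add_comp, assoc, hβDα, hαb, hβα, comp_zero, add_zero]
    have h2 : β n ≫ T = β n := by
      rw [hT, comp_add, assoc, ← assoc (β n) (α (n + 1)), hβα,
        zero_comp, zero_add, ← assoc (D n), ← assoc (β n), hβDα, hbβ]
    have h3 : T ≫ T = T := by
      have h : T ≫ T = ((α (n + 1) ≫ β (n + 1)) ≫ D (n + 1)) ≫ T + (D n ≫ α n ≫ β n) ≫ T := by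
        rw [← add_comp, ← hT]
      rw [h]
      simp only [assoc, h2]
      rw [hT, comp_add, reassoc_of% (hD n), zero_comp, add_zero]
      simp only [assoc]
      rw [← assoc (D (n + 1)) (α (n + 1)), ← assoc (β (n + 1)), hβDα,
        ← assoc (b (n + 1)), hbβ]
    have h4 : e (n + 1) ≫ T = T := by
      simp only [hT, comp_add]
      rw [← assoc (e (n + 1)) (α (n + 1) ≫ β (n + 1)), reassoc_of% (heα (n + 1)),
        reassoc_of% (heD n)]
    have h5 : T ≫ e (n + 1) = T := by
      simp only [hT, add_comp, assoc, hDe, hβe]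
    have h6 : (e (n + 1) - T) ≫ e (n + 1) ≫ (e (n + 1) - T) = 0 := by
      rw [← hS, add_comp, assoc, assoc, comp_add,
        ← assoc _ (α (n + 1)), sub_comp, hS, heα, h1, sub_self,
        zero_comp, zero_add, comp_sub (β n), hβe, h2, sub_self, comp_zero,
        comp_zero]
    rw [comp_sub, he, h4, comp_sub, sub_comp, he, h5,
      sub_comp, h4, h3, sub_self, sub_zero, sub_eq_zero] at h6
    exact h6.symm
end

noncomputable section

namespace HeisAct

open Equiv CoxeterRel

variable {k : Type*} [Field k] {C : Type*} [Category C] [Preadditive C] [Linear k C] (M : HeisAct k C)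

theorem a_inv_nat (n : ℕ) {Z Z' : C} (g : Z ⟶ Z') :
    (M.pw n).map (M.p.map g) ≫ (M.a n Z').inv = (M.a n Z).inv ≫ (M.pw (n + 1)).map g :=
  (inv_comp_eq_of_comp_hom_eq _ _ (M.a_nat n g)).symm

theorem a₀_inv_nat {Z Z' : C} (g : Z ⟶ Z') :
    g ≫ (M.a₀ Z').inv = (M.a₀ Z).inv ≫ (M.pw 0).map g :=
  (inv_comp_eq_of_comp_hom_eq _ _ (M.a₀_nat g)).symm

theorem ρ_mul_app (n : ℕ) (v w : Perm (Fin n)) (Z : C) :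
    (M.ρ n (v * w)).app Z = (M.ρ n w).app Z ≫ (M.ρ n v).app Z :=
  congrArg (fun f => NatTrans.app f Z) (map_mul (M.ρ n) v w)

theorem ρ_one_app (n : ℕ) (Z : C) : (M.ρ n 1).app Z = 𝟙 _ :=
  congrArg (fun f => NatTrans.app f Z) (map_one (M.ρ n))

theorem τ_mul (n : ℕ) (v w : Perm (Fin n)) : M.τ n (v * w) = M.τ n w ≫ M.τ n v :=
  map_mul (M.τ n) v w

theorem τ_one (n : ℕ) : M.τ n 1 = 𝟙 _ := map_one (M.τ n)

/-- A downward strand moved across `n` upward strands. -/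
def chi : (n : ℕ) → (Z : C) → (M.q.obj ((M.pw n).obj Z) ⟶ (M.pw n).obj (M.q.obj Z))
  | 0, Z => M.q.map (M.a₀ Z).hom ≫ (M.a₀ (M.q.obj Z)).inv
  | n + 1, Z => M.q.map (M.a n Z).hom ≫ chi n (M.p.obj Z) ≫ (M.pw n).map (M.x Z) ≫
      (M.a n (M.q.obj Z)).inv

/-- A downward strand moved back across `n` upward strands. -/
def chi' : (n : ℕ) → (Z : C) → ((M.pw n).obj (M.q.obj Z) ⟶ M.q.obj ((M.pw n).obj Z))
  | 0, Z => (M.a₀ (M.q.obj Z)).hom ≫ M.q.map (M.a₀ Z).inv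
  | n + 1, Z => (M.a n (M.q.obj Z)).hom ≫ (M.pw n).map (M.y Z) ≫ chi' n (M.p.obj Z) ≫
      M.q.map (M.a n Z).inv

theorem op_chi (n : ℕ) (Z : Cᵒᵖ) : M.op.chi n Z = (M.chi' n Z.unop).op := by
  induction n generalizing Z with
  | zero => rfl
  | succ n ih =>
    rw [chi, ih]
    exact congrArg Quiver.Hom.op ((assoc _ _ _).trans (assoc _ _ _))

theorem op_chi' (n : ℕ) (Z : Cᵒᵖ) : M.op.chi' n Z = (M.chi n Z.unop).op := by
  induction n generalizing Z with
  | zero => rfl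
  | succ n ih =>
    rw [chi', ih]
    exact congrArg Quiver.Hom.op ((assoc _ _ _).trans (assoc _ _ _))

theorem chi_nat (n : ℕ) {Z Z' : C} (g : Z ⟶ Z') :
    M.q.map ((M.pw n).map g) ≫ M.chi n Z' = M.chi n Z ≫ (M.pw n).map (M.q.map g) := by
  induction n generalizing Z Z' with
  | zero =>
    rw [chi, chi, ← M.q.map_comp_assoc, M.a₀_nat, M.q.map_comp, assoc, assoc,
      M.a₀_inv_nat]
  | succ n ih =>
    rw [chi, chi, ← M.q.map_comp_assoc, M.a_nat, M.q.map_comp, assoc, reassoc_of% ih,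
      ← (M.pw n).map_comp_assoc, M.x_nat]
    simp only [assoc, Functor.map_comp, M.a_inv_nat]

theorem chi'_nat (n : ℕ) {Z Z' : C} (g : Z ⟶ Z') :
    (M.pw n).map (M.q.map g) ≫ M.chi' n Z' = M.chi' n Z ≫ M.q.map ((M.pw n).map g) := by
  have h := M.op.chi_nat n g.op
  rw [op_chi, op_chi] at h
  exact (congrArg Quiver.Hom.unop h).symm

theorem chi'_chi (n : ℕ) (Z : C) : M.chi' n Z ≫ M.chi n Z = 𝟙 _ := by
  induction n generalizing Z with
  | zero => simp [chi, chi', ← M.q.map_comp_assoc]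
  | succ n ih =>
    simp only [chi, chi', assoc]
    rw [← M.q.map_comp_assoc, Iso.inv_hom_id, M.q.map_id, id_comp, reassoc_of% ih,
      ← (M.pw n).map_comp_assoc, M.y_x]
    simp

theorem qs_x_px (Z : C) : M.q.map (M.s Z) ≫ M.x (M.p.obj Z) ≫ M.p.map (M.x Z) =
    M.x (M.p.obj Z) ≫ M.p.map (M.x Z) ≫ M.s (M.q.obj Z) := by
  have h := congrArg Quiver.Hom.unop (M.op.s_py_y (Opposite.op Z))
  exact (assoc _ _ _).symm.trans (h.symm.trans (assoc _ _ _))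

theorem chi_ρ (n : ℕ) (w : Perm (Fin n)) (Z : C) :
    M.q.map ((M.ρ n w).app Z) ≫ M.chi n Z = M.chi n Z ≫ (M.ρ n w).app (M.q.obj Z) := by
  induction n generalizing Z with
  | zero => rw [Subsingleton.elim w 1, ρ_one_app, ρ_one_app]; simp
  | succ n ih =>
    have hext : ∀ (v : Perm (Fin n)) (Z : C), M.q.map ((M.ρ (n + 1) (extLast n v)).app Z) ≫
        M.chi (n + 1) Z = M.chi (n + 1) Z ≫ (M.ρ (n + 1) (extLast n v)).app (M.q.obj Z) := by
      intro v Z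
      rw [chi, ← M.q.map_comp_assoc, M.ρ_ext, M.q.map_comp, assoc, reassoc_of% ih,
        ← NatTrans.naturality_assoc, ← inv_comp_eq_of_comp_hom_eq _ _ (M.ρ_ext n v (M.q.obj Z))]
      simp only [assoc]
    by_cases h : w (Fin.last n) = Fin.last n
    · obtain ⟨v, rfl⟩ := exists_extLast h
      exact hext v Z
    · cases n with
      | zero => exact absurd (Subsingleton.elim (α := Fin 1) _ _) h
      | succ n =>
        obtain ⟨v, v', rfl⟩ := exists_extLast_mul_adj_mul h
        have hadj : M.q.map ((M.ρ (n + 2) (adj (n + 2) n)).app Z) ≫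
            M.chi (n + 2) Z = M.chi (n + 2) Z ≫ (M.ρ (n + 2) (adj (n + 2) n)).app (M.q.obj Z) := by
          have h1 : M.chi (n + 2) Z = M.q.map ((M.a (n + 1) Z).hom ≫ (M.a n _).hom) ≫ M.chi n _ ≫
              (M.pw n).map (M.x (M.p.obj Z) ≫ M.p.map (M.x Z)) ≫
              (M.a n _).inv ≫ (M.a (n + 1) _).inv := by
            simp only [chi, assoc, Functor.map_comp]
            rw [reassoc_of% (M.a_inv_nat n (M.x Z))]
          have h2 := inv_comp_eq_of_comp_hom_eq (M.a (n + 1) (M.q.obj Z) ≪≫ M.a n _)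
            (M.a (n + 1) (M.q.obj Z) ≪≫ M.a n _) ((M.ρ_adj n (M.q.obj Z)).trans
              (assoc _ _ _).symm)
          simp only [Iso.trans_inv, assoc] at h2
          rw [h1, ← M.q.map_comp_assoc, M.ρ_adj]
          simp only [assoc, h2, Functor.map_comp]
          rw [reassoc_of% (M.chi_nat n (M.s Z)), ← (M.pw n).map_comp_assoc, 
            ← (M.pw n).map_comp_assoc, assoc, M.qs_x_px]
          simp only [assoc, Functor.map_comp]
        simp only [ρ_mul_app, Functor.map_comp, assoc, hext]
        rw [reassoc_of% hadj, reassoc_of% (hext v' Z)]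

theorem chi'_ρ (n : ℕ) (w : Perm (Fin n)) (Z : C) :
    (M.ρ n w).app (M.q.obj Z) ≫ M.chi' n Z = M.chi' n Z ≫ M.q.map ((M.ρ n w).app Z) := by
  have h := M.op.chi_ρ n w⁻¹ (Opposite.op Z)
  rw [op_chi] at h
  have h' := congrArg Quiver.Hom.unop h
  change M.chi' n Z ≫ M.q.map ((M.ρ n w⁻¹⁻¹).app Z) = (M.ρ n w⁻¹⁻¹).app (M.q.obj Z) ≫ M.chi' n Z at h'
  rw [inv_inv] at h'
  exact h'.symm

/-- Creation of a downward and the last upward strand. -/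
def theta (n : ℕ) (Z : C) : (M.pw n).obj Z ⟶ M.q.obj ((M.pw (n + 1)).obj Z) :=
  (M.pw n).map (M.f Z) ≫ M.chi' n (M.p.obj Z) ≫ M.q.map (M.a n Z).inv

/-- Annihilation of a downward and the last upward strand. -/
def theta' (n : ℕ) (Z : C) : M.q.obj ((M.pw (n + 1)).obj Z) ⟶ (M.pw n).obj Z :=
  M.q.map (M.a n Z).hom ≫ M.chi n (M.p.obj Z) ≫ (M.pw n).map (M.e Z)

theorem op_theta (n : ℕ) (Z : C) : M.op.theta n (Opposite.op Z) = (M.theta' n Z).op := by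
  rw [theta, op_chi']
  exact congrArg Quiver.Hom.op (assoc _ _ _)

theorem theta_nat (n : ℕ) {Z Z' : C} (g : Z ⟶ Z') :
    (M.pw n).map g ≫ M.theta n Z' = M.theta n Z ≫ M.q.map ((M.pw (n + 1)).map g) := by
  rw [theta, theta, ← (M.pw n).map_comp_assoc, M.f_nat, (M.pw n).map_comp_assoc,
    reassoc_of% (M.chi'_nat n (M.p.map g)), ← M.q.map_comp, M.a_inv_nat]
  simp only [Functor.map_comp, assoc]

theorem theta'_nat (n : ℕ) {Z Z' : C} (g : Z ⟶ Z') :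
    M.q.map ((M.pw (n + 1)).map g) ≫ M.theta' n Z' = M.theta' n Z ≫ (M.pw n).map g := by
  have h := M.op.theta_nat n g.op
  rw [op_theta, op_theta] at h
  exact (congrArg Quiver.Hom.unop h).symm

theorem theta_ρ (n : ℕ) (w : Perm (Fin n)) (Z : C) :
    (M.ρ n w).app Z ≫ M.theta n Z = M.theta n Z ≫ M.q.map ((M.ρ (n + 1) (extLast n w)).app Z) := by
  rw [theta, ← NatTrans.naturality_assoc, reassoc_of% (M.chi'_ρ n w (M.p.obj Z)), ← M.q.map_comp,
    ← inv_comp_eq_of_comp_hom_eq _ _ (M.ρ_ext n w Z)]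
  simp only [Functor.map_comp, assoc]

theorem theta_adj (n : ℕ) (Z : C) :
    M.theta (n + 1) Z ≫ M.q.map ((M.ρ (n + 2) (adj (n + 2) n)).app Z) ≫ M.q.map (M.a (n + 1) Z).hom =
      (M.a n Z).hom ≫ M.theta n (M.p.obj Z) := by
  have h2 := inv_comp_eq_of_comp_hom_eq (M.a (n + 1) Z ≪≫ M.a n _)
    (M.a (n + 1) Z ≪≫ M.a n _) ((M.ρ_adj n Z).trans (assoc _ _ _).symm)
  simp only [Iso.trans_inv, assoc] at h2
  have h3 : (M.pw n).map (M.s Z) ≫ (M.pw n).map (M.s Z) = 𝟙 _ := by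
    rw [← Functor.map_comp, M.s_sq, CategoryTheory.Functor.map_id]
  rw [theta, chi', theta]
  simp only [assoc, ← M.q.map_comp]
  rw [reassoc_of% h2, Iso.inv_hom_id, comp_id, reassoc_of% (M.a_nat n (M.f Z)),
    ← (M.pw n).map_comp_assoc, M.pf_y, (M.pw n).map_comp_assoc, reassoc_of% (M.chi'_nat n (M.s Z)),
    ← M.q.map_comp, reassoc_of% h3]

theorem theta'_adj (n : ℕ) (Z : C) :
    M.q.map (M.a (n + 1) Z).inv ≫ M.q.map ((M.ρ (n + 2) (adj (n + 2) n)).app Z) ≫ M.theta' (n + 1) Z =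
      M.theta' n (M.p.obj Z) ≫ (M.a n Z).inv := by
  have h := M.op.theta_adj n (Opposite.op Z)
  rw [op_theta] at h
  have h1 : M.op.theta n (M.op.p.obj (Opposite.op Z)) = (M.theta' n (M.p.obj Z)).op := M.op_theta n _
  rw [h1] at h
  have h' := congrArg Quiver.Hom.unop h
  change (M.q.map (M.a (n + 1) Z).inv ≫ M.q.map ((M.ρ (n + 2) (adj (n + 2) n)⁻¹).app Z)) ≫
    M.theta' (n + 1) Z = M.theta' n (M.p.obj Z) ≫ (M.a n Z).inv at h'
  rw [adj_inv _ _ (by omega), assoc] at h'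
  exact h'

theorem theta_chi (n : ℕ) (Z : C) : M.theta n Z ≫ M.chi (n + 1) Z = 0 := by
  rw [theta, chi]
  simp only [assoc]
  rw [← M.q.map_comp_assoc, Iso.inv_hom_id, M.q.map_id, id_comp,
    reassoc_of% (M.chi'_chi n (M.p.obj Z)), ← (M.pw n).map_comp_assoc, M.f_x, Functor.map_zero,
    zero_comp]

theorem chi_chi'_zero (Z : C) : M.chi 0 Z ≫ M.chi' 0 Z = 𝟙 _ := by
  simp [chi, chi', ← M.q.map_comp]

theorem chi_chi'_succ (n : ℕ) (Z : C) : 𝟙 _ - M.chi (n + 1) Z ≫ M.chi' (n + 1) Z =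
    M.q.map (M.a n Z).hom ≫ (𝟙 _ - M.chi n (M.p.obj Z) ≫ M.chi' n (M.p.obj Z)) ≫
      M.q.map (M.a n Z).inv + M.theta' n Z ≫ M.theta n Z := by
  have h : (M.pw n).map (M.x Z) ≫ (M.pw n).map (M.y Z) =
      𝟙 _ - (M.pw n).map (M.e Z) ≫ (M.pw n).map (M.f Z) := by
    rw [← Functor.map_comp, ← Functor.map_comp, ← (M.pw n).map_id, ← Functor.map_sub, ← M.x_y Z,
      add_sub_cancel_right]
  rw [chi, chi', theta, theta']
  simp only [assoc, Iso.inv_hom_id_assoc]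
  rw [reassoc_of% h]
  simp only [sub_comp, comp_sub, id_comp, assoc]
  rw [← M.q.map_comp, Iso.hom_inv_id, M.q.map_id]
  abel

theorem exists_chi_chi' (n : ℕ) : ∃ g : Fin (n + 1) → Perm (Fin (n + 1)), ∀ Z : C,
    𝟙 _ - M.chi (n + 1) Z ≫ M.chi' (n + 1) Z = ∑ i, M.q.map ((M.ρ (n + 1) (g i)).app Z) ≫
      (M.theta' n Z ≫ M.theta n Z) ≫ M.q.map ((M.ρ (n + 1) (g i)⁻¹).app Z) := by
  induction n with
  | zero =>
    refine ⟨fun _ => 1, fun Z => ?_⟩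
    rw [chi_chi'_succ, chi_chi'_zero, sub_self, zero_comp, comp_zero]
    simp
  | succ n ih =>
    obtain ⟨g, hg⟩ := ih
    refine ⟨Fin.snoc (α := fun _ => Perm (Fin (n + 1 + 1))) (fun i => adj (n + 2) n * extLast (n + 1) (g i)) 1, fun Z => ?_⟩
    rw [chi_chi'_succ, hg, Fin.sum_univ_castSucc (n := n + 1)]
    simp only [Fin.snoc_castSucc, Fin.snoc_last, inv_one, ρ_one_app, CategoryTheory.Functor.map_id,
      id_comp, comp_id]
    rw [Preadditive.sum_comp, Preadditive.comp_sum]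
    congr 1
    refine Finset.sum_congr rfl fun i _ => ?_
    have h1 : M.q.map ((M.ρ (n + 2) (adj (n + 2) n)).app Z) ≫ M.theta' (n + 1) Z =
        M.q.map (M.a (n + 1) Z).hom ≫ M.theta' n (M.p.obj Z) ≫ (M.a n Z).inv := by
      rw [← theta'_adj, ← M.q.map_comp_assoc, Iso.hom_inv_id, M.q.map_id, id_comp]
    have h2 : M.theta (n + 1) Z ≫ M.q.map ((M.ρ (n + 2) (adj (n + 2) n)).app Z) =
        (M.a n Z).hom ≫ M.theta n (M.p.obj Z) ≫ M.q.map (M.a (n + 1) Z).inv := by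
      rw [← reassoc_of% (M.theta_adj n Z), ← M.q.map_comp, Iso.hom_inv_id, M.q.map_id,
        comp_id]
    have h3 := fun v => inv_comp_eq_of_comp_hom_eq _ _ (M.ρ_ext (n + 1) v Z)
    rw [mul_inv_rev, adj_inv _ _ (by omega), ← map_inv, ρ_mul_app, ρ_mul_app]
    simp only [Functor.map_comp, assoc]
    rw [reassoc_of% h1, reassoc_of% h2, Iso.inv_hom_id_assoc, ← M.q.map_comp_assoc, ← M.ρ_ext,
      M.q.map_comp_assoc, ← M.q.map_comp (M.a (n + 1) Z).inv, h3, M.q.map_comp]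

end HeisAct
end

noncomputable section

namespace HeisAct

open Equiv CoxeterRel

variable {k : Type*} [Field k] {C : Type*} [Category C] [Preadditive C] [Linear k C] (M : HeisAct k C)

/-- `n` upward strands followed by `n` downward strands. -/
abbrev U (n : ℕ) : C := (M.pw n).obj (M.W n)

/-- A permutation of the upward strands and the mirrored permutation of the downward strands, with
a sign. -/
def br (n : ℕ) (w : Perm (Fin n)) : M.U n ⟶ M.U n :=
  (Perm.sign w : ℤ) • ((M.ρ n w).app (M.W n) ≫ (M.pw n).map (M.τ n (flipPerm n w)))

theorem br_mul (n : ℕ) (v w : Perm (Fin n)) : M.br n (v * w) = M.br n w ≫ M.br n v := by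
  simp only [br, Preadditive.comp_zsmul, Preadditive.zsmul_comp, smul_smul]
  rw [map_mul Perm.sign, map_mul (flipPerm n), τ_mul, ρ_mul_app, Units.val_mul, Functor.map_comp]
  simp only [assoc]
  rw [NatTrans.naturality_assoc]

/-- The antisymmetrizer. -/
def A (n : ℕ) : M.U n ⟶ M.U n := ((n.factorial : k)⁻¹) • ∑ w, M.br n w

theorem br_A (n : ℕ) (w : Perm (Fin n)) : M.br n w ≫ M.A n = M.A n := by
  rw [A, Linear.comp_smul, Preadditive.comp_sum]
  simp only [← br_mul]
  exact congrArg _ (Equiv.sum_comp (Equiv.mulRight w) (M.br n))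

theorem A_br (n : ℕ) (w : Perm (Fin n)) : M.A n ≫ M.br n w = M.A n := by
  rw [A, Linear.smul_comp, Preadditive.sum_comp]
  simp only [← br_mul]
  exact congrArg _ (Equiv.sum_comp (Equiv.mulLeft w) (M.br n))

theorem inv_factorial_smul_sum [CharZero k] {V : Type*} [AddCommGroup V] [Module k V] (n : ℕ) (x : V) :
    ((n.factorial : k)⁻¹) • ∑ _w : Perm (Fin n), x = x := by
  rw [Finset.sum_const, Finset.card_univ, Fintype.card_perm, Fintype.card_fin, ← Nat.cast_smul_eq_nsmul k,
    smul_smul, inv_mul_cancel₀ (Nat.cast_ne_zero.mpr n.factorial_ne_zero), one_smul]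

theorem A_A [CharZero k] (n : ℕ) : M.A n ≫ M.A n = M.A n := by
  have h : M.A n ≫ M.A n = (((n.factorial : k)⁻¹) • ∑ w, M.br n w) ≫ M.A n := rfl
  rw [h, Linear.smul_comp, Preadditive.sum_comp]
  simp only [br_A, inv_factorial_smul_sum]

/-- The cap joining the innermost strands. -/
def D (n : ℕ) : M.U (n + 1) ⟶ M.U n :=
  (M.pw (n + 1)).map (M.b n).hom ≫ (M.a n _).hom ≫ (M.pw n).map (M.c (M.W n))

theorem br_D (n : ℕ) (w : Perm (Fin n)) : M.br (n + 1) (extLast n w) ≫ M.D n = M.D n ≫ M.br n w := by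
  simp only [br, D, Preadditive.comp_zsmul, Preadditive.zsmul_comp, assoc, sign_extLast]
  rw [flipPerm_extLast, ← (M.pw (n + 1)).map_comp_assoc, M.τ_ext, (M.pw (n + 1)).map_comp_assoc,
    reassoc_of% (M.a_nat n), ← (M.pw n).map_comp, M.c_nat, ← NatTrans.naturality_assoc,
    reassoc_of% (M.ρ_ext n w), Functor.map_comp, NatTrans.naturality_assoc]

theorem A_D_A [CharZero k] (n : ℕ) : M.A (n + 1) ≫ M.D n ≫ M.A n = M.A (n + 1) ≫ M.D n := by
  rw [A.eq_def M n, Linear.comp_smul, Linear.comp_smul, Preadditive.comp_sum, Preadditive.comp_sum]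
  simp only [← br_D, ← assoc, A_br, inv_factorial_smul_sum]

theorem br_D_D (n : ℕ) : M.br (n + 2) (adj (n + 2) n) ≫ M.D (n + 1) ≫ M.D n = -M.D (n + 1) ≫ M.D n := by
  have h1 : M.D (n + 1) ≫ M.D n = (M.pw (n + 2)).map ((M.b (n + 1)).hom ≫ M.q.map (M.b n).hom) ≫
      ((M.a (n + 1) _).hom ≫ (M.a n _).hom) ≫ (M.pw n).map (M.p.map (M.c _) ≫ M.c _) := by
    simp only [D, assoc, Functor.map_comp]
    rw [← (M.pw (n + 1)).map_comp_assoc, ← M.c_nat, (M.pw (n + 1)).map_comp_assoc,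
      ← reassoc_of% (M.a_nat n (M.c (M.q.obj (M.W n)))), reassoc_of% (M.a_nat (n + 1)),
      reassoc_of% (M.a_nat (n + 1)), reassoc_of% (M.a_nat (n + 1))]
  have h2 : Perm.sign (adj (n + 2) n) = -1 := by
    rw [adj, dif_pos (by omega), Perm.sign_swap]
    simp [Fin.ext_iff]
  have h3 : flipPerm (n + 2) (adj (n + 2) n) = adj (n + 2) 0 := by
    rw [flipPerm_adj _ _ (by omega)]
    congr 1
    omega
  have h4 : (M.pw n).map (M.s _) ≫ (M.pw n).map (M.p.map (M.p.map (M.t (M.W n)))) ≫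
      (M.pw n).map (M.p.map (M.c _) ≫ M.c _) = (M.pw n).map (M.p.map (M.c _) ≫ M.c _) := by
    rw [← (M.pw n).map_comp, ← M.nested_cap, ← (M.pw n).map_comp, ← assoc, M.s_sq,
      id_comp]
  rw [h1, br, h2, h3]
  simp only [Units.val_neg, Units.val_one, neg_smul, one_smul, Preadditive.neg_comp, neg_inj,
    assoc]
  rw [← (M.pw (n + 2)).map_comp_assoc]
  have h5 := M.τ_adj n
  rw [h5, ← assoc (M.b (n + 1)).hom, (M.pw (n + 2)).map_comp_assoc, 
    ← NatTrans.naturality_assoc, reassoc_of% (M.a_nat (n + 1) (M.t (M.W n))),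
    reassoc_of% (M.a_nat n (M.p.map (M.t (M.W n)))), reassoc_of% (M.ρ_adj n), h4]

theorem A_D_D [CharZero k] (n : ℕ) : M.A (n + 2) ≫ M.D (n + 1) ≫ M.D n = 0 := by
  have h : M.A (n + 2) ≫ M.D (n + 1) ≫ M.D n = -(M.A (n + 2) ≫ M.D (n + 1) ≫ M.D n) := by
    conv_lhs => rw [← A_br _ _ (adj (n + 2) n), assoc, br_D_D]
    simp
  have h2 : (2 : k) • (M.A (n + 2) ≫ M.D (n + 1) ≫ M.D n) = 0 := by
    rw [two_smul]
    nth_rewrite 1 [h]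
    exact neg_add_cancel _
  exact (smul_eq_zero.mp h2).resolve_left two_ne_zero

/-- The signed permutations on the strands adjacent to a downward strand in the middle. -/
def brq (n : ℕ) (w : Perm (Fin n)) : (M.pw n).obj (M.q.obj (M.W n)) ⟶ (M.pw n).obj (M.q.obj (M.W n)) :=
  (Perm.sign w : ℤ) • ((M.ρ n w).app _ ≫ (M.pw n).map (M.q.map (M.τ n (flipPerm n w))))

theorem br_chi (n : ℕ) (w : Perm (Fin n)) :
    M.q.map (M.br n w) ≫ M.chi n (M.W n) = M.chi n (M.W n) ≫ M.brq n w := by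
  simp only [br, brq, Functor.map_zsmul, Functor.map_comp, Preadditive.comp_zsmul,
    Preadditive.zsmul_comp, assoc]
  rw [M.chi_nat, reassoc_of% (M.chi_ρ n w (M.W n))]

theorem br_chi' (n : ℕ) (w : Perm (Fin n)) :
    M.brq n w ≫ M.chi' n (M.W n) = M.chi' n (M.W n) ≫ M.q.map (M.br n w) := by
  simp only [br, brq, Functor.map_zsmul, Functor.map_comp, Preadditive.comp_zsmul,
    Preadditive.zsmul_comp, assoc]
  rw [M.chi'_nat, reassoc_of% (M.chi'_ρ n w (M.W n))]

/-- The antisymmetrizer on the strands adjacent to a downward strand in the middle. -/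
def Aq (n : ℕ) : (M.pw n).obj (M.q.obj (M.W n)) ⟶ (M.pw n).obj (M.q.obj (M.W n)) :=
  ((n.factorial : k)⁻¹) • ∑ w, M.brq n w

theorem A_chi (n : ℕ) : M.q.map (M.A n) ≫ M.chi n (M.W n) = M.chi n (M.W n) ≫ M.Aq n := by
  simp only [A, Aq, Functor.map_smul, Functor.map_sum, Linear.comp_smul, Linear.smul_comp,
    Preadditive.comp_sum, Preadditive.sum_comp, br_chi]

theorem Aq_chi' (n : ℕ) : M.Aq n ≫ M.chi' n (M.W n) = M.chi' n (M.W n) ≫ M.q.map (M.A n) := by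
  simp only [A, Aq, Functor.map_smul, Functor.map_sum, Linear.comp_smul, Linear.smul_comp,
    Preadditive.comp_sum, Preadditive.sum_comp, br_chi']

theorem Aq_eq (n : ℕ) : M.Aq n = M.chi' n (M.W n) ≫ M.q.map (M.A n) ≫ M.chi n (M.W n) := by
  rw [A_chi, reassoc_of% (M.chi'_chi n (M.W n))]

theorem brq_eq (n : ℕ) (w : Perm (Fin n)) :
    M.brq n w = M.chi' n (M.W n) ≫ M.q.map (M.br n w) ≫ M.chi n (M.W n) := by
  rw [br_chi, reassoc_of% (M.chi'_chi n (M.W n))]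

theorem brq_Aq (n : ℕ) (w : Perm (Fin n)) : M.brq n w ≫ M.Aq n = M.Aq n := by
  rw [Aq_eq, ← assoc, br_chi', assoc, ← M.q.map_comp_assoc, br_A]

theorem Aq_brq (n : ℕ) (w : Perm (Fin n)) : M.Aq n ≫ M.brq n w = M.Aq n := by
  rw [brq_eq, ← assoc, Aq_chi', assoc, ← M.q.map_comp_assoc, A_br, ← Aq_eq]

theorem Aq_Aq [CharZero k] (n : ℕ) : M.Aq n ≫ M.Aq n = M.Aq n := by
  have h : M.Aq n ≫ M.Aq n = (((n.factorial : k)⁻¹) • ∑ w, M.brq n w) ≫ M.Aq n := rfl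
  rw [h, Linear.smul_comp, Preadditive.sum_comp]
  simp only [brq_Aq, inv_factorial_smul_sum]

/-- Creation of a downward and the innermost upward strand. -/
def beta (n : ℕ) : (M.pw n).obj (M.q.obj (M.W n)) ⟶ M.q.obj (M.U (n + 1)) :=
  M.theta n _ ≫ M.q.map ((M.pw (n + 1)).map (M.b n).inv)

/-- Annihilation of a downward and the innermost upward strand. -/
def beta' (n : ℕ) : M.q.obj (M.U (n + 1)) ⟶ (M.pw n).obj (M.q.obj (M.W n)) :=
  M.q.map ((M.pw (n + 1)).map (M.b n).hom) ≫ M.theta' n _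

theorem beta'_beta (n : ℕ) : M.beta' n ≫ M.beta n = M.theta' n _ ≫ M.theta n _ := by
  have h : (M.pw (n + 1)).map (M.b n).hom ≫ (M.pw (n + 1)).map (M.b n).inv = 𝟙 _ := by
    rw [← Functor.map_comp, Iso.hom_inv_id, CategoryTheory.Functor.map_id]
  rw [beta', beta, assoc, reassoc_of% (M.theta'_nat n), reassoc_of% (M.theta_nat n),
    ← M.q.map_comp, h, CategoryTheory.Functor.map_id, comp_id]

theorem brq_beta (n : ℕ) (w : Perm (Fin n)) :
    M.brq n w ≫ M.beta n = M.beta n ≫ M.q.map (M.br (n + 1) (extLast n w)) := by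
  simp only [br, brq, beta, Functor.map_zsmul, Functor.map_comp, Preadditive.comp_zsmul,
    Preadditive.zsmul_comp, assoc, sign_extLast, flipPerm_extLast]
  have h := inv_comp_eq_of_comp_hom_eq _ _ (M.τ_ext n (flipPerm n w))
  rw [reassoc_of% (M.theta_nat n), reassoc_of% (M.theta_ρ n w)]
  simp only [← M.q.map_comp]
  rw [NatTrans.naturality_assoc, ← (M.pw (n + 1)).map_comp, ← (M.pw (n + 1)).map_comp, h]

theorem beta_D (n : ℕ) : M.beta n ≫ M.q.map (M.D n) = M.chi' n (M.W n) := by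
  have h : (M.pw (n + 1)).map (M.b n).inv ≫ (M.pw (n + 1)).map (M.b n).hom = 𝟙 _ := by
    rw [← Functor.map_comp, Iso.inv_hom_id, CategoryTheory.Functor.map_id]
  rw [beta, D, theta]
  simp only [assoc, ← M.q.map_comp]
  rw [reassoc_of% h, Iso.inv_hom_id_assoc, ← M.chi'_nat, ← (M.pw n).map_comp_assoc, M.f_qc]
  simp

theorem beta_chi (n : ℕ) : M.beta n ≫ M.chi (n + 1) (M.W (n + 1)) = 0 := by
  rw [beta, assoc, M.chi_nat, reassoc_of% (M.theta_chi n), zero_comp]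

theorem beta_adj (n : ℕ) : M.beta (n + 1) ≫ M.q.map (M.br (n + 2) (adj (n + 2) n)) ≫
    M.q.map (M.D (n + 1)) ≫ M.chi (n + 1) (M.W (n + 1)) = 0 := by
  have h : M.q.map ((M.pw (n + 2)).map (M.b (n + 1)).inv) ≫
      M.q.map ((M.ρ (n + 2) (adj (n + 2) n)).app _ ≫
        (M.pw (n + 2)).map (M.τ (n + 2) (flipPerm (n + 2) (adj (n + 2) n)))) ≫
      M.q.map (M.D (n + 1)) = (M.q.map ((M.ρ (n + 2) (adj (n + 2) n)).app _) ≫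
        M.q.map (M.a (n + 1) _).hom) ≫ M.q.map ((M.pw (n + 1)).map (M.p.map ((M.b (n + 1)).inv ≫
          M.τ (n + 2) (flipPerm (n + 2) (adj (n + 2) n)) ≫ (M.b (n + 1)).hom) ≫ M.c _)) := by
    simp only [D, ← M.q.map_comp, Functor.map_comp (M.pw (n + 1)), assoc]
    rw [← reassoc_of% (M.a_nat (n + 1))]
    simp only [Functor.map_comp (M.pw (n + 2)), assoc, NatTrans.naturality_assoc]
  simp only [beta, br, Functor.map_zsmul, Preadditive.comp_zsmul, Preadditive.zsmul_comp,
    assoc]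
  rw [reassoc_of% h, reassoc_of% (M.theta_adj n), M.chi_nat, reassoc_of% (M.theta_chi n),
    zero_comp, comp_zero, smul_zero]

theorem Aq_beta_A (n : ℕ) [CharZero k] :
    M.Aq n ≫ M.beta n ≫ M.q.map (M.A (n + 1)) = M.beta n ≫ M.q.map (M.A (n + 1)) := by
  rw [Aq, Linear.smul_comp, Preadditive.sum_comp]
  simp only [← assoc, brq_beta]
  simp only [assoc, ← M.q.map_comp, br_A, inv_factorial_smul_sum]

theorem Aq_beta_br (n : ℕ) (w : Perm (Fin (n + 1))) :
    (w ∈ Set.range (extLast n) → M.Aq n ≫ M.beta n ≫ M.q.map (M.br (n + 1) w) ≫ M.q.map (M.D n) ≫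
      M.chi n (M.W n) = M.Aq n) ∧
    (w ∉ Set.range (extLast n) → M.Aq n ≫ M.beta n ≫ M.q.map (M.br (n + 1) w) ≫ M.q.map (M.D n) ≫
      M.chi n (M.W n) = 0) := by
  constructor
  · rintro ⟨v, rfl⟩
    rw [← assoc (M.beta n), ← brq_beta, assoc, reassoc_of% (M.beta_D n), chi'_chi,
      comp_id, Aq_brq]
  · intro h
    cases n with
    | zero => exact absurd ⟨1, Subsingleton.elim (α := Perm (Fin 1)) _ _⟩ h
    | succ n =>
      obtain ⟨v, v', rfl⟩ := exists_extLast_mul_adj_mul (n := n) (w := w) fun h' => h <| by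
        obtain ⟨v, hv⟩ := exists_extLast h'
        exact ⟨v, hv.symm⟩
      rw [br_mul, br_mul, M.q.map_comp, M.q.map_comp, assoc, assoc,
        ← M.q.map_comp_assoc (M.br _ (extLast (n + 1) v)), br_D, M.q.map_comp_assoc, br_chi,
        ← assoc (M.beta _), ← brq_beta, assoc, reassoc_of% (M.beta_adj n),
        zero_comp, comp_zero, comp_zero]

theorem Aq_beta_A_D_chi [CharZero k] (n : ℕ) : ((n + 1 : ℕ) : k) • M.Aq n ≫ M.beta n ≫
    M.q.map (M.A (n + 1)) ≫ M.q.map (M.D n) ≫ M.chi n (M.W n) = M.Aq n := by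
  have h : ∑ w : Perm (Fin n), M.Aq n = ∑ w, M.Aq n ≫ M.beta n ≫ M.q.map (M.br (n + 1) w) ≫
      M.q.map (M.D n) ≫ M.chi n (M.W n) :=
    Fintype.sum_of_injective (extLast n) (extLast_injective n) _ _
      (fun w hw => (M.Aq_beta_br n w).2 hw)
      (fun w => ((M.Aq_beta_br n (extLast n w)).1 ⟨w, rfl⟩).symm)
  rw [A, Functor.map_smul, Linear.smul_comp, Linear.comp_smul, Linear.comp_smul, Functor.map_sum,
    Preadditive.sum_comp, Preadditive.comp_sum, Preadditive.comp_sum, ← h, smul_smul,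
    Nat.factorial_succ, Nat.cast_mul, mul_inv, ← mul_assoc, mul_inv_cancel₀ (Nat.cast_ne_zero.mpr n.succ_ne_zero),
    one_mul, inv_factorial_smul_sum]

theorem A_chi_chi'_A [CharZero k] (n : ℕ) :
    M.q.map (M.A (n + 1)) ≫ (𝟙 _ - M.chi (n + 1) _ ≫ M.chi' (n + 1) _) ≫ M.q.map (M.A (n + 1)) =
      ((n + 1 : ℕ) : k) • (M.q.map (M.A (n + 1)) ≫ M.beta' n ≫ M.beta n ≫ M.q.map (M.A (n + 1))) := by
  obtain ⟨g, hg⟩ := M.exists_chi_chi' n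
  rw [hg, Preadditive.sum_comp, Preadditive.comp_sum]
  have h : ∀ w, M.q.map (M.A (n + 1)) ≫ (M.q.map ((M.ρ (n + 1) w).app (M.W (n + 1))) ≫
      (M.theta' n (M.W (n + 1)) ≫ M.theta n (M.W (n + 1))) ≫
        M.q.map ((M.ρ (n + 1) w⁻¹).app (M.W (n + 1)))) ≫ M.q.map (M.A (n + 1)) =
      M.q.map (M.A (n + 1)) ≫ M.beta' n ≫ M.beta n ≫ M.q.map (M.A (n + 1)) := by
    intro w
    have h1 : M.q.map (M.br (n + 1) w) ≫ M.theta' n _ ≫ M.theta n _ ≫ M.q.map (M.br (n + 1) w⁻¹) =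
        M.q.map ((M.ρ (n + 1) w).app (M.W (n + 1))) ≫ M.theta' n _ ≫ M.theta n _ ≫
          M.q.map ((M.ρ (n + 1) w⁻¹).app (M.W (n + 1))) := by
      simp only [br, Functor.map_zsmul, Preadditive.comp_zsmul, Preadditive.zsmul_comp, smul_smul,
        Perm.sign_inv, Int.units_coe_mul_self, one_smul]
      rw [M.q.map_comp, assoc, reassoc_of% (M.theta'_nat n), reassoc_of% (M.theta_nat n),
        ← M.q.map_comp, NatTrans.naturality_assoc, ← (M.pw (n + 1)).map_comp, ← τ_mul, ← map_mul,
        inv_mul_cancel, map_one, τ_one, CategoryTheory.Functor.map_id, comp_id]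
    simp only [assoc]
    rw [← reassoc_of% h1, ← M.q.map_comp_assoc, A_br, ← M.q.map_comp, br_A,
      reassoc_of% (M.beta'_beta n)]
  simp only [h, Finset.sum_const, Finset.card_univ, Fintype.card_fin, Nat.cast_smul_eq_nsmul]

/-- The downward strand contracts the complex. -/
theorem exists_contraction [CharZero k] : ∃ H : ∀ n, M.q.obj (M.U n) ⟶ M.q.obj (M.U (n + 1)),
    (∀ n, M.q.map (M.A n) ≫ H n = H n) ∧ (∀ n, H n ≫ M.q.map (M.A (n + 1)) = H n) ∧
    H 0 ≫ M.q.map (M.A 1 ≫ M.D 0) = M.q.map (M.A 0) ∧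
    ∀ n, H (n + 1) ≫ M.q.map (M.A (n + 2) ≫ M.D (n + 1)) + M.q.map (M.A (n + 1) ≫ M.D n) ≫ H n =
      M.q.map (M.A (n + 1)) := by
  have hAA : ∀ n, M.q.map (M.A n) ≫ M.q.map (M.A n) = M.q.map (M.A n) := fun n => by
    rw [← M.q.map_comp, A_A]
  obtain ⟨h1, h2⟩ := contraction_of_splitting (X := fun n => M.q.obj (M.U n))
    (B := fun n => (M.pw n).obj (M.q.obj (M.W n)))
    (e := fun n => M.q.map (M.A n)) (b := M.Aq) (D := fun n => M.q.map (M.A (n + 1) ≫ M.D n))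
    (α := fun n => M.q.map (M.A n) ≫ M.chi n _) (α' := fun n => M.chi' n _ ≫ M.q.map (M.A n))
    (β := fun n => ((n + 1 : ℕ) : k) • (M.Aq n ≫ M.beta n ≫ M.q.map (M.A (n + 1))))
    (β' := fun n => M.q.map (M.A (n + 1)) ≫ M.beta' n)
    hAA
    (fun n => by rw [reassoc_of% (hAA n)])
    (fun n => by rw [A_chi, assoc, Aq_Aq])
    (fun n => by rw [Linear.comp_smul, reassoc_of% (M.Aq_Aq n)])
    (fun n => by rw [Linear.smul_comp, assoc, assoc, hAA])
    (fun n => by rw [← M.q.map_comp, reassoc_of% (M.A_A (n + 1))])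
    (fun n => by rw [← M.q.map_comp, assoc, A_D_A])
    (fun n => by rw [← M.q.map_comp, assoc, reassoc_of% (M.A_D_A (n + 1)), A_D_D,
      Functor.map_zero])
    (by rw [assoc, reassoc_of% (M.chi_chi'_zero (M.W 0)), hAA])
    (fun n => by
      have h := M.A_chi_chi'_A n
      rw [Linear.comp_smul, Aq_beta_A, assoc (M.q.map _) (M.beta' n), ← h]
      simp only [sub_comp, comp_sub, id_comp, assoc, hAA]
      abel)
    (fun n => by
      rw [Linear.smul_comp, assoc, assoc, reassoc_of% (hAA (n + 1)), A_chi,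
        reassoc_of% (M.beta_chi n), zero_comp, comp_zero, smul_zero])
    (fun n => by
      rw [M.q.map_comp, Linear.smul_comp]
      simp only [assoc]
      rw [reassoc_of% (hAA (n + 1)), ← M.q.map_comp_assoc (M.D n), ← M.q.map_comp_assoc (M.A (n + 1)),
        A_D_A, M.q.map_comp_assoc, Aq_beta_A_D_chi])
  refine ⟨fun n => (M.q.map (M.A n) ≫ M.chi n _) ≫
    (((n + 1 : ℕ) : k) • (M.Aq n ≫ M.beta n ≫ M.q.map (M.A (n + 1)))), fun n => ?_, fun n => ?_, h1, h2⟩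
  · simp only [assoc]
    rw [reassoc_of% (hAA n)]
  · simp only [assoc, Linear.smul_comp, Linear.comp_smul, hAA]

end HeisAct
end

noncomputable section

namespace HeisAct

variable {k : Type*} [Field k] {C : Type*} [Category C] [Preadditive C] [Linear k C] (M : HeisAct k C)

theorem y_eq' (Z : C) : M.y Z = M.p.map (M.q.map (M.f Z)) ≫ M.p.map (M.t (M.p.obj Z)) ≫
    M.c (M.q.obj (M.p.obj Z)) := by
  rw [M.pt_c, reassoc_of% (M.y_nat (M.f Z)), ← M.q.map_comp, M.pf_c]
  simp

theorem s_eq (Z : C) : M.s Z = M.p.map (M.p.map (M.f Z)) ≫ M.p.map (M.y (M.p.obj Z)) ≫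
    M.c (M.p.obj (M.p.obj Z)) := by
  rw [M.py_c, reassoc_of% (M.s_nat (M.f Z)), ← M.p.map_comp, M.pf_c]
  simp

theorem x_eq' (Z : C) : M.x Z = M.d (M.q.obj (M.p.obj Z)) ≫ M.p.map (M.t (M.p.obj Z)) ≫
    M.p.map (M.q.map (M.e Z)) :=
  congrArg Quiver.Hom.unop ((M.op.y_eq' (Opposite.op Z)).trans (assoc _ _ _).symm)

theorem s_eq' (Z : C) : M.s Z = M.d (M.p.obj (M.p.obj Z)) ≫ M.p.map (M.x (M.p.obj Z)) ≫
    M.p.map (M.p.map (M.e Z)) :=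
  congrArg Quiver.Hom.unop ((M.op.s_eq (Opposite.op Z)).trans (assoc _ _ _).symm)

end HeisAct

theorem comp_id_map_id {C : Type*} [Category C] (F : C ⥤ C) {X : C} (f : F.obj X ⟶ F.obj X) :
    f ≫ 𝟙 _ ≫ F.map (𝟙 X) = 𝟙 _ ≫ F.map (𝟙 X) ≫ f := by simp

namespace Heis

open Equiv CoxeterRel

variable (k : Type u) [Field k]

/-- The sideways crossing `PQ → QP`. -/
def crossPQ : (P : Heis k) ⊗ Q ⟶ Q ⊗ P := mk Diag.crossPQ

/-- The sideways crossing `QP → PQ`. -/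
def crossQP : (Q : Heis k) ⊗ P ⟶ P ⊗ Q := mk Diag.crossQP

/-- The cap `QP → 1`. -/
def capQP : (Q : Heis k) ⊗ P ⟶ 𝟙_ (Heis k) := mk Diag.capQP

/-- The cup `1 → QP`. -/
def cupQP : 𝟙_ (Heis k) ⟶ (Q : Heis k) ⊗ P := mk Diag.cupQP

variable {k}

/-- A diagram on the two leftmost strands. -/
def onFirst {A B A' B' : Heis k} (f : A ⊗ B ⟶ A' ⊗ B') (Z : Heis k) :
    A ⊗ (B ⊗ Z) ⟶ A' ⊗ (B' ⊗ Z) :=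
  (α_ A B Z).inv ≫ f ▷ Z ≫ (α_ A' B' Z).hom

/-- A diagram on the two rightmost strands. -/
def onLast {A B A' B' : Heis k} (f : A ⊗ B ⟶ A' ⊗ B') (Z : Heis k) :
    (Z ⊗ A) ⊗ B ⟶ (Z ⊗ A') ⊗ B' :=
  (α_ Z A B).hom ≫ Z ◁ f ≫ (α_ Z A' B').inv

/-- A cap on the left. -/
def capFirst {A B : Heis k} (f : A ⊗ B ⟶ 𝟙_ (Heis k)) (Z : Heis k) : A ⊗ (B ⊗ Z) ⟶ Z :=
  (α_ A B Z).inv ≫ f ▷ Z ≫ (λ_ Z).hom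

/-- A cup on the left. -/
def cupFirst {A B : Heis k} (f : 𝟙_ (Heis k) ⟶ A ⊗ B) (Z : Heis k) : Z ⟶ A ⊗ (B ⊗ Z) :=
  (λ_ Z).inv ≫ f ▷ Z ≫ (α_ A B Z).hom

/-- A cap on the right. -/
def capLast {A B : Heis k} (f : A ⊗ B ⟶ 𝟙_ (Heis k)) (Z : Heis k) : (Z ⊗ A) ⊗ B ⟶ Z :=
  (α_ Z A B).hom ≫ Z ◁ f ≫ (ρ_ Z).hom

/-- A cup on the right. -/
def cupLast {A B : Heis k} (f : 𝟙_ (Heis k) ⟶ A ⊗ B) (Z : Heis k) : Z ⟶ (Z ⊗ A) ⊗ B :=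
  (ρ_ Z).inv ≫ Z ◁ f ≫ (α_ Z A B).inv

theorem onFirst_nat {A B A' B' : Heis k} (f : A ⊗ B ⟶ A' ⊗ B') {Z Z' : Heis k} (g : Z ⟶ Z') :
    A ◁ B ◁ g ≫ onFirst f Z' = onFirst f Z ≫ A' ◁ B' ◁ g := by
  rw [onFirst, onFirst, associator_inv_naturality_right_assoc, whisker_exchange_assoc]
  simp only [assoc, associator_naturality_right]

theorem onLast_nat {A B A' B' : Heis k} (f : A ⊗ B ⟶ A' ⊗ B') {Z Z' : Heis k} (g : Z ⟶ Z') :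
    g ▷ A ▷ B ≫ onLast f Z' = onLast f Z ≫ g ▷ A' ▷ B' := by
  rw [onLast, onLast, associator_naturality_left_assoc, ← whisker_exchange_assoc]
  simp only [assoc, associator_inv_naturality_left]

theorem capFirst_nat {A B : Heis k} (f : A ⊗ B ⟶ 𝟙_ (Heis k)) {Z Z' : Heis k} (g : Z ⟶ Z') :
    A ◁ B ◁ g ≫ capFirst f Z' = capFirst f Z ≫ g := by
  rw [capFirst, capFirst, associator_inv_naturality_right_assoc, whisker_exchange_assoc]
  simp only [assoc, leftUnitor_naturality]

theorem capLast_nat {A B : Heis k} (f : A ⊗ B ⟶ 𝟙_ (Heis k)) {Z Z' : Heis k} (g : Z ⟶ Z') :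
    g ▷ A ▷ B ≫ capLast f Z' = capLast f Z ≫ g := by
  rw [capLast, capLast, associator_naturality_left_assoc, ← whisker_exchange_assoc]
  simp only [assoc, rightUnitor_naturality]

theorem cupFirst_nat {A B : Heis k} (f : 𝟙_ (Heis k) ⟶ A ⊗ B) {Z Z' : Heis k} (g : Z ⟶ Z') :
    g ≫ cupFirst f Z' = cupFirst f Z ≫ A ◁ B ◁ g := by
  rw [cupFirst, cupFirst, leftUnitor_inv_naturality_assoc, whisker_exchange_assoc]
  simp only [assoc, associator_naturality_right]

theorem cupLast_nat {A B : Heis k} (f : 𝟙_ (Heis k) ⟶ A ⊗ B) {Z Z' : Heis k} (g : Z ⟶ Z') :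
    g ≫ cupLast f Z' = cupLast f Z ≫ g ▷ A ▷ B := by
  rw [cupLast, cupLast, rightUnitor_inv_naturality_assoc, ← whisker_exchange_assoc]
  simp only [assoc, associator_inv_naturality_left]

variable (k)

theorem zigzag₁ : (ρ_ (P : Heis k)).inv ≫ P ◁ cupQP k ≫ (α_ P Q P).inv ≫ capPQ k ▷ P ≫
    (λ_ P).hom = 𝟙 _ := Quotient.sound Rel.zigzag₁

theorem zigzag₂ : (λ_ (P : Heis k)).inv ≫ cupPQ k ▷ P ≫ (α_ P Q P).hom ≫ P ◁ capQP k ≫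
    (ρ_ P).hom = 𝟙 _ := Quotient.sound Rel.zigzag₂

theorem zigzag₃ : (ρ_ (Q : Heis k)).inv ≫ Q ◁ cupPQ k ≫ (α_ Q P Q).inv ≫ capQP k ▷ Q ≫
    (λ_ Q).hom = 𝟙 _ := Quotient.sound Rel.zigzag₃

theorem zigzag₄ : (λ_ (Q : Heis k)).inv ≫ cupQP k ▷ Q ≫ (α_ Q P Q).hom ≫ Q ◁ capPQ k ≫
    (ρ_ Q).hom = 𝟙 _ := Quotient.sound Rel.zigzag₄

variable {k}

/-- Rotation of a morphism. -/
def rotateCW {Y Z : Heis k} (f : P ⊗ Y ⟶ Z ⊗ P) : Y ⊗ Q ⟶ Q ⊗ Z :=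
  (λ_ _).inv ≫ cupQP k ▷ (Y ⊗ Q) ≫ (((α_ Q P (Y ⊗ Q)).hom ≫ Q ◁ (α_ P Y Q).inv) ≫ Q ◁ (f ▷ Q) ≫
    (Q ◁ (α_ Z P Q).hom ≫ (α_ Q Z (P ⊗ Q)).inv)) ≫ (Q ⊗ Z) ◁ capPQ k ≫ (ρ_ _).hom

/-- Rotation of a morphism in the other direction. -/
def rotateCCW {X W : Heis k} (f : X ⊗ P ⟶ P ⊗ W) : Q ⊗ X ⟶ W ⊗ Q :=
  (ρ_ _).inv ≫ (Q ⊗ X) ◁ cupPQ k ≫ (((α_ Q X (P ⊗ Q)).hom ≫ Q ◁ (α_ X P Q).inv) ≫ Q ◁ (f ▷ Q) ≫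
    (Q ◁ (α_ P W Q).hom ≫ (α_ Q P (W ⊗ Q)).inv)) ≫ capQP k ▷ (W ⊗ Q) ≫ (λ_ _).hom

variable (k)

theorem crossPQ_eq : crossPQ k = rotateCW (crossP k) := rfl

theorem crossQP_eq : crossQP k = rotateCCW (crossP k) := rfl

theorem crossQ_eq : crossQ k = rotateCW (crossPQ k) := rfl

theorem crossQ_eq' : crossQ k = rotateCCW (crossQP k) := Quotient.sound Rel.rotate

theorem crossPQ_crossQP : crossPQ k ≫ crossQP k = 𝟙 _ := Quotient.sound Rel.up_down

theorem crossQP_crossPQ_add : crossQP k ≫ crossPQ k + capQP k ≫ cupQP k = 𝟙 _ := by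
  have h : crossQP k ≫ crossPQ k = 𝟙 _ + (-1 : k) • (capQP k ≫ cupQP k) := Quotient.sound Rel.down_up
  rw [h, neg_smul, one_smul, neg_add_cancel_right]

theorem cupQP_capQP : cupQP k ≫ capQP k = 𝟙 _ := Quotient.sound Rel.bubble

theorem permP_adj (n i : ℕ) (h : i + 1 < n) : permP k n (adj n i) = strandR (crossP k) n i :=
  hom_adj _ i h

theorem permQ_adj (n i : ℕ) (h : i + 1 < n) : permQ k n (adj n i) = strandL (crossQ k) n i :=
  hom_adj _ i h

theorem permP_extLast (n : ℕ) (w : Perm (Fin n)) :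
    permP k (n + 1) (extLast n w) = permP k n w ▷ P := by
  have h : (permP k (n + 1)).comp (extLast n) = (addR P n).comp (permP k n) := by
    refine MonoidHom.eq_of_eqOn_denseM (closure_adj n) ?_
    rintro _ ⟨i, hi, rfl⟩
    have hi' : i + 1 < n := hi
    obtain ⟨m, rfl⟩ : ∃ m, n = m + 1 := ⟨n - 1, by omega⟩
    rw [MonoidHom.comp_apply, MonoidHom.comp_apply, extLast_adj _ _ hi, permP_adj _ _ _ hi,
      permP_adj _ _ _ (by omega), strandR_of_ne (by omega)]
  exact DFunLike.congr_fun h w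

theorem permQ_extFirst (n : ℕ) (w : Perm (Fin n)) :
    permQ k (n + 1) (extFirst n w) = Q ◁ permQ k n w := by
  have h : (permQ k (n + 1)).comp (extFirst n) = (addL Q n).comp (permQ k n) := by
    refine MonoidHom.eq_of_eqOn_denseM (closure_adj n) ?_
    rintro _ ⟨i, hi, rfl⟩
    have hi' : i + 1 < n := hi
    obtain ⟨m, rfl⟩ : ∃ m, n = m + 1 := ⟨n - 1, by omega⟩
    rw [MonoidHom.comp_apply, MonoidHom.comp_apply, extFirst_adj _ _ hi, permQ_adj _ _ _ hi,
      permQ_adj _ _ _ (by omega)]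
    rfl
  exact DFunLike.congr_fun h w

instance : MonoidalLinear k (Heis k) where
  whiskerLeft_smul X _ _ r f := by
    obtain ⟨f⟩ := f
    exact Quotient.sound (Rel.ten_smul r _ f)
  smul_whiskerRight r _ _ f X := by
    obtain ⟨f⟩ := f
    exact Quotient.sound (Rel.smul_ten r f _)

theorem up_braid : (α_ (P : Heis k) P P).inv ≫ crossP k ▷ P ≫ (α_ P P P).hom ≫ P ◁ crossP k ≫
    (α_ P P P).inv ≫ crossP k ▷ P ≫ (α_ P P P).hom =
    P ◁ crossP k ≫ (α_ P P P).inv ≫ crossP k ▷ P ≫ (α_ P P P).hom ≫ P ◁ crossP k := by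
  have h := (crossP_symmetry k).braid
  simpa only [firstTwo, assoc] using h

theorem down_braid : (α_ (Q : Heis k) Q Q).inv ≫ crossQ k ▷ Q ≫ (α_ Q Q Q).hom ≫ Q ◁ crossQ k ≫
    (α_ Q Q Q).inv ≫ crossQ k ▷ Q ≫ (α_ Q Q Q).hom =
    Q ◁ crossQ k ≫ (α_ Q Q Q).inv ≫ crossQ k ▷ Q ≫ (α_ Q Q Q).hom ≫ Q ◁ crossQ k := by
  have h := (crossQ_symmetry k).braid
  simpa only [firstTwo, assoc] using h

/-- The action of Khovanov's category on itself from the left. -/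
def leftAct : HeisAct k (Heis k) where
  p := tensorLeft P
  q := tensorLeft Q
  s := onFirst (crossP k)
  t := onFirst (crossQ k)
  x := onFirst (crossQP k)
  y := onFirst (crossPQ k)
  c := capFirst (capPQ k)
  d := cupFirst (cupPQ k)
  e := capFirst (capQP k)
  f := cupFirst (cupQP k)
  s_nat g := onFirst_nat _ g
  x_nat g := onFirst_nat _ g
  y_nat g := onFirst_nat _ g
  c_nat g := capFirst_nat _ g
  d_nat g := cupFirst_nat _ g
  e_nat g := capFirst_nat _ g
  f_nat g := cupFirst_nat _ g
  pf_c Z := by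
    refine Eq.trans ?_ ((congrArg (· ▷ Z) (zigzag₁ k)).trans (id_whiskerRight _ _))
    dsimp [cupFirst, capFirst]
    monoidal
  f_qc Z := by
    refine Eq.trans ?_ ((congrArg (· ▷ Z) (zigzag₄ k)).trans (id_whiskerRight _ _))
    dsimp [cupFirst, capFirst]
    monoidal
  d_pe Z := by
    refine Eq.trans ?_ ((congrArg (· ▷ Z) (zigzag₂ k)).trans (id_whiskerRight _ _))
    dsimp [cupFirst, capFirst]
    monoidal
  qd_e Z := by
    refine Eq.trans ?_ ((congrArg (· ▷ Z) (zigzag₃ k)).trans (id_whiskerRight _ _))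
    dsimp [cupFirst, capFirst]
    monoidal
  y_eq Z := by
    rw [crossPQ_eq]
    dsimp [onFirst, rotateCW, cupFirst, capFirst]
    monoidal
  x_eq Z := by
    rw [crossQP_eq]
    dsimp [onFirst, rotateCCW, cupFirst, capFirst]
    monoidal
  t_eq Z := by
    rw [crossQ_eq]
    dsimp [onFirst, rotateCW, cupFirst, capFirst]
    monoidal
  t_eq' Z := by
    rw [crossQ_eq']
    dsimp [onFirst, rotateCCW, cupFirst, capFirst]
    monoidal
  s_sq Z := by
    simp only [onFirst, assoc, Iso.hom_inv_id_assoc]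
    rw [← comp_whiskerRight_assoc, (crossP_symmetry k).sq]
    simp
  s_braid Z := by
    have h := congrArg (fun f => (α_ P P (P ⊗ Z)).inv ≫ (α_ (P ⊗ P) P Z).inv ≫ (α_ P P P).hom ▷ Z ≫
      f ▷ Z ≫ (α_ P (P ⊗ P) Z).hom ≫ P ◁ (α_ P P Z).hom) (up_braid k)
    refine Eq.trans ?_ (h.trans ?_) <;>
    · dsimp [onFirst]
      monoidal
  y_x Z := by
    simp only [onFirst, assoc, Iso.hom_inv_id_assoc]
    rw [← comp_whiskerRight_assoc, crossPQ_crossQP]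
    simp
  x_y Z := by
    simp only [onFirst, capFirst, cupFirst, assoc, Iso.hom_inv_id_assoc]
    rw [← comp_whiskerRight_assoc, ← comp_whiskerRight_assoc, ← comp_add,
      ← add_comp, ← MonoidalPreadditive.add_whiskerRight, crossQP_crossPQ_add]
    simp
  f_e Z := by
    simp only [capFirst, cupFirst, assoc, Iso.hom_inv_id_assoc]
    rw [← comp_whiskerRight_assoc, cupQP_capQP]
    simp
  pw n := tensorLeft (powR P n)
  a₀ Z := λ_ Z
  a n Z := α_ (powR P n) P Z
  a₀_nat g := leftUnitor_naturality g
  a_nat n _ _ g := associator_naturality_right _ _ g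
  W := powL Q
  b n := Iso.refl _
  ρ n :=
    { toFun w := { app Z := permP k n w ▷ Z, naturality _ _ g := whisker_exchange _ g }
      map_one' := NatTrans.ext (funext fun Z => by simp)
      map_mul' v w := NatTrans.ext (funext fun Z => by
        rw [map_mul]
        exact comp_whiskerRight _ _ _) }
  τ := permQ k
  ρ_ext n w Z := by
    change permP k (n + 1) (extLast n w) ▷ Z ≫ (α_ (powR P n) P Z).hom = _
    rw [permP_extLast]
    exact associator_naturality_left _ _ _
  ρ_adj n Z := by
    change permP k (n + 2) (adj (n + 2) n) ▷ Z ≫ (α_ (powR P n ⊗ P) P Z).hom ≫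
      (α_ (powR P n) P (P ⊗ Z)).hom = (α_ (powR P n ⊗ P) P Z).hom ≫
      (α_ (powR P n) P (P ⊗ Z)).hom ≫ powR P n ◁ onFirst (crossP k) Z
    rw [permP_adj _ _ _ (by omega), strandR_last]
    dsimp only [lastTwo, onFirst]
    monoidal
  τ_ext n w := by
    rw [permQ_extFirst]
    exact (comp_id _).trans (id_comp _).symm
  τ_adj n := by
    rw [permQ_adj _ _ _ (by omega)]
    exact comp_id_map_id (tensorLeft Q) (X := powL Q (n + 1)) (firstTwo (crossQ k) (powL Q n))
  q_additive := inferInstance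
  q_linear := inferInstance
  pw_additive _ := inferInstance

theorem onLast_eq {A B A' B' : Heis k} (f : A ⊗ B ⟶ A' ⊗ B') (Z : Heis k) :
    onLast f Z = ((α_ Z A B).hom ≫ Z ◁ A ◁ (ρ_ B).inv) ≫ Z ◁ onFirst f (𝟙_ _) ≫
      Z ◁ A' ◁ (ρ_ B').hom ≫ (α_ Z A' B').inv := by
  dsimp only [onLast, onFirst]
  monoidal

/-- The action of Khovanov's category on itself from the right. -/
def rightAct : HeisAct k (Heis k) where
  p := tensorRight Q
  q := tensorRight P
  s := onLast (crossQ k)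
  t := onLast (crossP k)
  x := onLast (crossQP k)
  y := onLast (crossPQ k)
  c := capLast (capPQ k)
  d := cupLast (cupPQ k)
  e := capLast (capQP k)
  f := cupLast (cupQP k)
  s_nat g := onLast_nat _ g
  x_nat g := onLast_nat _ g
  y_nat g := onLast_nat _ g
  c_nat g := capLast_nat _ g
  d_nat g := cupLast_nat _ g
  e_nat g := capLast_nat _ g
  f_nat g := cupLast_nat _ g
  pf_c Z := by
    refine Eq.trans ?_ ((congrArg (Z ◁ ·) (zigzag₄ k)).trans (whiskerLeft_id _ _))
    dsimp [cupLast, capLast]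
    monoidal
  f_qc Z := by
    refine Eq.trans ?_ ((congrArg (Z ◁ ·) (zigzag₁ k)).trans (whiskerLeft_id _ _))
    dsimp [cupLast, capLast]
    monoidal
  d_pe Z := by
    refine Eq.trans ?_ ((congrArg (Z ◁ ·) (zigzag₃ k)).trans (whiskerLeft_id _ _))
    dsimp [cupLast, capLast]
    monoidal
  qd_e Z := by
    refine Eq.trans ?_ ((congrArg (Z ◁ ·) (zigzag₂ k)).trans (whiskerLeft_id _ _))
    dsimp [cupLast, capLast]
    monoidal
  y_eq Z := by
    have h : onFirst (crossPQ k) (𝟙_ _) = _ := (leftAct k).y_eq' (𝟙_ _)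
    rw [onLast_eq, h]
    dsimp [leftAct, onFirst, onLast, cupLast, capLast, cupFirst, capFirst]
    monoidal
  x_eq Z := by
    have h : onFirst (crossQP k) (𝟙_ _) = _ := (leftAct k).x_eq' (𝟙_ _)
    rw [onLast_eq, h]
    dsimp [leftAct, onFirst, onLast, cupLast, capLast, cupFirst, capFirst]
    monoidal
  t_eq Z := by
    have h : onFirst (crossP k) (𝟙_ _) = _ := (leftAct k).s_eq (𝟙_ _)
    rw [onLast_eq, h]
    dsimp [leftAct, onFirst, onLast, cupLast, capLast, cupFirst, capFirst]
    monoidal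
  t_eq' Z := by
    have h : onFirst (crossP k) (𝟙_ _) = _ := (leftAct k).s_eq' (𝟙_ _)
    rw [onLast_eq, h]
    dsimp [leftAct, onFirst, onLast, cupLast, capLast, cupFirst, capFirst]
    monoidal
  s_sq Z := by
    simp only [onLast, assoc, Iso.inv_hom_id_assoc]
    rw [← whiskerLeft_comp_assoc, (crossQ_symmetry k).sq]
    simp
  s_braid Z := by
    have h := congrArg (fun f => (α_ (Z ⊗ Q) Q Q).hom ≫ (α_ Z Q (Q ⊗ Q)).hom ≫
      Z ◁ f ≫ (α_ Z Q (Q ⊗ Q)).inv ≫ (α_ (Z ⊗ Q) Q Q).inv) (down_braid k)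
    refine Eq.trans ?_ (h.symm.trans ?_) <;>
    · dsimp [onLast]
      monoidal
  y_x Z := by
    simp only [onLast, assoc, Iso.inv_hom_id_assoc]
    rw [← whiskerLeft_comp_assoc, crossPQ_crossQP]
    simp
  x_y Z := by
    simp only [onLast, capLast, cupLast, assoc, Iso.inv_hom_id_assoc, Iso.hom_inv_id_assoc]
    rw [← whiskerLeft_comp_assoc, ← whiskerLeft_comp_assoc, ← comp_add,
      ← add_comp, ← MonoidalPreadditive.whiskerLeft_add, crossQP_crossPQ_add]
    simp
  f_e Z := by
    simp only [capLast, cupLast, assoc, Iso.inv_hom_id_assoc]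
    rw [← whiskerLeft_comp_assoc, cupQP_capQP]
    simp
  pw n := tensorRight (powL Q n)
  a₀ Z := ρ_ Z
  a n Z := (α_ Z Q (powL Q n)).symm
  a₀_nat g := rightUnitor_naturality g
  a_nat n _ _ g := associator_inv_naturality_left g _ _
  W := powR P
  b n := Iso.refl _
  ρ n :=
    { toFun w :=
        { app Z := Z ◁ permQ k n (flipPerm n w)
          naturality _ _ g := (whisker_exchange g _).symm }
      map_one' := NatTrans.ext (funext fun Z => by simp)
      map_mul' v w := NatTrans.ext (funext fun Z => by
        rw [map_mul, map_mul]
        exact whiskerLeft_comp _ _ _) }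
  τ n := (permP k n).comp (flipPerm n)
  ρ_ext n w Z := by
    change Z ◁ permQ k (n + 1) (flipPerm (n + 1) (extLast n w)) ≫ (α_ Z Q (powL Q n)).inv = _
    rw [flipPerm_extLast, permQ_extFirst]
    exact associator_inv_naturality_right _ _ _
  ρ_adj n Z := by
    change Z ◁ permQ k (n + 2) (flipPerm (n + 2) (adj (n + 2) n)) ≫ (α_ Z Q (Q ⊗ powL Q n)).inv ≫
      (α_ (Z ⊗ Q) Q (powL Q n)).inv = (α_ Z Q (Q ⊗ powL Q n)).inv ≫
      (α_ (Z ⊗ Q) Q (powL Q n)).inv ≫ onLast (crossQ k) Z ▷ powL Q n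
    rw [flipPerm_adj _ _ (by omega), permQ_adj _ _ _ (by omega), 
      show n + 2 - 2 - n = 0 by omega]
    dsimp only [strandL, firstTwo, onLast]
    monoidal
  τ_ext n w := by
    rw [MonoidHom.comp_apply, ← flipPerm_flipPerm n w, ← flipPerm_extLast, flipPerm_flipPerm,
      permP_extLast, MonoidHom.comp_apply, flipPerm_flipPerm]
    exact (comp_id _).trans (id_comp _).symm
  τ_adj n := by
    rw [MonoidHom.comp_apply, flipPerm_adj _ _ (by omega), permP_adj _ _ _ (by omega),
      show n + 2 - 2 - 0 = n by omega, strandR_last]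
    exact comp_id_map_id (tensorRight P) (X := powR P (n + 1)) (lastTwo (crossP k) (powR P n))
  q_additive := inferInstance
  q_linear := inferInstance
  pw_additive _ := inferInstance

end Heis
end

noncomputable section

namespace HeisAct

open Equiv

variable {k : Type*} [Field k] {C : Type*} [Category C] [Preadditive C] [Linear k C] (M : HeisAct k C)

theorem op_br (n : ℕ) (w : Perm (Fin n)) : M.op.br n w = (M.br n w⁻¹).op := by
  have h : M.br n w⁻¹ = (Perm.sign w : ℤ) • ((M.pw n).map (M.τ n (flipPerm n w)⁻¹) ≫
      (M.ρ n w⁻¹).app (M.W n)) := by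
    rw [br, Perm.sign_inv, NatTrans.naturality, map_inv (flipPerm n)]
  rw [h]
  rfl

theorem op_A (n : ℕ) : M.op.A n = (M.A n).op := by
  have h : M.A n = ((n.factorial : k)⁻¹) • ∑ w, M.br n w⁻¹ :=
    congrArg (_ • ·) (Equiv.sum_comp (Equiv.inv _) (M.br n)).symm
  rw [h, A]
  simp only [op_br]
  refine congrArg (_ • ·) ?_
  exact (op_sum _ _ _ _).symm

end HeisAct

namespace Heis

open Equiv CoxeterRel

variable (k : Type u) [Field k]

/-- `n` upward strands followed by `n` downward strands. -/
abbrev strands (n : ℕ) : Heis k := powR P n ⊗ powL Q n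

/-- The antisymmetrizer on upward and downward strands. -/
def antisym (n : ℕ) : strands k n ⟶ strands k n :=
  ((n.factorial : k)⁻¹) • ∑ w : Perm (Fin n), (Perm.sign w : ℤ) •
    (permP k n w ⊗ₘ permQ k n (flipPerm n w))

/-- Joining the innermost strands by a cap. -/
def innerCap (n : ℕ) : strands k (n + 1) ⟶ strands k n := Heisenberg.midCap (powR P n) (powL Q n)

/-- Joining the innermost strands by a cup. -/
def innerCup (n : ℕ) : strands k n ⟶ strands k (n + 1) := Heisenberg.midCup (powR P n) (powL Q n)

theorem leftAct_A (n : ℕ) : (leftAct k).A n = antisym k n := by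
  refine congrArg (_ • ·) (Finset.sum_congr rfl fun w _ => ?_)
  exact congrArg (_ • ·) (MonoidalCategory.tensorHom_def _ _).symm

theorem rightAct_A (n : ℕ) : (rightAct k).A n = antisym k n := by
  refine congrArg (_ • ·) (Finset.sum_congr rfl fun w _ => ?_)
  refine congrArg (_ • ·) (Eq.trans ?_ (MonoidalCategory.tensorHom_def' _ _).symm)
  change powR P n ◁ permQ k n (flipPerm n w) ≫ permP k n (flipPerm n (flipPerm n w)) ▷ powL Q n = _
  rw [flipPerm_flipPerm]
  rfl

theorem leftAct_D (n : ℕ) : (leftAct k).D n = innerCap k n :=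
  (congrArg (· ≫ _) (whiskerLeft_id (powR P (n + 1)) (powL Q (n + 1)))).trans (id_comp _)

theorem leftAct_op_D (n : ℕ) : (leftAct k).op.D n = (innerCup k n).op :=
  congrArg Quiver.Hom.op ((congrArg (_ ≫ ·) (whiskerLeft_id (powR P (n + 1)) (powL Q (n + 1)))).trans
    (comp_id _))

theorem rightAct_D (n : ℕ) : (rightAct k).D n = innerCap k n := by
  refine ((congrArg (· ≫ _) (id_whiskerRight (powR P (n + 1)) (powL Q (n + 1)))).trans
    (id_comp _)).trans ?_
  change (α_ (powR P n ⊗ P) Q (powL Q n)).inv ≫ capLast (capPQ k) (powR P n) ▷ powL Q n = _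
  dsimp only [capLast, innerCap, Heisenberg.midCap]
  monoidal

theorem rightAct_op_D (n : ℕ) : (rightAct k).op.D n = (innerCup k n).op := by
  refine congrArg Quiver.Hom.op (((congrArg (_ ≫ ·)
    (id_whiskerRight (powR P (n + 1)) (powL Q (n + 1)))).trans (comp_id _)).trans ?_)
  change cupLast (cupPQ k) (powR P n) ▷ powL Q n ≫ (α_ (powR P n ⊗ P) Q (powL Q n)).hom = _
  dsimp only [cupLast, innerCup, Heisenberg.midCup]
  monoidal

theorem leftAct_op_A (n : ℕ) : (leftAct k).op.A n = (antisym k n).op := by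
  rw [HeisAct.op_A, leftAct_A]
  rfl

theorem rightAct_op_A (n : ℕ) : (rightAct k).op.A n = (antisym k n).op := by
  rw [HeisAct.op_A, rightAct_A]
  rfl

variable [CharZero k]

theorem antisym_innerCap (n : ℕ) : antisym k (n + 1) ≫ innerCap k n ≫ antisym k n =
    antisym k (n + 1) ≫ innerCap k n := by
  have h := (leftAct k).A_D_A n
  simp only [leftAct_A, leftAct_D] at h
  exact h

theorem antisym_innerCap_innerCap (n : ℕ) :
    antisym k (n + 2) ≫ innerCap k (n + 1) ≫ innerCap k n = 0 := by
  have h := (leftAct k).A_D_D n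
  simp only [leftAct_A, leftAct_D] at h
  exact h

theorem innerCup_antisym (n : ℕ) : antisym k n ≫ innerCup k n ≫ antisym k (n + 1) =
    innerCup k n ≫ antisym k (n + 1) := by
  have h := (leftAct k).op.A_D_A n
  simp only [leftAct_op_A, leftAct_op_D] at h
  exact (assoc _ _ _).symm.trans (congrArg Quiver.Hom.unop h)

theorem innerCup_innerCup_antisym (n : ℕ) :
    innerCup k n ≫ innerCup k (n + 1) ≫ antisym k (n + 2) = 0 := by
  have h := (leftAct k).op.A_D_D n
  simp only [leftAct_op_A, leftAct_op_D] at h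
  exact (assoc _ _ _).symm.trans (congrArg Quiver.Hom.unop h)

theorem exists_contraction_cap_left : ∃ H : ∀ n, (Q ⊗ strands k n ⟶ Q ⊗ strands k (n + 1)),
    (∀ n, Q ◁ antisym k n ≫ H n = H n) ∧
    H 0 ≫ Q ◁ (antisym k 1 ≫ innerCap k 0) = Q ◁ antisym k 0 ∧
    ∀ n, H (n + 1) ≫ Q ◁ (antisym k (n + 2) ≫ innerCap k (n + 1)) +
      Q ◁ (antisym k (n + 1) ≫ innerCap k n) ≫ H n = Q ◁ antisym k (n + 1) := by
  obtain ⟨H, h1, -, h3, h4⟩ := (leftAct k).exists_contraction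
  simp only [leftAct_A, leftAct_D] at h1 h3 h4
  exact ⟨H, h1, h3, h4⟩

theorem exists_contraction_cap_right : ∃ H : ∀ n, (strands k n ⊗ P ⟶ strands k (n + 1) ⊗ P),
    (∀ n, antisym k n ▷ P ≫ H n = H n) ∧
    H 0 ≫ (antisym k 1 ≫ innerCap k 0) ▷ P = antisym k 0 ▷ P ∧
    ∀ n, H (n + 1) ≫ (antisym k (n + 2) ≫ innerCap k (n + 1)) ▷ P +
      (antisym k (n + 1) ≫ innerCap k n) ▷ P ≫ H n = antisym k (n + 1) ▷ P := by
  obtain ⟨H, h1, -, h3, h4⟩ := (rightAct k).exists_contraction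
  simp only [rightAct_A, rightAct_D] at h1 h3 h4
  exact ⟨H, h1, h3, h4⟩

theorem exists_contraction_cup_left : ∃ H : ∀ n, (Q ⊗ strands k (n + 1) ⟶ Q ⊗ strands k n),
    (∀ n, H n ≫ Q ◁ antisym k n = H n) ∧
    Q ◁ (innerCup k 0 ≫ antisym k 1) ≫ H 0 = Q ◁ antisym k 0 ∧
    ∀ n, Q ◁ (innerCup k (n + 1) ≫ antisym k (n + 2)) ≫ H (n + 1) +
      H n ≫ Q ◁ (innerCup k n ≫ antisym k (n + 1)) = Q ◁ antisym k (n + 1) := by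
  obtain ⟨H, h1, -, h3, h4⟩ := (leftAct k).op.exists_contraction
  simp only [leftAct_op_A, leftAct_op_D] at h1 h3 h4
  exact ⟨fun n => (H n).unop, fun n => congrArg Quiver.Hom.unop (h1 n),
    congrArg Quiver.Hom.unop h3,
    fun n => congrArg Quiver.Hom.unop (h4 n)⟩

theorem exists_contraction_cup_right : ∃ H : ∀ n, (strands k (n + 1) ⊗ P ⟶ strands k n ⊗ P),
    (∀ n, H n ≫ antisym k n ▷ P = H n) ∧
    (innerCup k 0 ≫ antisym k 1) ▷ P ≫ H 0 = antisym k 0 ▷ P ∧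
    ∀ n, (innerCup k (n + 1) ≫ antisym k (n + 2)) ▷ P ≫ H (n + 1) +
      H n ≫ (innerCup k n ≫ antisym k (n + 1)) ▷ P = antisym k (n + 1) ▷ P := by
  obtain ⟨H, h1, -, h3, h4⟩ := (rightAct k).op.exists_contraction
  simp only [rightAct_op_A, rightAct_op_D] at h1 h3 h4
  exact ⟨fun n => (H n).unop, fun n => congrArg Quiver.Hom.unop (h1 n),
    congrArg Quiver.Hom.unop h3,
    fun n => congrArg Quiver.Hom.unop (h4 n)⟩

end Heis
end

noncomputable section

section DiagonalAverage

open MonoidAlgebra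

variable {k G E : Type*} [Field k] [Group G] [Fintype G] [Ring E] [Algebra k E]
  (L R : MonoidAlgebra k G →ₐ[k] E)

/-- The average of the diagonal action of a finite group. -/
def diagAvg : E := (Fintype.card G : k)⁻¹ • ∑ w : G, L (single w 1) * R (single w 1)

variable {L R}

theorem single_one_mul_single_one (v w : G) :
    (single v 1 * single w 1 : MonoidAlgebra k G) = single (v * w) 1 := by
  rw [single_mul_single, one_mul]

theorem mul_diagAvg (hLR : ∀ x y, L x * R y = R y * L x)
    (w : G) : L (single w 1) * R (single w 1) * diagAvg L R = diagAvg L R := by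
  rw [diagAvg, mul_smul_comm, Finset.mul_sum]
  refine congrArg (_ • ·) (Fintype.sum_equiv (Equiv.mulLeft w) _ _ fun v => ?_)
  rw [Equiv.coe_mulLeft, ← single_one_mul_single_one, map_mul, map_mul, mul_assoc,
    ← mul_assoc (R _), ← hLR]
  simp only [mul_assoc]

theorem diagAvg_mul (hLR : ∀ x y, L x * R y = R y * L x)
    (w : G) : diagAvg L R * (L (single w 1) * R (single w 1)) = diagAvg L R := by
  rw [diagAvg, smul_mul_assoc, Finset.sum_mul]
  refine congrArg (_ • ·) (Fintype.sum_equiv (Equiv.mulRight w) _ _ fun v => ?_)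
  rw [Equiv.coe_mulRight, ← single_one_mul_single_one, map_mul, map_mul, mul_assoc,
    ← mul_assoc (R _), ← hLR]
  simp only [mul_assoc]

theorem diagAvg_mul_left (hLR : ∀ x y, L x * R y = R y * L x)
    (x : MonoidAlgebra k G) :
    diagAvg L R * L x = diagAvg L R * R (inv' x) := by
  induction x using MonoidAlgebra.induction_linear with
  | zero => simp [inv'_zero]
  | add x y hx hy => simp only [map_add, inv'_add, mul_add, hx, hy]
  | single w t =>
    have e : (single w t : MonoidAlgebra k G) = t • single w 1 := by simp
    have h : (R (single w 1)) * R (single w⁻¹ 1) = 1 := by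
      rw [← map_mul, single_one_mul_single_one, mul_inv_cancel, ← one_def, map_one]
    rw [e, inv'_smul, inv'_single, map_smul, map_smul, mul_smul_comm, mul_smul_comm]
    congr 1
    rw [← mul_one (L _), ← h, ← mul_assoc (L _), ← mul_assoc, diagAvg_mul hLR]

theorem left_mul_diagAvg (hLR : ∀ x y, L x * R y = R y * L x)
    (x : MonoidAlgebra k G) :
    L x * diagAvg L R = R (inv' x) * diagAvg L R := by
  induction x using MonoidAlgebra.induction_linear with
  | zero => simp [inv'_zero]
  | add x y hx hy => simp only [map_add, inv'_add, add_mul, hx, hy]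
  | single w t =>
    have e : (single w t : MonoidAlgebra k G) = t • single w 1 := by simp
    have h : (R (single w⁻¹ 1)) * R (single w 1) = 1 := by
      rw [← map_mul, single_one_mul_single_one, inv_mul_cancel, ← one_def, map_one]
    rw [e, inv'_smul, inv'_single, map_smul, map_smul, smul_mul_assoc, smul_mul_assoc]
    congr 1
    rw [← one_mul (L _), ← h, mul_assoc (R _), ← hLR, mul_assoc, mul_diagAvg hLR]

theorem diagAvg_mul_left_of_idem (hLR : ∀ x y, L x * R y = R y * L x) {y : MonoidAlgebra k G}
    (hy : y * y = y) : diagAvg L R * L y = diagAvg L R * (L y * R (inv' y)) := by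
  rw [hLR, ← mul_assoc, ← diagAvg_mul_left hLR, mul_assoc, ← map_mul, hy]

theorem left_mul_diagAvg_of_idem (hLR : ∀ x y, L x * R y = R y * L x) {y : MonoidAlgebra k G}
    (hy : y * y = y) : L y * diagAvg L R = L y * R (inv' y) * diagAvg L R := by
  rw [mul_assoc, ← left_mul_diagAvg hLR, ← mul_assoc, ← map_mul, hy]

theorem sandwich_diagAvg (hLR : ∀ x y, L x * R y = R y * L x) (x y : MonoidAlgebra k G) :
    L x * R (inv' x) * diagAvg L R * (L y * R (inv' y)) =
      (Fintype.card G : k)⁻¹ • ∑ w : G, L (x * single w 1 * y) * R (inv' (y * single w⁻¹ 1 * x)) := by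
  rw [diagAvg, mul_smul_comm, smul_mul_assoc, Finset.mul_sum, Finset.sum_mul]
  refine congrArg (_ • ·) (Finset.sum_congr rfl fun w _ => ?_)
  have h : ∀ x y z, R y * (L x * z) = L x * (R y * z) := fun x y z => by
    rw [← mul_assoc, ← hLR, mul_assoc]
  simp only [inv'_mul, inv'_single, map_mul, inv_inv, mul_assoc, h]

variable [CharZero k]

theorem diagAvg_mul_self (hLR : ∀ x y, L x * R y = R y * L x) : diagAvg L R * diagAvg L R = diagAvg L R := by
  have h : diagAvg L R * diagAvg L R =
      ((Fintype.card G : k)⁻¹ • ∑ w : G, L (single w 1) * R (single w 1)) * diagAvg L R := rfl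
  rw [h, smul_mul_assoc, Finset.sum_mul]
  simp only [mul_diagAvg hLR]
  rw [Finset.sum_const, Finset.card_univ, ← Nat.cast_smul_eq_nsmul k, smul_smul,
    inv_mul_cancel₀ (Nat.cast_ne_zero.mpr Fintype.card_ne_zero), one_smul]

theorem diagAvg_mul_left_mul (hLR : ∀ x y, L x * R y = R y * L x)
    (x : MonoidAlgebra k G) :
    diagAvg L R * L x * diagAvg L R = (Fintype.card G : k)⁻¹ • (diagAvg L R * L (conjSum x)) := by
  conv_lhs =>
    enter [2]
    rw [diagAvg]
  rw [mul_smul_comm, Finset.mul_sum, conjSum, map_sum, Finset.mul_sum]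
  refine congrArg (_ • ·) (Fintype.sum_equiv (Equiv.inv _) _ _ fun w => ?_)
  have h := diagAvg_mul_left hLR (single w⁻¹ (1 : k))
  rw [inv'_single, inv_inv] at h
  rw [hLR, mul_assoc, ← mul_assoc (L x), hLR x, mul_assoc, ← map_mul, ← mul_assoc, ← h, mul_assoc,
    ← map_mul, Equiv.inv_apply, inv_inv, mul_assoc]

end DiagonalAverage

namespace YoungDiagram

open Equiv MonoidAlgebra

variable {k E : Type*} [Field k] [CharZero k] [Ring E] [Algebra k E] {l m : YoungDiagram}

section

variable {α : Type} [Fintype α] [DecidableEq α] {L R : MonoidAlgebra k (Perm α) →ₐ[k] E}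

theorem tabYoung_diagAvg_of_ne (h : l ≠ m) (T : l.Box ≃ α) (S : m.Box ≃ α) 
    (hLR : ∀ x y, L x * R y = R y * L x) :
    L (tabYoung k T) * diagAvg L R * L (tabYoung k S) = 0 := by
  rw [diagAvg, mul_smul_comm, smul_mul_assoc, Finset.mul_sum, Finset.sum_mul, Finset.sum_eq_zero,
    smul_zero]
  intro w _
  rw [← mul_assoc, mul_assoc, ← hLR, ← mul_assoc, ← map_mul, ← map_mul,
    tabYoung_mul_mul_of_ne k h, map_zero, zero_mul]

theorem tabYoung_diagAvg (T : l.Box ≃ α) (hLR : ∀ x y, L x * R y = R y * L x) :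
    L (tabYoung k T) * diagAvg L R * L (tabYoung k T) =
      (kappa k T / (Fintype.card (Perm α) : k)) • (L (tabYoung k T) * R (inv' (tabYoung k T))) := by
  have h3 : chi T (1 : MonoidAlgebra k (Perm α)) = 1 :=
    chi_eq_of_sandwich _ (by rw [mul_one, tabYoung_mul_self, one_smul])
  have h4 := sum_chi_mul_chi (k := k) T 1 1
  simp only [one_mul, mul_one, h3] at h4
  rw [left_mul_diagAvg_of_idem hLR (tabYoung_mul_self _), mul_assoc,
    diagAvg_mul_left_of_idem hLR (tabYoung_mul_self _), ← mul_assoc, sandwich_diagAvg hLR]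
  simp only [tabYoung_sandwich, inv'_smul, map_smul, smul_mul_smul_comm]
  rw [← Finset.sum_smul, h4, smul_smul, div_eq_inv_mul]

theorem sum_diagAvg (hLR : ∀ x y, L x * R y = R y * L x) (T : ∀ l : Shape α, l.1.Box ≃ α) :
    ∑ l, ((Fintype.card (Perm α) : k) / kappa k (T l)) •
      (diagAvg L R * L (tabYoung k (T l)) * diagAvg L R) = diagAvg L R := by
  have h : ∀ l, ((Fintype.card (Perm α) : k) / kappa k (T l)) •
      (diagAvg L R * L (tabYoung k (T l)) * diagAvg L R) =
        diagAvg L R * L ((kappa k l.tableau)⁻¹ • l.block k) := by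
    intro l
    rw [diagAvg_mul_left_mul hLR, smul_smul, map_smul, mul_smul_comm, ← Shape.block_eq,
      kappa_eq k (T l) l.tableau]
    congr 1
    rw [div_mul_eq_mul_div, mul_inv_cancel₀ (Nat.cast_ne_zero.mpr Fintype.card_ne_zero), one_div]
  simp only [h]
  rw [← Finset.mul_sum, ← map_sum, sum_inv_kappa_smul_block, map_one, mul_one]

end

section

variable {α : Type} [Fintype α] [DecidableEq α] {L R : MonoidAlgebra k (Perm (Option α)) →ₐ[k] E}

theorem extAlg_diagAvg_of_not_addBox (h : ¬AddBox m l) (S : m.Box ≃ α) (T : l.Box ≃ Option α)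
    (hLR : ∀ x y, L x * R y = R y * L x) :
    L (extAlg k α (tabYoung k S)) * diagAvg L R * L (tabYoung k T) = 0 := by
  rw [diagAvg, mul_smul_comm, smul_mul_assoc, Finset.mul_sum, Finset.sum_mul, Finset.sum_eq_zero,
    smul_zero]
  intro w _
  rw [← mul_assoc, mul_assoc, ← hLR, ← mul_assoc, ← map_mul, ← map_mul,
    extAlg_tabYoung_mul_of_not_addBox h, map_zero, zero_mul]

theorem tabYoung_diagAvg_of_not_addBox (h : ¬AddBox m l) (S : m.Box ≃ α) (T : l.Box ≃ Option α)
    (hLR : ∀ x y, L x * R y = R y * L x) :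
    L (tabYoung k T) * diagAvg L R * L (extAlg k α (tabYoung k S)) = 0 := by
  rw [diagAvg, mul_smul_comm, smul_mul_assoc, Finset.mul_sum, Finset.sum_mul, Finset.sum_eq_zero,
    smul_zero]
  intro w _
  rw [← mul_assoc, mul_assoc, ← hLR, ← mul_assoc, ← map_mul, ← map_mul,
    mul_eq_zero_symm T fun x => extAlg_tabYoung_mul_of_not_addBox h S T x, map_zero, zero_mul]

theorem AddBox.extAlg_diagAvg (h : AddBox m l) (S : m.Box ≃ α) (T : l.Box ≃ Option α)
    (hLR : ∀ x y, L x * R y = R y * L x) {σ : Perm (Option α)} (hσ : h.extTab S = T.trans σ) :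
    L (extAlg k α (tabYoung k S)) * R (inv' (extAlg k α (tabYoung k S))) * diagAvg L R *
      L (tabYoung k T) = (kappa k T / (Fintype.card (Perm (Option α)) : k) / h.scalar k) •
        (L (extAlg k α (tabYoung k S) * single σ 1 * tabYoung k T) *
          R (inv' (tabYoung k T * single σ⁻¹ 1 * extAlg k α (tabYoung k S)))) := by
  set e := extAlg k α (tabYoung k S) with he
  set y := tabYoung k T with hy
  have hf : tabYoung k (h.extTab S) = single σ 1 * y * single σ⁻¹ 1 := by rw [hσ, tabYoung_conj]
  have hfσ : tabYoung k (h.extTab S) * single σ 1 = single σ 1 * y := by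
    rw [hf, mul_assoc, single_one_mul_single_one, inv_mul_cancel, ← MonoidAlgebra.one_def, mul_one]
  have hσf : single σ⁻¹ 1 * tabYoung k (h.extTab S) = y * single σ⁻¹ 1 := by
    rw [hf, ← mul_assoc, ← mul_assoc, single_one_mul_single_one, inv_mul_cancel, ← MonoidAlgebra.one_def, one_mul]
  rw [mul_assoc, diagAvg_mul_left_of_idem hLR (tabYoung_mul_self T), ← mul_assoc,
    sandwich_diagAvg hLR, ← Equiv.sum_comp (Equiv.mulRight σ)]
  have h2 : ∀ w : Perm (Option α), L (e * single (Equiv.mulRight σ w) 1 * y) *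
      R (inv' (y * single (Equiv.mulRight σ w)⁻¹ 1 * e)) =
      (chi (h.extTab S) (e * single w 1) * chi (h.extTab S) (single w⁻¹ 1 * e) *
        ((h.scalar k)⁻¹ * (h.scalar k)⁻¹)) •
        (L (e * single σ 1 * y) * R (inv' (y * single σ⁻¹ 1 * e))) := by
    intro w
    have e1 : e * single (w * σ) 1 * y =
        (chi (h.extTab S) (e * single w 1) / h.scalar k) • (e * single σ 1 * y) := by
      rw [← single_one_mul_single_one, mul_assoc, mul_assoc, ← hfσ, ← mul_assoc, ← mul_assoc,
        AddBox.extAlg_mul_mul, smul_mul_assoc, mul_assoc, hfσ, mul_assoc]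
    have e2 : y * single (w * σ)⁻¹ 1 * e =
        (chi (h.extTab S) (single w⁻¹ 1 * e) / h.scalar k) • (y * single σ⁻¹ 1 * e) := by
      rw [mul_inv_rev, ← single_one_mul_single_one, ← mul_assoc, ← hσf, mul_assoc, mul_assoc,
        mul_assoc, ← mul_assoc _ _ e, AddBox.mul_mul_extAlg, mul_smul_comm]
    rw [Equiv.coe_mulRight, e1, e2, inv'_smul, map_smul, map_smul, smul_mul_smul_comm]
    congr 1
    ring
  rw [Finset.sum_congr rfl fun w _ => h2 w]
  have ee : e * e = e := by rw [he, ← map_mul, tabYoung_mul_self]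
  rw [← Finset.sum_smul, ← Finset.sum_mul, sum_chi_mul_chi, ee, he, AddBox.chi_extAlg, smul_smul,
    kappa_eq k (h.extTab S) T]
  congr 1
  have := h.scalar_ne_zero (k := k)
  field_simp

theorem AddBox.tabYoung_diagAvg (h : AddBox m l) (S : m.Box ≃ α) (T : l.Box ≃ Option α)
    (hLR : ∀ x y, L x * R y = R y * L x) {σ : Perm (Option α)} (hσ : h.extTab S = T.trans σ) :
    L (tabYoung k T) * diagAvg L R *
      (L (extAlg k α (tabYoung k S)) * R (inv' (extAlg k α (tabYoung k S)))) =
        (kappa k T / (Fintype.card (Perm (Option α)) : k) / h.scalar k) •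
        (L (tabYoung k T * single σ⁻¹ 1 * extAlg k α (tabYoung k S)) *
          R (inv' (extAlg k α (tabYoung k S) * single σ 1 * tabYoung k T))) := by
  set e := extAlg k α (tabYoung k S) with he
  set y := tabYoung k T with hy
  have hf : tabYoung k (h.extTab S) = single σ 1 * y * single σ⁻¹ 1 := by rw [hσ, tabYoung_conj]
  have hfσ : tabYoung k (h.extTab S) * single σ 1 = single σ 1 * y := by
    rw [hf, mul_assoc, single_one_mul_single_one, inv_mul_cancel, ← MonoidAlgebra.one_def, mul_one]
  have hσf : single σ⁻¹ 1 * tabYoung k (h.extTab S) = y * single σ⁻¹ 1 := by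
    rw [hf, ← mul_assoc, ← mul_assoc, single_one_mul_single_one, inv_mul_cancel, ← MonoidAlgebra.one_def, one_mul]
  rw [left_mul_diagAvg_of_idem hLR (tabYoung_mul_self T), sandwich_diagAvg hLR,
    ← Equiv.sum_comp (Equiv.mulLeft σ⁻¹)]
  have h2 : ∀ w : Perm (Option α), L (y * single (Equiv.mulLeft σ⁻¹ w) 1 * e) *
      R (inv' (e * single (Equiv.mulLeft σ⁻¹ w)⁻¹ 1 * y)) =
      (chi (h.extTab S) (e * single w⁻¹ 1) * chi (h.extTab S) (single w 1 * e) *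
        ((h.scalar k)⁻¹ * (h.scalar k)⁻¹)) •
        (L (y * single σ⁻¹ 1 * e) * R (inv' (e * single σ 1 * y))) := by
    intro w
    have e1 : e * single (σ⁻¹ * w)⁻¹ 1 * y =
        (chi (h.extTab S) (e * single w⁻¹ 1) / h.scalar k) • (e * single σ 1 * y) := by
      rw [mul_inv_rev, inv_inv, ← single_one_mul_single_one, mul_assoc, mul_assoc, ← hfσ,
        ← mul_assoc, ← mul_assoc,
        AddBox.extAlg_mul_mul, smul_mul_assoc, mul_assoc, hfσ, mul_assoc]
    have e2 : y * single (σ⁻¹ * w) 1 * e =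
        (chi (h.extTab S) (single w 1 * e) / h.scalar k) • (y * single σ⁻¹ 1 * e) := by
      rw [← single_one_mul_single_one, ← mul_assoc, ← hσf, mul_assoc, mul_assoc,
        mul_assoc, ← mul_assoc _ _ e, AddBox.mul_mul_extAlg, mul_smul_comm]
    rw [Equiv.coe_mulLeft, e1, e2, inv'_smul, map_smul, map_smul, smul_mul_smul_comm]
    congr 1
    ring
  rw [Finset.sum_congr rfl fun w _ => h2 w]
  have ee : e * e = e := by rw [he, ← map_mul, tabYoung_mul_self]
  have hs := sum_chi_mul_chi (h.extTab S) e e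
  rw [← Equiv.sum_comp (Equiv.inv _)] at hs
  simp only [Equiv.inv_apply, inv_inv] at hs
  rw [← Finset.sum_smul, ← Finset.sum_mul, hs, ee, he, AddBox.chi_extAlg, smul_smul,
    kappa_eq k (h.extTab S) T]
  congr 1
  have := h.scalar_ne_zero (k := k)
  field_simp

end

end YoungDiagram
end

noncomputable section

section MatUnique

variable {C : Type*} [Category C] [Preadditive C]

theorem mat_comp_eq {M N K : Mat_ C} (f : M ⟶ N) (g : N ⟶ K) (j : N.ι) (hj : ∀ j', j' = j) (i : M.ι)
    (l : K.ι) : (f ≫ g) i l = f i j ≫ g j l := by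
  rw [Mat_.comp_apply]
  exact Fintype.sum_eq_single j fun j' h => absurd (hj j') h

end MatUnique

namespace Heisenberg

variable {k : Type u} [CommRing k]

section

variable {X Y Z W : Heis k} {e : End X} {f : End Y} {g : End Z} {p : End W}

/-- The morphism between direct summands that is induced by a morphism of the ambient objects. -/
def imageMap (he : e * e = e) (hf : f * f = f) (u : X ⟶ Y) : image e he ⟶ image f hf :=
  cutDown (image e he) (image f hf) ((Mat_.embedding _).map u)

theorem imageMap_apply (he : e * e = e) (hf : f * f = f) (u : X ⟶ Y) (i j : PUnit) :
    (imageMap he hf u).f i j = e ≫ u ≫ f := by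
  refine (mat_comp_eq _ _ PUnit.unit (fun _ => rfl) _ _).trans (congrArg (e ≫ ·) ?_)
  exact mat_comp_eq _ _ PUnit.unit (fun _ => rfl) _ _

theorem image_hom_ext {he : e * e = e} {hf : f * f = f} {φ ψ : image e he ⟶ image f hf}
    (h : φ.f PUnit.unit PUnit.unit = ψ.f PUnit.unit PUnit.unit) : φ = ψ :=
  Idempotents.Karoubi.hom_ext _ _ (Mat_.hom_ext _ _ fun _ _ => h)

theorem imageMap_congr {he : e * e = e} {hf : f * f = f} {u v : X ⟶ Y}
    (h : e ≫ u ≫ f = e ≫ v ≫ f) : imageMap he hf u = imageMap he hf v :=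
  image_hom_ext (by rw [imageMap_apply, imageMap_apply, h])

theorem imageMap_comp (he : e * e = e) (hf : f * f = f) (hg : g * g = g) (u : X ⟶ Y) (v : Y ⟶ Z) :
    imageMap he hf u ≫ imageMap hf hg v = imageMap he hg (u ≫ f ≫ v) := by
  refine image_hom_ext ((mat_comp_eq _ _ PUnit.unit (fun _ => rfl) _ _).trans ?_)
  rw [imageMap_apply, imageMap_apply]
  refine Eq.trans ?_ (imageMap_apply _ _ _ _ _).symm
  have hf' : f ≫ f = f := hf
  change (e ≫ u ≫ f) ≫ f ≫ v ≫ g = e ≫ (u ≫ f ≫ v) ≫ g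
  simp only [assoc]
  rw [reassoc_of% hf']

theorem imageMap_id (he : e * e = e) : imageMap he he (𝟙 X) = 𝟙 (image e he) := by
  refine image_hom_ext ((imageMap_apply _ _ _ _ _).trans ?_)
  rw [id_comp]
  exact he

theorem imageMap_self (he : e * e = e) : imageMap he he e = 𝟙 (image e he) := by
  have he' : e ≫ e = e := he
  rw [← imageMap_id]
  refine imageMap_congr ?_
  rw [id_comp, he', he']

theorem imageMap_add (he : e * e = e) (hf : f * f = f) (u v : X ⟶ Y) :
    imageMap he hf (u + v) = imageMap he hf u + imageMap he hf v := by
  refine image_hom_ext ((imageMap_apply _ _ _ _ _).trans ?_)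
  refine Eq.trans ?_ (congrArg₂ (· + ·) (imageMap_apply he hf u PUnit.unit PUnit.unit).symm
    (imageMap_apply he hf v PUnit.unit PUnit.unit).symm)
  change e ≫ (u + v) ≫ f = e ≫ u ≫ f + e ≫ v ≫ f
  rw [add_comp, comp_add]

theorem imageMap_zero (he : e * e = e) (hf : f * f = f) :
    imageMap he hf (0 : X ⟶ Y) = 0 := by
  have h := imageMap_add he hf (0 : X ⟶ Y) 0
  rw [add_zero] at h
  exact left_eq_add.mp h

theorem imageMap_sum (he : e * e = e) (hf : f * f = f) {ι : Type*} (s : Finset ι) (u : ι → (X ⟶ Y)) :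
    imageMap he hf (∑ i ∈ s, u i) = ∑ i ∈ s, imageMap he hf (u i) :=
  map_sum (AddMonoidHom.mk' (imageMap he hf) (imageMap_add he hf)) u s

theorem tensor_idem (he : e * e = e) (hf : f * f = f) :
    (show End (X ⊗ Y) from e ⊗ₘ f) * (show End (X ⊗ Y) from e ⊗ₘ f) =
      (show End (X ⊗ Y) from e ⊗ₘ f) := by
  have he' : e ≫ e = e := he
  have hf' : f ≫ f = f := hf
  refine (tensorHom_comp_tensorHom e f e f).trans ?_
  rw [he', hf']

theorem tensor_hom_idem (he : e * e = e) (hf : f * f = f) : (e ⊗ₘ f) ≫ (e ⊗ₘ f) = e ⊗ₘ f :=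
  tensor_idem he hf

/-- The tensor product of two images is the image of the tensor product of the idempotents. -/
def tenImage (he : e * e = e) (hf : f * f = f) :
    tenObj (image e he) (image f hf) ≅ image (X := X ⊗ Y) (e ⊗ₘ f) (tensor_idem he hf) where
  hom := ⟨fun _ _ => e ⊗ₘ f, by
    refine Mat_.hom_ext _ _ fun i j => (mat_comp_eq _ _ (PUnit.unit, PUnit.unit)
      (fun _ => rfl) _ _).trans ((congrArg (_ ≫ ·)
        (mat_comp_eq _ _ PUnit.unit (fun _ => rfl) _ _)).trans ?_)
    exact (congrArg (_ ≫ ·) (tensor_hom_idem he hf)).trans (tensor_hom_idem he hf)⟩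
  inv := ⟨fun _ _ => e ⊗ₘ f, by
    refine Mat_.hom_ext _ _ fun i j => (mat_comp_eq _ _ PUnit.unit
      (fun _ => rfl) _ _).trans ((congrArg (_ ≫ ·)
        (mat_comp_eq _ _ (PUnit.unit, PUnit.unit) (fun _ => rfl) _ _)).trans ?_)
    exact (congrArg (_ ≫ ·) (tensor_hom_idem he hf)).trans (tensor_hom_idem he hf)⟩
  hom_inv_id := Idempotents.Karoubi.hom_ext _ _ (Mat_.hom_ext _ _ fun i j =>
    (mat_comp_eq _ _ PUnit.unit (fun _ => rfl) _ _).trans (tensor_hom_idem he hf))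
  inv_hom_id := Idempotents.Karoubi.hom_ext _ _ (Mat_.hom_ext _ _ fun i j =>
    (mat_comp_eq _ _ (PUnit.unit, PUnit.unit) (fun _ => rfl) _ _).trans (tensor_hom_idem he hf))

theorem tenHom_imageMap (he : e * e = e) (hf : f * f = f) (hg : g * g = g) (hp : p * p = p)
    (u : X ⟶ Z) (v : Y ⟶ W) :
    tenHom (imageMap he hg u) (imageMap hf hp v) ≫ (tenImage hg hp).hom =
      (tenImage he hf).hom ≫ imageMap (tensor_idem he hf) (tensor_idem hg hp) (u ⊗ₘ v) := by
  refine Idempotents.Karoubi.hom_ext _ _ (Mat_.hom_ext _ _ fun i j =>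
    (mat_comp_eq _ _ (PUnit.unit, PUnit.unit) (fun _ => rfl) _ _).trans
    (Eq.trans ?_ (mat_comp_eq _ _ PUnit.unit (fun _ => rfl) _ _).symm))
  refine (congrArg₂ (fun a b => (a ⊗ₘ b) ≫ (g ⊗ₘ p)) (imageMap_apply he hg u PUnit.unit PUnit.unit)
    (imageMap_apply hf hp v PUnit.unit PUnit.unit)).trans (Eq.trans ?_ (congrArg ((e ⊗ₘ f) ≫ ·)
      (imageMap_apply (tensor_idem he hf) (tensor_idem hg hp) (u ⊗ₘ v) PUnit.unit PUnit.unit)).symm)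
  have he' : e ≫ e = e := he
  have hf' : f ≫ f = f := hf
  have hg' : g ≫ g = g := hg
  have hp' : p ≫ p = p := hp
  change ((e ≫ u ≫ g) ⊗ₘ (f ≫ v ≫ p)) ≫ (g ⊗ₘ p) = (e ⊗ₘ f) ≫ (e ⊗ₘ f) ≫ (u ⊗ₘ v) ≫ (g ⊗ₘ p)
  simp only [tensorHom_comp_tensorHom, assoc, hg', hp']
  rw [reassoc_of% he', reassoc_of% hf']

theorem induced_eq (he : e * e = e) (hf : f * f = f) (hg : g * g = g) (hp : p * p = p)
    (u : X ⊗ Y ⟶ Z ⊗ W) : induced he hf hg hp u = (tenImage he hf).hom ≫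
      imageMap (tensor_idem he hf) (tensor_idem hg hp) u ≫ (tenImage hg hp).inv := by
  refine Idempotents.Karoubi.hom_ext _ _ (Mat_.hom_ext _ _ fun i j =>
    (mat_comp_eq _ _ (PUnit.unit, PUnit.unit) (fun _ => rfl) _ _).trans
    (Eq.trans ?_ (mat_comp_eq _ _ PUnit.unit (fun _ => rfl) _ _).symm))
  refine Eq.trans ?_ (congrArg ((e ⊗ₘ f) ≫ ·) (Eq.trans (mat_comp_eq (imageMap (tensor_idem he hf)
    (tensor_idem hg hp) u).f (tenImage hg hp).inv.f PUnit.unit (fun _ => rfl) PUnit.unit j)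
    (congrArg (fun a => a ≫ (g ⊗ₘ p)) (imageMap_apply
    (tensor_idem he hf) (tensor_idem hg hp) u PUnit.unit PUnit.unit)))).symm
  refine (congrArg ((e ⊗ₘ f) ≫ ·)
    (mat_comp_eq _ _ (PUnit.unit, PUnit.unit) (fun _ => rfl) _ _)).trans ?_
  change (e ⊗ₘ f) ≫ u ≫ (g ⊗ₘ p) = (e ⊗ₘ f) ≫ ((e ⊗ₘ f) ≫ u ≫ (g ⊗ₘ p)) ≫ (g ⊗ₘ p)
  simp only [assoc]
  rw [tensor_hom_idem hg hp, reassoc_of% tensor_hom_idem he hf]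

end

end Heisenberg
end

noncomputable section

theorem signTwist_signTwist {k α : Type*} [Field k] [Fintype α] [DecidableEq α]
    (x : MonoidAlgebra k (Equiv.Perm α)) :
    YoungDiagram.signTwist k α (YoungDiagram.signTwist k α x) = x := by
  induction x using MonoidAlgebra.induction_linear with
  | zero => simp
  | add x y hx hy => simp only [map_add, hx, hy]
  | single w t =>
    rw [YoungDiagram.signTwist_single, YoungDiagram.signTwist_single, mul_assoc, ← Int.cast_mul,
      ← Units.val_mul, Int.units_mul_self]
    simp

theorem comp_eq_of_single {k G C : Type*} [Field k] [Group G] [Category C] [Preadditive C]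
    [Linear k C] {X Y : C} (φ : MonoidAlgebra k G →ₐ[k] End X) (ψ : MonoidAlgebra k G →ₐ[k] End Y)
    (c : X ⟶ Y) (h : ∀ w, φ (MonoidAlgebra.single w 1) ≫ c = c ≫ ψ (MonoidAlgebra.single w 1))
    (x : MonoidAlgebra k G) : φ x ≫ c = c ≫ ψ x := by
  induction x using MonoidAlgebra.induction_linear with
  | zero =>
    rw [map_zero, map_zero]
    exact zero_comp.trans comp_zero.symm
  | add x y hx hy =>
    rw [map_add, map_add]
    exact (add_comp _ _ _ _ _ _).trans
      ((congrArg₂ (· + ·) hx hy).trans (comp_add _ _ _ _ _ _).symm)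
  | single w t =>
    have e : (MonoidAlgebra.single w t : MonoidAlgebra k G) = t • MonoidAlgebra.single w 1 := by simp
    rw [e, map_smul, map_smul, Linear.smul_comp, Linear.comp_smul, h]

namespace Heis

open Equiv MonoidAlgebra YoungDiagram

variable (k : Type u) [Field k]

/-- The action of the group algebra on upward strands. -/
def liftP (n : ℕ) : MonoidAlgebra k (Perm (Fin n)) →ₐ[k] End (powR (P : Heis k) n) :=
  MonoidAlgebra.lift k _ _ (permP k n)

/-- The action of the group algebra on downward strands. -/
def liftQ (n : ℕ) : MonoidAlgebra k (Perm (Fin n)) →ₐ[k] End (powL (Q : Heis k) n) :=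
  MonoidAlgebra.lift k _ _ (permQ k n)

theorem liftP_single (n : ℕ) (w : Perm (Fin n)) : liftP k n (single w 1) = permP k n w := by
  rw [liftP, lift_single, one_smul]

theorem liftQ_single (n : ℕ) (w : Perm (Fin n)) : liftQ k n (single w 1) = permQ k n w := by
  rw [liftQ, lift_single, one_smul]

/-- Whiskering on the right as a homomorphism of algebras. -/
def whiskR (X Z : Heis k) : End X →ₐ[k] End (X ⊗ Z) :=
  AlgHom.ofLinearMap
    { toFun := fun f => f ▷ Z
      map_add' := fun f g => MonoidalPreadditive.add_whiskerRight f g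
      map_smul' := fun t f => MonoidalLinear.smul_whiskerRight t f Z }
    (id_whiskerRight X Z) (fun f g => comp_whiskerRight g f Z)

/-- Whiskering on the left as a homomorphism of algebras. -/
def whiskL (X Z : Heis k) : End X →ₐ[k] End (Z ⊗ X) :=
  AlgHom.ofLinearMap
    { toFun := fun f => Z ◁ f
      map_add' := fun f g => MonoidalPreadditive.whiskerLeft_add f g
      map_smul' := fun t f => MonoidalLinear.whiskerLeft_smul Z t f }
    (whiskerLeft_id Z X) (fun f g => whiskerLeft_comp Z g f)

/-- Conjugation with the order reversal. -/
def flipAlg (n : ℕ) : MonoidAlgebra k (Perm (Fin n)) ≃ₐ[k] MonoidAlgebra k (Perm (Fin n)) :=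
  domCongr k k Fin.revPerm.permCongrHom

/-- The action on the upward strands of `strands k n`. -/
def actL (n : ℕ) : MonoidAlgebra k (Perm (Fin n)) →ₐ[k] End (strands k n) :=
  (whiskR k (powR P n) (powL Q n)).comp (liftP k n)

/-- The action on the downward strands of `strands k n`. -/
def actD (n : ℕ) : MonoidAlgebra k (Perm (Fin n)) →ₐ[k] End (strands k n) :=
  (whiskL k (powL Q n) (powR P n)).comp (liftQ k n)

/-- The action on the downward strands of `strands k n`, in reversed order and twisted with the
sign. -/
def actR (n : ℕ) : MonoidAlgebra k (Perm (Fin n)) →ₐ[k] End (strands k n) :=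
  (actD k n).comp ((flipAlg k n).toAlgHom.comp (signTwist k (Fin n)))

theorem actL_mul_actD (n : ℕ) (x y : MonoidAlgebra k (Perm (Fin n))) :
    actL k n x * actD k n y = actD k n y * actL k n x :=
  whisker_exchange (liftP k n x) (liftQ k n y)

theorem actL_mul_actR (n : ℕ) (x y : MonoidAlgebra k (Perm (Fin n))) :
    actL k n x * actR k n y = actR k n y * actL k n x := actL_mul_actD k n _ _

theorem flipAlg_single (n : ℕ) (w : Perm (Fin n)) (t : k) :
    flipAlg k n (single w t) = single (flipPerm n w) t :=
  domCongr_single ..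

theorem flipAlg_flipAlg (n : ℕ) (x : MonoidAlgebra k (Perm (Fin n))) :
    flipAlg k n (flipAlg k n x) = x := by
  induction x using MonoidAlgebra.induction_linear with
  | zero => simp
  | add x y hx hy => simp only [map_add, hx, hy]
  | single w t => rw [flipAlg_single, flipAlg_single, flipPerm_flipPerm]

theorem actL_single (n : ℕ) (w : Perm (Fin n)) :
    actL k n (single w 1) = permP k n w ▷ powL Q n :=
  congrArg (fun z : End _ => z ▷ powL Q n) (liftP_single k n w)

theorem actD_single (n : ℕ) (w : Perm (Fin n)) :
    actD k n (single w 1) = powR P n ◁ permQ k n w :=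
  congrArg (fun z : End _ => powR P n ◁ z) (liftQ_single k n w)

theorem actD_eq (n : ℕ) (x : MonoidAlgebra k (Perm (Fin n))) :
    actD k n x = actR k n (signTwist k _ (flipAlg k n x)) := by
  change _ = actD k n (flipAlg k n (signTwist k _ (signTwist k _ (flipAlg k n x))))
  rw [signTwist_signTwist, flipAlg_flipAlg]

theorem actR_single (n : ℕ) (w : Perm (Fin n)) :
    actR k n (single w 1) = ((Perm.sign w : ℤ) : k) • (powR P n ◁ permQ k n (flipPerm n w)) := by
  change actD k n (flipAlg k n (signTwist k _ (single w 1))) = _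
  rw [signTwist_single, flipAlg_single, ← actD_single, ← map_smul, smul_single, smul_eq_mul, one_mul,
    mul_one]

theorem diagAvg_actL_actR (n : ℕ) : diagAvg (actL k n) (actR k n) = antisym k n := by
  rw [diagAvg, antisym, Fintype.card_perm, Fintype.card_fin]
  refine congrArg (_ • ·) (Finset.sum_congr rfl fun w _ => ?_)
  rw [actR_single, actL_single, mul_smul_comm, Int.cast_smul_eq_zsmul, tensorHom_def']
  rfl

theorem actD_tabYoung {n : ℕ} {l : YoungDiagram} (T : l.transpose.Box ≃ Fin n) :
    actD k n (tabYoung k T) =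
      actR k n (inv' (tabYoung k (l.boxTranspose.trans (T.trans Fin.revPerm)))) := by
  rw [actD_eq, ← signTwist_tabYoung_transpose, tabYoung_trans T]
  rfl

theorem midCap_naturality_left {A A' : Heis k} (f : A ⟶ A') (B : Heis k) :
    (f ▷ P) ▷ (Q ⊗ B) ≫ Heisenberg.midCap A' B = Heisenberg.midCap A B ≫ f ▷ B := by
  dsimp only [Heisenberg.midCap]
  rw [associator_naturality_left_assoc, ← whisker_exchange, assoc]

theorem midCap_naturality_right (A : Heis k) {B B' : Heis k} (f : B ⟶ B') :
    (A ⊗ P) ◁ Q ◁ f ≫ Heisenberg.midCap A B' = Heisenberg.midCap A B ≫ A ◁ f := by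
  dsimp only [Heisenberg.midCap]
  simp only [assoc, ← whiskerLeft_comp, associator_naturality_right_assoc]
  rw [associator_inv_naturality_right_assoc, whisker_exchange_assoc, leftUnitor_naturality]

theorem midCup_naturality_left {A A' : Heis k} (f : A ⟶ A') (B : Heis k) :
    Heisenberg.midCup A B ≫ (f ▷ P) ▷ (Q ⊗ B) = f ▷ B ≫ Heisenberg.midCup A' B := by
  dsimp only [Heisenberg.midCup]
  rw [assoc, ← associator_inv_naturality_left, whisker_exchange_assoc]

theorem midCup_naturality_right (A : Heis k) {B B' : Heis k} (f : B ⟶ B') :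
    Heisenberg.midCup A B ≫ (A ⊗ P) ◁ Q ◁ f = A ◁ f ≫ Heisenberg.midCup A B' := by
  dsimp only [Heisenberg.midCup]
  rw [assoc, ← associator_inv_naturality_right, ← whiskerLeft_comp_assoc,
    ← whiskerLeft_comp_assoc]
  simp only [assoc]
  rw [← associator_naturality_right, ← whisker_exchange_assoc, leftUnitor_inv_naturality_assoc]

theorem midCap_naturality {A A' B B' : Heis k} (f : A ⟶ A') (g : B ⟶ B') :
    ((f ▷ P) ⊗ₘ (Q ◁ g)) ≫ Heisenberg.midCap A' B' = Heisenberg.midCap A B ≫ (f ⊗ₘ g) := by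
  rw [MonoidalCategory.tensorHom_def, MonoidalCategory.tensorHom_def, assoc, midCap_naturality_right,
    ← assoc, midCap_naturality_left, assoc]

theorem midCup_naturality {A A' B B' : Heis k} (f : A ⟶ A') (g : B ⟶ B') :
    Heisenberg.midCup A B ≫ ((f ▷ P) ⊗ₘ (Q ◁ g)) = (f ⊗ₘ g) ≫ Heisenberg.midCup A' B' := by
  rw [MonoidalCategory.tensorHom_def, MonoidalCategory.tensorHom_def, ← assoc, midCup_naturality_left, assoc,
    midCup_naturality_right, assoc]

/-- The inclusion of group algebras that adds a fixed last letter. -/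
def extA (n : ℕ) : MonoidAlgebra k (Perm (Fin n)) →ₐ[k] MonoidAlgebra k (Perm (Fin (n + 1))) :=
  (domCongr k k finSuccEquivLast.symm.permCongrHom).toAlgHom.comp (extAlg k (Fin n))

theorem extA_single (n : ℕ) (w : Perm (Fin n)) (t : k) :
    extA k n (single w t) = single (extLast n w) t := by
  change domCongr k k finSuccEquivLast.symm.permCongrHom (extAlg k (Fin n) (single w t)) = _
  rw [extAlg_single, domCongr_single]
  rfl

theorem actL_innerCap (n : ℕ) (x : MonoidAlgebra k (Perm (Fin n))) :
    actL k (n + 1) (extA k n x) ≫ innerCap k n = innerCap k n ≫ actL k n x := by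
  refine comp_eq_of_single ((actL k (n + 1)).comp (extA k n)) (actL k n) _ (fun w => ?_) x
  change actL k (n + 1) (extA k n (single w 1)) ≫ _ = _
  rw [extA_single, actL_single, actL_single, permP_extLast]
  exact midCap_naturality_left k _ _

theorem actR_innerCap (n : ℕ) (x : MonoidAlgebra k (Perm (Fin n))) :
    actR k (n + 1) (extA k n x) ≫ innerCap k n = innerCap k n ≫ actR k n x := by
  refine comp_eq_of_single ((actR k (n + 1)).comp (extA k n)) (actR k n) _ (fun w => ?_) x
  change actR k (n + 1) (extA k n (single w 1)) ≫ _ = _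
  rw [extA_single, actR_single, actR_single, Linear.smul_comp, Linear.comp_smul, flipPerm_extLast,
    permQ_extFirst, sign_extLast]
  exact congrArg (_ • ·) (midCap_naturality_right k _ _)

theorem innerCup_actL (n : ℕ) (x : MonoidAlgebra k (Perm (Fin n))) :
    innerCup k n ≫ actL k (n + 1) (extA k n x) = actL k n x ≫ innerCup k n := by
  refine (comp_eq_of_single (actL k n) ((actL k (n + 1)).comp (extA k n)) _ (fun w => ?_) x).symm
  change _ = _ ≫ actL k (n + 1) (extA k n (single w 1))
  rw [extA_single, actL_single, actL_single, permP_extLast]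
  exact (midCup_naturality_left k _ _).symm

theorem innerCup_actR (n : ℕ) (x : MonoidAlgebra k (Perm (Fin n))) :
    innerCup k n ≫ actR k (n + 1) (extA k n x) = actR k n x ≫ innerCup k n := by
  refine (comp_eq_of_single (actR k n) ((actR k (n + 1)).comp (extA k n)) _ (fun w => ?_) x).symm
  change _ = _ ≫ actR k (n + 1) (extA k n (single w 1))
  rw [extA_single, actR_single, actR_single, Linear.smul_comp, Linear.comp_smul, flipPerm_extLast,
    permQ_extFirst, sign_extLast]
  exact congrArg (_ • ·) (midCup_naturality_right k _ _).symm

end Heis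
end

noncomputable section

namespace YoungDiagram

open Equiv MonoidAlgebra

variable {k E : Type*} [Field k] [CharZero k] [Ring E] [Algebra k E] {l m : YoungDiagram}
  {α : Type} [Fintype α] [DecidableEq α] {L R : MonoidAlgebra k (Perm (Option α)) →ₐ[k] E}

theorem kappa_trans {β : Type} [Fintype β] [DecidableEq β] (T : l.Box ≃ α) (e : α ≃ β) :
    kappa k (T.trans e) = kappa k T := by
  have h : conjSum (tabYoung k (T.trans e)) =
      domCongr k k e.permCongrHom (conjSum (tabYoung k T)) := by
    rw [conjSum, conjSum, map_sum, tabYoung_trans]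
    refine (Fintype.sum_equiv e.permCongr _ _ fun w => ?_).symm
    rw [map_mul, map_mul, domCongr_single, domCongr_single, map_inv]
    rfl
  refine chi_eq_of_sandwich _ ?_
  rw [h, tabYoung_trans, ← map_mul, ← map_mul, tabYoung_mul_conjSum, smul_mul_assoc,
    tabYoung_mul_self, map_smul]

theorem AddBox.remove_identity (h : AddBox m l) (S : m.Box ≃ α) (T : l.Box ≃ Option α)
    (hLR : ∀ x y, L x * R y = R y * L x) {σ : Perm (Option α)} (hσ : h.extTab S = T.trans σ)
    (η θ : Perm (Option α)) :
    R (single η 1) * L (extAlg k α (tabYoung k S)) * diagAvg L R * L (tabYoung k T) *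
      R (single θ⁻¹ 1) = (kappa k T / (Fintype.card (Perm (Option α)) : k) / h.scalar k) •
        (L (extAlg k α (tabYoung k S)) *
          R (inv' (single η 1 * extAlg k α (tabYoung k S) * single η⁻¹ 1)) *
          (L (single σ 1) * R (single (η * σ * θ⁻¹) 1)) *
          (L (tabYoung k T) * R (inv' (single θ 1 * tabYoung k T * single θ⁻¹ 1)))) := by
  have ee : extAlg k α (tabYoung k S) * extAlg k α (tabYoung k S) = extAlg k α (tabYoung k S) := by
    rw [← map_mul, tabYoung_mul_self]
  have c1 : ∀ (w : Perm (Option α)) (x : E), R (single w⁻¹ 1) * (R (single w 1) * x) = x := by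
    intro w x
    rw [← mul_assoc, ← map_mul, single_one_mul_single_one, inv_mul_cancel, ← MonoidAlgebra.one_def,
      map_one, one_mul]
  have h1 : ∀ x y z, R y * (L x * z) = L x * (R y * z) := fun x y z => by
    rw [← mul_assoc, ← hLR, mul_assoc]
  rw [mul_assoc (R _), left_mul_diagAvg_of_idem hLR ee, mul_assoc (R _), h.extAlg_diagAvg S T hLR hσ,
    mul_smul_comm, smul_mul_assoc]
  refine congrArg (_ • ·) ?_
  simp only [inv'_mul, inv'_single, map_mul, inv_inv, mul_assoc, h1, ← single_one_mul_single_one, c1]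

theorem AddBox.insert_identity (h : AddBox m l) (S : m.Box ≃ α) (T : l.Box ≃ Option α)
    (hLR : ∀ x y, L x * R y = R y * L x) {σ : Perm (Option α)} (hσ : h.extTab S = T.trans σ)
    (η θ : Perm (Option α)) :
    R (single θ 1) * L (tabYoung k T) * diagAvg L R * L (extAlg k α (tabYoung k S)) *
      R (single η⁻¹ 1) = (kappa k T / (Fintype.card (Perm (Option α)) : k) / h.scalar k) •
        (L (tabYoung k T) * R (inv' (single θ 1 * tabYoung k T * single θ⁻¹ 1)) *
          (L (single σ⁻¹ 1) * R (single (θ * σ⁻¹ * η⁻¹) 1)) *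
          (L (extAlg k α (tabYoung k S)) *
            R (inv' (single η 1 * extAlg k α (tabYoung k S) * single η⁻¹ 1)))) := by
  have ee : extAlg k α (tabYoung k S) * extAlg k α (tabYoung k S) = extAlg k α (tabYoung k S) := by
    rw [← map_mul, tabYoung_mul_self]
  have c1 : ∀ (w : Perm (Option α)) (x : E), R (single w⁻¹ 1) * (R (single w 1) * x) = x := by
    intro w x
    rw [← mul_assoc, ← map_mul, single_one_mul_single_one, inv_mul_cancel, ← MonoidAlgebra.one_def,
      map_one, one_mul]
  have h1 : ∀ x y z, R y * (L x * z) = L x * (R y * z) := fun x y z => by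
    rw [← mul_assoc, ← hLR, mul_assoc]
  rw [mul_assoc (_ * _) (diagAvg L R), diagAvg_mul_left_of_idem hLR ee, mul_assoc (R _),
    ← mul_assoc (L _), h.tabYoung_diagAvg S T hLR hσ, mul_smul_comm, smul_mul_assoc]
  refine congrArg (_ • ·) ?_
  simp only [inv'_mul, inv'_single, map_mul, inv_inv, mul_assoc, h1, ← single_one_mul_single_one, c1]

end YoungDiagram

namespace Heis

open Equiv MonoidAlgebra YoungDiagram

variable (k : Type u) [Field k]

/-- Relabelling of the last letter. -/
def lastAlg (n : ℕ) : MonoidAlgebra k (Perm (Option (Fin n))) ≃ₐ[k] MonoidAlgebra k (Perm (Fin (n + 1))) :=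
  domCongr k k finSuccEquivLast.symm.permCongrHom

theorem lastAlg_single (n : ℕ) (w : Perm (Option (Fin n))) (t : k) :
    lastAlg k n (single w t) = single (finSuccEquivLast.symm.permCongrHom w) t :=
  domCongr_single ..

theorem lastAlg_tabYoung {n : ℕ} {l : YoungDiagram} (T : l.Box ≃ Fin (n + 1)) :
    lastAlg k n (tabYoung k (T.trans finSuccEquivLast)) = tabYoung k T := by
  change domCongr k k finSuccEquivLast.symm.permCongrHom _ = _
  rw [← tabYoung_trans]
  congr 1
  ext x
  simp

theorem lastAlg_extAlg (n : ℕ) (x : MonoidAlgebra k (Perm (Fin n))) :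
    lastAlg k n (extAlg k (Fin n) x) = extA k n x := rfl

theorem diagAvg_lastAlg {n : ℕ} {E : Type*} [Ring E] [Algebra k E]
    (L R : MonoidAlgebra k (Perm (Fin (n + 1))) →ₐ[k] E) :
    diagAvg (L.comp (lastAlg k n).toAlgHom) (R.comp (lastAlg k n).toAlgHom) = diagAvg L R := by
  rw [diagAvg, diagAvg, Fintype.card_congr (finSuccEquivLast (n := n)).permCongr]
  refine congrArg (_ • ·) (Fintype.sum_equiv finSuccEquivLast.symm.permCongr _ _ fun w => ?_)
  change L (lastAlg k n (single w 1)) * R (lastAlg k n (single w 1)) = _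
  rw [lastAlg_single]
  rfl

theorem lastAlg_inv' (n : ℕ) (x : MonoidAlgebra k (Perm (Option (Fin n)))) :
    lastAlg k n (inv' x) = inv' (lastAlg k n x) := (inv'_domCongr _ _).symm

theorem extA_inv' (n : ℕ) (x : MonoidAlgebra k (Perm (Fin n))) :
    extA k n (inv' x) = inv' (extA k n x) := by
  rw [← lastAlg_extAlg, ← lastAlg_extAlg, ← inv'_extAlg, lastAlg_inv']

theorem permCongrHom_optionPerm (n : ℕ) (w : Perm (Fin n)) :
    finSuccEquivLast.symm.permCongrHom (optionPerm _ w) = extLast n w := rfl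

variable [CharZero k] {n : ℕ} {l m : YoungDiagram}

theorem remove_identity (h : AddBox m l) (S : m.Box ≃ Fin n) (T : l.Box ≃ Fin (n + 1))
    {σ : Perm (Fin (n + 1))} (hσ : (h.extTab S).trans finSuccEquivLast.symm = T.trans σ)
    (η : Perm (Fin n)) (θ : Perm (Fin (n + 1))) :
    actR k (n + 1) (single (extLast n η) 1) * actL k (n + 1) (extA k n (tabYoung k S)) *
      diagAvg (actL k (n + 1)) (actR k (n + 1)) * actL k (n + 1) (tabYoung k T) *
      actR k (n + 1) (single θ⁻¹ 1) =
        (kappa k T / (Fintype.card (Perm (Fin (n + 1))) : k) / h.scalar k) •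
        (actL k (n + 1) (extA k n (tabYoung k S)) *
          actR k (n + 1) (extA k n (inv' (single η 1 * tabYoung k S * single η⁻¹ 1))) *
          (actL k (n + 1) (single σ 1) * actR k (n + 1) (single (extLast n η * σ * θ⁻¹) 1)) *
          (actL k (n + 1) (tabYoung k T) *
            actR k (n + 1) (inv' (single θ 1 * tabYoung k T * single θ⁻¹ 1)))) := by
  have hσ' : h.extTab S =
      (T.trans finSuccEquivLast).trans (finSuccEquivLast.symm.permCongrHom.symm σ) := by
    refine Equiv.ext fun x => ?_
    have := congrArg finSuccEquivLast (DFunLike.congr_fun hσ x)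
    simpa using this
  have key := h.remove_identity (k := k) S (T.trans finSuccEquivLast)
    (L := (actL k (n + 1)).comp (lastAlg k n).toAlgHom)
    (R := (actR k (n + 1)).comp (lastAlg k n).toAlgHom) (fun x y => actL_mul_actR k _ _ _) hσ'
    (optionPerm _ η) (finSuccEquivLast.symm.permCongrHom.symm θ)
  have hL : ∀ x, ((actL k (n + 1)).comp (lastAlg k n).toAlgHom) x =
    actL k (n + 1) (lastAlg k n x) := fun _ => rfl
  have hR : ∀ x, ((actR k (n + 1)).comp (lastAlg k n).toAlgHom) x =
    actR k (n + 1) (lastAlg k n x) := fun _ => rfl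
  rw [diagAvg_lastAlg, kappa_trans, Fintype.card_congr (finSuccEquivLast (n := n)).symm.permCongr]
    at key
  simp only [hL, hR, lastAlg_inv', map_mul (lastAlg k n), lastAlg_single, lastAlg_tabYoung,
    lastAlg_extAlg, map_mul finSuccEquivLast.symm.permCongrHom, permCongrHom_optionPerm,
    MulEquiv.apply_symm_apply, map_inv] at key
  rw [extA_inv', map_mul, map_mul, extA_single, extA_single, map_inv]
  exact key

theorem insert_identity (h : AddBox m l) (S : m.Box ≃ Fin n) (T : l.Box ≃ Fin (n + 1))
    {σ : Perm (Fin (n + 1))} (hσ : (h.extTab S).trans finSuccEquivLast.symm = T.trans σ)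
    (η : Perm (Fin n)) (θ : Perm (Fin (n + 1))) :
    actR k (n + 1) (single θ 1) * actL k (n + 1) (tabYoung k T) *
      diagAvg (actL k (n + 1)) (actR k (n + 1)) * actL k (n + 1) (extA k n (tabYoung k S)) *
      actR k (n + 1) (single (extLast n η)⁻¹ 1) =
        (kappa k T / (Fintype.card (Perm (Fin (n + 1))) : k) / h.scalar k) •
        (actL k (n + 1) (tabYoung k T) *
            actR k (n + 1) (inv' (single θ 1 * tabYoung k T * single θ⁻¹ 1)) *
          (actL k (n + 1) (single σ⁻¹ 1) *
            actR k (n + 1) (single (θ * σ⁻¹ * (extLast n η)⁻¹) 1)) *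
          (actL k (n + 1) (extA k n (tabYoung k S)) *
          actR k (n + 1) (extA k n (inv' (single η 1 * tabYoung k S * single η⁻¹ 1))))) := by
  have hσ' : h.extTab S =
      (T.trans finSuccEquivLast).trans (finSuccEquivLast.symm.permCongrHom.symm σ) := by
    refine Equiv.ext fun x => ?_
    have := congrArg finSuccEquivLast (DFunLike.congr_fun hσ x)
    simpa using this
  have key := h.insert_identity (k := k) S (T.trans finSuccEquivLast)
    (L := (actL k (n + 1)).comp (lastAlg k n).toAlgHom)
    (R := (actR k (n + 1)).comp (lastAlg k n).toAlgHom) (fun x y => actL_mul_actR k _ _ _) hσ'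
    (optionPerm _ η) (finSuccEquivLast.symm.permCongrHom.symm θ)
  have hL : ∀ x, ((actL k (n + 1)).comp (lastAlg k n).toAlgHom) x =
    actL k (n + 1) (lastAlg k n x) := fun _ => rfl
  have hR : ∀ x, ((actR k (n + 1)).comp (lastAlg k n).toAlgHom) x =
    actR k (n + 1) (lastAlg k n x) := fun _ => rfl
  rw [diagAvg_lastAlg, kappa_trans, Fintype.card_congr (finSuccEquivLast (n := n)).symm.permCongr]
    at key
  simp only [hL, hR, lastAlg_inv', map_mul (lastAlg k n), lastAlg_single, lastAlg_tabYoung,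
    lastAlg_extAlg, map_mul finSuccEquivLast.symm.permCongrHom, permCongrHom_optionPerm,
    MulEquiv.apply_symm_apply, map_inv] at key
  rw [extA_inv', map_mul, map_mul, extA_single, extA_single, map_inv]
  exact key

theorem extA_mul_diagAvg_mul_of_not_addBox (h : ¬AddBox m l) (S : m.Box ≃ Fin n)
    (T : l.Box ≃ Fin (n + 1)) :
    actL k (n + 1) (extA k n (tabYoung k S)) * diagAvg (actL k (n + 1)) (actR k (n + 1)) *
      actL k (n + 1) (tabYoung k T) = 0 := by
  have key := extAlg_diagAvg_of_not_addBox (k := k) h S (T.trans finSuccEquivLast)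
    (L := (actL k (n + 1)).comp (lastAlg k n).toAlgHom)
    (R := (actR k (n + 1)).comp (lastAlg k n).toAlgHom) (fun x y => actL_mul_actR k _ _ _)
  have hL : ∀ x, ((actL k (n + 1)).comp (lastAlg k n).toAlgHom) x =
    actL k (n + 1) (lastAlg k n x) := fun _ => rfl
  rw [diagAvg_lastAlg, hL, hL, lastAlg_tabYoung, lastAlg_extAlg] at key
  exact key

theorem mul_diagAvg_mul_extA_of_not_addBox (h : ¬AddBox m l) (S : m.Box ≃ Fin n)
    (T : l.Box ≃ Fin (n + 1)) :
    actL k (n + 1) (tabYoung k T) * diagAvg (actL k (n + 1)) (actR k (n + 1)) *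
      actL k (n + 1) (extA k n (tabYoung k S)) = 0 := by
  have key := tabYoung_diagAvg_of_not_addBox (k := k) h S (T.trans finSuccEquivLast)
    (L := (actL k (n + 1)).comp (lastAlg k n).toAlgHom)
    (R := (actR k (n + 1)).comp (lastAlg k n).toAlgHom) (fun x y => actL_mul_actR k _ _ _)
  have hL : ∀ x, ((actL k (n + 1)).comp (lastAlg k n).toAlgHom) x =
    actL k (n + 1) (lastAlg k n x) := fun _ => rfl
  rw [diagAvg_lastAlg, hL, hL, lastAlg_tabYoung, lastAlg_extAlg] at key
  exact key

end Heis
end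

noncomputable section

namespace Heis

open Equiv MonoidAlgebra YoungDiagram Heisenberg

variable (k : Type u) [Field k] [CharZero k] {n : ℕ} {l m : YoungDiagram}

/-- The antisymmetrizer as an element of the endomorphism algebra. -/
abbrev avg (n : ℕ) : End (strands k n) := diagAvg (actL k n) (actR k n)

theorem avg_idem (n : ℕ) : avg k n * avg k n = avg k n := diagAvg_mul_self (actL_mul_actR k n)

/-- The object in degree `n` of the complex of antisymmetrized strands. -/
abbrev strandObj (n : ℕ) : Heisenberg k := image (avg k n) (avg_idem k n)

/-- The differential of the complex of antisymmetrized strands given by caps. -/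
def strandCap (n : ℕ) : strandObj k (n + 1) ⟶ strandObj k n := imageMap _ _ (innerCap k n)

/-- The differential of the complex of antisymmetrized strands given by cups. -/
def strandCup (n : ℕ) : strandObj k n ⟶ strandObj k (n + 1) := imageMap _ _ (innerCup k n)

/-- The idempotent that cuts out `P^l Q^{l^t}`, for two tableaux. -/
def eps (r q : l.Box ≃ Fin n) : End (strands k n) :=
  actL k n (tabYoung k r) * actR k n (inv' (tabYoung k q))

theorem eps_idem (r q : l.Box ≃ Fin n) : eps k r q * eps k r q = eps k r q := by
  rw [eps, mul_assoc, ← mul_assoc (actR k n _), ← actL_mul_actR, mul_assoc, ← map_mul, ← inv'_mul,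
    ← mul_assoc, ← map_mul, tabYoung_mul_self, tabYoung_mul_self]

/-- The permutation that carries one tableau to another one. -/
def tabPerm (r q : l.Box ≃ Fin n) : Perm (Fin n) := r.symm.trans q

/-- The sign of a permutation in the base field. -/
def sgn (w : Perm (Fin n)) : k := ((Perm.sign w : ℤ) : k)

theorem sgn_mul_self (w : Perm (Fin n)) : sgn k w * sgn k w = 1 := by
  rw [sgn, ← Int.cast_mul, ← Units.val_mul, Int.units_mul_self]
  simp

theorem tabYoung_tabPerm (r q : l.Box ≃ Fin n) : tabYoung k q =
    single (tabPerm r q) 1 * tabYoung k r * single (tabPerm r q)⁻¹ 1 := by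
  rw [← tabYoung_conj]
  congr 1
  ext x
  simp [tabPerm]

/-- The map from `P^l Q^{l^t}` to the antisymmetrized strands, with a scalar. -/
def toStrand (c : k) (r q : l.Box ≃ Fin n) : image _ (eps_idem k r q) ⟶ strandObj k n :=
  imageMap _ _ ((c * sgn k (tabPerm r q)) • actR k n (single (tabPerm r q)⁻¹ 1))

/-- The map from the antisymmetrized strands to `P^l Q^{l^t}`, with a scalar. -/
def ofStrand (c : k) (r q : l.Box ≃ Fin n) : strandObj k n ⟶ image _ (eps_idem k r q) :=
  imageMap _ _ ((c * sgn k (tabPerm r q)) • actR k n (single (tabPerm r q) 1))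

theorem actR_single_inv_mul (w : Perm (Fin n)) :
    actR k n (single w⁻¹ 1) * actR k n (single w 1) = 1 := by
  rw [← map_mul, single_one_mul_single_one, inv_mul_cancel, ← MonoidAlgebra.one_def, map_one]

theorem actR_tabYoung (r q : l.Box ≃ Fin n) : actR k n (inv' (tabYoung k q)) =
    actR k n (single (tabPerm r q) 1) * actR k n (inv' (tabYoung k r)) *
      actR k n (single (tabPerm r q)⁻¹ 1) := by
  rw [tabYoung_tabPerm k r q, inv'_mul, inv'_mul, inv'_single, inv'_single, inv_inv, map_mul, map_mul,
    mul_assoc]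

theorem eps_mul_avg (r q : l.Box ≃ Fin n) :
    eps k r q * actR k n (single (tabPerm r q) 1) * avg k n =
      actR k n (single (tabPerm r q) 1) * actL k n (tabYoung k r) * avg k n := by
  rw [eps, actR_tabYoung k r q, mul_assoc, mul_assoc, mul_assoc (_ * _),
    ← mul_assoc (actR k n (single (tabPerm r q)⁻¹ 1)), actR_single_inv_mul, one_mul, ← mul_assoc,
    ← mul_assoc, actL_mul_actR, mul_assoc (actR k n (single (tabPerm r q) 1)),
    mul_assoc (actR k n (single (tabPerm r q) 1)),
    ← left_mul_diagAvg_of_idem (actL_mul_actR k n) (tabYoung_mul_self r), mul_assoc]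

theorem avg_mul_eps (r q : l.Box ≃ Fin n) :
    avg k n * (actR k n (single (tabPerm r q)⁻¹ 1) * eps k r q) =
      avg k n * (actL k n (tabYoung k r) * actR k n (single (tabPerm r q)⁻¹ 1)) := by
  rw [eps, actR_tabYoung k r q, ← mul_assoc (actR k n _), ← actL_mul_actR, mul_assoc,
    mul_assoc (actR k n (single (tabPerm r q) 1)), ← mul_assoc (actR k n (single (tabPerm r q)⁻¹ 1)),
    actR_single_inv_mul, one_mul, ← mul_assoc, ← mul_assoc, ← mul_assoc,
    mul_assoc _ (actL k n (tabYoung k r)) (actR k n (inv' _)),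
    ← diagAvg_mul_left_of_idem (actL_mul_actR k n) (tabYoung_mul_self r)]

theorem eps_sandwich (r q : l.Box ≃ Fin n) (r' q' : m.Box ≃ Fin n) :
    eps k r' q' * actR k n (single (tabPerm r' q') 1) * avg k n *
      actR k n (single (tabPerm r q)⁻¹ 1) * eps k r q =
    actR k n (single (tabPerm r' q') 1) * (actL k n (tabYoung k r') * avg k n *
      actL k n (tabYoung k r)) * actR k n (single (tabPerm r q)⁻¹ 1) := by
  rw [mul_assoc _ _ (eps k r q), eps_mul_avg, mul_assoc _ (avg k n), avg_mul_eps]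
  simp only [mul_assoc]

theorem smul_comp_smul {C : Type*} [Category C] [Preadditive C] [Linear k C] {X Y Z W V : C}
    (a b : k) (e : V ⟶ X) (f : X ⟶ Y) (g : Y ⟶ Z) (h : Z ⟶ W) {U : C} (e' : W ⟶ U) :
    e ≫ ((a • f) ≫ g ≫ (b • h)) ≫ e' = (a * b) • (e ≫ f ≫ g ≫ h ≫ e') := by
  simp only [Linear.smul_comp, Linear.comp_smul, assoc, smul_smul]
  rw [mul_comm]

theorem toStrand_ofStrand_of_ne (hlm : l ≠ m) (c d : k) (r q : l.Box ≃ Fin n) (r' q' : m.Box ≃ Fin n) :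
    toStrand k c r q ≫ ofStrand k d r' q' = 0 := by
  refine (imageMap_comp _ _ _ _ _).trans (Eq.trans (imageMap_congr ?_) (imageMap_zero _ _))
  refine (smul_comp_smul ..).trans ?_
  refine (congrArg (_ • ·) (eps_sandwich k r q r' q')).trans ?_
  rw [tabYoung_diagAvg_of_ne hlm.symm _ _ (actL_mul_actR k n), mul_zero, zero_mul, smul_zero]
  simp

theorem toStrand_ofStrand (c d : k) (r q : l.Box ≃ Fin n)
    (hcd : c * d * kappa k r = (Fintype.card (Perm (Fin n)) : k)) :
    toStrand k c r q ≫ ofStrand k d r q = 𝟙 _ := by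
  refine (imageMap_comp _ _ _ _ _).trans (Eq.trans (imageMap_congr ?_) (imageMap_self _))
  refine (smul_comp_smul ..).trans ?_
  refine (congrArg (_ • ·) (eps_sandwich k r q r q)).trans ?_
  have h1 : (c * sgn k (tabPerm r q) * (d * sgn k (tabPerm r q))) *
      (kappa k r / (Fintype.card (Perm (Fin n)) : k)) = 1 := by
    rw [mul_mul_mul_comm, sgn_mul_self, mul_one, mul_div_assoc', hcd,
      div_self (Nat.cast_ne_zero.2 Fintype.card_ne_zero)]
  rw [tabYoung_diagAvg _ (actL_mul_actR k n), mul_smul_comm, smul_mul_assoc, smul_smul, h1, one_smul]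
  refine Eq.trans ?_ ((eps_idem k r q).symm.trans (congrArg (· * _) (eps_idem k r q).symm))
  rw [eps, actR_tabYoung k r q, ← mul_assoc, ← actL_mul_actR]
  simp only [mul_assoc]

theorem sum_ofStrand_toStrand (c d : Shape (Fin n) → k) (r q : ∀ l : Shape (Fin n), l.1.Box ≃ Fin n)
    (hcd : ∀ l, c l * d l * kappa k (r l) = (Fintype.card (Perm (Fin n)) : k)) :
    ∑ l, ofStrand k (d l) (r l) (q l) ≫ toStrand k (c l) (r l) (q l) = 𝟙 (strandObj k n) := by
  have h1 : ∀ l, ofStrand k (d l) (r l) (q l) ≫ toStrand k (c l) (r l) (q l) = _ :=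
    fun l => imageMap_comp _ _ _ _ _
  rw [Finset.sum_congr rfl fun l _ => h1 l, ← imageMap_sum]
  refine Eq.trans (imageMap_congr ?_) (imageMap_self _)
  rw [Preadditive.sum_comp, Preadditive.comp_sum]
  have h2 : ∀ l, (avg k n ≫ (((d l * sgn k (tabPerm (r l) (q l))) •
      actR k n (single (tabPerm (r l) (q l)) 1)) ≫ eps k (r l) (q l) ≫
        ((c l * sgn k (tabPerm (r l) (q l))) • actR k n (single (tabPerm (r l) (q l))⁻¹ 1))) ≫ avg k n) =
      ((Fintype.card (Perm (Fin n)) : k) / kappa k (r l)) •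
        (avg k n * actL k n (tabYoung k (r l)) * avg k n) := by
    intro l
    refine (smul_comp_smul ..).trans ?_
    have e1 : d l * sgn k (tabPerm (r l) (q l)) * (c l * sgn k (tabPerm (r l) (q l))) =
        (Fintype.card (Perm (Fin n)) : k) / kappa k (r l) := by
      rw [mul_mul_mul_comm, sgn_mul_self, mul_one, ← hcd l, mul_div_cancel_right₀ _ (kappa_ne_zero _),
        mul_comm]
    rw [e1]
    refine congrArg (_ • ·) ?_
    change avg k n * actR k n (single (tabPerm (r l) (q l))⁻¹ 1) * eps k (r l) (q l) *
      actR k n (single (tabPerm (r l) (q l)) 1) * avg k n = _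
    rw [mul_assoc (avg k n), avg_mul_eps, mul_assoc (avg k n), mul_assoc (actL k n _),
      actR_single_inv_mul, mul_one]
  refine (Finset.sum_congr rfl fun l _ => h2 l).trans ?_
  rw [sum_diagAvg (actL_mul_actR k n)]
  exact (((congrArg (· * _) (avg_idem k n))).trans (avg_idem k n)).symm

end Heis
end

noncomputable section

namespace Heis

open Equiv MonoidAlgebra YoungDiagram Heisenberg

variable (k : Type u) [Field k] [CharZero k] {n : ℕ} {l m : YoungDiagram}

theorem eps_eq (r q : l.Box ≃ Fin n) : eps k r q = actL k n (tabYoung k r) * actR k n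
    (inv' (single (tabPerm r q) 1 * tabYoung k r * single (tabPerm r q)⁻¹ 1)) := by
  rw [eps, tabYoung_tabPerm k r q]

theorem avg_innerCap_avg (n : ℕ) : avg k (n + 1) ≫ innerCap k n ≫ avg k n =
    avg k (n + 1) ≫ innerCap k n := by
  rw [avg, avg, diagAvg_actL_actR, diagAvg_actL_actR]
  exact antisym_innerCap k n

theorem avg_innerCup_avg (n : ℕ) : avg k n ≫ innerCup k n ≫ avg k (n + 1) =
    innerCup k n ≫ avg k (n + 1) := by
  rw [avg, avg, diagAvg_actL_actR, diagAvg_actL_actR]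
  exact innerCup_antisym k n

theorem smul_comp_comp_smul {C : Type*} [Category C] [Preadditive C] [Linear k C]
    {U V X Y Z W S T : C} (a b : k) (e : U ⟶ V) (f : V ⟶ X) (g : X ⟶ Y) (c : Y ⟶ Z) (g' : Z ⟶ W)
    (h : W ⟶ S) (e' : S ⟶ T) : e ≫ ((a • f) ≫ g ≫ c ≫ g' ≫ (b • h)) ≫ e' =
      (a * b) • (e ≫ f ≫ g ≫ c ≫ g' ≫ h ≫ e') := by
  simp only [Linear.smul_comp, Linear.comp_smul, assoc, smul_smul]
  rw [mul_comm]

theorem cap_sandwich (r q : l.Box ≃ Fin (n + 1)) (r' q' : m.Box ≃ Fin n) :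
    eps k r q ≫ actR k (n + 1) (single (tabPerm r q)⁻¹ 1) ≫ avg k (n + 1) ≫ innerCap k n ≫ avg k n ≫
      actR k n (single (tabPerm r' q') 1) ≫ eps k r' q' =
    (actR k (n + 1) (single (extLast n (tabPerm r' q')) 1) * actL k (n + 1) (extA k n (tabYoung k r')) *
      avg k (n + 1) * actL k (n + 1) (tabYoung k r) * actR k (n + 1) (single (tabPerm r q)⁻¹ 1)) ≫
      innerCap k n := by
  have e1 : eps k r q ≫ actR k (n + 1) (single (tabPerm r q)⁻¹ 1) ≫ avg k (n + 1) =
      actR k (n + 1) (single (tabPerm r q)⁻¹ 1) ≫ actL k (n + 1) (tabYoung k r) ≫ avg k (n + 1) := by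
    refine Eq.trans ?_ ((avg_mul_eps k r q).trans ?_)
    · exact (assoc _ _ _).symm
    · exact assoc _ _ _
  have e2 : avg k n ≫ actR k n (single (tabPerm r' q') 1) ≫ eps k r' q' =
      avg k n ≫ actL k n (tabYoung k r') ≫ actR k n (single (tabPerm r' q') 1) := eps_mul_avg k r' q'
  have e3 : innerCap k n ≫ actL k n (tabYoung k r') ≫ actR k n (single (tabPerm r' q') 1) =
      actL k (n + 1) (extA k n (tabYoung k r')) ≫
        actR k (n + 1) (single (extLast n (tabPerm r' q')) 1) ≫ innerCap k n := by
    rw [← extA_single, actR_innerCap, ← assoc, ← actL_innerCap, assoc]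
  rw [e2, reassoc_of% e1, reassoc_of% avg_innerCap_avg, e3]
  change _ = (actR k (n + 1) (single (tabPerm r q)⁻¹ 1) ≫ actL k (n + 1) (tabYoung k r) ≫
    avg k (n + 1) ≫ actL k (n + 1) (extA k n (tabYoung k r')) ≫
    actR k (n + 1) (single (extLast n (tabPerm r' q')) 1)) ≫ innerCap k n
  simp only [assoc]

theorem cup_sandwich (r q : l.Box ≃ Fin (n + 1)) (r' q' : m.Box ≃ Fin n) :
    eps k r' q' ≫ actR k n (single (tabPerm r' q')⁻¹ 1) ≫ avg k n ≫ innerCup k n ≫ avg k (n + 1) ≫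
      actR k (n + 1) (single (tabPerm r q) 1) ≫ eps k r q =
    innerCup k n ≫ (actR k (n + 1) (single (tabPerm r q) 1) * actL k (n + 1) (tabYoung k r) *
      avg k (n + 1) * actL k (n + 1) (extA k n (tabYoung k r')) *
      actR k (n + 1) (single (extLast n (tabPerm r' q'))⁻¹ 1)) := by
  have e1 : eps k r' q' ≫ actR k n (single (tabPerm r' q')⁻¹ 1) ≫ avg k n =
      actR k n (single (tabPerm r' q')⁻¹ 1) ≫ actL k n (tabYoung k r') ≫ avg k n := by
    refine Eq.trans ?_ ((avg_mul_eps k r' q').trans ?_)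
    · exact (assoc _ _ _).symm
    · exact assoc _ _ _
  have e2 : avg k (n + 1) ≫ actR k (n + 1) (single (tabPerm r q) 1) ≫ eps k r q =
      avg k (n + 1) ≫ actL k (n + 1) (tabYoung k r) ≫ actR k (n + 1) (single (tabPerm r q) 1) :=
    eps_mul_avg k r q
  have e3 : actR k n (single (tabPerm r' q')⁻¹ 1) ≫ actL k n (tabYoung k r') ≫ innerCup k n =
      innerCup k n ≫ actR k (n + 1) (single (extLast n (tabPerm r' q'))⁻¹ 1) ≫
        actL k (n + 1) (extA k n (tabYoung k r')) := by
    rw [← map_inv, ← extA_single, ← innerCup_actL, ← assoc, ← innerCup_actR, assoc]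
  rw [e2, reassoc_of% e1, reassoc_of% avg_innerCup_avg, reassoc_of% e3]
  rfl

theorem toStrand_cap_ofStrand (h : AddBox m l) (c d : k) (r q : l.Box ≃ Fin (n + 1))
    (r' q' : m.Box ≃ Fin n) {σ : Perm (Fin (n + 1))}
    (hσ : (h.extTab r').trans finSuccEquivLast.symm = r.trans σ)
    (hcd : c * d * kappa k r = (Fintype.card (Perm (Fin (n + 1))) : k)) :
    toStrand k c r q ≫ strandCap k n ≫ ofStrand k d r' q' =
      imageMap _ _ (((sgn k (tabPerm r q) * sgn k (tabPerm r' q') / h.scalar k) •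
        (actL k (n + 1) (single σ 1) *
          actR k (n + 1) (single (extLast n (tabPerm r' q') * σ * (tabPerm r q)⁻¹) 1))) ≫
        innerCap k n) := by
  refine (congrArg (_ ≫ ·) (imageMap_comp _ _ _ _ _)).trans ((imageMap_comp _ _ _ _ _).trans
    (imageMap_congr ?_))
  refine (smul_comp_comp_smul ..).trans ?_
  rw [cap_sandwich, remove_identity k h r' r hσ, Linear.smul_comp, Linear.smul_comp, Linear.smul_comp,
    Linear.comp_smul, smul_smul]
  have e1 : c * sgn k (tabPerm r q) * (d * sgn k (tabPerm r' q')) *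
      (kappa k r / (Fintype.card (Perm (Fin (n + 1))) : k) / h.scalar k) =
      sgn k (tabPerm r q) * sgn k (tabPerm r' q') / h.scalar k := by
    rw [← hcd]
    have := kappa_ne_zero (k := k) r
    have hc : c * d * kappa k r ≠ 0 := by
      rw [hcd]
      exact Nat.cast_ne_zero.2 Fintype.card_ne_zero
    have hc1 : c ≠ 0 := fun h => hc (by simp [h])
    have hd1 : d ≠ 0 := fun h => hc (by simp [h])
    field_simp
  rw [e1]
  refine congrArg (_ • ·) ?_
  have e3 : innerCap k n ≫ eps k r' q' = (actL k (n + 1) (extA k n (tabYoung k r')) *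
      actR k (n + 1) (extA k n (inv' (tabYoung k q')))) ≫ innerCap k n := by
    change innerCap k n ≫ actR k n _ ≫ actL k n _ = (actR k (n + 1) _ ≫ actL k (n + 1) _) ≫ _
    rw [assoc, actL_innerCap, ← assoc, ← actR_innerCap, assoc]
  rw [assoc, e3, tabYoung_tabPerm k r' q', eps_eq k r q]
  exact (assoc _ _ _).trans (congrArg (_ ≫ ·) (assoc _ _ _))

theorem toStrand_cup_ofStrand (h : AddBox m l) (c d : k) (r q : l.Box ≃ Fin (n + 1))
    (r' q' : m.Box ≃ Fin n) {σ : Perm (Fin (n + 1))}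
    (hσ : (h.extTab r').trans finSuccEquivLast.symm = r.trans σ)
    (hcd : c * d * kappa k r = (Fintype.card (Perm (Fin (n + 1))) : k)) :
    toStrand k c r' q' ≫ strandCup k n ≫ ofStrand k d r q =
      imageMap _ _ (innerCup k n ≫ ((sgn k (tabPerm r q) * sgn k (tabPerm r' q') / h.scalar k) •
        (actL k (n + 1) (single σ⁻¹ 1) *
          actR k (n + 1) (single (tabPerm r q * σ⁻¹ * (extLast n (tabPerm r' q'))⁻¹) 1)))) := by
  refine (congrArg (_ ≫ ·) (imageMap_comp _ _ _ _ _)).trans ((imageMap_comp _ _ _ _ _).trans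
    (imageMap_congr ?_))
  refine (smul_comp_comp_smul ..).trans ?_
  rw [cup_sandwich, insert_identity k h r' r hσ, Linear.comp_smul, Linear.comp_smul, Linear.smul_comp,
    Linear.comp_smul, smul_smul]
  have e1 : c * sgn k (tabPerm r' q') * (d * sgn k (tabPerm r q)) *
      (kappa k r / (Fintype.card (Perm (Fin (n + 1))) : k) / h.scalar k) =
      sgn k (tabPerm r q) * sgn k (tabPerm r' q') / h.scalar k := by
    rw [← hcd]
    have := kappa_ne_zero (k := k) r
    have hc : c * d * kappa k r ≠ 0 := by
      rw [hcd]
      exact Nat.cast_ne_zero.2 Fintype.card_ne_zero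
    have hc1 : c ≠ 0 := fun h => hc (by simp [h])
    have hd1 : d ≠ 0 := fun h => hc (by simp [h])
    field_simp
  rw [e1]
  refine congrArg (_ • ·) ?_
  have e3 : eps k r' q' ≫ innerCup k n = innerCup k n ≫ (actL k (n + 1) (extA k n (tabYoung k r')) *
      actR k (n + 1) (extA k n (inv' (tabYoung k q')))) := by
    change (actR k n _ ≫ actL k n _) ≫ innerCup k n = innerCup k n ≫ actR k (n + 1) _ ≫ actL k (n + 1) _
    rw [assoc, ← innerCup_actL, ← assoc, ← innerCup_actR, assoc]
  rw [assoc, reassoc_of% e3, tabYoung_tabPerm k r' q', eps_eq k r q]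
  rfl

theorem toStrand_cap_ofStrand_of_not_addBox (h : ¬AddBox m l) (c d : k) (r q : l.Box ≃ Fin (n + 1))
    (r' q' : m.Box ≃ Fin n) : toStrand k c r q ≫ strandCap k n ≫ ofStrand k d r' q' = 0 := by
  refine (congrArg (_ ≫ ·) (imageMap_comp _ _ _ _ _)).trans ((imageMap_comp _ _ _ _ _).trans
    ((imageMap_congr ?_).trans (imageMap_zero _ _)))
  refine (smul_comp_comp_smul ..).trans ?_
  rw [cap_sandwich, mul_assoc (actR k (n + 1) _), mul_assoc (actR k (n + 1) _),
    extA_mul_diagAvg_mul_of_not_addBox k h, mul_zero, zero_mul]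
  exact (congrArg (_ • ·) zero_comp).trans ((smul_zero _).trans
    ((congrArg (_ ≫ ·) zero_comp).trans comp_zero).symm)

theorem toStrand_cup_ofStrand_of_not_addBox (h : ¬AddBox m l) (c d : k) (r q : l.Box ≃ Fin (n + 1))
    (r' q' : m.Box ≃ Fin n) : toStrand k c r' q' ≫ strandCup k n ≫ ofStrand k d r q = 0 := by
  refine (congrArg (_ ≫ ·) (imageMap_comp _ _ _ _ _)).trans ((imageMap_comp _ _ _ _ _).trans
    ((imageMap_congr ?_).trans (imageMap_zero _ _)))
  refine (smul_comp_comp_smul ..).trans ?_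
  rw [cup_sandwich, mul_assoc (actR k (n + 1) _), mul_assoc (actR k (n + 1) _),
    mul_diagAvg_mul_extA_of_not_addBox k h, mul_zero, zero_mul]
  exact (congrArg (_ • ·) comp_zero).trans ((smul_zero _).trans
    ((congrArg (_ ≫ ·) zero_comp).trans comp_zero).symm)

end Heis
end

noncomputable section

namespace YoungDiagram

open Equiv

variable {n : ℕ} {l m : YoungDiagram}

/-- The row tableau with labels in `Fin n`. -/
def rTab (l : YoungDiagram) (hl : l.card = n) : l.Box ≃ Fin n := l.rowTab.trans (finCongr hl)

/-- The transpose of the row tableau of the transpose, in reversed order. -/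
def qTab (l : YoungDiagram) (hl : l.card = n) : l.Box ≃ Fin n :=
  l.boxTranspose.trans ((rTab l.transpose ((card_transpose l).trans hl)).trans Fin.revPerm)

theorem AddBox.strip_transpose (h : AddBox m l) (x : l.Box) :
    h.transpose.strip (l.boxTranspose x) = (h.strip x).map m.boxTranspose := by
  change (if hx : (l.boxTranspose x).1 ∈ m.transpose.cells then some (⟨(l.boxTranspose x).1, hx⟩ :
    m.transpose.Box) else none) = Option.map m.boxTranspose
    (if hx : x.1 ∈ m.cells then some (⟨x.1, hx⟩ : m.Box) else none)
  by_cases hx : x.1 ∈ m.cells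
  · have hx' : (l.boxTranspose x).1 ∈ m.transpose.cells := (m.boxTranspose ⟨x.1, hx⟩).2
    rw [dif_pos hx, dif_pos hx']
    rfl
  · have hx' : (l.boxTranspose x).1 ∉ m.transpose.cells := fun h' =>
      hx (m.boxTranspose.symm ⟨_, h'⟩).2
    rw [dif_neg hx, dif_neg hx']
    rfl

/-- `newLast` as a permutation of `Fin (n + 1)`. -/
def AddBox.lastPerm (h : AddBox m l) (hl : l.card = n + 1) : Perm (Fin (n + 1)) :=
  (finCongr hl).permCongr h.newLast

/-- `newFirst` for the transposes as a permutation of `Fin (n + 1)`. -/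
def AddBox.firstPerm (h : AddBox m l) (hl : l.card = n + 1) : Perm (Fin (n + 1)) :=
  (finCongr ((card_transpose l).trans hl)).permCongr h.transpose.newFirst

theorem AddBox.extTab_rTab (h : AddBox m l) (hm : m.card = n) (hl : l.card = n + 1) :
    (h.extTab (rTab m hm)).trans finSuccEquivLast.symm = (rTab l hl).trans (h.lastPerm hl) := by
  subst hm
  refine Equiv.ext fun x => ?_
  simp [rTab, AddBox.lastPerm, AddBox.newLast, AddBox.extTab, Equiv.permCongr_apply]

theorem AddBox.permCongr_newFirst (h : AddBox m l) (hm : m.card = n) (hl : l.card = n + 1)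
    (x : l.Box) : (finCongr hl).permCongr h.newFirst (rTab l hl x) =
      (finSuccEquiv n).symm (h.extTab (rTab m hm) x) := by
  subst hm
  simp [rTab, AddBox.newFirst, AddBox.extTab, Equiv.permCongr_apply]

theorem AddBox.extLast_mul_lastPerm (h : AddBox m l) (hm : m.card = n) (hl : l.card = n + 1) :
    extLast n (Heis.tabPerm (rTab m hm) (qTab m hm)) * h.lastPerm hl *
      (Heis.tabPerm (rTab l hl) (qTab l hl))⁻¹ = flipPerm (n + 1) (h.firstPerm hl) := by
  have h1 : ∀ x, (h.lastPerm hl) (rTab l hl x) = finSuccEquivLast.symm (h.extTab (rTab m hm) x) :=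
    fun x => (DFunLike.congr_fun (h.extTab_rTab hm hl) x).symm
  have h2 : ∀ x, h.firstPerm hl (rTab l.transpose ((card_transpose l).trans hl) x) =
      (finSuccEquiv n).symm (h.transpose.extTab (rTab m.transpose ((card_transpose m).trans hm)) x) :=
    h.transpose.permCongr_newFirst _ _
  refine Equiv.ext fun i => ?_
  obtain ⟨x, rfl⟩ := (qTab l hl).surjective i
  have h3 : (Heis.tabPerm (rTab l hl) (qTab l hl))⁻¹ (qTab l hl x) = rTab l hl x := by
    rw [Perm.inv_eq_iff_eq]
    simp [Heis.tabPerm]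
  rw [Perm.mul_apply, Perm.mul_apply, h3, h1, flipPerm_apply]
  have h4 : (qTab l hl x).rev = rTab l.transpose ((card_transpose l).trans hl) (l.boxTranspose x) := by
    simp [qTab]
  rw [h4, h2]
  have h5 : ∀ (S : m.transpose.Box ≃ Fin n), h.transpose.extTab S (l.boxTranspose x) =
      ((h.strip x).map m.boxTranspose).map S := fun S => congrArg (Option.map S) (h.strip_transpose x)
  rw [h5]
  have h6 : h.extTab (rTab m hm) x = (h.strip x).map (rTab m hm) := rfl
  rw [h6]
  cases h.strip x with
  | none =>
    rw [Option.map_none, Option.map_none, Option.map_none, finSuccEquivLast_symm_none, extLast_last,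
      finSuccEquiv_symm_none, Fin.rev_zero]
  | some y =>
    rw [Option.map_some, Option.map_some, Option.map_some, finSuccEquivLast_symm_some,
      extLast_castSucc, finSuccEquiv_symm_some, Fin.rev_succ]
    simp [Heis.tabPerm, qTab]

end YoungDiagram

namespace Heisenberg

variable {k : Type u} [CommRing k] {X Y X' Y' : Heis k} {e : End X} {f : End Y} {e' : End X'}
  {f' : End Y'}

/-- Images of corresponding idempotents on isomorphic objects are isomorphic. -/
def imageIso (he : e * e = e) (hf : f * f = f) (u : X ≅ Y) (h : e ≫ u.hom = u.hom ≫ f) :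
    image e he ≅ image f hf where
  hom := imageMap he hf u.hom
  inv := imageMap hf he u.inv
  hom_inv_id := by
    rw [imageMap_comp, ← reassoc_of% h, u.hom_inv_id, comp_id, imageMap_self]
  inv_hom_id := by
    rw [imageMap_comp, h, u.inv_hom_id_assoc, imageMap_self]

theorem imageIso_conj (he : e * e = e) (hf : f * f = f) (u : X ≅ Y) (h : e ≫ u.hom = u.hom ≫ f)
    (he' : e' * e' = e') (hf' : f' * f' = f') (u' : X' ≅ Y') (h' : e' ≫ u'.hom = u'.hom ≫ f')
    (v : Y ⟶ Y') : (imageIso he hf u h).hom ≫ imageMap hf hf' v ≫ (imageIso he' hf' u' h').inv =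
      imageMap he he' (u.hom ≫ v ≫ u'.inv) := by
  have e1 : e ≫ e = e := he
  have e2 : e' ≫ e' = e' := he'
  have h3 : f' ≫ u'.inv = u'.inv ≫ e' := by
    rw [Iso.comp_inv_eq, assoc, h', u'.inv_hom_id_assoc]
  change imageMap _ _ _ ≫ imageMap _ _ _ ≫ imageMap _ _ _ = _
  rw [imageMap_comp, imageMap_comp]
  refine imageMap_congr ?_
  simp only [assoc, h3, e2]
  rw [← reassoc_of% h, reassoc_of% e1]

end Heisenberg

namespace Heis

open Equiv MonoidAlgebra YoungDiagram Heisenberg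

section

variable (k : Type u) [Field k]

/-- Transport of upward strands along an equality of numbers. -/
def castP {a b : ℕ} (h : a = b) : powR (P : Heis k) a ≅ powR P b := eqToIso (by rw [h])

/-- Transport of downward strands along an equality of numbers. -/
def castQ {a b : ℕ} (h : a = b) : powL (Q : Heis k) a ≅ powL Q b := eqToIso (by rw [h])

theorem permP_castP {a b : ℕ} (h : a = b) (w : Perm (Fin a)) :
    permP k a w ≫ (castP k h).hom = (castP k h).hom ≫ permP k b ((finCongr h).permCongr w) := by
  subst h
  exact (comp_id _).trans (id_comp _).symm

theorem permQ_castQ {a b : ℕ} (h : a = b) (w : Perm (Fin a)) :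
    permQ k a w ≫ (castQ k h).hom = (castQ k h).hom ≫ permQ k b ((finCongr h).permCongr w) := by
  subst h
  exact (comp_id _).trans (id_comp _).symm

variable {n : ℕ} {l m : YoungDiagram}

theorem actP_castP (hl : l.card = n) (x : MonoidAlgebra k (Perm l.Box)) :
    actP k l x ≫ (castP k hl).hom =
      (castP k hl).hom ≫ liftP k n (domCongr k k (rTab l hl).permCongrHom x) := by
  refine comp_eq_of_single (actP k l)
    ((liftP k n).comp (domCongr k k (rTab l hl).permCongrHom).toAlgHom) _ (fun w => ?_) x
  change actP k l (single w 1) ≫ _ =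
    _ ≫ liftP k n (domCongr k k (rTab l hl).permCongrHom (single w 1))
  rw [actP, lift_single, one_smul, domCongr_single, liftP_single]
  exact permP_castP k hl _

theorem actQ_castQ (hl : l.card = n) (x : MonoidAlgebra k (Perm l.Box)) :
    actQ k l x ≫ (castQ k hl).hom =
      (castQ k hl).hom ≫ liftQ k n (domCongr k k (rTab l hl).permCongrHom x) := by
  refine comp_eq_of_single (actQ k l)
    ((liftQ k n).comp (domCongr k k (rTab l hl).permCongrHom).toAlgHom) _ (fun w => ?_) x
  change actQ k l (single w 1) ≫ _ =
    _ ≫ liftQ k n (domCongr k k (rTab l hl).permCongrHom (single w 1))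
  rw [actQ, lift_single, one_smul, domCongr_single, liftQ_single]
  exact permQ_castQ k hl _

theorem splitP_castP (h : AddBox m l) (hm : m.card = n) (hl : l.card = n + 1) :
    splitP k h ≫ (castP k hm).hom ▷ P = (castP k hl).hom ≫ permP k (n + 1) (h.lastPerm hl) := by
  subst hm
  rw [AddBox.lastPerm, ← permP_castP]
  refine (congrArg (_ ≫ ·) (id_whiskerRight _ _)).trans (comp_id _)

theorem splitQ_castQ (h : AddBox m l) (hm : m.transpose.card = n) (hl : l.transpose.card = n + 1) :
    splitQ k h ≫ Q ◁ (castQ k hm).hom =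
      (castQ k hl).hom ≫ permQ k (n + 1) ((finCongr hl).permCongr h.transpose.newFirst) := by
  subst hm
  rw [← permQ_castQ]
  refine (congrArg (_ ≫ ·) (whiskerLeft_id _ _)).trans (comp_id _)

theorem trans_conj {D : Type*} [Category D] {A B C A' B' C' : D} (t : A ≅ B) (s : B ≅ C)
    (t' : A' ≅ B') (s' : B' ≅ C') (v : C ⟶ C') :
    (t ≪≫ s).hom ≫ v ≫ (t' ≪≫ s').inv = t.hom ≫ (s.hom ≫ v ≫ s'.inv) ≫ t'.inv := by
  simp

theorem castP_mergeP (h : AddBox m l) (hm : m.card = n) (hl : l.card = n + 1) :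
    (castP k hm).hom ▷ P ≫ permP k (n + 1) (h.lastPerm hl)⁻¹ = mergeP k h ≫ (castP k hl).hom := by
  subst hm
  rw [mergeP, assoc, permP_castP, AddBox.lastPerm]
  refine ((congrArg (· ≫ _) (id_whiskerRight _ _)).trans (id_comp _)).trans ?_
  rw [castP, eqToIso.hom, eqToHom_trans_assoc]
  exact (id_comp _).symm

theorem castQ_mergeQ (h : AddBox m l) (hm : m.transpose.card = n) (hl : l.transpose.card = n + 1) :
    Q ◁ (castQ k hm).hom ≫ permQ k (n + 1) ((finCongr hl).permCongr h.transpose.newFirst)⁻¹ =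
      mergeQ k h ≫ (castQ k hl).hom := by
  subst hm
  rw [mergeQ, assoc, permQ_castQ]
  refine ((congrArg (· ≫ _) (whiskerLeft_id _ _)).trans (id_comp _)).trans ?_
  rw [castQ, eqToIso.hom, eqToHom_trans_assoc]
  exact (id_comp _).symm

variable [CharZero k]

theorem act_cast (hl : l.card = n) :
    (actP k l (l.young k) ⊗ₘ actQ k l.transpose (l.transpose.young k)) ≫
      ((castP k hl).hom ⊗ₘ (castQ k ((card_transpose l).trans hl)).hom) =
    ((castP k hl).hom ⊗ₘ (castQ k ((card_transpose l).trans hl)).hom) ≫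
      eps k (rTab l hl) (qTab l hl) := by
  have h1 : eps k (rTab l hl) (qTab l hl) =
      (liftP k n (domCongr k k (rTab l hl).permCongrHom (l.young k)) ⊗ₘ
        liftQ k n (domCongr k k (rTab l.transpose ((card_transpose l).trans hl)).permCongrHom
          (l.transpose.young k))) := by
    rw [eps, qTab, ← actD_tabYoung, MonoidalCategory.tensorHom_def']
    rfl
  rw [h1]
  simp only [tensorHom_comp_tensorHom, actP_castP k hl, actQ_castQ]

/-- The object `P^l Q^{l^t}` as a direct summand of `strands k n`. -/
def symIso (hl : l.card = n) : symPQ k l ≅ image _ (eps_idem k (rTab l hl) (qTab l hl)) :=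
  tenImage (actP_young k l) (actQ_young k l.transpose) ≪≫
    imageIso (tensor_idem (actP_young k l) (actQ_young k l.transpose)) (eps_idem k (rTab l hl) (qTab l hl))
      (castP k hl ⊗ᵢ castQ k ((card_transpose l).trans hl)) (act_cast k hl)

theorem smul_actL_mul_actR (h : AddBox m l) (hm : m.card = n) (hl : l.card = n + 1) :
    (sgn k (tabPerm (rTab l hl) (qTab l hl)) * sgn k (tabPerm (rTab m hm) (qTab m hm)) / h.scalar k) •
        (actL k (n + 1) (single (h.lastPerm hl) 1) * actR k (n + 1)
          (single (extLast n (tabPerm (rTab m hm) (qTab m hm)) * h.lastPerm hl *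
            (tabPerm (rTab l hl) (qTab l hl))⁻¹) 1)) =
      h.coef k • (permP k (n + 1) (h.lastPerm hl) ⊗ₘ permQ k (n + 1) (h.firstPerm hl)) := by
  have hs : (((Perm.sign (extLast n (tabPerm (rTab m hm) (qTab m hm)) * h.lastPerm hl *
      (tabPerm (rTab l hl) (qTab l hl))⁻¹)) : ℤ) : k) = sgn k (tabPerm (rTab m hm) (qTab m hm)) *
      ((Perm.sign h.newLast : ℤ) : k) * sgn k (tabPerm (rTab l hl) (qTab l hl)) := by
    rw [map_mul, map_mul, sign_extLast, Perm.sign_inv, AddBox.lastPerm, Perm.sign_permCongr, sgn, sgn]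
    push_cast
    rfl
  rw [actR_single, hs, h.extLast_mul_lastPerm hm hl, flipPerm_flipPerm, mul_smul_comm, smul_smul,
    actL_single]
  have e1 : sgn k (tabPerm (rTab l hl) (qTab l hl)) * sgn k (tabPerm (rTab m hm) (qTab m hm)) /
      h.scalar k * (sgn k (tabPerm (rTab m hm) (qTab m hm)) * ((Perm.sign h.newLast : ℤ) : k) *
        sgn k (tabPerm (rTab l hl) (qTab l hl))) = h.coef k := by
    rw [AddBox.coef]
    linear_combination (((Perm.sign h.newLast : ℤ) : k) * (h.scalar k)⁻¹ *
      sgn k (tabPerm (rTab m hm) (qTab m hm)) ^ 2) * sgn_mul_self k (tabPerm (rTab l hl) (qTab l hl)) +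
      (((Perm.sign h.newLast : ℤ) : k) * (h.scalar k)⁻¹) *
        sgn_mul_self k (tabPerm (rTab m hm) (qTab m hm))
  rw [e1, MonoidalCategory.tensorHom_def']
  rfl

theorem symIso_conj {a b : ℕ} {l m : YoungDiagram} (hl : l.card = a) (hm : m.card = b)
    (v : strands k a ⟶ strands k b) :
    (symIso k hl).hom ≫ imageMap _ _ v ≫ (symIso k hm).inv =
      (tenImage (actP_young k l) (actQ_young k l.transpose)).hom ≫
        imageMap _ _ (((castP k hl).hom ⊗ₘ (castQ k ((card_transpose l).trans hl)).hom) ≫ v ≫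
          ((castP k hm).inv ⊗ₘ (castQ k ((card_transpose m).trans hm)).inv)) ≫
        (tenImage (actP_young k m) (actQ_young k m.transpose)).inv :=
  (trans_conj _ _ _ _ _).trans (congrArg (fun x => _ ≫ x ≫ _) (imageIso_conj _ _ _ _ _ _ _ _ _))

theorem induced_eq_symIso_conj {a b : ℕ} {l m : YoungDiagram} (hl : l.card = a) (hm : m.card = b)
    (u : powR P l.card ⊗ powL Q l.transpose.card ⟶ powR P m.card ⊗ powL Q m.transpose.card)
    (v : strands k a ⟶ strands k b)
    (h : u ≫ ((castP k hm).hom ⊗ₘ (castQ k ((card_transpose m).trans hm)).hom) =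
      ((castP k hl).hom ⊗ₘ (castQ k ((card_transpose l).trans hl)).hom) ≫ v) :
    induced (actP_young k l) (actQ_young k l.transpose) (actP_young k m)
      (actQ_young k m.transpose) u =
      (symIso k hl).hom ≫ imageMap _ _ v ≫ (symIso k hm).inv := by
  rw [symIso_conj, induced_eq]
  have e : u = ((castP k hl).hom ⊗ₘ (castQ k ((card_transpose l).trans hl)).hom) ≫ v ≫
      ((castP k hm).inv ⊗ₘ (castQ k ((card_transpose m).trans hm)).inv) := by
    rw [← assoc, ← h, assoc, tensorHom_comp_tensorHom, Iso.hom_inv_id,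
      Iso.hom_inv_id, id_tensorHom_id, comp_id]
  rw [← e]

theorem midCap_conj {A A' B B' X X' Y Y' : Heis k} {f : X ⟶ A ⊗ P} {g : A ⟶ A'} {s : X ⟶ X'}
    {w : X' ⟶ A' ⊗ P} {f' : Y ⟶ Q ⊗ B} {g' : B ⟶ B'} {t : Y ⟶ Y'} {w' : Y' ⟶ Q ⊗ B'}
    (h : f ≫ g ▷ P = s ≫ w) (h' : f' ≫ Q ◁ g' = t ≫ w') :
    ((f ⊗ₘ f') ≫ midCap A B) ≫ (g ⊗ₘ g') = (s ⊗ₘ t) ≫ (w ⊗ₘ w') ≫ midCap A' B' := by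
  rw [assoc, ← midCap_naturality, tensorHom_comp_tensorHom_assoc, h, h',
    tensorHom_comp_tensorHom_assoc]

theorem midCup_conj {A A' B B' X X' Y Y' : Heis k} {f : A ⊗ P ⟶ X} {g : A' ⟶ A} {s : X' ⟶ X}
    {w : A' ⊗ P ⟶ X'} {f' : Q ⊗ B ⟶ Y} {g' : B' ⟶ B} {t : Y' ⟶ Y} {w' : Q ⊗ B' ⟶ Y'}
    (h : g ▷ P ≫ f = w ≫ s) (h' : Q ◁ g' ≫ f' = w' ≫ t) :
    (midCup A' B' ≫ (w ⊗ₘ w')) ≫ (s ⊗ₘ t) = (g ⊗ₘ g') ≫ midCup A B ≫ (f ⊗ₘ f') := by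
  rw [assoc, tensorHom_comp_tensorHom, ← h, ← h', ← tensorHom_comp_tensorHom,
    ← assoc, midCup_naturality, assoc]

theorem capComponent_eq (h : AddBox m l) (hm : m.card = n) (hl : l.card = n + 1) :
    capComponent k h = (symIso k hl).hom ≫ imageMap _ _ ((h.coef k •
      (permP k (n + 1) (h.lastPerm hl) ⊗ₘ permQ k (n + 1) (h.firstPerm hl))) ≫ innerCap k n) ≫
        (symIso k hm).inv := by
  refine induced_eq_symIso_conj k hl hm _ _ ?_
  rw [Linear.smul_comp, Linear.smul_comp, Linear.comp_smul]
  refine congrArg (_ • ·) ?_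
  exact midCap_conj k (splitP_castP k h hm hl)
    (splitQ_castQ k h ((card_transpose m).trans hm) ((card_transpose l).trans hl))

theorem cupComponent_eq (h : AddBox m l) (hm : m.card = n) (hl : l.card = n + 1) :
    cupComponent k h = (symIso k hm).hom ≫ imageMap _ _ (innerCup k n ≫ (h.coef k •
      (permP k (n + 1) (h.lastPerm hl)⁻¹ ⊗ₘ permQ k (n + 1) (h.firstPerm hl)⁻¹))) ≫
        (symIso k hl).inv := by
  refine induced_eq_symIso_conj k hm hl _ _ ?_
  rw [Linear.smul_comp, Linear.comp_smul, Linear.comp_smul]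
  refine congrArg (_ • ·) ?_
  exact midCup_conj k (castP_mergeP k h hm hl)
    (castQ_mergeQ k h ((card_transpose m).trans hm) ((card_transpose l).trans hl))

theorem smul_actL_mul_actR_inv (h : AddBox m l) (hm : m.card = n) (hl : l.card = n + 1) :
    (sgn k (tabPerm (rTab l hl) (qTab l hl)) * sgn k (tabPerm (rTab m hm) (qTab m hm)) / h.scalar k) •
        (actL k (n + 1) (single (h.lastPerm hl)⁻¹ 1) * actR k (n + 1)
          (single (tabPerm (rTab l hl) (qTab l hl) * (h.lastPerm hl)⁻¹ *
            (extLast n (tabPerm (rTab m hm) (qTab m hm)))⁻¹) 1)) =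
      h.coef k • (permP k (n + 1) (h.lastPerm hl)⁻¹ ⊗ₘ permQ k (n + 1) (h.firstPerm hl)⁻¹) := by
  have hs : (((Perm.sign (tabPerm (rTab l hl) (qTab l hl) * (h.lastPerm hl)⁻¹ *
      (extLast n (tabPerm (rTab m hm) (qTab m hm)))⁻¹)) : ℤ) : k) =
      sgn k (tabPerm (rTab m hm) (qTab m hm)) *
      ((Perm.sign h.newLast : ℤ) : k) * sgn k (tabPerm (rTab l hl) (qTab l hl)) := by
    rw [map_mul, map_mul, Perm.sign_inv, Perm.sign_inv, sign_extLast, AddBox.lastPerm,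
      Perm.sign_permCongr, sgn, sgn]
    push_cast
    ring
  have hinv : tabPerm (rTab l hl) (qTab l hl) * (h.lastPerm hl)⁻¹ *
      (extLast n (tabPerm (rTab m hm) (qTab m hm)))⁻¹ = flipPerm (n + 1) (h.firstPerm hl)⁻¹ := by
    rw [map_inv, ← h.extLast_mul_lastPerm hm hl]
    group
  rw [actR_single, hs, hinv, flipPerm_flipPerm, mul_smul_comm, smul_smul, actL_single]
  have e1 : sgn k (tabPerm (rTab l hl) (qTab l hl)) * sgn k (tabPerm (rTab m hm) (qTab m hm)) /
      h.scalar k * (sgn k (tabPerm (rTab m hm) (qTab m hm)) * ((Perm.sign h.newLast : ℤ) : k) *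
        sgn k (tabPerm (rTab l hl) (qTab l hl))) = h.coef k := by
    rw [AddBox.coef]
    linear_combination (((Perm.sign h.newLast : ℤ) : k) * (h.scalar k)⁻¹ *
      sgn k (tabPerm (rTab m hm) (qTab m hm)) ^ 2) * sgn_mul_self k (tabPerm (rTab l hl) (qTab l hl)) +
      (((Perm.sign h.newLast : ℤ) : k) * (h.scalar k)⁻¹) *
        sgn_mul_self k (tabPerm (rTab m hm) (qTab m hm))
  rw [e1, MonoidalCategory.tensorHom_def']
  rfl

end

end Heis
end

noncomputable section

namespace Heis

open Equiv MonoidAlgebra YoungDiagram Heisenberg Limits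

section Biproduct

variable {C : Type v} [Category.{w} C] [Preadditive C] [HasFiniteBiproducts C]
  {J : Type}

/-- A biproduct is isomorphic to an object that is split into the same summands. -/
def biproductIso [Fintype J] (f : J → C) {Z : C} (a : ∀ j, f j ⟶ Z)
    (b : ∀ j, Z ⟶ f j) (hab : ∀ j, a j ≫ b j = 𝟙 _) (hne : ∀ i j, i ≠ j → a i ≫ b j = 0)
    (hs : ∑ j, b j ≫ a j = 𝟙 Z) : ⨁ f ≅ Z where
  hom := biproduct.desc a
  inv := biproduct.lift b
  hom_inv_id := by
    classical
    ext i j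
    rw [id_comp, biproduct.ι_π]
    simp only [assoc, biproduct.lift_π, biproduct.ι_desc_assoc]
    split_ifs with h
    · subst h
      simp [hab]
    · exact hne _ _ h
  inv_hom_id := by rw [biproduct.lift_desc, hs]

theorem desc_comp_comp_lift {J' : Type} [Finite J] [Finite J'] {f : J → C} {f' : J' → C} {Z Z' : C} (a : ∀ j, f j ⟶ Z) (b : ∀ j, Z' ⟶ f' j)
    (g : Z ⟶ Z') :
    biproduct.desc a ≫ g ≫ biproduct.lift b = biproduct.matrix fun i j => a i ≫ g ≫ b j := by
  ext i j
  simp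

end Biproduct

variable (k : Type u) [Field k] [CharZero k] {n : ℕ}

/-- The partitions of `n`. -/
abbrev Part (n : ℕ) : Type := {l : YoungDiagram // (l.card : ℤ) = (n : ℤ)}

instance : Fintype (Part n) := Fintype.ofFinite _

theorem Part.card_eq (l : Part n) : l.1.card = n := by exact_mod_cast l.2

/-- A partition of `n` as a shape. -/
def shapeEquiv (n : ℕ) : Part n ≃ Shape (Fin n) :=
  Equiv.subtypeEquivRight fun l => by rw [Fintype.card_fin]; exact Nat.cast_inj

/-- The inclusion of a summand `P^l Q^{l^t}`, up to the scalar `c`. -/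
def partIn (c : k) (l : Part n) : symPQ k l.1 ⟶ strandObj k n :=
  (symIso k l.card_eq).hom ≫ toStrand k c (rTab l.1 l.card_eq) (qTab l.1 l.card_eq)

/-- The projection to a summand `P^l Q^{l^t}`, up to the scalar `d`. -/
def partOut (d : k) (l : Part n) : strandObj k n ⟶ symPQ k l.1 :=
  ofStrand k d (rTab l.1 l.card_eq) (qTab l.1 l.card_eq) ≫ (symIso k l.card_eq).inv

theorem partIn_comp_partOut {a b : ℕ} (l : Part a) (m : Part b) (c d : k)
    (f : strandObj k a ⟶ strandObj k b) :
    partIn k c l ≫ f ≫ partOut k d m = (symIso k l.card_eq).hom ≫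
      (toStrand k c (rTab l.1 l.card_eq) (qTab l.1 l.card_eq) ≫ f ≫
        ofStrand k d (rTab m.1 m.card_eq) (qTab m.1 m.card_eq)) ≫ (symIso k m.card_eq).inv := by
  simp only [partIn, partOut, assoc]

/-- The object `sigmaObj k n` as a direct summand of `strands k n`, for a choice of scalars. -/
def sigmaIso (c d : Part n → k) (hcd : ∀ l, c l * d l * kappa k (rTab l.1 l.card_eq) =
    (Fintype.card (Perm (Fin n)) : k)) : sigmaObj k (n : ℤ) ≅ strandObj k n :=
  biproductIso (fun l : Part n => symPQ k l.1) (fun l => partIn k (c l) l) (fun l => partOut k (d l) l)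
    (fun l => by
      refine (congrArg (_ ≫ ·) (id_comp _)).symm.trans
        ((partIn_comp_partOut k l l (c l) (d l) (𝟙 _)).trans ?_)
      rw [id_comp, toStrand_ofStrand k _ _ _ _ (hcd l), id_comp, Iso.hom_inv_id])
    (fun l m hlm => by
      refine (congrArg (_ ≫ ·) (id_comp _)).symm.trans
        ((partIn_comp_partOut k l m (c l) (d m) (𝟙 _)).trans ?_)
      rw [id_comp, toStrand_ofStrand_of_ne k (fun h => hlm (Subtype.ext h)), zero_comp,
        comp_zero])
    (by
      refine Eq.trans ?_ (sum_ofStrand_toStrand k (fun l => c ((shapeEquiv n).symm l))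
        (fun l => d ((shapeEquiv n).symm l)) (fun l => rTab l.1 ((shapeEquiv n).symm l).card_eq)
        (fun l => qTab l.1 ((shapeEquiv n).symm l).card_eq) (fun l => hcd ((shapeEquiv n).symm l)))
      rw [← (shapeEquiv n).sum_comp]
      refine Finset.sum_congr rfl fun l _ => ?_
      simp only [partIn, partOut, assoc, Iso.inv_hom_id_assoc]
      rfl)

theorem sigmaIso_hom_conj {a b : ℕ} (c d : Part a → k) (hcd) (c' d' : Part b → k) (hcd')
    (f : strandObj k a ⟶ strandObj k b) :
    (sigmaIso k c d hcd).hom ≫ f ≫ (sigmaIso k c' d' hcd').inv =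
      biproduct.matrix fun l m => partIn k (c l) l ≫ f ≫ partOut k (d' m) m := by
  exact desc_comp_comp_lift _ _ _

/-- The number of permutations divided by the scalar of a shape. -/
def shapeScalar (l : Part n) : k :=
  (Fintype.card (Perm (Fin n)) : k) / kappa k (rTab l.1 l.card_eq)

theorem shapeScalar_mul (l : Part n) : shapeScalar k l * kappa k (rTab l.1 l.card_eq) =
    (Fintype.card (Perm (Fin n)) : k) := div_mul_cancel₀ _ (kappa_ne_zero _)

/-- The isomorphism of `sigmaObj k n` with `strandObj k n` adapted to `dMinus`. -/
def minusIso (n : ℕ) : sigmaObj k (n : ℤ) ≅ strandObj k n :=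
  sigmaIso k (shapeScalar k) 1 fun l => by rw [Pi.one_apply, mul_one, shapeScalar_mul]

/-- The isomorphism of `sigmaObj k n` with `strandObj k n` adapted to `dPlus`. -/
def plusIso (n : ℕ) : sigmaObj k (n : ℤ) ≅ strandObj k n :=
  sigmaIso k 1 (shapeScalar k) fun l => by rw [Pi.one_apply, one_mul, shapeScalar_mul]

theorem dMinus_eq (n : ℕ) : dMinus k ((n + 1 : ℕ) : ℤ) (n : ℤ) =
    (minusIso k (n + 1)).hom ≫ strandCap k n ≫ (minusIso k n).inv := by
  classical
  rw [minusIso, minusIso, sigmaIso_hom_conj, dMinus]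
  refine congrArg _ (funext fun (l : Part (n + 1)) => funext fun (m : Part n) => ?_)
  rw [partIn_comp_partOut]
  split_ifs with h
  · rw [toStrand_cap_ofStrand k h _ _ _ _ _ _ (h.extTab_rTab m.card_eq l.card_eq)
      (by rw [Pi.one_apply, mul_one, shapeScalar_mul]), smul_actL_mul_actR]
    exact capComponent_eq k h m.card_eq l.card_eq
  · rw [toStrand_cap_ofStrand_of_not_addBox k h, zero_comp, comp_zero]

theorem dPlus_eq (n : ℕ) : dPlus k (n : ℤ) ((n + 1 : ℕ) : ℤ) =
    (plusIso k n).hom ≫ strandCup k n ≫ (plusIso k (n + 1)).inv := by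
  classical
  rw [plusIso, plusIso, sigmaIso_hom_conj, dPlus]
  refine congrArg _ (funext fun (m : Part n) => funext fun (l : Part (n + 1)) => ?_)
  rw [partIn_comp_partOut]
  split_ifs with h
  · rw [toStrand_cup_ofStrand k h _ _ _ _ _ _ (h.extTab_rTab m.card_eq l.card_eq)
      (by rw [Pi.one_apply, one_mul, shapeScalar_mul]), smul_actL_mul_actR_inv]
    exact cupComponent_eq k h m.card_eq l.card_eq
  · rw [toStrand_cup_ofStrand_of_not_addBox k h, zero_comp, comp_zero]

theorem isZero_sigmaObj {n : ℤ} (hn : n < 0) : IsZero (sigmaObj k n) := by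
  have : IsEmpty {l : YoungDiagram // (l.card : ℤ) = n} :=
    ⟨fun l => by have := l.2; omega⟩
  rw [IsZero.iff_id_eq_zero]
  exact biproduct.hom_ext _ _ fun l => isEmptyElim l

theorem strandCap_comp (n : ℕ) : strandCap k (n + 1) ≫ strandCap k n = 0 := by
  refine (imageMap_comp _ _ _ _ _).trans ((imageMap_congr ?_).trans (imageMap_zero _ _))
  have h := antisym_innerCap_innerCap k n
  have h1 : avg k (n + 2) ≫ innerCap k (n + 1) ≫ avg k (n + 1) = avg k (n + 2) ≫ innerCap k (n + 1) :=
    avg_innerCap_avg k (n + 1)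
  rw [← diagAvg_actL_actR] at h
  simp only [assoc]
  rw [reassoc_of% h1, reassoc_of% h]
  simp

theorem strandCup_comp (n : ℕ) : strandCup k n ≫ strandCup k (n + 1) = 0 := by
  refine (imageMap_comp _ _ _ _ _).trans ((imageMap_congr ?_).trans (imageMap_zero _ _))
  have h := innerCup_innerCup_antisym k n
  rw [← diagAvg_actL_actR] at h
  have h2 : avg k (n + 1) ≫ innerCup k (n + 1) ≫ avg k (n + 2) = innerCup k (n + 1) ≫ avg k (n + 2) :=
    avg_innerCup_avg k (n + 1)
  simp only [assoc]
  rw [h2, h]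
  simp

end Heis
end

noncomputable section

section TensorData

/-- A biadditive tensor product with natural associators and unitors. -/
structure TensorData (W : Type w) [Category.{v} W] [Preadditive W] where
  /-- The tensor product of objects. -/
  obj : W → W → W
  /-- The tensor product of morphisms. -/
  map {X X' Y Y' : W} (f : X ⟶ X') (g : Y ⟶ Y') : obj X Y ⟶ obj X' Y'
  map_id (X Y : W) : map (𝟙 X) (𝟙 Y) = 𝟙 (obj X Y)
  map_comp {X X' X'' Y Y' Y'' : W} (f : X ⟶ X') (f' : X' ⟶ X'') (g : Y ⟶ Y') (g' : Y' ⟶ Y'') :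
    map (f ≫ f') (g ≫ g') = map f g ≫ map f' g'
  map_add_left {X X' Y Y' : W} (f f' : X ⟶ X') (g : Y ⟶ Y') : map (f + f') g = map f g + map f' g
  map_add_right {X X' Y Y' : W} (f : X ⟶ X') (g g' : Y ⟶ Y') : map f (g + g') = map f g + map f g'
  /-- The unit object. -/
  unit : W
  /-- The associator. -/
  assoc (X Y Z : W) : obj (obj X Y) Z ≅ obj X (obj Y Z)
  assoc_nat {X X' Y Y' Z Z' : W} (f : X ⟶ X') (g : Y ⟶ Y') (h : Z ⟶ Z') :
    map (map f g) h ≫ (assoc X' Y' Z').hom = (assoc X Y Z).hom ≫ map f (map g h)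
  /-- The left unitor. -/
  lunit (X : W) : obj unit X ≅ X
  lunit_nat {X X' : W} (f : X ⟶ X') : map (𝟙 unit) f ≫ (lunit X').hom = (lunit X).hom ≫ f
  /-- The right unitor. -/
  runit (X : W) : obj X unit ≅ X
  runit_nat {X X' : W} (f : X ⟶ X') : map f (𝟙 unit) ≫ (runit X').hom = (runit X).hom ≫ f

namespace TensorData

variable {W : Type w} [Category.{v} W] [Preadditive W] (F : TensorData W)

/-- The tensor product as a biadditive map on morphisms. -/
def mapAdd (X X' Y Y' : W) : (X ⟶ X') →+ (Y ⟶ Y') →+ (F.obj X Y ⟶ F.obj X' Y') :=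
  AddMonoidHom.mk' (fun f => AddMonoidHom.mk' (F.map f) (F.map_add_right f))
    (fun f f' => AddMonoidHom.ext fun g => F.map_add_left f f' g)

theorem map_zero_left {X X' Y Y' : W} (g : Y ⟶ Y') : F.map (0 : X ⟶ X') g = 0 :=
  DFunLike.congr_fun (map_zero (F.mapAdd X X' Y Y')) g

theorem map_zero_right {X X' Y Y' : W} (f : X ⟶ X') : F.map f (0 : Y ⟶ Y') = 0 :=
  map_zero (F.mapAdd X X' Y Y' f)

theorem map_neg_left {X X' Y Y' : W} (f : X ⟶ X') (g : Y ⟶ Y') : F.map (-f) g = -F.map f g :=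
  DFunLike.congr_fun (map_neg (F.mapAdd X X' Y Y') f) g

theorem map_sub_left {X X' Y Y' : W} (f f' : X ⟶ X') (g : Y ⟶ Y') :
    F.map (f - f') g = F.map f g - F.map f' g :=
  DFunLike.congr_fun (map_sub (F.mapAdd X X' Y Y') f f') g

theorem map_sub_right {X X' Y Y' : W} (f : X ⟶ X') (g g' : Y ⟶ Y') :
    F.map f (g - g') = F.map f g - F.map f g' :=
  map_sub (F.mapAdd X X' Y Y' f) g g'

theorem map_zsmul_left {X X' Y Y' : W} (n : ℤ) (f : X ⟶ X') (g : Y ⟶ Y') :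
    F.map (n • f) g = n • F.map f g :=
  DFunLike.congr_fun (map_zsmul (F.mapAdd X X' Y Y') n f) g

theorem inv_natural {X X' Y Y' : W} {a : X ≅ Y} {b : X' ≅ Y'} {f : X ⟶ X'} {g : Y ⟶ Y'}
    (h : f ≫ b.hom = a.hom ≫ g) : a.inv ≫ f = g ≫ b.inv := by
  rw [Iso.inv_comp_eq, ← reassoc_of% h, Iso.hom_inv_id, comp_id]

/-- The tensor product on the opposite category. -/
def op : TensorData Wᵒᵖ where
  obj X Y := Opposite.op (F.obj X.unop Y.unop)
  map f g := (F.map f.unop g.unop).op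
  map_id _ _ := congrArg Quiver.Hom.op (F.map_id _ _)
  map_comp _ _ _ _ := congrArg Quiver.Hom.op (F.map_comp _ _ _ _)
  map_add_left _ _ _ := congrArg Quiver.Hom.op (F.map_add_left _ _ _)
  map_add_right _ _ _ := congrArg Quiver.Hom.op (F.map_add_right _ _ _)
  unit := Opposite.op F.unit
  assoc X Y Z := (F.assoc X.unop Y.unop Z.unop).symm.op
  assoc_nat f g h := congrArg Quiver.Hom.op (inv_natural (F.assoc_nat f.unop g.unop h.unop))
  lunit X := (F.lunit X.unop).symm.op
  lunit_nat f := congrArg Quiver.Hom.op (inv_natural (F.lunit_nat f.unop))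
  runit X := (F.runit X.unop).symm.op
  runit_nat f := congrArg Quiver.Hom.op (inv_natural (F.runit_nat f.unop))

/-- The tensor product with the factors in the reverse order. -/
def rev : TensorData W where
  obj X Y := F.obj Y X
  map f g := F.map g f
  map_id _ _ := F.map_id _ _
  map_comp _ _ _ _ := F.map_comp _ _ _ _
  map_add_left _ _ _ := F.map_add_right _ _ _
  map_add_right _ _ _ := F.map_add_left _ _ _
  unit := F.unit
  assoc X Y Z := (F.assoc Z Y X).symm
  assoc_nat f g h := (inv_natural (F.assoc_nat h g f)).symm
  lunit := F.runit
  lunit_nat := F.runit_nat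
  runit := F.lunit
  runit_nat := F.lunit_nat

end TensorData

section Karoubi

open Idempotents

variable {W : Type w} [Category.{v} W]

/-- An isomorphism in the idempotent completion from an isomorphism that respects idempotents. -/
def karoubiIso {X Y : Karoubi W} (a : X.X ≅ Y.X) (h : X.p ≫ a.hom = a.hom ≫ Y.p) : X ≅ Y where
  hom := ⟨X.p ≫ a.hom, by rw [assoc, ← h, X.idem_assoc, X.idem_assoc]⟩
  inv := ⟨Y.p ≫ a.inv, by
    have h' : Y.p ≫ a.inv = a.inv ≫ X.p := by rw [Iso.eq_inv_comp, ← reassoc_of% h, Iso.hom_inv_id,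
      comp_id]
    rw [assoc, ← h', Y.idem_assoc, Y.idem_assoc]⟩
  hom_inv_id := Karoubi.hom_ext _ _ (by
    change (X.p ≫ a.hom) ≫ Y.p ≫ a.inv = X.p
    rw [assoc, ← reassoc_of% h, X.idem_assoc, Iso.hom_inv_id, comp_id])
  inv_hom_id := Karoubi.hom_ext _ _ (by
    change (Y.p ≫ a.inv) ≫ X.p ≫ a.hom = Y.p
    rw [h, assoc, Iso.inv_hom_id_assoc, Y.idem])

theorem karoubiIso_nat {X Y X' Y' : Karoubi W} (a : X.X ≅ Y.X) (h : X.p ≫ a.hom = a.hom ≫ Y.p)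
    (a' : X'.X ≅ Y'.X) (h' : X'.p ≫ a'.hom = a'.hom ≫ Y'.p) (f : X ⟶ X') (g : Y ⟶ Y')
    (hfg : f.f ≫ a'.hom = a.hom ≫ g.f) :
    f ≫ (karoubiIso a' h').hom = (karoubiIso a h).hom ≫ g :=
  Karoubi.hom_ext _ _ (by
    change f.f ≫ X'.p ≫ a'.hom = (X.p ≫ a.hom) ≫ g.f
    rw [assoc, ← hfg, Karoubi.p_comp_assoc, Karoubi.comp_p_assoc])

variable [Preadditive W]

/-- The tensor product on the idempotent completion. -/
def TensorData.karoubi (F : TensorData W) : TensorData (Karoubi W) where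
  obj X Y := ⟨F.obj X.X Y.X, F.map X.p Y.p, by rw [← F.map_comp, X.idem, Y.idem]⟩
  map f g := ⟨F.map f.f g.f, by
    change F.map _ _ ≫ F.map f.f g.f ≫ F.map _ _ = _
    rw [← F.map_comp, ← F.map_comp, f.comm, g.comm]⟩
  map_id _ _ := rfl
  map_comp _ _ _ _ := Karoubi.hom_ext _ _ (F.map_comp _ _ _ _)
  map_add_left _ _ _ := Karoubi.hom_ext _ _ (F.map_add_left _ _ _)
  map_add_right _ _ _ := Karoubi.hom_ext _ _ (F.map_add_right _ _ _)
  unit := ⟨F.unit, 𝟙 _, id_comp _⟩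
  assoc X Y Z := karoubiIso (F.assoc X.X Y.X Z.X) (F.assoc_nat _ _ _)
  assoc_nat _ _ _ := karoubiIso_nat _ _ _ _ _ _ (F.assoc_nat _ _ _)
  lunit X := karoubiIso (F.lunit X.X) (F.lunit_nat _)
  lunit_nat _ := karoubiIso_nat _ _ _ _ _ _ (F.lunit_nat _)
  runit X := karoubiIso (F.runit X.X) (F.runit_nat _)
  runit_nat _ := karoubiIso_nat _ _ _ _ _ _ (F.runit_nat _)

end Karoubi

section Mat

variable {C : Type w} [Category.{v} C] [Preadditive C]

open Classical in
/-- The matrix with entries `φ i` at the positions `(i, e i)`. -/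
def matReindex {M N : Mat_ C} (e : M.ι → N.ι) (φ : ∀ i, M.X i ⟶ N.X (e i)) : M ⟶ N :=
  fun i j => if h : e i = j then φ i ≫ eqToHom (congrArg N.X h) else 0

theorem matReindex_apply {M N : Mat_ C} (e : M.ι → N.ι) (φ : ∀ i, M.X i ⟶ N.X (e i)) (i : M.ι) :
    matReindex e φ i (e i) = φ i := (dif_pos rfl).trans (comp_id _)

theorem matReindex_apply_of_ne {M N : Mat_ C} (e : M.ι → N.ι) (φ : ∀ i, M.X i ⟶ N.X (e i)) (i : M.ι)
    (j : N.ι) (h : e i ≠ j) : matReindex e φ i j = 0 := dif_neg h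

theorem matReindex_comp {M N L : Mat_ C} (e : M.ι → N.ι) (φ : ∀ i, M.X i ⟶ N.X (e i)) (g : N ⟶ L)
    (i : M.ι) (j : L.ι) : (matReindex e φ ≫ g) i j = φ i ≫ g (e i) j := by
  refine (Mat_.comp_apply _ _ _ _).trans ((Finset.sum_eq_single (e i) (fun l _ hl => ?_)
    (fun h => absurd (Finset.mem_univ _) h)).trans ?_)
  · rw [matReindex_apply_of_ne _ _ _ _ hl.symm, zero_comp]
  · rw [matReindex_apply]

theorem comp_matReindex {M N L : Mat_ C} (e : M.ι → N.ι) (he : Function.Injective e)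
    (φ : ∀ i, M.X i ⟶ N.X (e i)) (f : L ⟶ M) (i : L.ι) (j : M.ι) :
    (f ≫ matReindex e φ) i (e j) = f i j ≫ φ j := by
  refine (Mat_.comp_apply _ _ _ _).trans ((Finset.sum_eq_single j (fun l _ hl => ?_)
    (fun h => absurd (Finset.mem_univ _) h)).trans ?_)
  · rw [matReindex_apply_of_ne _ _ _ _ fun h => hl (he h), comp_zero]
  · rw [matReindex_apply]

theorem matReindex_comp_matReindex {M N : Mat_ C} (e : M.ι → N.ι) (e' : N.ι → M.ι)
    (φ : ∀ i, M.X i ⟶ N.X (e i)) (ψ : ∀ j, N.X j ⟶ M.X (e' j)) (he : ∀ i, e' (e i) = i)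
    (h : ∀ i, φ i ≫ ψ (e i) = eqToHom (congrArg M.X (he i)).symm) :
    matReindex e φ ≫ matReindex e' ψ = 𝟙 M := by
  funext i j
  rw [matReindex_comp]
  by_cases hj : e' (e i) = j
  · subst hj
    rw [matReindex_apply, h]
    exact (congrFun (congrFun (Mat_.id_def M) _) _ |>.trans (dif_pos (he i).symm)).symm
  · rw [matReindex_apply_of_ne _ _ _ _ hj, comp_zero]
    exact (Mat_.id_apply_of_ne _ _ _ fun h' => hj ((he i).trans h')).symm

variable [MonoidalCategory C] [MonoidalPreadditive C]

variable (C) in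
/-- The tensor product on the additive envelope. -/
def matTensorData : TensorData (Mat_ C) where
  obj := matObj
  map := matHom
  map_id := matHom_id
  map_comp := matHom_comp
  map_add_left := matHom_add_left
  map_add_right := matHom_add_right
  unit := (Mat_.embedding C).obj (𝟙_ C)
  assoc X Y Z :=
    { hom := matReindex (M := matObj (matObj X Y) Z) (N := matObj X (matObj Y Z))
        (fun p => (p.1.1, (p.1.2, p.2))) fun p => (α_ (X.X p.1.1) (Y.X p.1.2) (Z.X p.2)).hom
      inv := matReindex (N := matObj (matObj X Y) Z) (M := matObj X (matObj Y Z))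
        (fun p => ((p.1, p.2.1), p.2.2)) fun p => (α_ (X.X p.1) (Y.X p.2.1) (Z.X p.2.2)).inv
      hom_inv_id := matReindex_comp_matReindex _ _ _ _ (fun _ => rfl) fun _ => Iso.hom_inv_id _
      inv_hom_id := matReindex_comp_matReindex _ _ _ _ (fun _ => rfl) fun _ => Iso.inv_hom_id _ }
  assoc_nat {X X' Y Y' Z Z'} f g h := by
    funext p q
    refine Eq.trans ?_ (matReindex_comp _ _ _ _ _).symm
    refine (comp_matReindex (M := matObj (matObj X' Y') Z') (N := matObj X' (matObj Y' Z'))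
      (fun p => (p.1.1, (p.1.2, p.2))) ?_ _ _ p ((q.1, q.2.1), q.2.2)).trans ?_
    · rintro ⟨⟨a, b⟩, c⟩ ⟨⟨a', b'⟩, c'⟩ h
      exact congrArg (fun x : X'.ι × (Y'.ι × Z'.ι) => ((x.1, x.2.1), x.2.2)) h
    · exact associator_naturality _ _ _
  lunit X :=
    { hom := matReindex (M := matObj ((Mat_.embedding C).obj (𝟙_ C)) X) (fun p => p.2)
        fun p => (λ_ (X.X p.2)).hom
      inv := matReindex (N := matObj ((Mat_.embedding C).obj (𝟙_ C)) X) (fun i => (PUnit.unit, i))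
        fun i => (λ_ (X.X i)).inv
      hom_inv_id := matReindex_comp_matReindex _ _ _ _ (fun _ => rfl) fun _ => Iso.hom_inv_id _
      inv_hom_id := matReindex_comp_matReindex _ _ _ _ (fun _ => rfl) fun _ => Iso.inv_hom_id _ }
  lunit_nat {X X'} f := by
    funext p q
    refine Eq.trans ?_ (matReindex_comp _ _ _ _ _).symm
    refine (comp_matReindex (M := matObj ((Mat_.embedding C).obj (𝟙_ C)) X') (fun p => p.2) ?_ _ _ p
      (PUnit.unit, q)).trans ?_
    · rintro ⟨a, b⟩ ⟨a', b'⟩ h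
      exact Prod.ext rfl h
    · refine (congrArg (· ≫ _) (congrArg (· ⊗ₘ f p.2 q) (Mat_.id_apply_self _ _))).trans ?_
      rw [id_tensorHom]
      exact leftUnitor_naturality _
  runit X :=
    { hom := matReindex (M := matObj X ((Mat_.embedding C).obj (𝟙_ C))) (fun p => p.1)
        fun p => (ρ_ (X.X p.1)).hom
      inv := matReindex (N := matObj X ((Mat_.embedding C).obj (𝟙_ C))) (fun i => (i, PUnit.unit))
        fun i => (ρ_ (X.X i)).inv
      hom_inv_id := matReindex_comp_matReindex _ _ _ _ (fun _ => rfl) fun _ => Iso.hom_inv_id _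
      inv_hom_id := matReindex_comp_matReindex _ _ _ _ (fun _ => rfl) fun _ => Iso.inv_hom_id _ }
  runit_nat {X X'} f := by
    funext p q
    refine Eq.trans ?_ (matReindex_comp _ _ _ _ _).symm
    refine (comp_matReindex (M := matObj X' ((Mat_.embedding C).obj (𝟙_ C))) (fun p => p.1) ?_ _ _ p
      (q, PUnit.unit)).trans ?_
    · rintro ⟨a, b⟩ ⟨a', b'⟩ h
      exact Prod.ext h rfl
    · refine (congrArg (· ≫ _) (congrArg (f p.1 q ⊗ₘ ·) (Mat_.id_apply_self _ _))).trans ?_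
      rw [tensorHom_id]
      exact rightUnitor_naturality _

end Mat

end TensorData
end

noncomputable section

namespace SumCompl

variable {W : Type w} [Category.{v} W] [Preadditive W]

theorem id_e_of_ne (A : SumCompl W) {i j : A.ι} (h : i ≠ j) : (𝟙 A : A ⟶ A).e i j = 0 := dif_neg h

theorem id_e_eq (A : SumCompl W) {i j : A.ι} (h : i = j) :
    (𝟙 A : A ⟶ A).e i j = eqToHom (congrArg A.X h) := by
  subst h
  exact id_e A i

theorem hom_ext {A B : SumCompl W} {f g : A ⟶ B} (h : ∀ i j, f.e i j = g.e i j) : f = g :=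
  Hom.ext (funext fun i => funext fun j => h i j)

/-- The entries as additive maps. -/
def eHom {A B : SumCompl W} (i : A.ι) (j : B.ι) : (A ⟶ B) →+ (A.X i ⟶ B.X j) :=
  AddMonoidHom.mk' (fun f => f.e i j) fun _ _ => rfl

theorem sub_e {A B : SumCompl W} (f g : A ⟶ B) (i : A.ι) (j : B.ι) :
    (f - g).e i j = f.e i j - g.e i j := map_sub (eHom i j) f g

theorem add_e {A B : SumCompl W} (f g : A ⟶ B) (i : A.ι) (j : B.ι) :
    (f + g).e i j = f.e i j + g.e i j := rfl

theorem zero_e {A B : SumCompl W} (i : A.ι) (j : B.ι) : (0 : A ⟶ B).e i j = 0 := rfl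

theorem comp_e_left {A B D : SumCompl W} (f : A ⟶ B) (g : B ⟶ D) (i : A.ι) (j : B.ι) (l : D.ι)
    (h : ∀ j', j' ≠ j → f.e i j' = 0) : (f ≫ g).e i l = f.e i j ≫ g.e j l :=
  finsum_eq_single _ j fun j' hj => by rw [h j' hj, zero_comp]

theorem comp_e_right {A B D : SumCompl W} (f : A ⟶ B) (g : B ⟶ D) (i : A.ι) (j : B.ι) (l : D.ι)
    (h : ∀ j', j' ≠ j → g.e j' l = 0) : (f ≫ g).e i l = f.e i j ≫ g.e j l :=
  finsum_eq_single _ j fun j' hj => by rw [h j' hj, comp_zero]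

theorem exists_of_comp_ne_zero {A B D : SumCompl W} {f : A ⟶ B} {g : B ⟶ D} {i : A.ι} {l : D.ι}
    (h : (f ≫ g).e i l ≠ 0) : ∃ j, f.e i j ≠ 0 ∧ g.e j l ≠ 0 := by
  obtain ⟨j, hj⟩ : ∃ j, f.e i j ≫ g.e j l ≠ 0 := by
    by_contra! hc
    exact h (finsum_eq_zero_of_forall_eq_zero hc)
  exact ⟨j, fun h0 => hj (by rw [h0, zero_comp]), fun h0 => hj (by rw [h0, comp_zero])⟩

open Classical in
/-- The matrix with entries `φ i` at the positions `(i, e i)`. -/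
def reindex {M N : SumCompl W} (e : M.ι → N.ι) (φ : ∀ i, M.X i ⟶ N.X (e i)) : M ⟶ N :=
  ⟨fun i j => if h : e i = j then φ i ≫ eqToHom (congrArg N.X h) else 0, fun i =>
    (Set.finite_singleton (e i)).subset fun _ hj => by
      by_contra hne
      exact hj (dif_neg fun h => hne h.symm)⟩

theorem reindex_e {M N : SumCompl W} (e : M.ι → N.ι) (φ : ∀ i, M.X i ⟶ N.X (e i)) (i : M.ι) :
    (reindex e φ).e i (e i) = φ i := (dif_pos rfl).trans (comp_id _)

theorem reindex_e_of_ne {M N : SumCompl W} (e : M.ι → N.ι) (φ : ∀ i, M.X i ⟶ N.X (e i)) (i : M.ι)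
    (j : N.ι) (h : e i ≠ j) : (reindex e φ).e i j = 0 := dif_neg h

theorem reindex_comp_e {M N L : SumCompl W} (e : M.ι → N.ι) (φ : ∀ i, M.X i ⟶ N.X (e i)) (g : N ⟶ L)
    (i : M.ι) (j : L.ι) : (reindex e φ ≫ g).e i j = φ i ≫ g.e (e i) j := by
  rw [comp_e_left _ _ _ (e i) _ fun l hl => reindex_e_of_ne _ _ _ _ hl.symm, reindex_e]

theorem comp_reindex_e {M N L : SumCompl W} (e : M.ι → N.ι) (he : Function.Injective e)
    (φ : ∀ i, M.X i ⟶ N.X (e i)) (f : L ⟶ M) (i : L.ι) (j : M.ι) :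
    (f ≫ reindex e φ).e i (e j) = f.e i j ≫ φ j := by
  rw [comp_e_right _ _ _ j _ fun l hl => reindex_e_of_ne _ _ _ _ fun h => hl (he h), reindex_e]

theorem reindex_comp_reindex {M N : SumCompl W} (e : M.ι → N.ι) (e' : N.ι → M.ι)
    (φ : ∀ i, M.X i ⟶ N.X (e i)) (ψ : ∀ j, N.X j ⟶ M.X (e' j)) (he : ∀ i, e' (e i) = i)
    (h : ∀ i, φ i ≫ ψ (e i) = eqToHom (congrArg M.X (he i)).symm) :
    reindex e φ ≫ reindex e' ψ = 𝟙 M := by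
  refine hom_ext fun i j => ?_
  rw [reindex_comp_e]
  by_cases hj : e' (e i) = j
  · subst hj
    rw [reindex_e, h, id_e_eq _ (he i).symm]
  · rw [reindex_e_of_ne _ _ _ _ hj, comp_zero, id_e_of_ne _ fun h' => hj ((he i).trans h')]

section Homog

variable {G : Type*} [AddCommGroup G] {X Y Z : SumCompl W} {dX : X.ι → G} {dY : Y.ι → G}
  {dZ : Z.ι → G} {a b c : G}

/-- A matrix is homogeneous of degree `a` for the given degrees of the summands. -/
def Homog (dX : X.ι → G) (dY : Y.ι → G) (a : G) (f : X ⟶ Y) : Prop :=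
  ∀ i j, f.e i j ≠ 0 → dY j = dX i + a

theorem Homog.comp {f : X ⟶ Y} {g : Y ⟶ Z} (hf : Homog dX dY a f) (hg : Homog dY dZ b g)
    (h : a + b = c) : Homog dX dZ c (f ≫ g) := fun i l hl => by
  obtain ⟨j, h1, h2⟩ := exists_of_comp_ne_zero hl
  rw [hg j l h2, hf i j h1, add_assoc, h]

theorem Homog.add {f g : X ⟶ Y} (hf : Homog dX dY a f) (hg : Homog dX dY a g) :
    Homog dX dY a (f + g) := fun i j hij => by
  by_contra hc
  refine hij ?_
  rw [add_e, not_not.1 (mt (hf i j) hc), not_not.1 (mt (hg i j) hc), add_zero]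

theorem Homog.sub {f g : X ⟶ Y} (hf : Homog dX dY a f) (hg : Homog dX dY a g) :
    Homog dX dY a (f - g) := fun i j hij => by
  by_contra hc
  refine hij ?_
  rw [sub_e, not_not.1 (mt (hf i j) hc), not_not.1 (mt (hg i j) hc), sub_zero]

theorem Homog.id : Homog dX dX 0 (𝟙 X) := fun i j hij => by
  by_contra hc
  exact hij (id_e_of_ne _ fun h => hc (by rw [h, add_zero]))

theorem Homog.zero : Homog dX dY a 0 := fun _ _ hij => absurd rfl hij

theorem homog_reindex (e : X.ι → Y.ι) (φ : ∀ i, X.X i ⟶ Y.X (e i)) (h : ∀ i, dY (e i) = dX i + a) :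
    Homog dX dY a (reindex e φ) := fun i j hij => by
  by_contra hc
  exact hij (reindex_e_of_ne _ _ _ _ fun h' => hc (h' ▸ h i))

end Homog

section Neumann

variable {A : SumCompl W} (ρ : A.ι → ℕ)

/-- The partial sums of the geometric series. -/
def geom (ψ : A ⟶ A) : ℕ → (A ⟶ A)
  | 0 => 0
  | m + 1 => 𝟙 A + geom ψ m ≫ ψ

theorem geom_lower {ψ : A ⟶ A} (hψ : ∀ i j, ψ.e i j ≠ 0 → ρ j < ρ i) (m : ℕ) (i j : A.ι)
    (h : (geom ψ m).e i j ≠ 0) : ρ j ≤ ρ i := by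
  induction m generalizing j with
  | zero => exact absurd rfl h
  | succ m ih =>
    by_contra hc
    refine h ?_
    rw [geom, add_e, id_e_of_ne _ (fun h' : i = j => hc (by rw [h'])), zero_add]
    by_contra h0
    obtain ⟨l, h1, h2⟩ := exists_of_comp_ne_zero h0
    exact hc ((hψ l j h2).le.trans (ih l h1))

theorem geom_sub_lower {ψ : A ⟶ A} (hψ : ∀ i j, ψ.e i j ≠ 0 → ρ j < ρ i) (m : ℕ) (i j : A.ι)
    (h : (geom ψ (m + 1) - geom ψ m).e i j ≠ 0) : ρ j + m ≤ ρ i := by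
  induction m generalizing j with
  | zero =>
    rw [geom, geom, geom, zero_comp, add_zero, sub_zero] at h
    by_contra hc
    exact h (id_e_of_ne _ fun h' => hc (by rw [h', add_zero]))
  | succ m ih =>
    have e : geom ψ (m + 2) - geom ψ (m + 1) = (geom ψ (m + 1) - geom ψ m) ≫ ψ := by
      change (𝟙 A + geom ψ (m + 1) ≫ ψ) - (𝟙 A + geom ψ m ≫ ψ) = _
      rw [sub_comp]
      abel
    rw [e] at h
    obtain ⟨l, h1, h2⟩ := exists_of_comp_ne_zero h
    have := hψ l j h2
    have := ih l h1
    omega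

/-- The geometric series of a matrix that lowers `ρ`. -/
def geomSeries (ψ : A ⟶ A) : A ⟶ A :=
  ⟨fun i j => (geom ψ (ρ i + 1)).e i j, fun i => (geom ψ (ρ i + 1)).finite i⟩

theorem geomSeries_comp {ψ : A ⟶ A} (hψ : ∀ i j, ψ.e i j ≠ 0 → ρ j < ρ i) :
    geomSeries ρ ψ ≫ (𝟙 A - ψ) = 𝟙 A := by
  refine hom_ext fun i j => ?_
  change (geom ψ (ρ i + 1) ≫ (𝟙 A - ψ)).e i j = _
  have e : geom ψ (ρ i + 1) ≫ (𝟙 A - ψ) = 𝟙 A - (geom ψ (ρ i + 2) - geom ψ (ρ i + 1)) := by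
    rw [geom.eq_2 ψ (ρ i + 1), comp_sub, comp_id]
    abel
  rw [e, sub_e, sub_eq_self]
  by_contra h
  have := geom_sub_lower ρ hψ _ i j h
  omega

theorem exists_inverse {ψ : A ⟶ A} (hψ : ∀ i j, ψ.e i j ≠ 0 → ρ j < ρ i) :
    ∃ v : A ⟶ A, v ≫ (𝟙 A - ψ) = 𝟙 A ∧ (𝟙 A - ψ) ≫ v = 𝟙 A ∧
      ∀ (dA : A.ι → ℤ), Homog dA dA 0 ψ → Homog dA dA 0 v := by
  have hlow : ∀ i j, (𝟙 A - geomSeries ρ ψ).e i j ≠ 0 → ρ j < ρ i := by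
    intro i j h
    have e : (𝟙 A - geomSeries ρ ψ).e i j = -(geom ψ (ρ i) ≫ ψ).e i j := by
      rw [sub_e]
      change _ - (𝟙 A + geom ψ (ρ i) ≫ ψ).e i j = _
      rw [add_e]
      abel
    rw [e, neg_ne_zero] at h
    obtain ⟨l, h1, h2⟩ := exists_of_comp_ne_zero h
    exact (hψ l j h2).trans_le (geom_lower ρ hψ _ i l h1)
  have h1 := geomSeries_comp ρ hψ
  have h2 := geomSeries_comp ρ hlow
  rw [sub_sub_cancel] at h2
  refine ⟨geomSeries ρ ψ, h1, ?_, fun dA hA i j => ?_⟩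
  · have h3 : geomSeries ρ (𝟙 A - geomSeries ρ ψ) = 𝟙 A - ψ := by
      refine (comp_id _).symm.trans ((congrArg (_ ≫ ·) h1.symm).trans ?_)
      rw [← assoc, h2, id_comp]
    rw [← h3, h2]
  · have h : ∀ m, Homog dA dA 0 (geom ψ m) := fun m => by
      induction m with
      | zero => exact Homog.zero
      | succ m ih => exact Homog.id.add (ih.comp hA (add_zero 0))
    exact h (ρ i + 1) i j

end Neumann

section Tensor

variable (F : TensorData W)

/-- The tensor product of formal direct sums. -/
abbrev tObj (X Y : SumCompl W) : SumCompl W := ⟨X.ι × Y.ι, fun p => F.obj (X.X p.1) (Y.X p.2)⟩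

/-- The tensor product of matrices. -/
def tMap {X X' Y Y' : SumCompl W} (f : X ⟶ X') (g : Y ⟶ Y') : tObj F X Y ⟶ tObj F X' Y' :=
  ⟨fun p q => F.map (f.e p.1 q.1) (g.e p.2 q.2), fun p =>
    ((f.finite p.1).prod (g.finite p.2)).subset fun q hq =>
      ⟨fun h => hq (by rw [h, F.map_zero_left]), fun h => hq (by rw [h, F.map_zero_right])⟩⟩

theorem tMap_id (X Y : SumCompl W) : tMap F (𝟙 X) (𝟙 Y) = 𝟙 (tObj F X Y) := by
  refine hom_ext fun p q => ?_
  change F.map ((𝟙 X : X ⟶ X).e p.1 q.1) ((𝟙 Y : Y ⟶ Y).e p.2 q.2) = _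
  by_cases h : p = q
  · subst h
    rw [id_e, id_e, id_e, F.map_id]
  · rw [id_e_of_ne _ h]
    by_cases h1 : p.1 = q.1
    · rw [id_e_of_ne Y fun h2 => h (Prod.ext h1 h2), F.map_zero_right]
    · rw [id_e_of_ne X h1, F.map_zero_left]

theorem tMap_comp {X X' X'' Y Y' Y'' : SumCompl W} (f : X ⟶ X') (f' : X' ⟶ X'') (g : Y ⟶ Y')
    (g' : Y' ⟶ Y'') : tMap F (f ≫ f') (g ≫ g') = tMap F f g ≫ tMap F f' g' := by
  refine hom_ext fun p q => ?_
  have h1 : (f ≫ f').e p.1 q.1 = ∑ a ∈ (f.finite p.1).toFinset, f.e p.1 a ≫ f'.e a q.1 := by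
    refine finsum_eq_sum_of_support_subset _ fun a ha => ?_
    rw [Set.Finite.coe_toFinset]
    exact fun h0 => ha ((congrArg (· ≫ _) h0).trans zero_comp)
  have h2 : (g ≫ g').e p.2 q.2 = ∑ b ∈ (g.finite p.2).toFinset, g.e p.2 b ≫ g'.e b q.2 := by
    refine finsum_eq_sum_of_support_subset _ fun a ha => ?_
    rw [Set.Finite.coe_toFinset]
    exact fun h0 => ha ((congrArg (· ≫ _) h0).trans zero_comp)
  have h3 : (tMap F f g ≫ tMap F f' g').e p q = ∑ x ∈ (f.finite p.1).toFinset ×ˢ (g.finite p.2).toFinset,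
      F.map (f.e p.1 x.1 ≫ f'.e x.1 q.1) (g.e p.2 x.2 ≫ g'.e x.2 q.2) := by
    rw [Finset.sum_congr rfl fun x _ => F.map_comp _ _ _ _]
    refine finsum_eq_sum_of_support_subset _ fun x hx => ?_
    rw [Finset.coe_product, Set.Finite.coe_toFinset, Set.Finite.coe_toFinset]
    refine ⟨fun h0 => hx ?_, fun h0 => hx ?_⟩
    · change F.map (f.e p.1 x.1) (g.e p.2 x.2) ≫ _ = 0
      rw [h0, F.map_zero_left, zero_comp]
    · change F.map (f.e p.1 x.1) (g.e p.2 x.2) ≫ _ = 0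
      rw [h0, F.map_zero_right, zero_comp]
  rw [h3]
  change F.mapAdd _ _ _ _ ((f ≫ f').e p.1 q.1) ((g ≫ g').e p.2 q.2) = _
  rw [h1, h2, map_sum, Finset.sum_product_right]
  refine Finset.sum_congr rfl fun b _ => ?_
  rw [map_sum, AddMonoidHom.finsetSum_apply]
  rfl

/-- The tensor product on formal direct sums. -/
def _root_.TensorData.sum : TensorData (SumCompl W) where
  obj := tObj F
  map := tMap F
  map_id := tMap_id F
  map_comp := tMap_comp F
  map_add_left _ _ _ := hom_ext fun _ _ => F.map_add_left _ _ _
  map_add_right _ _ _ := hom_ext fun _ _ => F.map_add_right _ _ _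
  unit := (incl W).obj F.unit
  assoc X Y Z :=
    { hom := reindex (M := tObj F (tObj F X Y) Z) (N := tObj F X (tObj F Y Z))
        (fun p => (p.1.1, (p.1.2, p.2))) fun p => (F.assoc (X.X p.1.1) (Y.X p.1.2) (Z.X p.2)).hom
      inv := reindex (N := tObj F (tObj F X Y) Z) (M := tObj F X (tObj F Y Z))
        (fun p => ((p.1, p.2.1), p.2.2)) fun p => (F.assoc (X.X p.1) (Y.X p.2.1) (Z.X p.2.2)).inv
      hom_inv_id := reindex_comp_reindex _ _ _ _ (fun _ => rfl) fun _ => Iso.hom_inv_id _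
      inv_hom_id := reindex_comp_reindex _ _ _ _ (fun _ => rfl) fun _ => Iso.inv_hom_id _ }
  assoc_nat {X X' Y Y' Z Z'} f g h := by
    refine hom_ext fun p q => ?_
    refine Eq.trans ?_ (reindex_comp_e _ _ _ _ _).symm
    refine (comp_reindex_e (M := tObj F (tObj F X' Y') Z') (N := tObj F X' (tObj F Y' Z'))
      (fun p => (p.1.1, (p.1.2, p.2))) ?_ _ _ p ((q.1, q.2.1), q.2.2)).trans ?_
    · rintro ⟨⟨a, b⟩, c⟩ ⟨⟨a', b'⟩, c'⟩ h
      exact congrArg (fun x : X'.ι × (Y'.ι × Z'.ι) => ((x.1, x.2.1), x.2.2)) h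
    · exact F.assoc_nat _ _ _
  lunit X :=
    { hom := reindex (M := tObj F ((incl W).obj F.unit) X) (fun p => p.2)
        fun p => (F.lunit (X.X p.2)).hom
      inv := reindex (N := tObj F ((incl W).obj F.unit) X) (fun i => (PUnit.unit, i))
        fun i => (F.lunit (X.X i)).inv
      hom_inv_id := reindex_comp_reindex _ _ _ _ (fun _ => rfl) fun _ => Iso.hom_inv_id _
      inv_hom_id := reindex_comp_reindex _ _ _ _ (fun _ => rfl) fun _ => Iso.inv_hom_id _ }
  lunit_nat {X X'} f := by
    refine hom_ext fun p q => ?_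
    refine Eq.trans ?_ (reindex_comp_e _ _ _ _ _).symm
    refine (comp_reindex_e (M := tObj F ((incl W).obj F.unit) X') (fun p => p.2) ?_ _ _ p
      (PUnit.unit, q)).trans ?_
    · rintro ⟨a, b⟩ ⟨a', b'⟩ h
      exact Prod.ext rfl h
    · exact (congrArg (· ≫ _) (congrArg (F.map · (f.e p.2 q)) (id_e ((incl W).obj F.unit) _))).trans
        (F.lunit_nat _)
  runit X :=
    { hom := reindex (M := tObj F X ((incl W).obj F.unit)) (fun p => p.1)
        fun p => (F.runit (X.X p.1)).hom
      inv := reindex (N := tObj F X ((incl W).obj F.unit)) (fun i => (i, PUnit.unit))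
        fun i => (F.runit (X.X i)).inv
      hom_inv_id := reindex_comp_reindex _ _ _ _ (fun _ => rfl) fun _ => Iso.hom_inv_id _
      inv_hom_id := reindex_comp_reindex _ _ _ _ (fun _ => rfl) fun _ => Iso.inv_hom_id _ }
  runit_nat {X X'} f := by
    refine hom_ext fun p q => ?_
    refine Eq.trans ?_ (reindex_comp_e _ _ _ _ _).symm
    refine (comp_reindex_e (M := tObj F X' ((incl W).obj F.unit)) (fun p => p.1) ?_ _ _ p
      (q, PUnit.unit)).trans ?_
    · rintro ⟨a, b⟩ ⟨a', b'⟩ h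
      exact Prod.ext h rfl
    · exact (congrArg (· ≫ _) (congrArg (F.map (f.e p.1 q) ·) (id_e ((incl W).obj F.unit) _))).trans
        (F.runit_nat _)

theorem homog_tMap {G : Type*} [AddCommGroup G] {X X' Y Y' : SumCompl W} {dX : X.ι → G} {dX' : X'.ι → G}
    {dY : Y.ι → G} {dY' : Y'.ι → G} {a b c : G} {f : X ⟶ X'} {g : Y ⟶ Y'} (hf : Homog dX dX' a f)
    (hg : Homog dY dY' b g) (h : a + b = c) :
    Homog (X := tObj F X Y) (Y := tObj F X' Y') (fun p => dX p.1 + dY p.2) (fun p => dX' p.1 + dY' p.2)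
      c (tMap F f g) := fun p q hpq => by
  have h1 := hf p.1 q.1 fun h0 => hpq (by
    change F.map (f.e p.1 q.1) _ = 0
    rw [h0, F.map_zero_left])
  have h2 := hg p.2 q.2 fun h0 => hpq (by
    change F.map _ (g.e p.2 q.2) = 0
    rw [h0, F.map_zero_right])
  change dX' q.1 + dY' q.2 = dX p.1 + dY p.2 + c
  rw [h1, h2, ← h]
  abel

end Tensor

end SumCompl
end

noncomputable section

theorem contraction_mul_inverse {R : Type*} [Ring R] {d h e v : R} (hdd : d * d = 0) (hee : e * e = e)
    (hde : e * d * e = e * d) (hue : (h * d + d * h) * e = h * d + d * h)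
    (h1 : v * (1 - e * (1 - (h * d + d * h))) = 1) (h2 : (1 - e * (1 - (h * d + d * h))) * v = 1) :
    e * (e * v * h * d + d * (e * v * h)) = e := by
  set u := h * d + d * h with hu
  set U := 1 - e * (1 - u) with hU
  have hud : u * d = d * u := by
    rw [hu, add_mul, mul_add, mul_assoc h, hdd, mul_zero, zero_add, ← mul_assoc d d, hdd, zero_mul,
      add_zero, mul_assoc]
  have heU : e * U = e * u := by rw [hU, mul_sub, ← mul_assoc, hee, mul_sub, mul_one]; abel
  have hUe : U * e = e * u := by
    rw [hU, sub_mul, mul_assoc, sub_mul, hue, mul_sub, one_mul, hee]; abel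
  have hve : v * e = e * v := by
    rw [← mul_one (v * e), ← h2, ← mul_assoc, mul_assoc v, heU, ← hUe, ← mul_assoc, h1, one_mul]
  have hedU : e * d * U = U * (e * d) := by
    rw [← mul_assoc, hUe, hU, mul_sub, ← mul_assoc, hde, mul_sub, mul_one, mul_assoc, mul_assoc, hud]
    abel
  have hved : v * (e * d) = e * d * v := by
    rw [← mul_one (v * (e * d)), ← h2, ← mul_assoc, mul_assoc v, hedU, ← mul_assoc, h1, one_mul]
  calc e * (e * v * h * d + d * (e * v * h)) = e * e * v * (h * d) + (e * d * e) * v * h := by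
        simp only [mul_add, mul_assoc]
    _ = v * (e * u) := by rw [hee, hde, ← hve, ← hved, hu]; simp only [mul_add, mul_assoc]
    _ = e := by rw [← hUe, ← mul_assoc, h1, one_mul]

variable {W : Type w} [Category.{v} W] [Preadditive W] {δ : ℤ}

open SumCompl

variable (W δ) in
/-- A graded object with a differential of degree `δ`, given by its formal direct sum. -/
structure GDiff where
  /-- The total object. -/
  obj : SumCompl W
  /-- The degrees of the summands. -/
  deg : obj.ι → ℤ
  /-- The differential. -/
  d : obj ⟶ obj
  homog : Homog deg deg δ d
  dd : d ≫ d = 0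

/-- Homotopy equivalences of graded objects with differential. -/
structure GDiff.HEquiv (K L : GDiff W δ) where
  /-- The map. -/
  f : K.obj ⟶ L.obj
  /-- The homotopy inverse. -/
  g : L.obj ⟶ K.obj
  /-- The homotopy on the source. -/
  h : K.obj ⟶ K.obj
  /-- The homotopy on the target. -/
  h' : L.obj ⟶ L.obj
  homog_f : Homog K.deg L.deg 0 f
  homog_g : Homog L.deg K.deg 0 g
  homog_h : Homog K.deg K.deg (-δ) h
  homog_h' : Homog L.deg L.deg (-δ) h'
  comm_f : f ≫ L.d = K.d ≫ f
  comm_g : g ≫ K.d = L.d ≫ g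
  fg : f ≫ g = K.d ≫ h + h ≫ K.d + 𝟙 _
  gf : g ≫ f = L.d ≫ h' + h' ≫ L.d + 𝟙 _

/-- Perturbation: if `T.d` is the sum of a part with a partial contraction onto `A` and a part that
lowers a grading by natural numbers, then `T` is homotopy equivalent to `A`. -/
theorem GDiff.nonempty_hEquiv_of_perturbation (T A : GDiff W δ) (D₀ D₁ h : T.obj ⟶ T.obj)
    (ι : A.obj ⟶ T.obj) (κ : T.obj ⟶ A.obj) (hD : T.d = D₀ + D₁) (hι : Homog A.deg T.deg 0 ι)
    (hκ : Homog T.deg A.deg 0 κ) (hh : Homog T.deg T.deg (-δ) h) (hικ : ι ≫ κ = 𝟙 _)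
    (hcomm : ι ≫ T.d = A.d ≫ ι) (hιh : ι ≫ h = 0) (hcontr : D₀ ≫ h + h ≫ D₀ = 𝟙 _ - κ ≫ ι)
    (ρ : T.obj.ι → ℕ)
    (hρ : ∀ i j, ((D₁ ≫ h + h ≫ D₁) ≫ (𝟙 _ - κ ≫ ι)).e i j ≠ 0 → ρ j < ρ i) :
    Nonempty (T.HEquiv A) := by
  have hιe : ι ≫ (𝟙 _ - κ ≫ ι) = 0 := by
    rw [comp_sub, comp_id, reassoc_of% hικ, sub_self]
  have hu : T.d ≫ h + h ≫ T.d = 𝟙 _ - κ ≫ ι + (D₁ ≫ h + h ≫ D₁) := by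
    rw [← hcontr, hD, add_comp, comp_add]
    abel
  have hψ : (𝟙 _ - (T.d ≫ h + h ≫ T.d)) ≫ (𝟙 _ - κ ≫ ι) =
      -((D₁ ≫ h + h ≫ D₁) ≫ (𝟙 _ - κ ≫ ι)) := by
    rw [hu, ← sub_sub, sub_sub_cancel, sub_comp, assoc, hιe, comp_zero,
      zero_sub]
  have hge : Homog T.deg T.deg 0 (κ ≫ ι) := hκ.comp hι (add_zero 0)
  have he : Homog T.deg T.deg 0 (𝟙 _ - κ ≫ ι) := Homog.id.sub hge
  have hdh : Homog T.deg T.deg 0 (T.d ≫ h + h ≫ T.d) :=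
    (T.homog.comp hh (add_neg_cancel δ)).add (hh.comp T.homog (neg_add_cancel δ))
  obtain ⟨v, h1, h2, h3⟩ := exists_inverse (A := T.obj) ρ
    (ψ := (𝟙 _ - (T.d ≫ h + h ≫ T.d)) ≫ (𝟙 _ - κ ≫ ι)) fun i j hij => hρ i j fun h0 => hij (by
      rw [hψ, ← zero_sub, sub_e, h0, zero_e, sub_zero])
  have hv := h3 T.deg ((Homog.id.sub hdh).comp he (add_zero 0))
  have hgdh : κ ≫ ι ≫ (T.d ≫ h + h ≫ T.d) = 0 := by
    rw [comp_add, reassoc_of% hcomm, hιh, reassoc_of% hιh]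
    simp
  have hgde : κ ≫ ι ≫ T.d ≫ (𝟙 _ - κ ≫ ι) = 0 := by
    rw [reassoc_of% hcomm, hιe]
    simp
  have key := contraction_mul_inverse (R := End T.obj) (d := T.d) (h := h) (e := 𝟙 _ - κ ≫ ι) (v := v)
    T.dd
    (by
      change (𝟙 _ - κ ≫ ι) ≫ (𝟙 _ - κ ≫ ι) = _
      rw [sub_comp, assoc, hιe]
      simp)
    (by
      change (𝟙 _ - κ ≫ ι) ≫ T.d ≫ (𝟙 _ - κ ≫ ι) = T.d ≫ (𝟙 _ - κ ≫ ι)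
      rw [sub_comp, assoc, hgde, id_comp, sub_zero])
    (by
      change (𝟙 _ - κ ≫ ι) ≫ (T.d ≫ h + h ≫ T.d) = T.d ≫ h + h ≫ T.d
      rw [sub_comp, assoc, hgdh, id_comp, sub_zero])
    h2 h1
  have key' : (T.d ≫ (h ≫ v ≫ (𝟙 _ - κ ≫ ι)) + (h ≫ v ≫ (𝟙 _ - κ ≫ ι)) ≫ T.d) ≫ (𝟙 _ - κ ≫ ι) =
    𝟙 _ - κ ≫ ι := key
  set s := h ≫ v ≫ (𝟙 _ - κ ≫ ι) with hs
  have hR : (𝟙 _ - (T.d ≫ s + s ≫ T.d)) ≫ κ ≫ ι = 𝟙 _ - (T.d ≫ s + s ≫ T.d) := by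
    have e : (𝟙 _ - (T.d ≫ s + s ≫ T.d)) ≫ (𝟙 _ - κ ≫ ι) = 0 := by
      rw [sub_comp, key', id_comp, sub_self]
    rw [comp_sub, comp_id, sub_eq_zero] at e
    exact e.symm
  have hss : Homog T.deg T.deg (-δ) s := hh.comp (hv.comp he (add_zero 0)) (add_zero _)
  have hιs : ι ≫ s = 0 := by rw [hs, reassoc_of% hιh, zero_comp]
  clear_value s
  have hRd : (𝟙 _ - (T.d ≫ s + s ≫ T.d)) ≫ T.d = T.d ≫ (𝟙 _ - (T.d ≫ s + s ≫ T.d)) := by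
    rw [sub_comp, comp_sub, add_comp, comp_add,
      assoc, assoc, T.dd, reassoc_of% T.dd]
    simp
  refine ⟨⟨(𝟙 _ - (T.d ≫ s + s ≫ T.d)) ≫ κ, ι, 0 - s, 0, ?_, hι, Homog.zero.sub hss, Homog.zero, ?_, hcomm,
    ?_, ?_⟩⟩
  · exact (Homog.id.sub ((T.homog.comp hss (add_neg_cancel δ)).add
      (hss.comp T.homog (neg_add_cancel δ)))).comp hκ (add_zero 0)
  · have e : κ ≫ A.d = κ ≫ ι ≫ T.d ≫ κ := by
      rw [reassoc_of% hcomm, hικ, comp_id]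
    rw [assoc, e, reassoc_of% hR, reassoc_of% hRd]
  · rw [assoc, hR]
    simp only [comp_sub, sub_comp, comp_zero, zero_comp]
    abel
  · rw [sub_comp, comp_sub, add_comp, comp_add,
      assoc, assoc, reassoc_of% hcomm, reassoc_of% hιs]
    simp [hικ, reassoc_of% hιs]

section Slice

variable {X Y Z : SumCompl W} {I J K : Type}

/-- The subsum of a formal direct sum along a map of index types. -/
abbrev slice (X : SumCompl W) (j : I → X.ι) : SumCompl W := ⟨I, fun i => X.X (j i)⟩

/-- The submatrix of a matrix. -/
def res (j : I → X.ι) (j' : J → Y.ι) (hj' : Function.Injective j') (f : X ⟶ Y) :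
    slice X j ⟶ slice Y j' :=
  ⟨fun p q => f.e (j p) (j' q), fun p => (f.finite (j p)).preimage hj'.injOn⟩

theorem res_comp (j : I → X.ι) (j' : J → Y.ι) (j'' : K → Z.ι) (hj' : Function.Injective j')
    (hj'' : Function.Injective j'') (f : X ⟶ Y) (g : Y ⟶ Z)
    (h : ∀ p q, f.e (j p) q ≠ 0 → q ∈ Set.range j') :
    res j j' hj' f ≫ res j' j'' hj'' g = res j j'' hj'' (f ≫ g) := by
  refine SumCompl.hom_ext fun p l => ?_
  change ∑ᶠ q, f.e (j p) (j' q) ≫ g.e (j' q) (j'' l) = ∑ᶠ q, f.e (j p) q ≫ g.e q (j'' l)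
  rw [← finsum_mem_range (f := fun q => f.e (j p) q ≫ g.e q (j'' l)) hj', ← finsum_mem_univ
    (f := fun q => f.e (j p) q ≫ g.e q (j'' l))]
  refine finsum_mem_inter_support_eq _ _ _ (Set.ext fun q => ⟨fun hq => ⟨trivial, hq.2⟩, fun hq =>
    ⟨h p q fun h0 => hq.2 ?_, hq.2⟩⟩)
  change f.e (j p) q ≫ _ = 0
  rw [h0, zero_comp]

theorem res_id (j : I → X.ι) (hj : Function.Injective j) : res j j hj (𝟙 X) = 𝟙 (slice X j) := by
  refine SumCompl.hom_ext fun p q => ?_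
  change (𝟙 X : X ⟶ X).e (j p) (j q) = _
  by_cases h : p = q
  · subst h
    rw [id_e, id_e]
  · rw [id_e_of_ne _ h, id_e_of_ne _ fun h' => h (hj h')]

end Slice

/-- Index types for the homogeneous parts of a graded object. -/
structure GDiff.Slices (K : GDiff W δ) where
  /-- The index type of the part of degree `n`. -/
  I : ℤ → Type
  /-- The inclusion of the indices of degree `n`. -/
  j : ∀ n, I n → K.obj.ι
  inj : ∀ n, Function.Injective (j n)
  mem_range : ∀ n t, t ∈ Set.range (j n) ↔ K.deg t = n

namespace GDiff

variable {K L M : GDiff W δ} (S : K.Slices) (T : L.Slices) (R : M.Slices)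

/-- The part of a matrix between two degrees. -/
def part (f : K.obj ⟶ L.obj) (m n : ℤ) : slice K.obj (S.j m) ⟶ slice L.obj (T.j n) :=
  res (S.j m) (T.j n) (T.inj n) f

theorem part_comp {f : K.obj ⟶ L.obj} {a : ℤ} (hf : Homog K.deg L.deg a f) (g : L.obj ⟶ M.obj)
    {m n : ℤ} (hn : m + a = n) (l : ℤ) : part S T f m n ≫ part T R g n l = part S R (f ≫ g) m l :=
  res_comp _ _ _ _ _ _ _ fun p q hq => (T.mem_range n q).2 (by
    rw [hf _ _ hq, (S.mem_range m _).1 ⟨p, rfl⟩, hn])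

theorem part_eq_zero {f : K.obj ⟶ L.obj} {a : ℤ} (hf : Homog K.deg L.deg a f) {m n : ℤ}
    (hn : m + a ≠ n) : part S T f m n = 0 := SumCompl.hom_ext fun p q => by
  by_contra h
  refine hn ?_
  rw [← (T.mem_range n _).1 ⟨q, rfl⟩, hf _ _ h, (S.mem_range m _).1 ⟨p, rfl⟩]

theorem part_add (f g : K.obj ⟶ L.obj) (m n : ℤ) :
    part S T (f + g) m n = part S T f m n + part S T g m n := rfl

variable {c : ComplexShape ℤ} (hc : ∀ i j, c.Rel i j ↔ i + δ = j)

/-- The complex with the homogeneous parts as objects. -/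
def realize : HomologicalComplex (SumCompl W) c where
  X n := slice K.obj (S.j n)
  d m n := part S S K.d m n
  shape m n h := part_eq_zero S S K.homog fun h' => h ((hc m n).2 h')
  d_comp_d' m n l h _ := by
    rw [part_comp S S S K.homog _ ((hc m n).1 h), K.dd]
    rfl

/-- The morphism of complexes given by a homogeneous matrix. -/
def realizeMap (f : K.obj ⟶ L.obj) (hf : Homog K.deg L.deg 0 f) (h : f ≫ L.d = K.d ≫ f) :
    realize S hc ⟶ realize T hc where
  f n := part S T f n n
  comm' m n _ := by
    refine (part_comp S T T hf L.d (add_zero m) n).trans ?_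
    rw [h]
    by_cases hmn : m + δ = n
    · exact (part_comp S S T K.homog f hmn n).symm
    · refine (part_eq_zero S T (K.homog.comp hf (add_zero δ)) hmn).trans ?_
      refine (zero_comp.symm.trans (congrArg (· ≫ _) ?_))
      exact (part_eq_zero S S K.homog hmn).symm

/-- The homotopy between morphisms of complexes given by a homogeneous matrix. -/
def realizeHomotopy {φ ψ : realize S hc ⟶ realize T hc} (f g h : _) (hφ : ∀ n, φ.f n = part S T f n n)
    (hψ : ∀ n, ψ.f n = part S T g n n) (hh : Homog K.deg L.deg (-δ) h)
    (hfg : f = K.d ≫ h + h ≫ L.d + g) : Homotopy φ ψ where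
  hom m n := part S T h m n
  zero m n hmn := part_eq_zero S T hh fun h' => hmn ((hc n m).2 (by omega))
  comm n := by
    refine Eq.trans ?_ (congrArg₂ (· + ·) (congrArg₂ (· + ·)
      (dNext_eq (C := realize S hc) (D := realize T hc) (fun m n => part S T h m n)
        ((hc n (n + δ)).2 rfl))
      (prevD_eq (C := realize S hc) (D := realize T hc) (fun m n => part S T h m n)
        ((hc (n - δ) n).2 (by omega)))) (hψ n)).symm
    rw [hφ, hfg, part_add, part_add]
    refine congrArg₂ (· + ·) (congrArg₂ (· + ·) ?_ ?_) rfl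
    · exact (part_comp S S T K.homog h rfl n).symm
    · exact (part_comp S T T hh L.d (by omega) n).symm

/-- Homotopy equivalences give homotopy equivalences of complexes. -/
def HEquiv.realize (e : K.HEquiv L) : HomotopyEquiv (realize S hc) (GDiff.realize T hc) where
  hom := realizeMap S T hc e.f e.homog_f e.comm_f
  inv := realizeMap T S hc e.g e.homog_g e.comm_g
  homotopyHomInvId := realizeHomotopy S S hc (e.f ≫ e.g) (𝟙 _) e.h
    (fun n => part_comp S T S e.homog_f e.g (add_zero n) n) (fun _ => (res_id _ _).symm) e.homog_h e.fg
  homotopyInvHomId := realizeHomotopy T T hc (e.g ≫ e.f) (𝟙 _) e.h'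
    (fun n => part_comp T S T e.homog_g e.f (add_zero n) n) (fun _ => (res_id _ _).symm) e.homog_h' e.gf

end GDiff
end

noncomputable section

namespace SumCompl

variable {W : Type w} [Category.{v} W] [Preadditive W] {X Y : SumCompl W}

/-- The automorphism that acts by the parity of the degree. -/
def signMap (dX : X.ι → ℤ) : X ⟶ X := reindex id fun i => (dX i).negOnePow • 𝟙 _

theorem signMap_comp_e (dX : X.ι → ℤ) (f : X ⟶ Y) (i : X.ι) (j : Y.ι) :
    (signMap dX ≫ f).e i j = (dX i).negOnePow • f.e i j := by
  rw [signMap, reindex_comp_e, Units.smul_def, Preadditive.zsmul_comp, id_comp]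
  rfl

theorem comp_signMap_e (dX : X.ι → ℤ) (f : Y ⟶ X) (i : Y.ι) (j : X.ι) :
    (f ≫ signMap dX).e i j = (dX j).negOnePow • f.e i j := by
  refine (comp_reindex_e id Function.injective_id _ f i j).trans ?_
  rw [Units.smul_def, Preadditive.comp_zsmul, comp_id]
  rfl

theorem signMap_comp_signMap (dX : X.ι → ℤ) : signMap dX ≫ signMap dX = 𝟙 X := by
  refine hom_ext fun i j => ?_
  rw [signMap_comp_e]
  by_cases h : i = j
  · subst h
    rw [signMap]
    refine (congrArg (_ • ·) (reindex_e id _ i)).trans ?_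
    rw [smul_smul, Int.units_mul_self, one_smul, id_e]
  · rw [signMap]
    refine (congrArg (_ • ·) (reindex_e_of_ne id _ i j h)).trans ?_
    rw [smul_zero, id_e_of_ne _ h]

theorem Homog.signMap_comm {dX : X.ι → ℤ} {dY : Y.ι → ℤ} {f : X ⟶ Y} (hf : Homog dX dY 0 f) :
    signMap dX ≫ f = f ≫ signMap dY := by
  refine hom_ext fun i j => ?_
  rw [signMap_comp_e, comp_signMap_e]
  by_cases h : f.e i j = 0
  · rw [h, smul_zero, smul_zero]
  · rw [hf i j h, add_zero]

theorem Homog.signMap_anticomm {dX : X.ι → ℤ} {dY : Y.ι → ℤ} {f : X ⟶ Y} {a : ℤ} (hf : Homog dX dY a f)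
    (ha : a.negOnePow = -1) : signMap dX ≫ f = -(f ≫ signMap dY) := by
  refine hom_ext fun i j => ?_
  rw [← zero_sub, sub_e, zero_e, zero_sub, signMap_comp_e, comp_signMap_e]
  by_cases h : f.e i j = 0
  · rw [h, smul_zero, smul_zero, neg_zero]
  · rw [hf i j h, Int.negOnePow_add, ha, mul_neg_one, Units.smul_def, Units.smul_def, Units.val_neg,
      neg_smul, neg_neg]

theorem homog_signMap {G : Type*} [AddCommGroup G] (dX : X.ι → ℤ) (d : X.ι → G) :
    Homog d d 0 (signMap dX) := homog_reindex _ _ fun _ => (add_zero _).symm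

theorem signMap_tMap (F : TensorData W) (dX : X.ι → ℤ) :
    F.sum.map (signMap dX) (𝟙 Y) =
      signMap (X := F.sum.obj X Y) fun p : X.ι × Y.ι => dX p.1 := by
  refine hom_ext fun p q => ?_
  have h1 : (signMap dX).e p.1 q.1 = (dX p.1).negOnePow • (𝟙 X : X ⟶ X).e p.1 q.1 := by
    rw [← signMap_comp_e, comp_id]
  have h2 : (signMap (X := F.sum.obj X Y) fun p : X.ι × Y.ι => dX p.1).e p q =
      (dX p.1).negOnePow • (𝟙 (F.sum.obj X Y) : _ ⟶ _).e p q :=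
    (congrArg (fun f => Hom.e f p q) (comp_id _)).symm.trans (signMap_comp_e
      (X := F.sum.obj X Y) (fun p : X.ι × Y.ι => dX p.1) (𝟙 _) p q)
  rw [h2, ← F.sum.map_id]
  change F.map ((signMap dX).e p.1 q.1) _ = _ • F.map _ _
  rw [h1, Units.smul_def, F.map_zsmul_left]
  rfl

/-- The matrix of a family of morphisms between graded objects. -/
def fam {A B : ℤ → W} (f : ∀ i j, A i ⟶ B j) (a : ℤ) (hf : ∀ i j, i + a ≠ j → f i j = 0) :
    (⟨ℤ, A⟩ : SumCompl W) ⟶ ⟨ℤ, B⟩ :=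
  ⟨f, fun i => (Set.finite_singleton (i + a)).subset fun j hj => by
    by_contra h
    exact hj (hf i j fun h' => h h'.symm)⟩

theorem homog_fam {A B : ℤ → W} (f : ∀ i j, A i ⟶ B j) (a : ℤ) (hf : ∀ i j, i + a ≠ j → f i j = 0) :
    Homog (X := ⟨ℤ, A⟩) (Y := ⟨ℤ, B⟩) (fun i : ℤ => i) (fun i : ℤ => i) a (fam f a hf) := fun i j hij => by
  by_contra h
  exact hij (hf i j fun h' => h h'.symm)

theorem fam_comp_e {A B : ℤ → W} {Y : SumCompl W} (f : ∀ i j, A i ⟶ B j) (a : ℤ)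
    (hf : ∀ i j, i + a ≠ j → f i j = 0) (g : (⟨ℤ, B⟩ : SumCompl W) ⟶ Y) (i : ℤ) (l : Y.ι) :
    (fam f a hf ≫ g).e i l = f i (i + a) ≫ g.e (i + a) l :=
  comp_e_left (fam f a hf) g i (i + a) l fun j hj => hf i j hj.symm

end SumCompl

open SumCompl

variable {W : Type w} [Category.{v} W] [Preadditive W] {δ : ℤ} {c : ComplexShape ℤ}
  (hc : ∀ i j, c.Rel i j ↔ i + δ = j)

/-- A graded object as a formal direct sum. -/
abbrev hatObj (A : ℤ → W) : SumCompl W := ⟨ℤ, A⟩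

/-- A complex as a graded object with differential. -/
abbrev hat (A : HomologicalComplex W c) : GDiff W δ where
  obj := hatObj A.X
  deg i := i
  d := fam A.d δ fun i j h => A.shape i j fun h' => h ((hc i j).1 h')
  homog := homog_fam _ _ _
  dd := SumCompl.hom_ext fun i l => by
    rw [fam_comp_e]
    exact A.d_comp_d _ _ _

/-- A morphism of complexes as a matrix. -/
def hatMap {A B : HomologicalComplex W c} (f : A ⟶ B) : hatObj A.X ⟶ hatObj B.X :=
  reindex (M := hatObj A.X) (N := hatObj B.X) (fun i => i) f.f

section

variable {A B D : HomologicalComplex W c}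

theorem hatMap_e (f : A ⟶ B) (i : ℤ) : (hatMap f).e i i = f.f i := reindex_e (M := hatObj A.X) (N := hatObj B.X) (fun i => i) f.f i

theorem hatMap_e_of_ne (f : A ⟶ B) {i j : ℤ} (h : i ≠ j) : (hatMap f).e i j = 0 :=
  reindex_e_of_ne (M := hatObj A.X) (N := hatObj B.X) (fun i => i) f.f i j h

theorem hatMap_comp_e {Y : SumCompl W} (f : A ⟶ B) (g : hatObj B.X ⟶ Y) (i : ℤ) (j : Y.ι) :
    (hatMap f ≫ g).e i j = f.f i ≫ g.e i j := reindex_comp_e (M := hatObj A.X) (N := hatObj B.X) (fun i => i) f.f g i j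

theorem comp_hatMap_e {Y : SumCompl W} (f : A ⟶ B) (g : Y ⟶ hatObj A.X) (i : Y.ι) (j : ℤ) :
    (g ≫ hatMap f).e i j = g.e i j ≫ f.f j :=
  comp_reindex_e (M := hatObj A.X) (N := hatObj B.X) (fun i => i) (fun _ _ h => h) f.f g i j

theorem homog_hatMap (f : A ⟶ B) : Homog (X := hatObj A.X) (Y := hatObj B.X) (hat hc A).deg (hat hc B).deg 0 (hatMap f) :=
  homog_reindex _ _ fun _ => (add_zero _).symm

theorem hatMap_comp (f : A ⟶ B) (g : B ⟶ D) : hatMap f ≫ hatMap g = hatMap (f ≫ g) := by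
  refine SumCompl.hom_ext fun (i : ℤ) (j : ℤ) => ?_
  rw [hatMap_comp_e]
  by_cases h : i = j
  · subst h
    rw [hatMap_e, hatMap_e]
    rfl
  · rw [hatMap_e_of_ne _ h, hatMap_e_of_ne _ h]
    exact comp_zero

theorem hatMap_id : hatMap (𝟙 A) = 𝟙 _ := by
  refine SumCompl.hom_ext fun (i : ℤ) (j : ℤ) => ?_
  by_cases h : i = j
  · subst h
    rw [hatMap_e, id_e]
    rfl
  · rw [hatMap_e_of_ne _ h, id_e_of_ne _ h]

theorem hatMap_comm (f : A ⟶ B) : hatMap f ≫ (hat hc B).d = (hat hc A).d ≫ hatMap f := by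
  refine SumCompl.hom_ext fun (i : ℤ) (j : ℤ) => ?_
  rw [hatMap_comp_e, comp_hatMap_e]
  exact f.comm i j

variable {f g : A ⟶ B}

theorem homotopy_hom_eq_zero (hc : ∀ i j, c.Rel i j ↔ i + δ = j) (h : Homotopy f g) {i j : ℤ} (hij : i + -δ ≠ j) : h.hom i j = 0 :=
  h.zero i j fun h' => hij (by
    have := (hc j i).1 h'
    omega)

/-- A homotopy as a matrix. -/
def hatHtpy (h : Homotopy f g) : hatObj A.X ⟶ hatObj B.X :=
  fam h.hom (-δ) fun _ _ => homotopy_hom_eq_zero hc h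

theorem homog_hatHtpy (h : Homotopy f g) : Homog (X := hatObj A.X) (Y := hatObj B.X) (hat hc A).deg (hat hc B).deg (-δ) (hatHtpy hc h) :=
  homog_fam _ _ _

theorem hatMap_eq_of_homotopy (h : Homotopy f g) : hatMap f =
    (hat hc A).d ≫ hatHtpy hc h + hatHtpy hc h ≫ (hat hc B).d + hatMap g := by
  refine SumCompl.hom_ext fun (i : ℤ) (j : ℤ) => ?_
  have e1 : ((hat hc A).d ≫ hatHtpy hc h).e i j = A.d i (i + δ) ≫ h.hom (i + δ) j :=
    fam_comp_e A.d δ (fun i j h => A.shape i j fun h' => h ((hc i j).1 h')) _ _ _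
  have e2 : (hatHtpy hc h ≫ (hat hc B).d).e i j = h.hom i (i + -δ) ≫ B.d (i + -δ) j :=
    fam_comp_e _ _ _ _ _ _
  rw [add_e, add_e, e1, e2]
  by_cases hij : i = j
  · subst hij
    have e := h.comm i
    rw [dNext_eq _ ((hc i (i + δ)).2 rfl), prevD_eq _ ((hc (i + -δ) i).2 (by omega))] at e
    rw [hatMap_e, hatMap_e]
    exact e
  · rw [homotopy_hom_eq_zero hc h (i := i + δ) (j := j) (by omega), B.shape (i + -δ) j fun h' => hij (by
      have := (hc _ _).1 h'; omega), comp_zero, comp_zero, hatMap_e_of_ne _ hij,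
      hatMap_e_of_ne _ hij, add_zero]
    exact (add_zero 0).symm

end

/-- A homotopy equivalence of complexes as one of graded objects. -/
def hatEquiv {A B : HomologicalComplex W c} (e : HomotopyEquiv A B) : (hat hc A).HEquiv (hat hc B) where
  f := hatMap e.hom
  g := hatMap e.inv
  h := hatHtpy hc e.homotopyHomInvId
  h' := hatHtpy hc e.homotopyInvHomId
  homog_f := homog_hatMap hc _
  homog_g := homog_hatMap hc _
  homog_h := homog_hatHtpy hc _
  homog_h' := homog_hatHtpy hc _
  comm_f := hatMap_comm hc _
  comm_g := hatMap_comm hc _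
  fg := by rw [hatMap_comp, hatMap_eq_of_homotopy hc e.homotopyHomInvId, hatMap_id]
  gf := by rw [hatMap_comp, hatMap_eq_of_homotopy hc e.homotopyInvHomId, hatMap_id]

section Tens

variable (F : TensorData W) (hδ : δ.negOnePow = -1)

namespace GDiff

/-- The degrees of the summands of a tensor product. -/
abbrev tensDeg {X Y : SumCompl W} (dX : X.ι → ℤ) (dY : Y.ι → ℤ) : (F.sum.obj X Y).ι → ℤ :=
  fun p : X.ι × Y.ι => dX p.1 + dY p.2

theorem homog_map {X X' Y Y' : SumCompl W} {dX : X.ι → ℤ} {dX' : X'.ι → ℤ}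
    {dY : Y.ι → ℤ} {dY' : Y'.ι → ℤ} {a b c : ℤ} {f : X ⟶ X'} {g : Y ⟶ Y'} (hf : Homog dX dX' a f)
    (hg : Homog dY dY' b g) (h : a + b = c) :
    Homog (tensDeg F dX dY) (tensDeg F dX' dY') c (F.sum.map f g) := homog_tMap F hf hg h

/-- The tensor product of graded objects with differential. -/
abbrev tens (K L : GDiff W δ) : GDiff W δ where
  obj := F.sum.obj K.obj L.obj
  deg := tensDeg F K.deg L.deg
  d := F.sum.map K.d (𝟙 _) + F.sum.map (signMap K.deg) L.d
  homog := (homog_map F K.homog Homog.id (add_zero δ)).add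
    (homog_map F (homog_signMap _ _) L.homog (zero_add δ))
  dd := by
    have h := K.homog.signMap_anticomm hδ
    simp only [add_comp, comp_add, ← F.sum.map_comp, K.dd, L.dd,
      comp_id, id_comp, h, F.sum.map_zero_left,
      F.sum.map_zero_right, F.sum.map_neg_left]
    abel

variable {K K' L L' : GDiff W δ}

/-- Homotopy invariance of the tensor product in the second factor. -/
def HEquiv.tensRight (K : GDiff W δ) (e : L.HEquiv L') : (tens F hδ K L).HEquiv (tens F hδ K L') where
  f := F.sum.map (𝟙 _) e.f
  g := F.sum.map (𝟙 _) e.g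
  h := F.sum.map (signMap K.deg) e.h
  h' := F.sum.map (signMap K.deg) e.h'
  homog_f := homog_map F Homog.id e.homog_f (add_zero 0)
  homog_g := homog_map F Homog.id e.homog_g (add_zero 0)
  homog_h := homog_map F (homog_signMap _ _) e.homog_h (zero_add _)
  homog_h' := homog_map F (homog_signMap _ _) e.homog_h' (zero_add _)
  comm_f := by
    simp only [tens, add_comp, comp_add, ← F.sum.map_comp,
      comp_id, id_comp, e.comm_f]
  comm_g := by
    simp only [tens, add_comp, comp_add, ← F.sum.map_comp,
      comp_id, id_comp, e.comm_g]
  fg := by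
    have h := K.homog.signMap_anticomm hδ
    simp only [tens, add_comp, comp_add, ← F.sum.map_comp,
      comp_id, id_comp, e.fg, F.sum.map_add_right, h,
      signMap_comp_signMap, F.sum.map_neg_left, F.sum.map_id]
    abel
  gf := by
    have h := K.homog.signMap_anticomm hδ
    simp only [tens, add_comp, comp_add, ← F.sum.map_comp,
      comp_id, id_comp, e.gf, F.sum.map_add_right, h,
      signMap_comp_signMap, F.sum.map_neg_left, F.sum.map_id]
    abel

/-- Homotopy invariance of the tensor product in the first factor. -/
def HEquiv.tensLeft (e : K.HEquiv K') (L : GDiff W δ) : (tens F hδ K L).HEquiv (tens F hδ K' L) where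
  f := F.sum.map e.f (𝟙 _)
  g := F.sum.map e.g (𝟙 _)
  h := F.sum.map e.h (𝟙 _)
  h' := F.sum.map e.h' (𝟙 _)
  homog_f := homog_map F e.homog_f Homog.id (add_zero 0)
  homog_g := homog_map F e.homog_g Homog.id (add_zero 0)
  homog_h := homog_map F e.homog_h Homog.id (add_zero _)
  homog_h' := homog_map F e.homog_h' Homog.id (add_zero _)
  comm_f := by
    have h := e.homog_f.signMap_comm
    simp only [tens, add_comp, comp_add, ← F.sum.map_comp,
      comp_id, id_comp, e.comm_f, h]
  comm_g := by
    have h := e.homog_g.signMap_comm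
    simp only [tens, add_comp, comp_add, ← F.sum.map_comp,
      comp_id, id_comp, e.comm_g, h]
  fg := by
    have h := e.homog_h.signMap_anticomm (by rw [Int.negOnePow_neg, hδ])
    simp only [tens, add_comp, comp_add, ← F.sum.map_comp,
      comp_id, id_comp, e.fg, F.sum.map_add_left, h,
      F.sum.map_neg_left, F.sum.map_id]
    abel
  gf := by
    have h := e.homog_h'.signMap_anticomm (by rw [Int.negOnePow_neg, hδ])
    simp only [tens, add_comp, comp_add, ← F.sum.map_comp,
      comp_id, id_comp, e.gf, F.sum.map_add_left, h,
      F.sum.map_neg_left, F.sum.map_id]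
    abel

end GDiff

end Tens
end

noncomputable section

open SumCompl

variable {W : Type w} [Category.{v} W] [Preadditive W] {δ : ℤ} (F : TensorData W)

namespace GDiff

/-- A splitting of a graded object into the unit in one degree and an object with zero unit part. -/
structure Splitting (D : GDiff W δ) (Y : SumCompl W) (sY : Y.ι → ℤ) where
  /-- The inclusion of the unit. -/
  j : F.sum.unit ⟶ D.obj
  /-- The projection to the unit. -/
  p₀ : D.obj ⟶ F.sum.unit
  /-- The inclusion of the complement into `Y`. -/
  i : D.obj ⟶ Y
  /-- The projection from `Y` to the complement. -/
  p : Y ⟶ D.obj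
  homog_j : Homog (fun _ => 0) D.deg 0 j
  homog_p₀ : Homog D.deg (fun _ => 0) 0 p₀
  homog_i : Homog D.deg sY 0 i
  homog_p : Homog sY D.deg 0 p
  jp₀ : j ≫ p₀ = 𝟙 _
  ji : j ≫ i = 0
  ip : i ≫ p = 𝟙 _ - p₀ ≫ j
  jd : j ≫ D.d = 0
  isZero (r : D.obj.ι) : 0 < δ * D.deg r → IsZero (D.obj.X r)

theorem lower_of_homog (hδ : δ = 1 ∨ δ = -1) {T : SumCompl W} {s : T.ι → ℤ} {ψ : T ⟶ T}
    (hψ : Homog s s δ ψ) (hz : ∀ r, 0 < δ * s r → IsZero (T.X r)) (p q : T.ι)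
    (h : ψ.e p q ≠ 0) : (-(δ * s q)).toNat < (-(δ * s p)).toNat := by
  have h1 := hψ p q h
  have h2 : ¬ 0 < δ * s q := fun h' => h ((hz q h').eq_zero_of_tgt _)
  rcases hδ with rfl | rfl <;> omega

theorem isZero_obj_left {X Y : W} (h : IsZero X) : IsZero (F.obj X Y) := by
  rw [IsZero.iff_id_eq_zero, ← F.map_id, (IsZero.iff_id_eq_zero _).1 h, F.map_zero_left]

theorem isZero_obj_right {X Y : W} (h : IsZero Y) : IsZero (F.obj X Y) := by
  rw [IsZero.iff_id_eq_zero, ← F.map_id, (IsZero.iff_id_eq_zero _).1 h, F.map_zero_right]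

theorem negOnePow_eq (hδ : δ = 1 ∨ δ = -1) : δ.negOnePow = -1 := by
  rcases hδ with rfl | rfl <;> simp

theorem comp_add_comp_eq {C : Type w} [Category.{v} C] [Preadditive C] {X Y : C} {d H : X ⟶ X}
    (h : d ≫ H + H ≫ d = 𝟙 X) (R : X ⟶ Y) : d ≫ H ≫ R + H ≫ d ≫ R = R := by
  rw [← assoc, ← assoc, ← add_comp, h, id_comp]

theorem contraction_of_factors {A X P Z : W} (i : X ⟶ F.obj P Z) (p : F.obj P Z ⟶ X)
    (H : F.obj A P ⟶ F.obj A P) {d : A ⟶ A} {g : X ⟶ X} (hip : i ≫ p = g)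
    (hH : F.map d (𝟙 P) ≫ H + H ≫ F.map d (𝟙 P) = 𝟙 _) :
    F.map d (𝟙 X) ≫ (F.map (𝟙 A) i ≫ (F.assoc A P Z).inv ≫ F.map H (𝟙 Z) ≫ (F.assoc A P Z).hom ≫
        F.map (𝟙 A) p) +
      (F.map (𝟙 A) i ≫ (F.assoc A P Z).inv ≫ F.map H (𝟙 Z) ≫ (F.assoc A P Z).hom ≫
        F.map (𝟙 A) p) ≫ F.map d (𝟙 X) = F.map (𝟙 A) g := by
  have e1 : F.map d (𝟙 X) ≫ F.map (𝟙 A) i ≫ (F.assoc A P Z).inv =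
      F.map (𝟙 A) i ≫ (F.assoc A P Z).inv ≫ F.map (F.map d (𝟙 P)) (𝟙 Z) := by
    rw [TensorData.inv_natural (F.assoc_nat d (𝟙 P) (𝟙 Z)), F.map_id,
      ← assoc, ← assoc, ← F.map_comp, ← F.map_comp]
    simp
  have e2 : (F.assoc A P Z).hom ≫ F.map (𝟙 A) p ≫ F.map d (𝟙 X) =
      F.map (F.map d (𝟙 P)) (𝟙 Z) ≫ (F.assoc A P Z).hom ≫ F.map (𝟙 A) p := by
    rw [reassoc_of% F.assoc_nat d (𝟙 P) (𝟙 Z), F.map_id, ← F.map_comp, ← F.map_comp]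
    simp
  have e3 : F.map (F.map d (𝟙 P)) (𝟙 Z) ≫ F.map H (𝟙 Z) +
      F.map H (𝟙 Z) ≫ F.map (F.map d (𝟙 P)) (𝟙 Z) = 𝟙 _ := by
    rw [← F.map_comp, ← F.map_comp, comp_id, ← F.map_add_left, hH, F.map_id]
  simp only [assoc]
  rw [reassoc_of% e1, e2, ← comp_add, ← comp_add, comp_add_comp_eq e3, Iso.inv_hom_id_assoc,
    ← F.map_comp, comp_id, hip]

section Right

variable {A X P Z : SumCompl W} (i : X ⟶ F.sum.obj P Z) (p : F.sum.obj P Z ⟶ X)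
  (H : F.sum.obj A P ⟶ F.sum.obj A P)

/-- The endomorphism of `A ⊗ X` that is induced by an endomorphism of `A ⊗ P`, for `X` related to
`P ⊗ Z`. -/
def conjRight : F.sum.obj A X ⟶ F.sum.obj A X :=
  F.sum.map (𝟙 A) i ≫ (F.sum.assoc A P Z).inv ≫ F.sum.map H (𝟙 Z) ≫
    (F.sum.assoc A P Z).hom ≫ F.sum.map (𝟙 A) p

theorem homog_assoc (sA : A.ι → ℤ) (sP : P.ι → ℤ) (sZ : Z.ι → ℤ) :
    Homog (tensDeg F (X := F.sum.obj A P) (tensDeg F sA sP) sZ)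
      (tensDeg F (Y := F.sum.obj P Z) sA (tensDeg F sP sZ)) 0
      (F.sum.assoc A P Z).hom :=
  homog_reindex _ _ fun _ => (add_assoc _ _ _).symm.trans (add_zero _).symm

theorem homog_assoc_inv (sA : A.ι → ℤ) (sP : P.ι → ℤ) (sZ : Z.ι → ℤ) :
    Homog (tensDeg F (Y := F.sum.obj P Z) sA (tensDeg F sP sZ))
      (tensDeg F (X := F.sum.obj A P) (tensDeg F sA sP) sZ) 0
      (F.sum.assoc A P Z).inv :=
  homog_reindex _ _ fun _ => (add_assoc _ _ _).trans (add_zero _).symm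

theorem homog_conjRight {sA : A.ι → ℤ} {sX : X.ι → ℤ} {sP : P.ι → ℤ} {sZ : Z.ι → ℤ} {b : ℤ}
    (hi : Homog sX (tensDeg F sP sZ) 0 i) (hp : Homog (tensDeg F sP sZ) sX 0 p)
    (hH : Homog (tensDeg F sA sP) (tensDeg F sA sP) b H) :
    Homog (tensDeg F sA sX) (tensDeg F sA sX) b (conjRight F i p H) :=
  (homog_map F Homog.id hi (add_zero 0)).comp ((homog_assoc_inv F sA sP sZ).comp
    ((homog_map F hH Homog.id (add_zero b)).comp ((homog_assoc F sA sP sZ).comp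
      (homog_map F Homog.id hp (add_zero 0)) (add_zero 0)) (add_zero b)) (zero_add b)) (zero_add b)

theorem conjRight_contraction {d : A ⟶ A} {g : X ⟶ X} (hip : i ≫ p = g)
    (hH : F.sum.map d (𝟙 P) ≫ H + H ≫ F.sum.map d (𝟙 P) = 𝟙 _) :
    F.sum.map d (𝟙 X) ≫ conjRight F i p H + conjRight F i p H ≫ F.sum.map d (𝟙 X) = F.sum.map (𝟙 A) g :=
  contraction_of_factors F.sum i p H hip hH

end Right

section Left

variable {A X Q Z : SumCompl W} (i : X ⟶ F.sum.obj Z Q) (p : F.sum.obj Z Q ⟶ X)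
  (H : F.sum.obj Q A ⟶ F.sum.obj Q A)

/-- The endomorphism of `X ⊗ A` that is induced by an endomorphism of `Q ⊗ A`, for `X` related to
`Z ⊗ Q`. -/
def conjLeft : F.sum.obj X A ⟶ F.sum.obj X A :=
  F.sum.map i (𝟙 A) ≫ (F.sum.assoc Z Q A).hom ≫ F.sum.map (𝟙 Z) H ≫
    (F.sum.assoc Z Q A).inv ≫ F.sum.map p (𝟙 A)

theorem homog_conjLeft {sA : A.ι → ℤ} {sX : X.ι → ℤ} {sQ : Q.ι → ℤ} {sZ : Z.ι → ℤ} {b : ℤ}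
    (hi : Homog sX (tensDeg F sZ sQ) 0 i) (hp : Homog (tensDeg F sZ sQ) sX 0 p)
    (hH : Homog (tensDeg F sQ sA) (tensDeg F sQ sA) b H) :
    Homog (tensDeg F sX sA) (tensDeg F sX sA) b (conjLeft F i p H) :=
  (homog_map F hi Homog.id (add_zero 0)).comp ((homog_assoc F sZ sQ sA).comp
    ((homog_map F Homog.id hH (zero_add b)).comp ((homog_assoc_inv F sZ sQ sA).comp
      (homog_map F hp Homog.id (add_zero 0)) (add_zero 0)) (add_zero b)) (zero_add b)) (zero_add b)

theorem conjLeft_contraction {d : A ⟶ A} {g : X ⟶ X} (hip : i ≫ p = g)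
    (hH : F.sum.map (𝟙 Q) d ≫ H + H ≫ F.sum.map (𝟙 Q) d = 𝟙 _) :
    F.sum.map (𝟙 X) d ≫ conjLeft F i p H + conjLeft F i p H ≫ F.sum.map (𝟙 X) d = F.sum.map g (𝟙 A) :=
  contraction_of_factors F.sum.rev i p H hip hH

end Left

variable (hδ : δ = 1 ∨ δ = -1) {A D : GDiff W δ} {P Z : SumCompl W} {sZ : Z.ι → ℤ}

theorem homog_runit {X : SumCompl W} (s : X.ι → ℤ) :
    Homog (tensDeg F s fun _ : F.sum.unit.ι => 0) s 0 (F.sum.runit X).hom :=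
  homog_reindex _ _ fun _ => (add_zero _).symm.trans (add_zero _).symm

theorem homog_runit_inv {X : SumCompl W} (s : X.ι → ℤ) :
    Homog s (tensDeg F s fun _ : F.sum.unit.ι => 0) 0 (F.sum.runit X).inv :=
  homog_reindex _ _ fun _ => rfl

theorem homog_lunit {X : SumCompl W} (s : X.ι → ℤ) :
    Homog (tensDeg F (fun _ : F.sum.unit.ι => 0) s) s 0 (F.sum.lunit X).hom :=
  homog_reindex _ _ fun _ => (zero_add _).symm.trans (add_zero _).symm

theorem homog_lunit_inv {X : SumCompl W} (s : X.ι → ℤ) :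
    Homog s (tensDeg F (fun _ : F.sum.unit.ι => 0) s) 0 (F.sum.lunit X).inv :=
  homog_reindex _ _ fun _ => (zero_add _).trans (add_zero _).symm

theorem nonempty_hEquiv_tens_right (e : D.Splitting F (F.sum.obj P Z)
      (tensDeg F (fun _ => 0) sZ)) (H : F.sum.obj A.obj P ⟶ F.sum.obj A.obj P)
    (hH : Homog (tensDeg F A.deg fun _ => 0) (tensDeg F A.deg fun _ => 0) (-δ) H)
    (hdH : F.sum.map A.d (𝟙 P) ≫ H + H ≫ F.sum.map A.d (𝟙 P) = 𝟙 _) :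
    Nonempty ((tens F (negOnePow_eq hδ) A D).HEquiv A) := by
  have hκι : (F.sum.map (𝟙 A.obj) e.p₀ ≫ (F.sum.runit A.obj).hom) ≫
      ((F.sum.runit A.obj).inv ≫ F.sum.map (𝟙 A.obj) e.j) =
      F.sum.map (𝟙 A.obj) (e.p₀ ≫ e.j) := by
    rw [assoc, Iso.hom_inv_id_assoc, ← F.sum.map_comp, comp_id]
  have h1 : 𝟙 (F.sum.obj A.obj D.obj) - F.sum.map (𝟙 A.obj) (e.p₀ ≫ e.j) =
      F.sum.map (𝟙 A.obj) (𝟙 _ - e.p₀ ≫ e.j) := by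
    rw [F.sum.map_sub_right, F.sum.map_id]
  have h0 : Homog (tensDeg F (fun _ : A.obj.ι => (0 : ℤ)) (fun _ : P.ι => (0 : ℤ)))
      (tensDeg F (fun _ : A.obj.ι => (0 : ℤ)) (fun _ : P.ι => (0 : ℤ))) 0 H := fun _ _ _ => rfl
  have hc0 := homog_conjRight F e.i e.p H e.homog_i e.homog_p h0
  have hd0 : Homog (tensDeg F (fun _ : A.obj.ι => (0 : ℤ)) D.deg)
      (tensDeg F (fun _ : A.obj.ι => (0 : ℤ)) D.deg) δ (F.sum.map (signMap A.deg) D.d) :=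
    homog_map F (homog_signMap _ _) D.homog (zero_add δ)
  refine nonempty_hEquiv_of_perturbation (tens F (negOnePow_eq hδ) A D) A
    (F.sum.map A.d (𝟙 _)) (F.sum.map (signMap A.deg) D.d) (conjRight F e.i e.p H)
    ((F.sum.runit A.obj).inv ≫ F.sum.map (𝟙 _) e.j)
    (F.sum.map (𝟙 _) e.p₀ ≫ (F.sum.runit A.obj).hom) rfl
    ((homog_runit_inv F A.deg).comp (homog_map F Homog.id e.homog_j (add_zero 0)) (add_zero 0))
    ((homog_map F Homog.id e.homog_p₀ (add_zero 0)).comp (homog_runit F A.deg) (add_zero 0))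
    (homog_conjRight F e.i e.p H e.homog_i e.homog_p hH) ?_ ?_ ?_ ?_
    (fun p => (-(δ * (0 + D.deg p.2))).toNat) ?_
  · rw [assoc, ← assoc (F.sum.map _ _), ← F.sum.map_comp, e.jp₀,
      comp_id, F.sum.map_id, id_comp, Iso.inv_hom_id]
  · have hr := TensorData.inv_natural (F.sum.runit_nat A.d)
    simp only [tens, comp_add, assoc, ← F.sum.map_comp, e.jd,
      F.sum.map_zero_right, comp_zero, add_zero, id_comp, comp_id]
    rw [← reassoc_of% hr, ← F.sum.map_comp, id_comp, comp_id]
  · rw [conjRight, assoc, ← assoc (F.sum.map _ e.j),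
      ← F.sum.map_comp, e.ji, F.sum.map_zero_right]
    simp
  · rw [conjRight_contraction F e.i e.p H e.ip hdH, hκι]
    exact h1.symm
  · rw [hκι]
    refine lower_of_homog hδ (s := tensDeg F (fun _ : A.obj.ι => (0 : ℤ)) D.deg) ?_ ?_
    · refine Homog.comp ((hd0.comp hc0 (add_zero δ)).add (hc0.comp hd0 (zero_add δ)))
        (Homog.id.sub (homog_map F (X := A.obj) (dX := fun _ => (0 : ℤ)) (dX' := fun _ => (0 : ℤ))
          Homog.id (e.homog_p₀.comp e.homog_j (add_zero 0)) (add_zero 0))) (add_zero δ)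
    · intro r hr
      replace hr : 0 < δ * (0 + D.deg r.2) := hr
      rw [zero_add] at hr
      exact isZero_obj_right F (e.isZero _ hr)

theorem nonempty_hEquiv_tens_left (e : D.Splitting F (F.sum.obj Z P)
      (tensDeg F sZ (fun _ => 0))) (H : F.sum.obj P A.obj ⟶ F.sum.obj P A.obj)
    (hH : Homog (tensDeg F (fun _ => 0) A.deg) (tensDeg F (fun _ => 0) A.deg) (-δ) H)
    (hdH : F.sum.map (𝟙 P) A.d ≫ H + H ≫ F.sum.map (𝟙 P) A.d = 𝟙 _) :
    Nonempty ((tens F (negOnePow_eq hδ) D A).HEquiv A) := by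
  have hκι : (F.sum.map e.p₀ (𝟙 A.obj) ≫ (F.sum.lunit A.obj).hom) ≫
      ((F.sum.lunit A.obj).inv ≫ F.sum.map e.j (𝟙 A.obj)) =
      F.sum.map (e.p₀ ≫ e.j) (𝟙 A.obj) := by
    rw [assoc, Iso.hom_inv_id_assoc, ← F.sum.map_comp, comp_id]
  have h1 : 𝟙 (F.sum.obj D.obj A.obj) - F.sum.map (e.p₀ ≫ e.j) (𝟙 A.obj) =
      F.sum.map (𝟙 _ - e.p₀ ≫ e.j) (𝟙 A.obj) := by
    rw [F.sum.map_sub_left, F.sum.map_id]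
  have h0 : Homog (tensDeg F (fun _ : P.ι => (0 : ℤ)) (fun _ : A.obj.ι => (0 : ℤ)))
      (tensDeg F (fun _ : P.ι => (0 : ℤ)) (fun _ : A.obj.ι => (0 : ℤ))) 0 H := fun _ _ _ => rfl
  have hsgn : (F.sum.map (signMap D.deg) (𝟙 A.obj)) =
    signMap (tensDeg F D.deg (fun _ : A.obj.ι => (0 : ℤ))) := by
    rw [signMap_tMap]
    exact congrArg (fun s => signMap s) (funext fun p => (add_zero _).symm)
  have hc0 := homog_conjLeft F e.i e.p H e.homog_i e.homog_p h0
  have hd0 : Homog (tensDeg F D.deg (fun _ : A.obj.ι => (0 : ℤ)))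
      (tensDeg F D.deg (fun _ : A.obj.ι => (0 : ℤ))) δ (F.sum.map D.d (𝟙 A.obj)) :=
    homog_map F D.homog Homog.id (add_zero δ)
  have hs0 : Homog (tensDeg F D.deg (fun _ : A.obj.ι => (0 : ℤ)))
      (tensDeg F D.deg (fun _ : A.obj.ι => (0 : ℤ))) 0 (F.sum.map (signMap D.deg) (𝟙 A.obj)) :=
    homog_map F (homog_signMap _ _) Homog.id (add_zero 0)
  have hcomm : F.sum.map (signMap D.deg) (𝟙 A.obj) ≫ conjLeft F e.i e.p H =
      conjLeft F e.i e.p H ≫ F.sum.map (signMap D.deg) (𝟙 A.obj) := by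
    rw [hsgn]
    exact hc0.signMap_comm
  have hsd : F.sum.map (signMap D.deg) A.d =
      F.sum.map (signMap D.deg) (𝟙 A.obj) ≫ F.sum.map (𝟙 _) A.d := by
    rw [← F.sum.map_comp, id_comp, comp_id]
  have hsd' : F.sum.map (signMap D.deg) A.d =
      F.sum.map (𝟙 _) A.d ≫ F.sum.map (signMap D.deg) (𝟙 A.obj) := by
    rw [← F.sum.map_comp, id_comp, comp_id]
  have hss : F.sum.map (signMap D.deg) (𝟙 A.obj) ≫ F.sum.map (signMap D.deg) (𝟙 A.obj) =
      𝟙 _ := by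
    rw [← F.sum.map_comp, signMap_comp_signMap, id_comp, F.sum.map_id]
  have hch := hs0.comp hc0 (add_zero 0)
  refine nonempty_hEquiv_of_perturbation (tens F (negOnePow_eq hδ) D A) A
    (F.sum.map (signMap D.deg) A.d) (F.sum.map D.d (𝟙 _))
    (F.sum.map (signMap D.deg) (𝟙 A.obj) ≫ conjLeft F e.i e.p H)
    ((F.sum.lunit A.obj).inv ≫ F.sum.map e.j (𝟙 _))
    (F.sum.map e.p₀ (𝟙 _) ≫ (F.sum.lunit A.obj).hom) (add_comm _ _)
    ((homog_lunit_inv F A.deg).comp (homog_map F e.homog_j Homog.id (add_zero 0)) (add_zero 0))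
    ((homog_map F e.homog_p₀ Homog.id (add_zero 0)).comp (homog_lunit F A.deg) (add_zero 0))
    ((homog_map F (homog_signMap _ _) Homog.id (add_zero 0)).comp
      (homog_conjLeft F e.i e.p H e.homog_i e.homog_p hH) (zero_add _)) ?_ ?_ ?_ ?_
    (fun p => (-(δ * (D.deg p.1 + 0))).toNat) ?_
  · rw [assoc, ← assoc (F.sum.map _ _), ← F.sum.map_comp, e.jp₀,
      comp_id, F.sum.map_id, id_comp, Iso.inv_hom_id]
  · have hr := TensorData.inv_natural (F.sum.lunit_nat A.d)
    have hj : e.j ≫ signMap D.deg = e.j := by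
      rw [← e.homog_j.signMap_comm]
      refine SumCompl.hom_ext fun a b => ?_
      rw [signMap_comp_e, Int.negOnePow_zero, one_smul]
    simp only [tens, comp_add, assoc, ← F.sum.map_comp, e.jd,
      F.sum.map_zero_left, comp_zero, zero_add, id_comp, hj]
    rw [← reassoc_of% hr, ← F.sum.map_comp, id_comp, comp_id]
  · rw [hcomm, conjLeft, assoc, assoc, ← assoc (F.sum.map e.j _),
      ← F.sum.map_comp, e.ji, F.sum.map_zero_left]
    simp
  · rw [hκι]
    refine Eq.trans ?_ ((conjLeft_contraction F e.i e.p H e.ip hdH).trans h1.symm)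
    refine congrArg₂ (· + ·) ?_ ?_
    · rw [hsd', assoc, reassoc_of% hss]
    · rw [hsd, hcomm, assoc, reassoc_of% hss]
  · rw [hκι]
    refine lower_of_homog hδ (s := tensDeg F D.deg (fun _ : A.obj.ι => (0 : ℤ))) ?_ ?_
    · refine Homog.comp ((hd0.comp hch (add_zero δ)).add (hch.comp hd0 (zero_add δ)))
        (Homog.id.sub (homog_map F (Y := A.obj) (dY := fun _ => (0 : ℤ)) (dY' := fun _ => (0 : ℤ))
          (e.homog_p₀.comp e.homog_j (add_zero 0)) Homog.id (add_zero 0))) (add_zero δ)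
    · intro r hr
      replace hr : 0 < δ * (D.deg r.1 + 0) := hr
      rw [add_zero] at hr
      exact isZero_obj_left F (e.isZero _ hr)

end GDiff
end

noncomputable section

open SumCompl

variable {W : Type w} [Category.{v} W] [Preadditive W] {δ : ℤ} (F : TensorData W)

/-- A family of morphisms of degree `δ` between graded objects has a contracting homotopy. -/
def Contracts (X : ℤ → W) (d : ∀ i j, X i ⟶ X j) (δ : ℤ) : Prop :=
  ∃ s : ∀ i j, X i ⟶ X j, ∀ l m n, l + δ = m → m + δ = n → d m n ≫ s n m + s m l ≫ d l m = 𝟙 _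

theorem Contracts.op {X : ℤ → W} {d : ∀ i j, X i ⟶ X j} (h : Contracts X d δ) :
    Contracts (fun n => Opposite.op (X n)) (fun i j => (d j i).op) (-δ) := by
  obtain ⟨s, hs⟩ := h
  refine ⟨fun i j => (s j i).op, fun l m n h1 h2 => ?_⟩
  rw [← op_comp, ← op_comp, ← op_add, add_comm, hs n m l (by omega) (by omega), op_id]

theorem Contracts.neg {X : ℤ → W} {d : ∀ i j, X i ⟶ X j} (h : Contracts X d δ) :
    Contracts (fun n => X (-n)) (fun i j => d (-i) (-j)) (-δ) := by
  obtain ⟨s, hs⟩ := h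
  exact ⟨fun i j => s (-i) (-j), fun l m n h1 h2 => hs _ _ _ (by omega) (by omega)⟩

theorem Contracts.exists_matrix {X : ℤ → W} {d : ∀ i j, X i ⟶ X j} (h : Contracts X d δ)
    (hd : ∀ i j, i + δ ≠ j → d i j = 0) :
    ∃ H : hatObj X ⟶ hatObj X, Homog (X := hatObj X) (Y := hatObj X) (fun i : ℤ => i) (fun i : ℤ => i)
      (-δ) H ∧ fam d δ hd ≫ H + H ≫ fam d δ hd = 𝟙 _ := by
  classical
  obtain ⟨s, hs⟩ := h
  have h0 : ∀ i j, i + -δ ≠ j → (if i + -δ = j then s i j else 0) = 0 := fun i j h => if_neg h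
  refine ⟨fam (fun i j => if i + -δ = j then s i j else 0) (-δ) h0, homog_fam _ _ _, ?_⟩
  refine SumCompl.hom_ext fun (i : ℤ) (j : ℤ) => ?_
  rw [add_e, fam_comp_e, fam_comp_e]
  change d i (i + δ) ≫ (if i + δ + -δ = j then s (i + δ) j else 0) +
    (if i + -δ = i + -δ then s i (i + -δ) else 0) ≫ d (i + -δ) j = _
  rw [if_pos rfl]
  by_cases hij : i = j
  · subst hij
    rw [if_pos (by omega), id_e]
    exact hs _ _ _ (by omega) rfl
  · rw [if_neg (by omega), hd (i + -δ) j (by omega), comp_zero, comp_zero,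
      id_e_of_ne _ hij]
    exact add_zero 0

section Pad

variable (X : ℤ → W) (P : W)

/-- The tensor product of a graded object with a single object on the right. -/
def padRight : hatObj (fun n => F.obj (X n) P) ≅ F.sum.obj (hatObj X) ((incl W).obj P) where
  hom := reindex (M := hatObj (fun n => F.obj (X n) P))
    (N := F.sum.obj (hatObj X) ((incl W).obj P)) (fun n => (n, PUnit.unit)) fun _ => 𝟙 _
  inv := reindex (M := F.sum.obj (hatObj X) ((incl W).obj P))
    (N := hatObj (fun n => F.obj (X n) P)) (fun p => p.1) fun _ => 𝟙 _
  hom_inv_id := reindex_comp_reindex _ _ _ _ (fun _ => rfl) fun _ => comp_id _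
  inv_hom_id := reindex_comp_reindex _ _ _ _ (fun _ => rfl) fun _ => comp_id _

/-- The tensor product of a graded object with a single object on the left. -/
def padLeft : hatObj (fun n => F.obj P (X n)) ≅ F.sum.obj ((incl W).obj P) (hatObj X) where
  hom := reindex (M := hatObj (fun n => F.obj P (X n)))
    (N := F.sum.obj ((incl W).obj P) (hatObj X)) (fun n => (PUnit.unit, n)) fun _ => 𝟙 _
  inv := reindex (M := F.sum.obj ((incl W).obj P) (hatObj X))
    (N := hatObj (fun n => F.obj P (X n))) (fun p => p.2) fun _ => 𝟙 _
  hom_inv_id := reindex_comp_reindex _ _ _ _ (fun _ => rfl) fun _ => comp_id _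
  inv_hom_id := reindex_comp_reindex _ _ _ _ (fun _ => rfl) fun _ => comp_id _

theorem homog_padRight : Homog (X := hatObj (fun n => F.obj (X n) P)) (fun n : ℤ => n)
    (GDiff.tensDeg F (X := hatObj X) (Y := (incl W).obj P) (fun n : ℤ => n) fun _ => 0) 0
    (padRight F X P).hom := homog_reindex _ _ fun _ => rfl

theorem homog_padRight_inv : Homog (Y := hatObj (fun n => F.obj (X n) P))
    (GDiff.tensDeg F (X := hatObj X) (Y := (incl W).obj P) (fun n : ℤ => n) fun _ => 0) (fun n : ℤ => n) 0
    (padRight F X P).inv := homog_reindex _ _ fun _ => (add_zero _).symm.trans (add_zero _).symm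

theorem homog_padLeft : Homog (X := hatObj (fun n => F.obj P (X n))) (fun n : ℤ => n)
    (GDiff.tensDeg F (X := (incl W).obj P) (Y := hatObj X) (fun _ => 0) fun n : ℤ => n) 0
    (padLeft F X P).hom := homog_reindex _ _ fun _ => (zero_add _).trans (add_zero _).symm

theorem homog_padLeft_inv : Homog (Y := hatObj (fun n => F.obj P (X n)))
    (GDiff.tensDeg F (X := (incl W).obj P) (Y := hatObj X) (fun _ => 0) fun n : ℤ => n) (fun n : ℤ => n) 0
    (padLeft F X P).inv := homog_reindex _ _ fun _ => (zero_add _).symm.trans (add_zero _).symm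

variable {X} (d : ∀ i j, X i ⟶ X j) (hd : ∀ i j, i + δ ≠ j → d i j = 0)

theorem fam_padRight : fam (fun i j => F.map (d i j) (𝟙 P)) δ
      (fun i j h => by rw [hd i j h, F.map_zero_left]) ≫ (padRight F X P).hom =
    (padRight F X P).hom ≫ F.sum.map (fam d δ hd) (𝟙 _) := by
  refine SumCompl.hom_ext fun (i : ℤ) (j : ℤ × PUnit) => ?_
  refine (comp_reindex_e (L := hatObj (fun n => F.obj (X n) P)) (M := hatObj (fun n => F.obj (X n) P))
    (N := F.sum.obj (hatObj X) ((incl W).obj P)) (fun n => (n, PUnit.unit))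
    (fun a b h => congrArg Prod.fst h) _ _ i j.1).trans ((reindex_comp_e _ _ _ _ _).trans ?_).symm
  refine (id_comp _).trans (Eq.trans ?_ (comp_id _).symm)
  change F.map (d i j.1) ((𝟙 ((incl W).obj P) : _ ⟶ _).e PUnit.unit PUnit.unit) = _
  exact congrArg (F.map (d i j.1)) (id_e ((incl W).obj P) PUnit.unit)

theorem fam_padLeft : fam (fun i j => F.map (𝟙 P) (d i j)) δ
      (fun i j h => by rw [hd i j h, F.map_zero_right]) ≫ (padLeft F X P).hom =
    (padLeft F X P).hom ≫ F.sum.map (𝟙 _) (fam d δ hd) := by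
  refine SumCompl.hom_ext fun (i : ℤ) (j : PUnit × ℤ) => ?_
  refine (comp_reindex_e (L := hatObj (fun n => F.obj P (X n))) (M := hatObj (fun n => F.obj P (X n)))
    (N := F.sum.obj ((incl W).obj P) (hatObj X)) (fun n => (PUnit.unit, n))
    (fun a b h => congrArg Prod.snd h) _ _ i j.2).trans ((reindex_comp_e _ _ _ _ _).trans ?_).symm
  refine (id_comp _).trans (Eq.trans ?_ (comp_id _).symm)
  change F.map ((𝟙 ((incl W).obj P) : _ ⟶ _).e PUnit.unit PUnit.unit) (d i j.2) = _
  exact congrArg (F.map · (d i j.2)) (id_e ((incl W).obj P) PUnit.unit)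

variable {F P d}

theorem conj_contraction {C : Type*} [Category* C] [Preadditive C] {X Y : C} (φ : X ≅ Y) {d H : X ⟶ X}
    {d' : Y ⟶ Y} (hd : d ≫ φ.hom = φ.hom ≫ d') (h : d ≫ H + H ≫ d = 𝟙 X) :
    d' ≫ (φ.inv ≫ H ≫ φ.hom) + (φ.inv ≫ H ≫ φ.hom) ≫ d' = 𝟙 Y := by
  have e : d' ≫ φ.inv = φ.inv ≫ d := by
    rw [Iso.comp_inv_eq, assoc, hd, Iso.inv_hom_id_assoc]
  rw [reassoc_of% e, assoc, assoc, ← hd, ← comp_add,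
    ← assoc H, ← assoc d, ← add_comp, h, id_comp, Iso.inv_hom_id]

theorem Contracts.exists_right (h : Contracts _ (fun i j => F.map (d i j) (𝟙 P)) δ) :
    ∃ H : F.sum.obj (hatObj X) ((incl W).obj P) ⟶ _,
      Homog (GDiff.tensDeg F (X := hatObj X) (Y := (incl W).obj P) (fun n : ℤ => n) fun _ => 0)
        (GDiff.tensDeg F (X := hatObj X) (Y := (incl W).obj P) (fun n : ℤ => n) fun _ => 0) (-δ) H ∧
      F.sum.map (fam d δ hd) (𝟙 _) ≫ H + H ≫ F.sum.map (fam d δ hd) (𝟙 _) = 𝟙 _ := by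
  obtain ⟨H, h1, h2⟩ := h.exists_matrix fun i j h => by rw [hd i j h, F.map_zero_left]
  exact ⟨(padRight F X P).inv ≫ H ≫ (padRight F X P).hom, (homog_padRight_inv F X P).comp
    (h1.comp (homog_padRight F X P) (add_zero _)) (zero_add _),
    conj_contraction _ (fam_padRight F P d hd) h2⟩

theorem Contracts.exists_left (h : Contracts _ (fun i j => F.map (𝟙 P) (d i j)) δ) :
    ∃ H : F.sum.obj ((incl W).obj P) (hatObj X) ⟶ _,
      Homog (GDiff.tensDeg F (X := (incl W).obj P) (Y := hatObj X) (fun _ => 0) fun n : ℤ => n)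
        (GDiff.tensDeg F (X := (incl W).obj P) (Y := hatObj X) (fun _ => 0) fun n : ℤ => n) (-δ) H ∧
      F.sum.map (𝟙 _) (fam d δ hd) ≫ H + H ≫ F.sum.map (𝟙 _) (fam d δ hd) = 𝟙 _ := by
  obtain ⟨H, h1, h2⟩ := h.exists_matrix fun i j h => by rw [hd i j h, F.map_zero_right]
  exact ⟨(padLeft F X P).inv ≫ H ≫ (padLeft F X P).hom, (homog_padLeft_inv F X P).comp
    (h1.comp (homog_padLeft F X P) (add_zero _)) (zero_add _),
    conj_contraction _ (fam_padLeft F P d hd) h2⟩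

end Pad

namespace GDiff

variable {F}

/-- Splittings along an isomorphism. -/
def Splitting.congr {D : GDiff W δ} {Y Y' : SumCompl W} {sY : Y.ι → ℤ} {sY' : Y'.ι → ℤ}
    (e : D.Splitting F Y sY) (φ : Y ≅ Y') (h1 : Homog sY sY' 0 φ.hom) (h2 : Homog sY' sY 0 φ.inv) :
    D.Splitting F Y' sY' where
  j := e.j
  p₀ := e.p₀
  i := e.i ≫ φ.hom
  p := φ.inv ≫ e.p
  homog_j := e.homog_j
  homog_p₀ := e.homog_p₀
  homog_i := e.homog_i.comp h1 (add_zero 0)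
  homog_p := h2.comp e.homog_p (add_zero 0)
  jp₀ := e.jp₀
  ji := by rw [reassoc_of% e.ji, zero_comp]
  ip := by rw [assoc, Iso.hom_inv_id_assoc, e.ip]
  jd := e.jd
  isZero := e.isZero

end GDiff

section Split

variable {c : ComplexShape ℤ} (hc : ∀ i j, c.Rel i j ↔ i + δ = j) (hδ : δ = 1 ∨ δ = -1)
  {D : HomologicalComplex W c} (u : D.X 0 ≅ F.unit)
  (hz : ∀ r, 0 < δ * r → IsZero (D.X r)) {Y : ℤ → W} (i : ∀ r, D.X r ⟶ Y r) (p : ∀ r, Y r ⟶ D.X r)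
  (hip : ∀ r, r ≠ 0 → i r ≫ p r = 𝟙 _)

/-- The splitting of a complex with the unit object in degree `0`. -/
def splitting : (hat hc D).Splitting F (hatObj Y) fun n : ℤ => n where
  j := reindex (M := F.sum.unit) (N := hatObj D.X) (fun _ => (0 : ℤ)) fun _ => u.inv
  p₀ := ⟨fun (n : ℤ) _ => if h : n = 0 then eqToHom (congrArg D.X h) ≫ u.hom else 0, fun _ =>
    Set.toFinite (α := PUnit) _⟩
  i := reindex (M := hatObj D.X) (N := hatObj Y) (fun n => n) fun n => if n = 0 then 0 else i n
  p := reindex (M := hatObj Y) (N := hatObj D.X) (fun n => n) fun n => if n = 0 then 0 else p n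
  homog_j := homog_reindex _ _ fun _ => rfl
  homog_p₀ := fun n _ h => by
    by_contra h'
    exact h (dif_neg fun h0 => h' (h0.symm.trans (add_zero n).symm))
  homog_i := homog_reindex _ _ fun _ => (add_zero _).symm
  homog_p := homog_reindex _ _ fun _ => (add_zero _).symm
  jp₀ := by
    refine SumCompl.hom_ext fun a b => ?_
    refine (reindex_comp_e (M := F.sum.unit) (N := hatObj D.X) _ _ _ a b).trans ?_
    refine Eq.trans ?_ (id_e F.sum.unit a).symm
    change u.inv ≫ (if h : (0 : ℤ) = 0 then eqToHom (congrArg D.X h) ≫ u.hom else 0) = 𝟙 F.unit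
    rw [dif_pos rfl, eqToHom_refl, id_comp, Iso.inv_hom_id]
  ji := by
    refine SumCompl.hom_ext fun a (b : ℤ) => ?_
    refine (reindex_comp_e (M := F.sum.unit) (N := hatObj D.X) (L := hatObj Y) _ _ _ a b).trans ?_
    by_cases h : b = 0
    · subst h
      rw [reindex_e (M := hatObj D.X) (N := hatObj Y) (fun n => n), if_pos rfl]
      exact comp_zero
    · rw [reindex_e_of_ne (M := hatObj D.X) (N := hatObj Y) (fun n => n) _ _ _ fun h' => h h'.symm]
      exact comp_zero
  ip := by
    refine SumCompl.hom_ext fun (a : ℤ) (b : ℤ) => ?_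
    rw [reindex_comp_e, sub_e]
    have e : ∀ f : (hatObj D.X) ⟶ F.sum.unit, (f ≫ reindex (M := F.sum.unit)
        (N := hatObj D.X) (fun _ => (0 : ℤ)) fun _ => u.inv).e a b = if h : b = 0 then
          f.e a PUnit.unit ≫ u.inv ≫ eqToHom (congrArg D.X h.symm) else 0 := fun f => by
      refine (comp_e_right (D := hatObj D.X) f _ a PUnit.unit b fun j hj => absurd rfl hj).trans ?_
      split_ifs with h
      · subst h
        exact congrArg (f.e a PUnit.unit ≫ ·) ((reindex_e (M := F.sum.unit) (N := hatObj D.X)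
          (fun _ => (0 : ℤ)) (fun _ => u.inv) PUnit.unit).trans (comp_id u.inv).symm)
      · exact (congrArg (_ ≫ ·) (reindex_e_of_ne (M := F.sum.unit) (N := hatObj D.X) _ _ _ _
          fun h' => h h'.symm)).trans comp_zero
    rw [e]
    by_cases hab : a = b
    · subst hab
      rw [reindex_e (M := hatObj Y) (N := hatObj D.X) (fun n => n), id_e]
      by_cases ha : a = 0
      · subst ha
        rw [if_pos rfl, zero_comp, dif_pos rfl]
        change 0 = _ - (if h : (0 : ℤ) = 0 then eqToHom (congrArg D.X h) ≫ u.hom else 0) ≫ _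
        rw [dif_pos rfl]
        have e' : 𝟙 (D.X 0) = (eqToHom rfl ≫ u.hom) ≫ u.inv ≫ eqToHom rfl := by simp
        exact (sub_eq_zero.2 e').symm
      · rw [if_neg ha, if_neg ha, dif_neg ha, sub_zero]
        exact hip a ha
    · rw [reindex_e_of_ne (M := hatObj Y) (N := hatObj D.X) (fun n => n) _ _ _ hab, id_e_of_ne _ hab]
      refine (comp_zero).trans ?_
      by_cases hb : b = 0
      · subst hb
        simp [hab]
      · rw [dif_neg hb]
        exact (sub_zero 0).symm
  jd := by
    refine SumCompl.hom_ext fun a (b : ℤ) => ?_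
    refine (reindex_comp_e (M := F.sum.unit) (N := hatObj D.X) (L := hatObj D.X) _ _ _ a b).trans ?_
    change u.inv ≫ D.d 0 b = 0
    by_cases h : δ = b
    · subst h
      exact (hz δ (by rcases hδ with rfl | rfl <;> norm_num)).eq_zero_of_tgt _
    · rw [D.shape 0 b fun h' => h (by have := (hc 0 b).1 h'; omega), comp_zero]
  isZero := hz

end Split

section Total

variable {c : ComplexShape ℤ} (hc : ∀ i j, c.Rel i j ↔ i + δ = j) (hδ : δ = 1 ∨ δ = -1)

/-- The homogeneous parts of a complex. -/
def hatSlices (A : HomologicalComplex W c) : (hat hc A).Slices where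
  I _ := PUnit
  j n _ := n
  inj _ _ _ _ := rfl
  mem_range _ _ := ⟨fun ⟨_, h⟩ => h.symm, fun h => ⟨⟨⟩, h.symm⟩⟩

/-- The homogeneous parts of a tensor product of complexes. -/
def totSlices (hδ' : δ.negOnePow = -1) (A B : HomologicalComplex W c) :
    (GDiff.tens F hδ' (hat hc A) (hat hc B)).Slices where
  I n := {p : ℤ × ℤ // p.1 + p.2 = n}
  j _ p := p.1
  inj _ := Subtype.val_injective
  mem_range n t := by
    refine ⟨?_, fun h => ⟨⟨t, h⟩, rfl⟩⟩
    rintro ⟨p, rfl⟩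
    exact p.2

/-- A complex as a complex of formal direct sums. -/
def single (A : HomologicalComplex W c) : HomologicalComplex (SumCompl W) c :=
  GDiff.realize (hatSlices hc A) hc

/-- The total complex of a tensor product of complexes. -/
def tot (A B : HomologicalComplex W c) : HomologicalComplex (SumCompl W) c :=
  GDiff.realize (totSlices F hc (GDiff.negOnePow_eq hδ) A B) hc

/-- A complex with the unit object in degree `0` and all other objects zero or retracts of members
of a given class. -/
structure UnitPlus (D : HomologicalComplex W c) (S : W → Prop) : Prop where
  unit : Nonempty (D.X 0 ≅ F.unit)
  isZero (r : ℤ) : 0 < δ * r → IsZero (D.X r)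
  retract (r : ℤ) : δ * r < 0 → ∃ Y, S Y ∧ Nonempty (Retract (D.X r) Y)

variable {F} in
theorem UnitPlus.exists_splitting (hδ : δ = 1 ∨ δ = -1) {D : HomologicalComplex W c} {G : W → W}
    (h : UnitPlus F (δ := δ) D fun Y => ∃ Z, Y = G Z) :
    ∃ Z : ℤ → W, Nonempty ((hat hc D).Splitting F (hatObj fun n => G (Z n)) fun n : ℤ => n) := by
  obtain ⟨⟨u⟩, hz, hr⟩ := h
  have h1 : ∀ r : ℤ, ∃ Z : W, ∃ (i : D.X r ⟶ G Z) (p : G Z ⟶ D.X r), r ≠ 0 → i ≫ p = 𝟙 _ := by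
    intro r
    rcases lt_trichotomy (δ * r) 0 with hlt | heq | hgt
    · obtain ⟨_, ⟨Z, rfl⟩, ⟨e⟩⟩ := hr r hlt
      exact ⟨Z, e.i, e.r, fun _ => e.retract⟩
    · refine ⟨D.X r, 0, 0, fun h0 => absurd heq ?_⟩
      rcases hδ with rfl | rfl <;> simpa using h0
    · exact ⟨D.X r, 0, 0, fun _ => (hz r hgt).eq_of_src _ _⟩
  choose Z i p hip using h1
  exact ⟨Z, ⟨splitting F hc hδ u hz i p hip⟩⟩

variable {F} in
theorem nonempty_homotopyEquiv_tot_right {A C D : HomologicalComplex W c} (e : HomotopyEquiv C D)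
    {P : W} (hD : UnitPlus F (δ := δ) D fun Y => ∃ Z, Y = F.obj P Z)
    (hA : Contracts _ (fun i j => F.map (A.d i j) (𝟙 P)) δ) :
    Nonempty (HomotopyEquiv (tot F hc hδ A C) (single hc A)) := by
  obtain ⟨Z, ⟨s⟩⟩ := hD.exists_splitting hc hδ (G := fun Z => F.obj P Z)
  obtain ⟨H, hH, hdH⟩ := hA.exists_right fun i j h => A.shape i j fun h' => h ((hc i j).1 h')
  obtain ⟨e'⟩ := GDiff.nonempty_hEquiv_tens_right F hδ (A := hat hc A)
    (s.congr (padLeft F Z P) (homog_padLeft F Z P) (homog_padLeft_inv F Z P)) H hH hdH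
  exact ⟨(((hatEquiv hc e).tensRight F (GDiff.negOnePow_eq hδ) (hat hc A)).realize _ _ hc).trans
    (e'.realize (totSlices F hc _ A D) _ hc)⟩

variable {F} in
theorem nonempty_homotopyEquiv_tot_left {A C D : HomologicalComplex W c} (e : HomotopyEquiv C D)
    {P : W} (hD : UnitPlus F (δ := δ) D fun Y => ∃ Z, Y = F.obj Z P)
    (hA : Contracts _ (fun i j => F.map (𝟙 P) (A.d i j)) δ) :
    Nonempty (HomotopyEquiv (tot F hc hδ C A) (single hc A)) := by
  obtain ⟨Z, ⟨s⟩⟩ := hD.exists_splitting hc hδ (G := fun Z => F.obj Z P)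
  obtain ⟨H, hH, hdH⟩ := hA.exists_left fun i j h => A.shape i j fun h' => h ((hc i j).1 h')
  obtain ⟨e'⟩ := GDiff.nonempty_hEquiv_tens_left F hδ (A := hat hc A)
    (s.congr (padRight F Z P) (homog_padRight F Z P) (homog_padRight_inv F Z P)) H hH hdH
  exact ⟨(((hatEquiv hc e).tensLeft F (GDiff.negOnePow_eq hδ) (hat hc A)).realize _ _ hc).trans
    (e'.realize (totSlices F hc _ D A) _ hc)⟩

end Total
end

noncomputable section

open SumCompl

section Op

open HomologicalComplex

variable {W : Type w} [Category.{v} W] [Preadditive W] {ι : Type*} {c : ComplexShape ι}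

/-- The opposite of a homotopy equivalence of complexes. -/
def opHomotopyEquiv {A B : HomologicalComplex W c} (e : HomotopyEquiv A B) : HomotopyEquiv A.op B.op where
  hom := (opFunctor W c).map e.inv.op
  inv := (opFunctor W c).map e.hom.op
  homotopyHomInvId := (Homotopy.ofEq ((opFunctor W c).map_comp e.inv.op e.hom.op).symm).trans
    (e.homotopyHomInvId.op.trans (Homotopy.ofEq ((opFunctor W c).map_id _)))
  homotopyInvHomId := (Homotopy.ofEq ((opFunctor W c).map_comp e.hom.op e.inv.op).symm).trans
    (e.homotopyInvHomId.op.trans (Homotopy.ofEq ((opFunctor W c).map_id _)))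

theorem UnitPlus.op {F : TensorData W} {δ : ℤ} {c : ComplexShape ℤ} {D : HomologicalComplex W c}
    {S : W → Prop} (h : UnitPlus F (δ := δ) D S) :
    UnitPlus F.op (δ := δ) D.op fun Y => S Y.unop where
  unit := h.unit.map fun u => u.symm.op
  isZero r hr := (h.isZero r hr).op
  retract r hr := by
    obtain ⟨Y, hY, ⟨e⟩⟩ := h.retract r hr
    exact ⟨Opposite.op Y, hY, ⟨e.op⟩⟩

theorem UnitPlus.mono {F : TensorData W} {δ : ℤ} {c : ComplexShape ℤ} {D : HomologicalComplex W c}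
    {S T : W → Prop} (h : UnitPlus F (δ := δ) D S) (hST : ∀ Y, S Y → T Y) : UnitPlus F (δ := δ) D T where
  unit := h.unit
  isZero := h.isZero
  retract r hr := by
    obtain ⟨Y, hY, e⟩ := h.retract r hr
    exact ⟨Y, hST Y hY, e⟩

end Op

section Compare

open Idempotents

variable (C : Type w) [Category.{v} C] [Preadditive C] [MonoidalCategory C] [MonoidalPreadditive C]

/-- The tensor product of the idempotent completion of the additive envelope. -/
abbrev envTensorData : TensorData (Karoubi (Mat_ C)) := (matTensorData C).karoubi

theorem down_rel (i j : ℤ) : (ComplexShape.down ℤ).Rel i j ↔ i + -1 = j := by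
  change j + 1 = i ↔ _
  omega

theorem down_symm_rel (i j : ℤ) : (ComplexShape.down ℤ).symm.Rel i j ↔ i + 1 = j := Iff.rfl

variable {C} (A B : ChainComplex (Karoubi (Mat_ C)) ℤ)

theorem id_e_eq_degDiag (i j : ℤ) : (𝟙 (hatObj A.X) : _ ⟶ _).e i j = degDiag A i j := by
  by_cases h : i = j
  · subst h
    rw [id_e, degDiag_self]
  · rw [id_e_of_ne _ h, degDiag_of_ne A h]

theorem signMap_e_eq_degDiag (i j : ℤ) :
    (signMap (X := hatObj A.X) fun i : ℤ => i).e i j = i.negOnePow • degDiag A i j := by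
  rw [← id_e_eq_degDiag]
  refine Eq.trans ?_ (signMap_comp_e (X := hatObj A.X) (fun i : ℤ => i) (𝟙 _) i j)
  rw [comp_id]

theorem totEntry_eq (p q : ℤ × ℤ) : totEntry A B p q =
    (envTensorData C).map (A.d p.1 q.1) ((𝟙 (hatObj B.X) : _ ⟶ _).e p.2 q.2) +
    (envTensorData C).map ((signMap (X := hatObj A.X) fun i : ℤ => i).e p.1 q.1) (B.d p.2 q.2) := by
  rw [id_e_eq_degDiag, signMap_e_eq_degDiag, Units.smul_def, TensorData.map_zsmul_left]
  rfl

/-- The tensor product of complexes as a total complex. -/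
def tensorSumIso : tensorSum A B ≅ tot (envTensorData C) down_rel (Or.inr rfl) A B :=
  HomologicalComplex.Hom.isoOfComponents (fun _ => Iso.refl _) fun i j _ =>
    (id_comp _).trans (Eq.trans (SumCompl.hom_ext
      (f := (tot (envTensorData C) down_rel (Or.inr rfl) A B).d i j) (g := (tensorSum A B).d i j)
      fun p q => (totEntry_eq A B p.1 q.1).symm) (comp_id _).symm)

theorem totEntry_op_eq (p q : ℤ × ℤ) : (totEntry A B p q).op =
    (envTensorData C).op.map (Y := Opposite.op (B.X q.2)) (Y' := Opposite.op (B.X p.2))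
      (A.d p.1 q.1).op ((𝟙 (hatObj B.op.X) : _ ⟶ _).e q.2 p.2) +
    (envTensorData C).op.map (X := Opposite.op (A.X q.1)) (X' := Opposite.op (A.X p.1)) ((signMap (X := hatObj A.op.X) fun i : ℤ => i).e q.1 p.1)
      (B.d p.2 q.2).op := by
  have h1 : ((𝟙 (hatObj B.op.X) : _ ⟶ _).e q.2 p.2) = (degDiag B p.2 q.2).op := by
    obtain ⟨_, p⟩ := p
    obtain ⟨_, q⟩ := q
    by_cases h : p = q
    · subst h
      rw [id_e, degDiag_self]
      rfl
    · rw [id_e_of_ne _ (Ne.symm h), degDiag_of_ne B h]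
      rfl
  have h2 : (signMap (X := hatObj A.op.X) fun i : ℤ => i).e q.1 p.1 =
      (p.1.negOnePow • degDiag A p.1 q.1).op := by
    obtain ⟨p, _⟩ := p
    obtain ⟨q, _⟩ := q
    have e := signMap_comp_e (X := hatObj A.op.X) (fun i : ℤ => i) (𝟙 _) q p
    rw [comp_id] at e
    rw [e]
    by_cases h : p = q
    · subst h
      rw [id_e, degDiag_self]
      rfl
    · rw [id_e_of_ne _ (Ne.symm h), degDiag_of_ne A h]
      exact (smul_zero _).trans (congrArg Quiver.Hom.op (smul_zero _)).symm
  rw [h1, h2]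
  change _ = Quiver.Hom.op ((envTensorData C).map _ _ + (envTensorData C).map (_ • _) _)
  rw [Units.smul_def, TensorData.map_zsmul_left]
  rfl

/-- The completed tensor product of complexes as the opposite of a total complex. -/
def tensorProdIso : tensorProd A B ≅
    (tot (envTensorData C).op down_symm_rel (Or.inl rfl) A.op B.op).op :=
  HomologicalComplex.Hom.isoOfComponents (fun _ => Iso.refl _) fun i j _ =>
    (id_comp _).trans (Eq.trans (congrArg Quiver.Hom.op (SumCompl.hom_ext
      (f := (tot (envTensorData C).op down_symm_rel (Or.inl rfl) A.op B.op).d j i)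
      (g := ((tensorProd A B).d i j).unop)
      fun q p => (totEntry_op_eq A B p.1 q.1).symm)) (comp_id _).symm)

end Compare

namespace Heisenberg

variable {k : Type u} [Field k] (A : Cpx k)

/-- A complex as a complex of formal direct sums. -/
def toSumIso : Cpx.toSum A ≅ single down_rel A :=
  HomologicalComplex.Hom.isoOfComponents (fun _ => Iso.refl _) fun _ _ _ =>
    (id_comp _).trans (comp_id _).symm

/-- A complex as a complex of formal products. -/
def toProdIso : Cpx.toProd A ≅ (single down_symm_rel A.op).op :=
  HomologicalComplex.Hom.isoOfComponents (fun _ => Iso.refl _) fun _ _ _ =>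
    (id_comp _).trans (comp_id _).symm

variable {A} {C D : Cpx k} {P : Heisenberg k}

theorem nonempty_tensorSum_right (e : HomotopyEquiv C D)
    (hD : UnitPlus (envTensorData (Heis k)) (δ := -1) D fun Y => ∃ Z, Y = tenObj P Z)
    (hA : Contracts _ (fun i j => tenHom (A.d i j) (𝟙 P)) (-1)) :
    Nonempty (HomotopyEquiv (tensorSum A C) (Cpx.toSum A)) := by
  obtain ⟨e'⟩ := nonempty_homotopyEquiv_tot_right (F := envTensorData (Heis k)) down_rel (Or.inr rfl) e
    hD hA
  exact ⟨(HomotopyEquiv.ofIso (tensorSumIso A C)).trans (e'.trans (HomotopyEquiv.ofIso (toSumIso A).symm))⟩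

theorem nonempty_tensorSum_left (e : HomotopyEquiv C D)
    (hD : UnitPlus (envTensorData (Heis k)) (δ := -1) D fun Y => ∃ Z, Y = tenObj Z P)
    (hA : Contracts _ (fun i j => tenHom (𝟙 P) (A.d i j)) (-1)) :
    Nonempty (HomotopyEquiv (tensorSum C A) (Cpx.toSum A)) := by
  obtain ⟨e'⟩ := nonempty_homotopyEquiv_tot_left (F := envTensorData (Heis k)) down_rel (Or.inr rfl) e
    hD hA
  exact ⟨(HomotopyEquiv.ofIso (tensorSumIso C A)).trans (e'.trans (HomotopyEquiv.ofIso (toSumIso A).symm))⟩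

theorem nonempty_tensorProd_right (e : HomotopyEquiv C D)
    (hD : UnitPlus (envTensorData (Heis k)) (δ := 1) D fun Y => ∃ Z, Y = tenObj P Z)
    (hA : Contracts _ (fun i j => tenHom (A.d i j) (𝟙 P)) (-1)) :
    Nonempty (HomotopyEquiv (tensorProd A C) (Cpx.toProd A)) := by
  obtain ⟨e'⟩ := nonempty_homotopyEquiv_tot_right (F := (envTensorData (Heis k)).op) (A := A.op)
    (P := Opposite.op P) down_symm_rel (Or.inl rfl) (opHomotopyEquiv e)
    (hD.op.mono fun Y ⟨Z, hZ⟩ => ⟨Opposite.op Z, congrArg Opposite.op hZ⟩) hA.op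
  exact ⟨(HomotopyEquiv.ofIso (tensorProdIso A C)).trans ((opHomotopyEquiv e').trans
    (HomotopyEquiv.ofIso (toProdIso A).symm))⟩

theorem nonempty_tensorProd_left (e : HomotopyEquiv C D)
    (hD : UnitPlus (envTensorData (Heis k)) (δ := 1) D fun Y => ∃ Z, Y = tenObj Z P)
    (hA : Contracts _ (fun i j => tenHom (𝟙 P) (A.d i j)) (-1)) :
    Nonempty (HomotopyEquiv (tensorProd C A) (Cpx.toProd A)) := by
  obtain ⟨e'⟩ := nonempty_homotopyEquiv_tot_left (F := (envTensorData (Heis k)).op) (A := A.op)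
    (P := Opposite.op P) down_symm_rel (Or.inl rfl) (opHomotopyEquiv e)
    (hD.op.mono fun Y ⟨Z, hZ⟩ => ⟨Opposite.op Z, congrArg Opposite.op hZ⟩) hA.op
  exact ⟨(HomotopyEquiv.ofIso (tensorProdIso C A)).trans ((opHomotopyEquiv e').trans
    (HomotopyEquiv.ofIso (toProdIso A).symm))⟩

end Heisenberg
end

noncomputable section

section Extend

variable {W : Type w} [Category.{v} W] [Preadditive W] {X : ℤ → W} {d : ∀ i j, X i ⟶ X j}
  {Y : ℕ → W}

theorem exists_extension (X : ℤ → W) (a b : ℕ → ℤ) (ha : Function.Injective a)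
    (g : ∀ n, X (a n) ⟶ X (b n)) : ∃ s : ∀ i j, X i ⟶ X j, ∀ n, s (a n) (b n) = g n := by
  classical
  refine ⟨fun i j => if h : ∃ n, a n = i ∧ b n = j then
    eqToHom (congrArg X h.choose_spec.1).symm ≫ g h.choose ≫ eqToHom (congrArg X h.choose_spec.2) else 0,
    fun n => ?_⟩
  have key : ∀ (m : ℕ) (h1 : a m = a n) (h2 : b m = b n),
      eqToHom (congrArg X h1).symm ≫ g m ≫ eqToHom (congrArg X h2) = g n := by
    intro m h1 h2
    obtain rfl := ha h1
    simp
  have hn : ∃ m, a m = a n ∧ b m = b n := ⟨n, rfl, rfl⟩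
  exact (dif_pos hn).trans (key _ hn.choose_spec.1 hn.choose_spec.2)

theorem contracts_down (hz : ∀ n < 0, IsZero (X n)) (φ : ∀ n : ℕ, X n ≅ Y n)
    {c : ∀ n, Y (n + 1) ⟶ Y n} (h : ∀ n, Y n ⟶ Y (n + 1))
    (hd : ∀ n : ℕ, d ((n + 1 : ℕ) : ℤ) n = (φ (n + 1)).hom ≫ c n ≫ (φ n).inv) (h0 : h 0 ≫ c 0 = 𝟙 _)
    (hs : ∀ n, h (n + 1) ≫ c (n + 1) + c n ≫ h n = 𝟙 _) : Contracts X d (-1) := by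
  obtain ⟨s, e⟩ := exists_extension X (fun n : ℕ => (n : ℤ)) (fun n : ℕ => ((n + 1 : ℕ) : ℤ))
    Nat.cast_injective fun n => (φ n).hom ≫ h n ≫ (φ (n + 1)).inv
  refine ⟨s, fun l m n h1 h2 => ?_⟩
  rcases lt_or_ge m 0 with hm | hm
  · exact (hz m hm).eq_of_src _ _
  obtain ⟨_ | m, rfl⟩ := Int.eq_ofNat_of_zero_le hm
  · obtain rfl : l = ((0 + 1 : ℕ) : ℤ) := by omega
    rw [(hz n (by omega)).eq_zero_of_src (s n _), comp_zero, zero_add, e, hd]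
    simp [reassoc_of% h0]
  · obtain rfl : l = ((m + 1 + 1 : ℕ) : ℤ) := by omega
    obtain rfl : n = (m : ℤ) := by omega
    rw [e, e, hd, hd]
    have hs' := congrArg (fun f => (φ (m + 1)).hom ≫ f ≫ (φ (m + 1)).inv) (hs m)
    simp only [add_comp, comp_add, id_comp, Iso.hom_inv_id,
      assoc] at hs'
    refine (add_comm _ _).trans (Eq.trans ?_ hs')
    simp only [assoc, Iso.inv_hom_id_assoc]

theorem contracts_up (hz : ∀ n < 0, IsZero (X n)) (φ : ∀ n : ℕ, X n ≅ Y n)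
    {c : ∀ n, Y n ⟶ Y (n + 1)} (h : ∀ n, Y (n + 1) ⟶ Y n)
    (hd : ∀ n : ℕ, d n ((n + 1 : ℕ) : ℤ) = (φ n).hom ≫ c n ≫ (φ (n + 1)).inv) (h0 : c 0 ≫ h 0 = 𝟙 _)
    (hs : ∀ n, c (n + 1) ≫ h (n + 1) + h n ≫ c n = 𝟙 _) : Contracts X d 1 := by
  obtain ⟨s, e⟩ := exists_extension X (fun n : ℕ => ((n + 1 : ℕ) : ℤ)) (fun n : ℕ => (n : ℤ))
    (fun a b hab => by simpa using hab) fun n => (φ (n + 1)).hom ≫ h n ≫ (φ n).inv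
  refine ⟨s, fun l m n h1 h2 => ?_⟩
  rcases lt_or_ge m 0 with hm | hm
  · exact (hz m hm).eq_of_src _ _
  obtain ⟨_ | m, rfl⟩ := Int.eq_ofNat_of_zero_le hm
  · obtain rfl : n = ((0 + 1 : ℕ) : ℤ) := by omega
    rw [(hz l (by omega)).eq_zero_of_tgt (s _ l), zero_comp, add_zero, e, hd]
    simp [reassoc_of% h0]
  · obtain rfl : n = ((m + 1 + 1 : ℕ) : ℤ) := by omega
    obtain rfl : l = (m : ℤ) := by omega
    rw [e, e, hd, hd]
    have hs' := congrArg (fun f => (φ (m + 1)).hom ≫ f ≫ (φ (m + 1)).inv) (hs m)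
    simp only [add_comp, comp_add, id_comp, Iso.hom_inv_id,
      assoc] at hs'
    refine Eq.trans ?_ hs'
    simp only [assoc, Iso.inv_hom_id_assoc]

end Extend

namespace Heisenberg

section Image

variable {k : Type u} [CommRing k] {A : ℤ → Heisenberg k} {d : ∀ i j, A i ⟶ A j}
  {X : ℕ → Heis k} {e : ∀ n, End (X n)} {he : ∀ n, e n * e n = e n}
  (φ : ∀ n : ℕ, A n ≅ image (e n) (he n))

theorem contracts_image_down (hz : ∀ n < 0, IsZero (A n)) {c : ∀ n, X (n + 1) ⟶ X n} {H : ∀ n, X n ⟶ X (n + 1)}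
    (hd : ∀ n : ℕ, d ((n + 1 : ℕ) : ℤ) n = (φ (n + 1)).hom ≫ imageMap _ _ (c n) ≫ (φ n).inv)
    (h1 : ∀ n, e n ≫ H n = H n) (h3 : H 0 ≫ e 1 ≫ c 0 = e 0)
    (h4 : ∀ n, H (n + 1) ≫ e (n + 2) ≫ c (n + 1) + (e (n + 1) ≫ c n) ≫ H n = e (n + 1)) :
    Contracts A d (-1) := by
  have hee : ∀ n, e n ≫ e n = e n := he
  refine contracts_down (Y := fun n => image (e n) (he n)) (c := fun n => imageMap (he (n + 1)) (he n) (c n))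
    hz φ (fun n => imageMap (he n) (he (n + 1)) (H n)) hd ?_ fun n => ?_
  · rw [imageMap_comp, h3, imageMap_self]
  · rw [imageMap_comp, imageMap_comp, ← imageMap_self (he (n + 1)), ← imageMap_add]
    refine imageMap_congr (Eq.trans ?_ (congrArg (fun t => e (n + 1) ≫ t ≫ e (n + 1)) (h4 n)))
    simp only [add_comp, comp_add, assoc, h1, reassoc_of% h1, reassoc_of% hee]

theorem contracts_image_up (hz : ∀ n < 0, IsZero (A n)) {c : ∀ n, X n ⟶ X (n + 1)} {H : ∀ n, X (n + 1) ⟶ X n}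
    (hd : ∀ n : ℕ, d n ((n + 1 : ℕ) : ℤ) = (φ n).hom ≫ imageMap _ _ (c n) ≫ (φ (n + 1)).inv)
    (h1 : ∀ n, H n ≫ e n = H n) (h3 : (c 0 ≫ e 1) ≫ H 0 = e 0)
    (h4 : ∀ n, (c (n + 1) ≫ e (n + 2)) ≫ H (n + 1) + H n ≫ c n ≫ e (n + 1) = e (n + 1)) :
    Contracts A d 1 := by
  have hee : ∀ n, e n ≫ e n = e n := he
  refine contracts_up (Y := fun n => image (e n) (he n)) (c := fun n => imageMap (he n) (he (n + 1)) (c n))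
    hz φ (fun n => imageMap (he (n + 1)) (he n) (H n)) hd ?_ fun n => ?_
  · rw [imageMap_comp, ← assoc, h3, imageMap_self]
  · rw [imageMap_comp, imageMap_comp, ← imageMap_self (he (n + 1)), ← imageMap_add]
    refine imageMap_congr (Eq.trans ?_ (congrArg (fun t => e (n + 1) ≫ t ≫ e (n + 1)) (h4 n)))
    simp only [add_comp, comp_add, assoc, reassoc_of% h1, hee]

end Image

open Heis

variable (k : Type u) [Field k] [CharZero k]

/-- The object `P`. -/
abbrev objP : Heisenberg k := image (X := Heis.P) (1 : End Heis.P) (one_mul 1)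

/-- The object `Q`. -/
abbrev objQ : Heisenberg k := image (X := Heis.Q) (1 : End Heis.Q) (one_mul 1)

variable {k}

/-- The tensor product of an isomorphism with an object on the right. -/
def tenIsoRight {A B : Heisenberg k} (φ : A ≅ B) (D : Heisenberg k) : tenObj A D ≅ tenObj B D where
  hom := tenHom φ.hom (𝟙 D)
  inv := tenHom φ.inv (𝟙 D)
  hom_inv_id := by rw [← tenHom_comp, φ.hom_inv_id, comp_id, tenHom_id]
  inv_hom_id := by rw [← tenHom_comp, φ.inv_hom_id, comp_id, tenHom_id]

/-- The tensor product of an isomorphism with an object on the left. -/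
def tenIsoLeft (D : Heisenberg k) {A B : Heisenberg k} (φ : A ≅ B) : tenObj D A ≅ tenObj D B where
  hom := tenHom (𝟙 D) φ.hom
  inv := tenHom (𝟙 D) φ.inv
  hom_inv_id := by rw [← tenHom_comp, φ.hom_inv_id, comp_id, tenHom_id]
  inv_hom_id := by rw [← tenHom_comp, φ.inv_hom_id, comp_id, tenHom_id]

theorem tenHom_imageMap_right {A B : Heisenberg k} {X Y Z : Heis k} {e : End X} {f : End Y} {p : End Z}
    (he : e * e = e) (hf : f * f = f) (hp : p * p = p) (u : X ⟶ Y) {φ : A ≅ image e he}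
    {ψ : B ≅ image f hf} {d : A ⟶ B} (hd : d = φ.hom ≫ imageMap he hf u ≫ ψ.inv) :
    tenHom d (𝟙 (image p hp)) = (tenIsoRight φ _ ≪≫ tenImage he hp).hom ≫
      imageMap (tensor_idem he hp) (tensor_idem hf hp) (u ▷ Z) ≫
        (tenIsoRight ψ _ ≪≫ tenImage hf hp).inv := by
  have h := tenHom_imageMap he hp hf hp u (𝟙 Z)
  rw [imageMap_id, tensorHom_id, ← Iso.eq_comp_inv, assoc] at h
  rw [Iso.trans_hom, Iso.trans_inv, assoc, ← reassoc_of% h]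
  change _ = tenHom φ.hom (𝟙 _) ≫ _ ≫ tenHom ψ.inv (𝟙 _)
  rw [← tenHom_comp, ← tenHom_comp, hd, comp_id, comp_id]

theorem tenHom_imageMap_left {A B : Heisenberg k} {X Y Z : Heis k} {e : End X} {f : End Y} {p : End Z}
    (he : e * e = e) (hf : f * f = f) (hp : p * p = p) (u : X ⟶ Y) {φ : A ≅ image e he}
    {ψ : B ≅ image f hf} {d : A ⟶ B} (hd : d = φ.hom ≫ imageMap he hf u ≫ ψ.inv) :
    tenHom (𝟙 (image p hp)) d = (tenIsoLeft _ φ ≪≫ tenImage hp he).hom ≫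
      imageMap (tensor_idem hp he) (tensor_idem hp hf) (Z ◁ u) ≫
        (tenIsoLeft _ ψ ≪≫ tenImage hp hf).inv := by
  have h := tenHom_imageMap hp he hp hf (𝟙 Z) u
  rw [imageMap_id, id_tensorHom, ← Iso.eq_comp_inv, assoc] at h
  rw [Iso.trans_hom, Iso.trans_inv, assoc, ← reassoc_of% h]
  change _ = tenHom (𝟙 _) φ.hom ≫ _ ≫ tenHom (𝟙 _) ψ.inv
  rw [← tenHom_comp, ← tenHom_comp, hd, comp_id, comp_id]

variable (k)

theorem avg_eq_antisym : (fun n => avg k n) = antisym k := funext fun n => diagAvg_actL_actR k n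

theorem contracts_minus_right : Contracts (fun n => tenObj (sigmaObj k n) (objP k)) (fun i j => tenHom (dMinus k i j) (𝟙 (objP k))) (-1) := by
  obtain ⟨H, h1, h3, h4⟩ := exists_contraction_cap_right k
  rw [← avg_eq_antisym] at h1 h3 h4
  have ht : ∀ n, (avg k n ⊗ₘ (1 : End Heis.P)) = avg k n ▷ Heis.P := fun _ => tensorHom_id _ _
  refine contracts_image_down (X := fun n => strands k n ⊗ Heis.P)
    (e := fun n => avg k n ⊗ₘ (1 : End Heis.P)) (he := fun n => tensor_idem (avg_idem k n) (one_mul 1))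
    (H := H) (c := fun n => innerCap k n ▷ Heis.P)
    (fun n => tenIsoRight (minusIso k n) _ ≪≫ tenImage (avg_idem k n) (one_mul 1))
    (fun _ hn => GDiff.isZero_obj_left (envTensorData (Heis k)) (isZero_sigmaObj k hn))
    (fun n => tenHom_imageMap_right (avg_idem k (n + 1)) (avg_idem k n) (one_mul 1) _ (dMinus_eq k n))
    (fun n => by rw [ht, h1]) ?_ fun n => ?_
  · rw [ht, ht, ← comp_whiskerRight, h3]
  · rw [ht, ht, ← comp_whiskerRight, ← comp_whiskerRight, h4]

theorem contracts_minus_left : Contracts (fun n => tenObj (objQ k) (sigmaObj k n)) (fun i j => tenHom (𝟙 (objQ k)) (dMinus k i j)) (-1) := by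
  obtain ⟨H, h1, h3, h4⟩ := exists_contraction_cap_left k
  rw [← avg_eq_antisym] at h1 h3 h4
  have ht : ∀ n, ((1 : End Heis.Q) ⊗ₘ avg k n) = Heis.Q ◁ avg k n := fun _ => id_tensorHom _ _
  refine contracts_image_down (X := fun n => Heis.Q ⊗ strands k n)
    (e := fun n => (1 : End Heis.Q) ⊗ₘ avg k n) (he := fun n => tensor_idem (one_mul 1) (avg_idem k n))
    (H := H) (c := fun n => Heis.Q ◁ innerCap k n)
    (fun n => tenIsoLeft _ (minusIso k n) ≪≫ tenImage (one_mul 1) (avg_idem k n))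
    (fun _ hn => GDiff.isZero_obj_right (envTensorData (Heis k)) (isZero_sigmaObj k hn))
    (fun n => tenHom_imageMap_left (avg_idem k (n + 1)) (avg_idem k n) (one_mul 1) _ (dMinus_eq k n))
    (fun n => by rw [ht, h1]) ?_ fun n => ?_
  · rw [ht, ht, ← MonoidalCategory.whiskerLeft_comp, h3]
  · rw [ht, ht, ← MonoidalCategory.whiskerLeft_comp, ← MonoidalCategory.whiskerLeft_comp, h4]

theorem contracts_plus_right : Contracts (fun n => tenObj (sigmaObj k n) (objP k)) (fun i j => tenHom (dPlus k i j) (𝟙 (objP k))) 1 := by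
  obtain ⟨H, h1, h3, h4⟩ := exists_contraction_cup_right k
  rw [← avg_eq_antisym] at h1 h3 h4
  have ht : ∀ n, (avg k n ⊗ₘ (1 : End Heis.P)) = avg k n ▷ Heis.P := fun _ => tensorHom_id _ _
  refine contracts_image_up (X := fun n => strands k n ⊗ Heis.P)
    (e := fun n => avg k n ⊗ₘ (1 : End Heis.P)) (he := fun n => tensor_idem (avg_idem k n) (one_mul 1))
    (H := H) (c := fun n => innerCup k n ▷ Heis.P)
    (fun n => tenIsoRight (plusIso k n) _ ≪≫ tenImage (avg_idem k n) (one_mul 1))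
    (fun _ hn => GDiff.isZero_obj_left (envTensorData (Heis k)) (isZero_sigmaObj k hn))
    (fun n => tenHom_imageMap_right (avg_idem k n) (avg_idem k (n + 1)) (one_mul 1) _ (dPlus_eq k n))
    (fun n => by rw [ht, h1]) ?_ fun n => ?_
  · rw [ht, ht, ← comp_whiskerRight, h3]
  · rw [ht, ht, ← comp_whiskerRight, ← comp_whiskerRight, h4]

theorem contracts_plus_left : Contracts (fun n => tenObj (objQ k) (sigmaObj k n)) (fun i j => tenHom (𝟙 (objQ k)) (dPlus k i j)) 1 := by
  obtain ⟨H, h1, h3, h4⟩ := exists_contraction_cup_left k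
  rw [← avg_eq_antisym] at h1 h3 h4
  have ht : ∀ n, ((1 : End Heis.Q) ⊗ₘ avg k n) = Heis.Q ◁ avg k n := fun _ => id_tensorHom _ _
  refine contracts_image_up (X := fun n => Heis.Q ⊗ strands k n)
    (e := fun n => (1 : End Heis.Q) ⊗ₘ avg k n) (he := fun n => tensor_idem (one_mul 1) (avg_idem k n))
    (H := H) (c := fun n => Heis.Q ◁ innerCup k n)
    (fun n => tenIsoLeft _ (plusIso k n) ≪≫ tenImage (one_mul 1) (avg_idem k n))
    (fun _ hn => GDiff.isZero_obj_right (envTensorData (Heis k)) (isZero_sigmaObj k hn))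
    (fun n => tenHom_imageMap_left (avg_idem k n) (avg_idem k (n + 1)) (one_mul 1) _ (dPlus_eq k n))
    (fun n => by rw [ht, h1]) ?_ fun n => ?_
  · rw [ht, ht, ← MonoidalCategory.whiskerLeft_comp, h3]
  · rw [ht, ht, ← MonoidalCategory.whiskerLeft_comp, ← MonoidalCategory.whiskerLeft_comp, h4]

theorem dMinus_comp (a b c : ℤ) : dMinus k a b ≫ dMinus k b c = 0 := by
  by_cases h1 : b + 1 = a
  · by_cases h2 : c + 1 = b
    · rcases lt_or_ge c 0 with hc | hc
      · exact (isZero_sigmaObj k hc).eq_of_tgt _ _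
      obtain ⟨n, rfl⟩ := Int.eq_ofNat_of_zero_le hc
      obtain rfl : b = ((n + 1 : ℕ) : ℤ) := by omega
      obtain rfl : a = ((n + 1 + 1 : ℕ) : ℤ) := by omega
      rw [dMinus_eq, dMinus_eq]
      simp only [assoc, Iso.inv_hom_id_assoc, reassoc_of% strandCap_comp k n,
        zero_comp, comp_zero]
    · rw [dMinus_shape k h2, comp_zero]
  · rw [dMinus_shape k h1, zero_comp]

theorem dPlus_comp (a b c : ℤ) : dPlus k a b ≫ dPlus k b c = 0 := by
  by_cases h1 : a + 1 = b
  · by_cases h2 : b + 1 = c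
    · rcases lt_or_ge a 0 with ha | ha
      · exact (isZero_sigmaObj k ha).eq_of_src _ _
      obtain ⟨n, rfl⟩ := Int.eq_ofNat_of_zero_le ha
      obtain rfl : b = ((n + 1 : ℕ) : ℤ) := by omega
      obtain rfl : c = ((n + 1 + 1 : ℕ) : ℤ) := by omega
      rw [dPlus_eq, dPlus_eq]
      simp only [assoc, Iso.inv_hom_id_assoc, reassoc_of% strandCup_comp k n,
        zero_comp, comp_zero]
    · rw [dPlus_shape k h2, comp_zero]
  · rw [dPlus_shape k h1, zero_comp]

end Heisenberg
end

noncomputable section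

section Power

variable {C : Type w} [Category.{v} C] [MonoidalCategory C]

/-- Moving a tensor factor from the right of a power to its left. -/
def powRComm (V : C) : ∀ n, powR V n ⊗ V ≅ V ⊗ powR V n
  | 0 => λ_ V ≪≫ (ρ_ V).symm
  | n + 1 => whiskerRightIso (powRComm V n) V ≪≫ α_ V (powR V n) V

/-- Moving a tensor factor from the left of a power to its right. -/
def powLComm (V : C) : ∀ n, V ⊗ powL V n ≅ powL V n ⊗ V
  | 0 => ρ_ V ≪≫ (λ_ V).symm
  | n + 1 => whiskerLeftIso V (powLComm V n) ≪≫ (α_ V (powL V n) V).symm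

end Power

namespace TensorData

open Limits

variable {W : Type w} [Category.{v} W] [Preadditive W] (F : TensorData W) {X Y : W}

/-- Retracts of tensor products with a fixed object on the left. -/
def LeftMultiple (P Y : W) : Prop := ∃ Z, Nonempty (Retract Y (F.obj P Z))

/-- Retracts of tensor products with a fixed object on the right. -/
def RightMultiple (P Y : W) : Prop := F.rev.LeftMultiple P Y

variable {F} {P : W}

/-- The tensor product of a retract with an object on the right. -/
def retractRight (e : Retract X Y) (Z : W) : Retract (F.obj X Z) (F.obj Y Z) where
  i := F.map e.i (𝟙 Z)
  r := F.map e.r (𝟙 Z)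
  retract := by rw [← F.map_comp, e.retract, comp_id, F.map_id]

theorem LeftMultiple.of_retract (h : F.LeftMultiple P Y) (e : Retract X Y) : F.LeftMultiple P X := by
  obtain ⟨Z, ⟨e'⟩⟩ := h
  exact ⟨Z, ⟨e.trans e'⟩⟩

theorem LeftMultiple.tensor (h : F.LeftMultiple P X) (Y : W) : F.LeftMultiple P (F.obj X Y) := by
  obtain ⟨Z, ⟨e⟩⟩ := h
  exact ⟨F.obj Z Y, ⟨(retractRight e Y).trans (Retract.ofIso (F.assoc P Z Y))⟩⟩

theorem RightMultiple.tensor (X : W) (h : F.RightMultiple P Y) : F.RightMultiple P (F.obj X Y) :=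
  LeftMultiple.tensor (F := F.rev) h X

variable [HasFiniteBiproducts W] {N : ℕ} {f : Fin N → W}

theorem LeftMultiple.biproduct (h : ∀ n, F.LeftMultiple P (f n)) : F.LeftMultiple P (⨁ f) := by
  choose Z e using fun n => h n
  replace e := fun n => (e n).some
  refine ⟨⨁ Z, ⟨biproduct.desc fun n => (e n).i ≫ F.map (𝟙 P) (biproduct.ι Z n),
    biproduct.lift fun n => F.map (𝟙 P) (biproduct.π Z n) ≫ (e n).r, ?_⟩⟩
  refine biproduct.hom_ext' _ _ fun a => biproduct.hom_ext _ _ fun b => ?_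
  simp only [Category.assoc, biproduct.lift_π, biproduct.ι_desc_assoc, comp_id]
  rw [← Category.assoc (F.map _ _), ← F.map_comp, comp_id]
  by_cases hab : a = b
  · subst hab
    rw [biproduct.ι_π_self, biproduct.ι_π_self, F.map_id, id_comp, (e a).retract]
  · rw [biproduct.ι_π_ne _ hab, biproduct.ι_π_ne _ hab, F.map_zero_right, zero_comp, comp_zero]

theorem RightMultiple.biproduct (h : ∀ n, F.RightMultiple P (f n)) : F.RightMultiple P (⨁ f) :=
  LeftMultiple.biproduct h

end TensorData

namespace Heisenberg

open Heis Limits TensorData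

variable {k : Type u} [Field k]

/-- The image of an idempotent endomorphism is a retract of the image of the identity. -/
def imageRetract {X Y : Heis k} {e : End X} (he : e * e = e) (a : X ≅ Y) :
    Retract (image e he) (image (X := Y) (1 : End Y) (one_mul 1)) where
  i := imageMap he (one_mul 1) a.hom
  r := imageMap (one_mul 1) he a.inv
  retract := by
    rw [imageMap_comp, ← imageMap_id]
    refine congrArg _ ?_
    change a.hom ≫ 𝟙 _ ≫ a.inv = _
    rw [id_comp, a.hom_inv_id]

/-- Full images of isomorphic objects are isomorphic. -/
def oneImageIso {X Y : Heis k} (a : X ≅ Y) :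
    image (X := X) (1 : End X) (one_mul 1) ≅ image (X := Y) (1 : End Y) (one_mul 1) where
  hom := (imageRetract (one_mul 1) a).i
  inv := (imageRetract (one_mul 1) a).r
  hom_inv_id := (imageRetract (one_mul 1) a).retract
  inv_hom_id := (imageRetract (one_mul 1) a.symm).retract

theorem one_tensor_one (X Y : Heis k) : ((1 : End X) ⊗ₘ (1 : End Y)) = (1 : End (X ⊗ Y)) :=
  id_tensorHom_id _ _

theorem image_congr {X : Heis k} {e f : End X} (he : e * e = e) (hf : f * f = f) (h : e = f) :
    image e he = image f hf := by subst h; rfl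

/-- The tensor product of full images. -/
def oneTenImage (X Y : Heis k) : image (X := X ⊗ Y) (1 : End (X ⊗ Y)) (one_mul 1) ≅
    tenObj (image (X := X) (1 : End X) (one_mul 1)) (image (X := Y) (1 : End Y) (one_mul 1)) :=
  eqToIso (image_congr _ _ (one_tensor_one X Y).symm) ≪≫ (tenImage (one_mul 1) (one_mul 1)).symm

variable [CharZero k]

theorem exists_card_eq_succ {l : YoungDiagram} (hl : l ≠ ⊥) : ∃ n, l.card = n + 1 :=
  Nat.exists_eq_succ_of_ne_zero fun h => hl (by
    refine SetLike.coe_injective ?_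
    have h' : l.cells = ∅ := Finset.card_eq_zero.1 h
    ext x
    change x ∈ l.cells ↔ x ∈ (⊥ : YoungDiagram).cells
    rw [h']
    rfl)

theorem leftMultiple_symP {l : YoungDiagram} (hl : l ≠ ⊥) :
    (envTensorData (Heis k)).LeftMultiple (objP k) (symP k l) := by
  obtain ⟨n, hn⟩ := exists_card_eq_succ hl
  have a : powR (Heis.P : Heis k) l.card ≅ Heis.P ⊗ powR Heis.P n :=
    eqToIso (by rw [hn]; rfl) ≪≫ powRComm Heis.P n
  exact ⟨_, ⟨(imageRetract (actP_young k l) a).trans (Retract.ofIso (oneTenImage _ _))⟩⟩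

theorem rightMultiple_symQ {l : YoungDiagram} (hl : l ≠ ⊥) :
    (envTensorData (Heis k)).RightMultiple (objQ k) (symQ k l) := by
  obtain ⟨n, hn⟩ := exists_card_eq_succ hl
  have a : powL (Heis.Q : Heis k) l.card ≅ powL Heis.Q n ⊗ Heis.Q :=
    eqToIso (by rw [hn]; rfl) ≪≫ powLComm Heis.Q n
  exact ⟨_, ⟨(imageRetract (actQ_young k l) a).trans (Retract.ofIso (oneTenImage _ _))⟩⟩

theorem IsReducible.leftMultiple {Y : Heisenberg k} (h : IsReducible Y) :
    (envTensorData (Heis k)).LeftMultiple (objP k) Y := by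
  obtain ⟨N, l, m, X, hlm, ⟨e⟩⟩ := h
  exact (LeftMultiple.biproduct fun n => ((leftMultiple_symP (hlm n).1).tensor (X n)).tensor
    (symQ k (m n))).of_retract (Retract.ofIso e)

theorem IsReducible.rightMultiple {Y : Heisenberg k} (h : IsReducible Y) :
    (envTensorData (Heis k)).RightMultiple (objQ k) Y := by
  obtain ⟨N, l, m, X, hlm, ⟨e⟩⟩ := h
  exact LeftMultiple.of_retract (RightMultiple.biproduct fun n =>
    (rightMultiple_symQ (hlm n).2).tensor (tenObj (symP k (l n)) (X n))) (Retract.ofIso e)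

theorem unitPlus_left {δ : ℤ} {D : Cpx k} (hu : Nonempty (D.X 0 ≅ unit k))
    (hz : ∀ r, 0 < δ * r → IsZero (D.X r)) (hr : ∀ r, δ * r < 0 → IsReducible (D.X r)) :
    UnitPlus (envTensorData (Heis k)) (δ := δ) D fun Y => ∃ Z, Y = tenObj (objP k) Z :=
  ⟨hu, hz, fun r h => by
    obtain ⟨Z, e⟩ := (hr r h).leftMultiple
    exact ⟨_, ⟨Z, rfl⟩, e⟩⟩

theorem unitPlus_right {δ : ℤ} {D : Cpx k} (hu : Nonempty (D.X 0 ≅ unit k))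
    (hz : ∀ r, 0 < δ * r → IsZero (D.X r)) (hr : ∀ r, δ * r < 0 → IsReducible (D.X r)) :
    UnitPlus (envTensorData (Heis k)) (δ := δ) D fun Y => ∃ Z, Y = tenObj Z (objQ k) :=
  ⟨hu, hz, fun r h => by
    obtain ⟨Z, e⟩ := (hr r h).rightMultiple
    exact ⟨_, ⟨Z, rfl⟩, e⟩⟩

theorem IsCMinus.absorb {A C : Cpx k} (hC : IsCMinus C)
    (hr : Contracts _ (fun i j => tenHom (A.d i j) (𝟙 (objP k))) (-1))
    (hl : Contracts _ (fun i j => tenHom (𝟙 (objQ k)) (A.d i j)) (-1)) :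
    Nonempty (HomotopyEquiv (tensorSum A C) (Cpx.toSum A)) ∧
      Nonempty (HomotopyEquiv (tensorSum C A) (Cpx.toSum A)) := by
  obtain ⟨D, ⟨e⟩, hu, hz, hD⟩ := hC
  exact ⟨nonempty_tensorSum_right e (unitPlus_left hu (fun r h => hz r (by omega))
    fun r h => hD r (by omega)) hr, nonempty_tensorSum_left e (unitPlus_right hu
    (fun r h => hz r (by omega)) fun r h => hD r (by omega)) hl⟩

theorem IsCPlus.absorb {A C : Cpx k} (hC : IsCPlus C)
    (hr : Contracts _ (fun i j => tenHom (A.d i j) (𝟙 (objP k))) (-1))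
    (hl : Contracts _ (fun i j => tenHom (𝟙 (objQ k)) (A.d i j)) (-1)) :
    Nonempty (HomotopyEquiv (tensorProd A C) (Cpx.toProd A)) ∧
      Nonempty (HomotopyEquiv (tensorProd C A) (Cpx.toProd A)) := by
  obtain ⟨D, ⟨e⟩, hu, hz, hD⟩ := hC
  exact ⟨nonempty_tensorProd_right e (unitPlus_left hu (fun r h => hz r (by omega))
    fun r h => hD r (by omega)) hr, nonempty_tensorProd_left e (unitPlus_right hu
    (fun r h => hz r (by omega)) fun r h => hD r (by omega)) hl⟩

variable (k)

theorem avg_zero : avg k 0 = 1 := by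
  rw [avg, diagAvg, Fintype.sum_unique, Fintype.card_unique]
  change _ • (actL k 0 (MonoidAlgebra.single 1 1) * actR k 0 (MonoidAlgebra.single 1 1)) = 1
  rw [← MonoidAlgebra.one_def, map_one, map_one, mul_one, Nat.cast_one, inv_one, one_smul]

theorem unit_eq : unit k = image (X := 𝟙_ (Heis k)) (1 : End (𝟙_ (Heis k))) (one_mul 1) := by
  unfold unit image
  congr 1
  exact ((Mat_.embedding _).map_id _).symm

theorem nonempty_sigmaObj_zero : Nonempty (sigmaObj k 0 ≅ unit k) := by
  exact ⟨minusIso k 0 ≪≫ eqToIso (image_congr (f := 1) _ (one_mul 1) (avg_zero k)) ≪≫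
    oneImageIso (X := strands k 0) (λ_ (𝟙_ (Heis k))) ≪≫ eqToIso (unit_eq k).symm⟩

theorem isReducible_sigmaObj {n : ℤ} (hn : 0 < n) : IsReducible (sigmaObj k n) := by
  let e := Finite.equivFin {l : YoungDiagram // (l.card : ℤ) = n}
  have h : ∀ l : YoungDiagram, (l.card : ℤ) = n → l ≠ ⊥ := by
    rintro l h rfl
    rw [YoungDiagram.card, YoungDiagram.cells_bot, Finset.card_empty] at h
    omega
  refine ⟨_, fun i => (e.symm i).1, fun i => (e.symm i).1.transpose, fun _ => unit k, fun i =>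
    ⟨h _ (e.symm i).2, h _ ?_⟩, ⟨biproduct.whiskerEquiv e fun l => ?_⟩⟩
  · rw [YoungDiagram.card_transpose]
    exact (e.symm i).2
  · exact tenIsoRight ((envTensorData (Heis k)).runit _) _ ≪≫ eqToIso (by
      change symPQ k (e.symm (e l)).1 = symPQ k l.1
      rw [Equiv.symm_apply_apply])

end Heisenberg

end

theorem mainTheorem7 (k : Type u) [Field k] [CharZero k] :
    ∃ (hm : ∀ a b c, Heisenberg.dMinus k a b ≫ Heisenberg.dMinus k b c = 0)
      (hp : ∀ a b c, Heisenberg.dPlus k a b ≫ Heisenberg.dPlus k b c = 0),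
      (∀ C : Heisenberg.Cpx k, Heisenberg.IsCMinus C →
        Nonempty (HomotopyEquiv (tensorSum (Heisenberg.sigmaMinus hm) C)
          (Heisenberg.Cpx.toSum (Heisenberg.sigmaMinus hm))) ∧
        Nonempty (HomotopyEquiv (tensorSum C (Heisenberg.sigmaMinus hm))
          (Heisenberg.Cpx.toSum (Heisenberg.sigmaMinus hm))) ∧
        Nonempty (HomotopyEquiv (tensorSum (Heisenberg.sigmaPlus hp) C)
          (Heisenberg.Cpx.toSum (Heisenberg.sigmaPlus hp))) ∧
        Nonempty (HomotopyEquiv (tensorSum C (Heisenberg.sigmaPlus hp))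
          (Heisenberg.Cpx.toSum (Heisenberg.sigmaPlus hp)))) ∧
      (∀ C : Heisenberg.Cpx k, Heisenberg.IsCPlus C →
        Nonempty (HomotopyEquiv (tensorProd (Heisenberg.sigmaPlus hp) C)
          (Heisenberg.Cpx.toProd (Heisenberg.sigmaPlus hp))) ∧
        Nonempty (HomotopyEquiv (tensorProd C (Heisenberg.sigmaPlus hp))
          (Heisenberg.Cpx.toProd (Heisenberg.sigmaPlus hp))) ∧
        Nonempty (HomotopyEquiv (tensorProd (Heisenberg.sigmaMinus hm) C)
          (Heisenberg.Cpx.toProd (Heisenberg.sigmaMinus hm))) ∧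
        Nonempty (HomotopyEquiv (tensorProd C (Heisenberg.sigmaMinus hm))
          (Heisenberg.Cpx.toProd (Heisenberg.sigmaMinus hm)))) ∧
      Nonempty (HomotopyEquiv (tensorSum (Heisenberg.sigmaMinus hm) (Heisenberg.sigmaMinus hm))
          (Heisenberg.Cpx.toSum (Heisenberg.sigmaMinus hm))) ∧
      Nonempty (HomotopyEquiv (tensorProd (Heisenberg.sigmaPlus hp) (Heisenberg.sigmaPlus hp))
          (Heisenberg.Cpx.toProd (Heisenberg.sigmaPlus hp))) := by
  have cm : Heisenberg.IsCMinus (Heisenberg.sigmaMinus (Heisenberg.dMinus_comp k)) := ⟨_, ⟨HomotopyEquiv.refl _⟩,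
    Heisenberg.nonempty_sigmaObj_zero k, fun _ h => Heis.isZero_sigmaObj k h, fun _ h => Heisenberg.isReducible_sigmaObj k h⟩
  have cp : Heisenberg.IsCPlus (Heisenberg.sigmaPlus (Heisenberg.dPlus_comp k)) := ⟨_, ⟨HomotopyEquiv.refl _⟩,
    Heisenberg.nonempty_sigmaObj_zero k, fun n h => Heis.isZero_sigmaObj k (show -n < 0 by omega),
    fun n h => Heisenberg.isReducible_sigmaObj k (show 0 < -n by omega)⟩
  have mr := Heisenberg.contracts_minus_right k
  have ml := Heisenberg.contracts_minus_left k
  have pr := (Heisenberg.contracts_plus_right k).neg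
  have pl := (Heisenberg.contracts_plus_left k).neg
  refine ⟨Heisenberg.dMinus_comp k, Heisenberg.dPlus_comp k, fun C hC => ?_, fun C hC => ?_, ?_, ?_⟩
  · have h1 := hC.absorb (A := Heisenberg.sigmaMinus (Heisenberg.dMinus_comp k)) mr ml
    have h2 := hC.absorb (A := Heisenberg.sigmaPlus (Heisenberg.dPlus_comp k)) pr pl
    exact ⟨h1.1, h1.2, h2.1, h2.2⟩
  · have h1 := hC.absorb (A := Heisenberg.sigmaMinus (Heisenberg.dMinus_comp k)) mr ml
    have h2 := hC.absorb (A := Heisenberg.sigmaPlus (Heisenberg.dPlus_comp k)) pr pl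
    exact ⟨h2.1, h2.2, h1.1, h1.2⟩
  · exact (cm.absorb (A := Heisenberg.sigmaMinus (Heisenberg.dMinus_comp k)) mr ml).1
  · exact (cp.absorb (A := Heisenberg.sigmaPlus (Heisenberg.dPlus_comp k)) pr pl).1
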